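/- **Conventions.** An $\mathbb F$-ring with involution ($C\mathbb F R^t$) is a category $A$ whose objects are the finite sets, with arrows $A_{Y,X}$ from $X$ to $Y$, together with a strict symmetric monoidal structure $\oplus$ given on objects by disjoint union, an involution $a\mapsto a^t$, $A_{Y,X}\to A_{X,Y}$, and a strict monoidal, involution-preserving functor to $A$ from the category of finite sets and partial bijections that is the identity on objects; $\emptyset$ is initial and final, and $A$ is commutative: for $a\in A_{Y,X}$, $b\in A_{[1],Z}$, $d\in A_{Z,[1]}$ one has $a\circ(\oplus_X\, b\circ d)=(\oplus_Y\, b\circ d)\circ a=(\oplus_Y b)\circ(\oplus_Z a)\circ(\oplus_X d)$. Elements of $A_{[1],[1]}$ are the scalars. For a commutative (semi)ring $B$ let $\mathbb F(B)_{Y,X}$ be the set of $Y\times X$ matrices over $B$, with matrix product, block sum and transpose; a subring $R\subseteq K$ is identified with $\mathbb F(R)\subseteq\mathbb F(K)$. $\mathbb Z_{\mathbb R}\subseteq\mathbb F(\mathbb R)$ and $\mathbb Z_{\mathbb C}\subseteq\mathbb F(\mathbb C)$ consist of the matrices that map the closed $L_2$ unit ball into the closed $L_2$ unit ball. For a commutative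 monoid $M$, $\mathbb F\{M\}_{Y,X}$ is the set of $Y\times X$ matrices with entries in $M\amalg\{0\}$ and at most one entry of $M$ in every row and every column. An ideal of $A$ is a set $I$ of scalars such that $b\circ(\oplus_{x\in X} a_x)\circ d\in I$ for all $a_x\in I$, $b\in A_{[1],X}$, $d\in A_{X,[1]}$. A symmetric prime is a proper ideal $\mathfrak p$ that is generated by its symmetric elements ($s^t=s$) and for which the symmetric scalars outside $\mathfrak p$ are closed under multiplication. $\operatorname{spec}(A)$ is the set of symmetric primes with the topology generated by the sets $\{\mathfrak p : f\notin\mathfrak p\}$, $f$ symmetric, and with the sheaf of functions $\mathfrak p\mapsto s(\mathfrak p)\in A_{\mathfrak p}$ which are locally fractions $a/f$. Let $K$ be a number field with ring of integers $\mathcal O_K$, let $\gamma_K=\{\sigma:K\hookrightarrow\mathbb C\}/(\sigma\sim\bar\sigma)$ and $\mathcal O_\sigma=K\cap\sigma^{-1}(\mathbb Z_{\mathbb C})$, i.e. the sub-$\mathbb F$-ring of those matrices in $\mathbb F(K)$ which $\sigma$ maps into $\mathbb Z_{\mathbb C}$. For square free $N>1$ let $X_N^K$ be obtained by glueing $\operatorname{spec}(\mathcal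 O_K)$ and the $\operatorname{spec}(\mathcal O_K[\tfrac1N]\cap\mathcal O_\sigma)$, $\sigma\in\gamma_K$, along $\operatorname{spec}(\mathcal O_K[\tfrac1N])$. For $N\mid M$ there is the natural map $X^K_M\to X^K_N$, and $X^K=\varprojlim_N X^K_N$ is the limit as a space with a sheaf of $\mathbb F$-rings with involution: the limit of the spaces, with the colimit of the inverse images of the sheaves. For $K=\mathbb Q$ use $\mathbb Z_{(\eta)}=\mathbb Q\cap\mathbb Z_{\mathbb R}$ as the only ring $\mathcal O_\sigma$; the space is then denoted $X=\varprojlim_N X_N$. A sub-$\mathbb F$-ring (with involution) $B\subseteq\mathbb F(K)$ is a valuation sub-$\mathbb F$-ring if (i) for every $a\in\mathbb F(K)_{Y,X}$ there is a scalar $d\ne0$ of $B$ with $(\oplus_Y d)\circ a\in B$, (ii) $B_{Y,X}=\{a : b'\circ a\circ b\in B_{[1],[1]}\ \text{for all}\ b'\in B_{[1],Y},\ b\in B_{X,[1]}\}$, and (iii) $a\in B_{[1],[1]}$ or $a^{-1}\in B_{[1],[1]}$ for all $a\in K^*$. $\operatorname{Val}(K)$ is the set of all of them. **Theorem.** (a)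 The points of $X$ are, without repetition, the primes $p$ of $\mathbb Z$ (including $(0)$), the component of $p$ in every $X_N$ being the point $p$ of $\operatorname{spec}\mathbb Z$, and the real prime $\eta$, whose component in $X_N$ is the maximal ideal of $\mathbb Z[\tfrac1N]\cap\mathbb Z_{\mathbb R}$. The non-empty open subsets of $X$ are exactly the co-finite subsets that contain $(0)$; $X$ has Krull dimension $1$, and $\eta$ is a closed point, as are the finite primes. The stalks of $\mathcal O_X$ embed in $\mathbb F(\mathbb Q)$, compatibly with sections, with images $\mathbb F(\mathbb Z_{(p)})$ at $p$ and $\mathbb Z_{(\eta)}$ at $\eta$, and for every non-empty open $\mathcal U\subseteq X$ the sections embed with image $$\mathcal O_X(\mathcal U)=\mathbb Q\cap\prod_{p\in\mathcal U}\mathbb Z_{(p)}$$ (the matrices in $\mathbb F(\mathbb Q)$ that lie in $\mathbb F(\mathbb Z_{(p)})$ for all primes $p\in\mathcal U$, and in $\mathbb Z_{(\eta)}$ if $\eta\in\mathcal U$). The global sections are $\mathcal O_X(X)\cong\mathbb F\{\pm1\}$. Sending a point to its stalk, as a sub-$\mathbb F$-ring of $\mathbb F(\mathbb Q)$, is a bijection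 from $X$ onto $\operatorname{Val}(\mathbb Q)$. (b) The same holds for every number field $K$, with $\mathbb Z,\mathbb Q,\eta,\mathbb Z_{(\eta)}$ replaced by $\mathcal O_K$, $K$, $\sigma\in\gamma_K$, $\mathcal O_\sigma$: the points of $X^K$ are the primes of $\mathcal O_K$ and the $\sigma\in\gamma_K$; the non-empty open sets are the co-finite sets containing $(0)$; $X^K$ has Krull dimension $1$, and all points other than $(0)$ are closed; $\mathcal O_{X^K}(\mathcal U)$, for non-empty open $\mathcal U$, consists of the matrices in $\mathbb F(K)$ that lie in $\mathbb F(\mathcal O_{K,\mathfrak p})$ for all $\mathfrak p\in\mathcal U$ and in $\mathcal O_\sigma$ for all $\sigma\in\mathcal U$; the global sections are $\mathcal O_{X^K}(X^K)\cong\mathbb F\{\mu_K\}$, with $\mu_K$ the group of roots of unity of $K$; and sending a point to its stalk in $\mathbb F(K)$ is a bijection from $X^K$ onto $\operatorname{Val}(K)$. -/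

import Mathlib

universe u

namespace FOne

/-! ### Finite sets with partial bijections, and rings over the field with one element -/

/-- Disjoint union of partial bijections. -/
def pSum {X₀ X₁ Y₀ Y₁ : Type} (φ : X₀ ≃. Y₀) (ψ : X₁ ≃. Y₁) : X₀ ⊕ X₁ ≃. Y₀ ⊕ Y₁ where
  toFun := Sum.elim (fun x => (φ x).map Sum.inl) (fun x => (ψ x).map Sum.inr)
  invFun := Sum.elim (fun y => (φ.symm y).map Sum.inl) (fun y => (ψ.symm y).map Sum.inr)
  inv := by rintro (a | a) (b | b) <;> simp [PEquiv.eq_some_iff]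

/-- The data of a category whose objects are the finite sets, with `Hom Y X = A_{Y,X}` the arrows
from `X` to `Y`, together with a direct sum, an involution, and a map `emb` from the category of
finite sets and partial bijections. -/
structure FData where
  Hom : (Y X : Type) → [Fintype Y] → [Fintype X] → Type u
  comp : ∀ {Z Y X : Type} [Fintype Z] [Fintype Y] [Fintype X], Hom Z Y → Hom Y X → Hom Z X
  sum : ∀ {Y₀ Y₁ X₀ X₁ : Type} [Fintype Y₀] [Fintype Y₁] [Fintype X₀] [Fintype X₁],
    Hom Y₀ X₀ → Hom Y₁ X₁ → Hom (Y₀ ⊕ Y₁) (X₀ ⊕ X₁)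
  tr : ∀ {Y X : Type} [Fintype Y] [Fintype X], Hom Y X → Hom X Y
  emb : ∀ {Y X : Type} [Fintype Y] [Fintype X], (X ≃. Y) → Hom Y X

/-- The bijection used to add one more summand. -/
def finProdSucc (n : ℕ) (Y : Type) : Y ⊕ (Fin n × Y) ≃ Fin (n + 1) × Y where
  toFun := Sum.elim (fun y => (0, y)) (fun p => (p.1.succ, p.2))
  invFun p := Fin.cases (motive := fun _ => Y ⊕ (Fin n × Y)) (Sum.inl p.2)
    (fun i => Sum.inr (i, p.2)) p.1
  left_inv := by rintro (y | ⟨i, y⟩) <;> simp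
  right_inv := by
    rintro ⟨i, y⟩
    refine Fin.cases ?_ (fun i => ?_) i <;> simp

namespace FData

variable (A : FData.{u}) {B : FData.{u}}
variable {X Y Z W X' Y' Z' X'' Y'' X₀ X₁ Y₀ Y₁ : Type}
variable [Fintype X] [Fintype Y] [Fintype Z] [Fintype W] [Fintype X'] [Fintype Y'] [Fintype Z']
variable [Fintype X''] [Fintype Y''] [Fintype X₀] [Fintype X₁] [Fintype Y₀] [Fintype Y₁]

def ofEquiv (e : X ≃ Y) : A.Hom Y X := A.emb e.toPEquiv

/-- The identity arrow of the one-point set, i.e. the scalar `1`. -/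
def one : A.Hom Unit Unit := A.emb (PEquiv.refl Unit)

/-- The zero arrow. -/
def zero : A.Hom Y X := A.emb ⊥

variable {A}

/-- Transport of an arrow along bijections of its source and target. -/
def re (e : Y ≃ Y') (f : X ≃ X') (a : A.Hom Y X) : A.Hom Y' X' :=
  A.comp (A.ofEquiv e) (A.comp a (A.ofEquiv f.symm))

/-- `a 0 ⊕ ... ⊕ a (n - 1)`. -/
def finSum : (n : ℕ) → (Fin n → A.Hom Y X) → A.Hom (Fin n × Y) (Fin n × X)
  | 0, _ => A.zero
  | n + 1, a => re (finProdSucc n Y) (finProdSucc n X) (A.sum (a 0) (finSum n fun i => a i.succ))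

/-- The direct sum `⊕_{z ∈ Z} a z`, an arrow from `Z × X` to `Z × Y`. -/
noncomputable def dsum (Z : Type) [Fintype Z] (a : Z → A.Hom Y X) : A.Hom (Z × Y) (Z × X) :=
  re ((Fintype.equivFin Z).symm.prodCongr (Equiv.refl Y))
    ((Fintype.equivFin Z).symm.prodCongr (Equiv.refl X))
    (finSum _ fun i => a ((Fintype.equivFin Z).symm i))

/-- The direct sum `⊕_{x ∈ X} a x` of scalars, an arrow from `X` to `X`. -/
noncomputable def diag (X : Type) [Fintype X] (a : X → A.Hom Unit Unit) : A.Hom X X :=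
  re (Equiv.prodPUnit X) (Equiv.prodPUnit X) (dsum X a)

/-- `⊕_X s` for a scalar `s`. -/
noncomputable def scal (X : Type) [Fintype X] (s : A.Hom Unit Unit) : A.Hom X X :=
  diag X fun _ => s

variable (A)

/-- The laws of a commutative `𝔽`-ring with involution: a category with a strict symmetric
monoidal functor from finite sets with partial bijections which is the identity on objects, with
the empty set initial and final, with a compatible involution, and commutative. The functor is not
required to be injective on arrows, so that the zero ring, the final object, is allowed. -/
structure Lawful : Prop where
  comp_assoc : ∀ {W Z Y X : Type} [Fintype W] [Fintype Z] [Fintype Y] [Fintype X]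
    (a : A.Hom W Z) (b : A.Hom Z Y) (c : A.Hom Y X),
    A.comp (A.comp a b) c = A.comp a (A.comp b c)
  id_comp : ∀ {Y X : Type} [Fintype Y] [Fintype X] (a : A.Hom Y X),
    A.comp (A.emb (PEquiv.refl Y)) a = a
  comp_id : ∀ {Y X : Type} [Fintype Y] [Fintype X] (a : A.Hom Y X),
    A.comp a (A.emb (PEquiv.refl X)) = a
  emb_trans : ∀ {Z Y X : Type} [Fintype Z] [Fintype Y] [Fintype X] (φ : X ≃. Y) (ψ : Y ≃. Z),
    A.emb (φ.trans ψ) = A.comp (A.emb ψ) (A.emb φ)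
  initial : ∀ {Y X : Type} [Fintype Y] [Fintype X] [IsEmpty X] (a : A.Hom Y X), a = A.zero
  final : ∀ {Y X : Type} [Fintype Y] [Fintype X] [IsEmpty Y] (a : A.Hom Y X), a = A.zero
  sum_comp : ∀ {Z₀ Z₁ Y₀ Y₁ X₀ X₁ : Type} [Fintype Z₀] [Fintype Z₁] [Fintype Y₀] [Fintype Y₁]
    [Fintype X₀] [Fintype X₁] (a : A.Hom Z₀ Y₀) (b : A.Hom Y₀ X₀) (c : A.Hom Z₁ Y₁)
    (d : A.Hom Y₁ X₁), A.sum (A.comp a b) (A.comp c d) = A.comp (A.sum a c) (A.sum b d)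
  sum_emb : ∀ {Y₀ Y₁ X₀ X₁ : Type} [Fintype Y₀] [Fintype Y₁] [Fintype X₀] [Fintype X₁]
    (φ : X₀ ≃. Y₀) (ψ : X₁ ≃. Y₁), A.sum (A.emb φ) (A.emb ψ) = A.emb (pSum φ ψ)
  sum_assoc : ∀ {Y₀ Y₁ Y₂ X₀ X₁ X₂ : Type} [Fintype Y₀] [Fintype Y₁] [Fintype Y₂] [Fintype X₀]
    [Fintype X₁] [Fintype X₂] (a : A.Hom Y₀ X₀) (b : A.Hom Y₁ X₁) (c : A.Hom Y₂ X₂),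
    re (Equiv.sumAssoc _ _ _) (Equiv.sumAssoc _ _ _) (A.sum (A.sum a b) c) =
      A.sum a (A.sum b c)
  sum_comm : ∀ {Y₀ Y₁ X₀ X₁ : Type} [Fintype Y₀] [Fintype Y₁] [Fintype X₀] [Fintype X₁]
    (a : A.Hom Y₀ X₀) (b : A.Hom Y₁ X₁),
    re (Equiv.sumComm _ _) (Equiv.sumComm _ _) (A.sum a b) = A.sum b a
  zero_sum : ∀ {Y X : Type} [Fintype Y] [Fintype X] (a : A.Hom Y X),
    re (Equiv.emptySum Empty Y) (Equiv.emptySum Empty X) (A.sum A.zero a) = a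
  tr_tr : ∀ {Y X : Type} [Fintype Y] [Fintype X] (a : A.Hom Y X), A.tr (A.tr a) = a
  tr_comp : ∀ {Z Y X : Type} [Fintype Z] [Fintype Y] [Fintype X] (a : A.Hom Z Y) (b : A.Hom Y X),
    A.tr (A.comp a b) = A.comp (A.tr b) (A.tr a)
  tr_sum : ∀ {Y₀ Y₁ X₀ X₁ : Type} [Fintype Y₀] [Fintype Y₁] [Fintype X₀] [Fintype X₁]
    (a : A.Hom Y₀ X₀) (b : A.Hom Y₁ X₁), A.tr (A.sum a b) = A.sum (A.tr a) (A.tr b)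
  tr_emb : ∀ {Y X : Type} [Fintype Y] [Fintype X] (φ : X ≃. Y), A.tr (A.emb φ) = A.emb φ.symm
  comm_scal : ∀ {Z Y X : Type} [Fintype Z] [Fintype Y] [Fintype X] (a : A.Hom Y X)
    (b : A.Hom Unit Z) (d : A.Hom Z Unit),
    A.comp a (scal X (A.comp b d)) = A.comp (scal Y (A.comp b d)) a
  comm_dsum : ∀ {Z Y X : Type} [Fintype Z] [Fintype Y] [Fintype X] (a : A.Hom Y X)
    (b : A.Hom Unit Z) (d : A.Hom Z Unit),
    A.comp (scal Y (A.comp b d)) a =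
      re (Equiv.prodPUnit Y) (Equiv.prodPUnit X)
        (A.comp (dsum Y fun _ => b)
          (A.comp (re (Equiv.prodComm Z Y) (Equiv.prodComm Z X) (dsum Z fun _ => a))
            (dsum X fun _ => d)))

end FData

/-- A commutative `𝔽`-ring with involution. -/
structure CFR extends FData.{u} where
  lawful : toFData.Lawful

/-- A homomorphism: a strict monoidal functor over finite sets with partial bijections which
preserves the involution. -/
structure FHom (A B : FData.{u}) where
  app : ∀ {Y X : Type} [Fintype Y] [Fintype X], A.Hom Y X → B.Hom Y X
  map_comp : ∀ {Z Y X : Type} [Fintype Z] [Fintype Y] [Fintype X] (a : A.Hom Z Y) (b : A.Hom Y X),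
    app (A.comp a b) = B.comp (app a) (app b)
  map_sum : ∀ {Y₀ Y₁ X₀ X₁ : Type} [Fintype Y₀] [Fintype Y₁] [Fintype X₀] [Fintype X₁]
    (a : A.Hom Y₀ X₀) (b : A.Hom Y₁ X₁), app (A.sum a b) = B.sum (app a) (app b)
  map_tr : ∀ {Y X : Type} [Fintype Y] [Fintype X] (a : A.Hom Y X), app (A.tr a) = B.tr (app a)
  map_emb : ∀ {Y X : Type} [Fintype Y] [Fintype X] (φ : X ≃. Y), app (A.emb φ) = B.emb φ

namespace FHom

variable {A B C : FData.{u}}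
variable {X Y Z X' Y' : Type} [Fintype X] [Fintype Y] [Fintype Z] [Fintype X'] [Fintype Y']

def comp (g : FHom B C) (f : FHom A B) : FHom A C where
  app a := g.app (f.app a)
  map_comp a b := by rw [f.map_comp, g.map_comp]
  map_sum a b := by rw [f.map_sum, g.map_sum]
  map_tr a := by rw [f.map_tr, g.map_tr]
  map_emb φ := by rw [f.map_emb, g.map_emb]

/-- Injectivity on all sets of arrows. -/
def Injective (f : FHom A B) : Prop :=
  ∀ (Y X : Type) [Fintype Y] [Fintype X], Function.Injective (f.app : A.Hom Y X → B.Hom Y X)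

/-- A homomorphism is an isomorphism when it is bijective on all sets of arrows. -/
def IsIso (f : FHom A B) : Prop :=
  ∀ (Y X : Type) [Fintype Y] [Fintype X], Function.Bijective (f.app : A.Hom Y X → B.Hom Y X)

theorem map_re (f : FHom A B) (e : Y ≃ Y') (e' : X ≃ X') (a : A.Hom Y X) :
    f.app (FData.re e e' a) = FData.re e e' (f.app a) := by
  simp only [FData.re, FData.ofEquiv, f.map_comp, f.map_emb]

theorem map_zero (f : FHom A B) : f.app (A.zero : A.Hom Y X) = B.zero := f.map_emb _

theorem map_finSum (f : FHom A B) (n : ℕ) (a : Fin n → A.Hom Y X) :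
    f.app (FData.finSum n a) = FData.finSum n fun i => f.app (a i) := by
  induction n with
  | zero => exact f.map_emb _
  | succ n ih => rw [FData.finSum, map_re, f.map_sum, ih, FData.finSum]

theorem map_dsum (f : FHom A B) (a : Z → A.Hom Y X) :
    f.app (FData.dsum Z a) = FData.dsum Z fun i => f.app (a i) := by
  rw [FData.dsum, map_re, map_finSum, FData.dsum]

theorem map_diag (f : FHom A B) (a : X → A.Hom Unit Unit) :
    f.app (FData.diag X a) = FData.diag X fun i => f.app (a i) := by
  rw [FData.diag, map_re, map_dsum, FData.diag]

theorem map_scal (f : FHom A B) (a : A.Hom Unit Unit) :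
    f.app (FData.scal X a) = FData.scal X (f.app a) := map_diag _ _

end FHom

namespace FData.Lawful

/-- The laws can be checked after a jointly injective family of homomorphisms. -/
theorem of_injective {A : FData.{u}} {ι : Sort*} (B : ι → FData.{u}) (hB : ∀ i, (B i).Lawful)
    (f : ∀ i, FHom A (B i))
    (inj : ∀ {Y X : Type} [Fintype Y] [Fintype X] (a b : A.Hom Y X),
      (∀ i, (f i).app a = (f i).app b) → a = b) : A.Lawful where
  comp_assoc a b c := inj _ _ fun i => by simp only [(f i).map_comp, (hB i).comp_assoc]
  id_comp a := inj _ _ fun i => by simp only [(f i).map_comp, (f i).map_emb, (hB i).id_comp]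
  comp_id a := inj _ _ fun i => by simp only [(f i).map_comp, (f i).map_emb, (hB i).comp_id]
  emb_trans φ ψ := inj _ _ fun i => by simp only [(f i).map_comp, (f i).map_emb, (hB i).emb_trans]
  initial a := inj _ _ fun i => by rw [(hB i).initial ((f i).app a), (f i).map_zero]
  final a := inj _ _ fun i => by rw [(hB i).final ((f i).app a), (f i).map_zero]
  sum_comp a b c d := inj _ _ fun i => by
    simp only [(f i).map_comp, (f i).map_sum, (hB i).sum_comp]
  sum_emb φ ψ := inj _ _ fun i => by simp only [(f i).map_sum, (f i).map_emb, (hB i).sum_emb]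
  sum_assoc a b c := inj _ _ fun i => by
    simp only [(f i).map_sum, (f i).map_re, (hB i).sum_assoc]
  sum_comm a b := inj _ _ fun i => by simp only [(f i).map_sum, (f i).map_re, (hB i).sum_comm]
  zero_sum a := inj _ _ fun i => by
    simp only [(f i).map_sum, (f i).map_re, (f i).map_zero, (hB i).zero_sum]
  tr_tr a := inj _ _ fun i => by simp only [(f i).map_tr, (hB i).tr_tr]
  tr_comp a b := inj _ _ fun i => by simp only [(f i).map_comp, (f i).map_tr, (hB i).tr_comp]
  tr_sum a b := inj _ _ fun i => by simp only [(f i).map_sum, (f i).map_tr, (hB i).tr_sum]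
  tr_emb φ := inj _ _ fun i => by simp only [(f i).map_tr, (f i).map_emb, (hB i).tr_emb]
  comm_scal a b d := inj _ _ fun i => by
    simp only [(f i).map_comp, (f i).map_scal, (hB i).comm_scal]
  comm_dsum a b d := inj _ _ fun i => by
    simp only [(f i).map_comp, (f i).map_scal, (f i).map_re, (f i).map_dsum, (hB i).comm_dsum]

end FData.Lawful

/-! ### The `𝔽`-ring of matrices over a commutative semiring, sub-`𝔽`-rings, products -/

open Classical in
/-- Matrices with entries in `B`: the direct sum is the block diagonal sum, the involution is the
transpose. -/
noncomputable def matData (B : Type u) [CommSemiring B] : FData.{u} where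
  Hom Y X _ _ := Matrix Y X B
  comp a b := a * b
  sum a b := Matrix.fromBlocks a 0 0 b
  tr a := a.transpose
  emb φ := Matrix.of fun y x => if φ x = some y then 1 else 0

section Mat

variable {B : Type u} [CommSemiring B]
variable {X Y Z X' Y' : Type} [Fintype X] [Fintype Y] [Fintype Z] [Fintype X'] [Fintype Y']

open Classical in
theorem mat_emb_apply (φ : X ≃. Y) (y : Y) (x : X) :
    (matData B).emb φ y x = if φ x = some y then 1 else 0 := rfl

theorem mat_comp_apply (a : (matData B).Hom Z Y) (b : (matData B).Hom Y X) (z : Z) (x : X) :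
    (matData B).comp a b z x = ∑ y, a z y * b y x := rfl

theorem mat_ext {a b : (matData B).Hom Y X} (h : ∀ y x, a y x = b y x) : a = b := Matrix.ext h

theorem mat_re_apply (e : Y ≃ Y') (f : X ≃ X') (a : (matData B).Hom Y X) (y : Y') (x : X') :
    FData.re e f a y x = a (e.symm y) (f.symm x) := by
  classical
  simp only [FData.re, FData.ofEquiv, mat_comp_apply, mat_emb_apply, Equiv.toPEquiv_apply,
    Option.some.injEq]
  rw [Finset.sum_eq_single (e.symm y), Finset.sum_eq_single (f.symm x)]
  · simp
  · intro b _ hb; simp [Ne.symm hb]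
  · simp
  · intro b _ hb
    rw [if_neg, zero_mul]
    rintro rfl; simp at hb
  · simp

theorem mat_finSum_apply (n : ℕ) (a : Fin n → (matData B).Hom Y X) (p : Fin n × Y)
    (q : Fin n × X) : FData.finSum n a p q = if p.1 = q.1 then a p.1 p.2 q.2 else 0 := by
  induction n with
  | zero => exact p.1.elim0
  | succ n ih =>
    obtain ⟨i, y⟩ := p
    obtain ⟨j, x⟩ := q
    rw [FData.finSum, mat_re_apply]
    refine Fin.cases ?_ (fun i => ?_) i <;> refine Fin.cases ?_ (fun j => ?_) j
    · rfl
    · exact (if_neg (Fin.succ_ne_zero j).symm).symm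
    · exact (if_neg (Fin.succ_ne_zero i)).symm
    · refine (ih _ (i, y) (j, x)).trans ?_
      simp

open Classical in
theorem mat_dsum_apply (a : Z → (matData B).Hom Y X) (p : Z × Y)
    (q : Z × X) : FData.dsum Z a p q = if p.1 = q.1 then a p.1 p.2 q.2 else 0 := by
  rw [FData.dsum, mat_re_apply, mat_finSum_apply]
  simp

open Classical in
theorem mat_diag_apply (a : X → (matData B).Hom Unit Unit) (x x' : X) :
    FData.diag X a x x' = if x = x' then a x () () else 0 := by
  rw [FData.diag, mat_re_apply, mat_dsum_apply]
  rfl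

open Classical in
theorem mat_scal_apply (s : (matData B).Hom Unit Unit) (x x' : X) :
    FData.scal X s x x' = if x = x' then s () () else 0 := mat_diag_apply _ _ _

theorem fromBlocks_diag_mul {Z₀ Z₁ Y₀ Y₁ X₀ X₁ : Type} [Fintype Y₀] [Fintype Y₁]
    (a : Matrix Z₀ Y₀ B) (b : Matrix Y₀ X₀ B) (c : Matrix Z₁ Y₁ B) (d : Matrix Y₁ X₁ B) :
    Matrix.fromBlocks (a * b) 0 0 (c * d) =
      Matrix.fromBlocks a 0 0 c * Matrix.fromBlocks b 0 0 d := by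
  rw [Matrix.fromBlocks_multiply]; simp

theorem mat_lawful (B : Type u) [CommSemiring B] : (matData B).Lawful where
  comp_assoc a b c := Matrix.mul_assoc a b c
  id_comp a := by
    classical
    refine mat_ext fun y x => ?_
    simp [mat_comp_apply, mat_emb_apply]
  comp_id a := by
    classical
    refine mat_ext fun y x => ?_
    simp [mat_comp_apply, mat_emb_apply]
  emb_trans φ ψ := by
    classical
    refine mat_ext fun z x => ?_
    rw [mat_comp_apply, mat_emb_apply]
    simp only [mat_emb_apply]
    change (if (φ x).bind ψ = some z then (1 : B) else 0) = _
    cases h : φ x with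
    | none => simp
    | some y =>
      rw [Finset.sum_eq_single y]
      · simp
      · intro b _ hb; simp [Ne.symm hb]
      · simp
  initial a := by exact mat_ext fun y x => isEmptyElim x
  final a := by exact mat_ext fun y x => isEmptyElim y
  sum_comp a b c d := by
    exact fromBlocks_diag_mul a b c d
  sum_emb φ ψ := by
    classical
    refine mat_ext fun y x => ?_
    rcases y with y | y <;> rcases x with x | x <;> simp [matData, pSum]
  sum_assoc a b c := by
    refine mat_ext fun y x => ?_
    rw [mat_re_apply]
    rcases y with y | y | y <;> rcases x with x | x | x <;> rfl
  sum_comm a b := by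
    refine mat_ext fun y x => ?_
    rw [mat_re_apply]
    rcases y with y | y <;> rcases x with x | x <;> rfl
  zero_sum a := by
    refine mat_ext fun y x => ?_
    rw [mat_re_apply]; rfl
  tr_tr a := rfl
  tr_comp a b := Matrix.transpose_mul a b
  tr_sum a b := by
    refine mat_ext fun y x => ?_
    rcases y with y | y <;> rcases x with x | x <;> rfl
  tr_emb φ := by
    classical
    refine mat_ext fun y x => ?_
    change (if φ y = some x then (1 : B) else 0) = if φ.symm x = some y then 1 else 0
    simp [PEquiv.eq_some_iff]
  comm_scal a b d := by
    classical
    refine mat_ext fun y x => ?_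
    simp only [mat_comp_apply, mat_scal_apply]
    simp [mul_comm]
  comm_dsum a b d := by
    classical
    refine mat_ext fun y x => ?_
    rw [mat_re_apply]
    simp only [mat_comp_apply, mat_scal_apply, mat_dsum_apply, mat_re_apply]
    simp only [Fintype.sum_prod_type]
    simp [Finset.sum_mul]
    refine Finset.sum_congr rfl fun z _ => ?_
    rw [Finset.sum_eq_single z]
    · exact (mul_assoc _ _ _).trans (congrArg _ ((mul_comm _ _).trans
        (congrArg (· * d z ()) (if_pos rfl).symm)))
    · intro w _ hw
      exact (congrArg (· * d w ()) (if_neg hw.symm)).trans (zero_mul _)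
    · simp

end Mat

/-- The `𝔽`-ring `𝔽(B)` of a commutative semiring `B`. -/
noncomputable def mat (B : Type u) [CommSemiring B] : CFR.{u} := ⟨matData B, mat_lawful B⟩

/-- The homomorphism of `𝔽`-rings given by a homomorphism of semirings. -/
noncomputable def matMap {B C : Type u} [CommSemiring B] [CommSemiring C] (f : B →+* C) :
    FHom (mat B).toFData (mat C).toFData where
  app a := Matrix.map a f
  map_comp a b := Matrix.map_mul
  map_sum a b := by
    refine (Matrix.fromBlocks_map _ _ _ _ _).trans ?_
    simp [mat, matData]
  map_tr a := rfl
  map_emb φ := by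
    classical
    refine mat_ext fun y x => ?_
    change f (if φ x = some y then 1 else 0) = if φ x = some y then 1 else 0
    split <;> simp

/-- A sub-`𝔽`-ring (with involution). -/
@[ext]
structure Sub (A : CFR.{u}) where
  carrier : ∀ (Y X : Type) [Fintype Y] [Fintype X], Set (A.Hom Y X)
  comp_mem : ∀ {Z Y X : Type} [Fintype Z] [Fintype Y] [Fintype X] {a : A.Hom Z Y} {b : A.Hom Y X},
    a ∈ carrier Z Y → b ∈ carrier Y X → A.comp a b ∈ carrier Z X
  sum_mem : ∀ {Y₀ Y₁ X₀ X₁ : Type} [Fintype Y₀] [Fintype Y₁] [Fintype X₀] [Fintype X₁]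
    {a : A.Hom Y₀ X₀} {b : A.Hom Y₁ X₁}, a ∈ carrier Y₀ X₀ → b ∈ carrier Y₁ X₁ →
      A.sum a b ∈ carrier (Y₀ ⊕ Y₁) (X₀ ⊕ X₁)
  tr_mem : ∀ {Y X : Type} [Fintype Y] [Fintype X] {a : A.Hom Y X},
    a ∈ carrier Y X → A.tr a ∈ carrier X Y
  emb_mem : ∀ {Y X : Type} [Fintype Y] [Fintype X] (φ : X ≃. Y), A.emb φ ∈ carrier Y X

namespace Sub

variable {A B : CFR.{u}}

def toData (S : Sub A) : FData.{u} where
  Hom Y X _ _ := S.carrier Y X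
  comp a b := ⟨A.comp a.1 b.1, S.comp_mem a.2 b.2⟩
  sum a b := ⟨A.sum a.1 b.1, S.sum_mem a.2 b.2⟩
  tr a := ⟨A.tr a.1, S.tr_mem a.2⟩
  emb φ := ⟨A.emb φ, S.emb_mem φ⟩

/-- The inclusion into the ambient `𝔽`-ring. -/
def inclData (S : Sub A) : FHom S.toData A.toFData where
  app a := a.1
  map_comp _ _ := rfl
  map_sum _ _ := rfl
  map_tr _ := rfl
  map_emb _ := rfl

/-- A sub-`𝔽`-ring as an `𝔽`-ring. -/
def ring (S : Sub A) : CFR.{u} where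
  toFData := S.toData
  lawful := .of_injective (fun _ : Unit => A.toFData) (fun _ => A.lawful) (fun _ => S.inclData)
    fun _ _ h => Subtype.ext (h ())

def incl (S : Sub A) : FHom S.ring.toFData A.toFData := S.inclData

instance : PartialOrder (Sub A) where
  le S T := ∀ (Y X : Type) [Fintype Y] [Fintype X], S.carrier Y X ⊆ T.carrier Y X
  le_refl S Y X _ _ := subset_rfl
  le_trans S T R h h' Y X _ _ := (h Y X).trans (h' Y X)
  le_antisymm S T h h' := by
    ext Y X _ _ a
    exact ⟨fun ha => h Y X ha, fun ha => h' Y X ha⟩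

/-- The inclusion of a smaller sub-`𝔽`-ring into a bigger one. -/
def inclusion {S T : Sub A} (h : S ≤ T) : FHom S.ring.toFData T.ring.toFData where
  app a := ⟨a.1, h _ _ a.2⟩
  map_comp _ _ := rfl
  map_sum _ _ := rfl
  map_tr _ := rfl
  map_emb _ := rfl

instance : Min (Sub A) where
  min S T :=
    { carrier := fun Y X _ _ => S.carrier Y X ∩ T.carrier Y X
      comp_mem := fun ha hb => ⟨S.comp_mem ha.1 hb.1, T.comp_mem ha.2 hb.2⟩
      sum_mem := fun ha hb => ⟨S.sum_mem ha.1 hb.1, T.sum_mem ha.2 hb.2⟩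
      tr_mem := fun ha => ⟨S.tr_mem ha.1, T.tr_mem ha.2⟩
      emb_mem := fun φ => ⟨S.emb_mem φ, T.emb_mem φ⟩ }

/-- The inverse image under a homomorphism. -/
def comap (f : FHom A.toFData B.toFData) (S : Sub B) : Sub A where
  carrier Y X _ _ := {a | f.app a ∈ S.carrier Y X}
  comp_mem {_ _ _} _ _ _ {a b} ha hb := by
    rw [Set.mem_ofPred_eq, f.map_comp]; exact S.comp_mem ha hb
  sum_mem {_ _ _ _} _ _ _ _ {a b} ha hb := by
    rw [Set.mem_ofPred_eq, f.map_sum]; exact S.sum_mem ha hb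
  tr_mem {_ _} _ _ {a} ha := by
    rw [Set.mem_ofPred_eq, f.map_tr]; exact S.tr_mem ha
  emb_mem φ := by
    rw [Set.mem_ofPred_eq, f.map_emb]; exact S.emb_mem φ

/-- The image of a homomorphism. -/
def range (f : FHom A.toFData B.toFData) : Sub B where
  carrier Y X _ _ := Set.range (f.app : A.Hom Y X → B.Hom Y X)
  comp_mem := by
    rintro _ _ _ _ _ _ _ _ ⟨a, rfl⟩ ⟨b, rfl⟩
    exact ⟨_, f.map_comp a b⟩
  sum_mem := by
    rintro _ _ _ _ _ _ _ _ _ _ ⟨a, rfl⟩ ⟨b, rfl⟩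
    exact ⟨_, f.map_sum a b⟩
  tr_mem := by
    rintro _ _ _ _ _ ⟨a, rfl⟩
    exact ⟨_, f.map_tr a⟩
  emb_mem φ := ⟨_, f.map_emb φ⟩

/-- The matrices over `K` with entries in a subring `R`, i.e. `𝔽(R) ⊆ 𝔽(K)`. -/
noncomputable def ofSubring {K : Type u} [CommRing K] (R : Subring K) : Sub (mat K) where
  carrier Y X _ _ := {a : Matrix Y X K | ∀ y x, a y x ∈ R}
  comp_mem ha hb y x := _root_.sum_mem fun z _ => mul_mem (ha y z) (hb z x)
  sum_mem ha hb := by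
    rintro (y | y) (x | x)
    exacts [ha y x, zero_mem R, zero_mem R, hb y x]
  tr_mem ha y x := ha x y
  emb_mem φ y x := by
    classical
    change (if φ x = some y then (1 : K) else 0) ∈ R
    split
    exacts [one_mem R, zero_mem R]

end Sub

/-- The product of a family of `𝔽`-rings. -/
def prodData {ι : Type u} (A : ι → CFR.{u}) : FData.{u} where
  Hom Y X _ _ := ∀ i, (A i).Hom Y X
  comp a b i := (A i).comp (a i) (b i)
  sum a b i := (A i).sum (a i) (b i)
  tr a i := (A i).tr (a i)
  emb φ i := (A i).emb φ

def projData {ι : Type u} (A : ι → CFR.{u}) (i : ι) : FHom (prodData A) (A i).toFData where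
  app a := a i
  map_comp _ _ := rfl
  map_sum _ _ := rfl
  map_tr _ := rfl
  map_emb _ := rfl

def prod {ι : Type u} (A : ι → CFR.{u}) : CFR.{u} where
  toFData := prodData A
  lawful := .of_injective (fun i => (A i).toFData) (fun i => (A i).lawful) (projData A)
    fun _ _ h => funext h

/-- The homomorphism into a product with given components. -/
def prodLift {C : FData.{u}} {ι : Type u} (A : ι → CFR.{u}) (f : ∀ i, FHom C (A i).toFData) :
    FHom C (prod A).toFData where
  app a i := (f i).app a
  map_comp a b := funext fun i => (f i).map_comp a b
  map_sum a b := funext fun i => (f i).map_sum a b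
  map_tr a := funext fun i => (f i).map_tr a
  map_emb φ := funext fun i => (f i).map_emb φ

/-- A homomorphism whose values lie in a sub-`𝔽`-ring. -/
def FHom.codRestrict {C : FData.{u}} {A : CFR.{u}} (f : FHom C A.toFData) (S : Sub A)
    (h : ∀ {Y X : Type} [Fintype Y] [Fintype X] (a : C.Hom Y X), f.app a ∈ S.carrier Y X) :
    FHom C S.ring.toFData where
  app a := ⟨f.app a, h a⟩
  map_comp a b := Subtype.ext (f.map_comp a b)
  map_sum a b := Subtype.ext (f.map_sum a b)
  map_tr a := Subtype.ext (f.map_tr a)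
  map_emb φ := Subtype.ext (f.map_emb φ)

/-! ### Localization -/

theorem pSum_equiv {X₀ X₁ Y₀ Y₁ : Type} (e : X₀ ≃ Y₀) (f : X₁ ≃ Y₁) :
    pSum e.toPEquiv f.toPEquiv = (e.sumCongr f).toPEquiv := by
  ext (x | x) <;> rfl

section Laws

open FData

variable {A : CFR.{u}}
variable {X Y Z W X' Y' Z' X'' Y'' X₀ X₁ Y₀ Y₁ X₀' X₁' Y₀' Y₁' : Type}
variable [Fintype X] [Fintype Y] [Fintype Z] [Fintype W] [Fintype X'] [Fintype Y'] [Fintype Z']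
variable [Fintype X''] [Fintype Y''] [Fintype X₀] [Fintype X₁] [Fintype Y₀] [Fintype Y₁]
variable [Fintype X₀'] [Fintype X₁'] [Fintype Y₀'] [Fintype Y₁']

theorem ofEquiv_trans (e : X ≃ Y) (f : Y ≃ Z) :
    A.ofEquiv (e.trans f) = A.comp (A.ofEquiv f) (A.ofEquiv e) := by
  rw [ofEquiv, Equiv.toPEquiv_trans, A.lawful.emb_trans]; rfl

theorem ofEquiv_symm_comp (e : X ≃ Y) (a : A.Hom X Z) :
    A.comp (A.ofEquiv e.symm) (A.comp (A.ofEquiv e) a) = a := by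
  rw [← A.lawful.comp_assoc, ← ofEquiv_trans, Equiv.self_trans_symm]
  exact A.lawful.id_comp a

theorem ofEquiv_comp_symm (e : X ≃ Y) (a : A.Hom Y Z) :
    A.comp (A.ofEquiv e) (A.comp (A.ofEquiv e.symm) a) = a := ofEquiv_symm_comp e.symm a

theorem re_refl (a : A.Hom Y X) : re (Equiv.refl Y) (Equiv.refl X) a = a :=
  (A.lawful.id_comp _).trans (A.lawful.comp_id a)

theorem re_re (e : Y ≃ Y') (e' : Y' ≃ Y'') (f : X ≃ X') (f' : X' ≃ X'') (a : A.Hom Y X) :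
    re e' f' (re e f a) = re (e.trans e') (f.trans f') a := by
  simp only [re, Equiv.symm_trans, ofEquiv_trans, A.lawful.comp_assoc]

theorem comp_re (e : Z ≃ Z') (f : Y ≃ Y') (g : X ≃ X') (a : A.Hom Z Y) (b : A.Hom Y X) :
    A.comp (re e f a) (re f g b) = re e g (A.comp a b) := by
  simp only [re, A.lawful.comp_assoc, ofEquiv_symm_comp]

theorem sum_re (e₀ : Y₀ ≃ Y₀') (f₀ : X₀ ≃ X₀') (e₁ : Y₁ ≃ Y₁') (f₁ : X₁ ≃ X₁')
    (a : A.Hom Y₀ X₀) (b : A.Hom Y₁ X₁) :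
    A.sum (re e₀ f₀ a) (re e₁ f₁ b) = re (e₀.sumCongr e₁) (f₀.sumCongr f₁) (A.sum a b) := by
  simp only [re, ofEquiv, A.lawful.sum_comp, A.lawful.sum_emb, pSum_equiv]; rfl

theorem tr_re (e : Y ≃ Y') (f : X ≃ X') (a : A.Hom Y X) :
    A.tr (re e f a) = re f e (A.tr a) := by
  simp only [re, ofEquiv, A.lawful.tr_comp, A.lawful.tr_emb, A.lawful.comp_assoc,
    ← Equiv.toPEquiv_symm, Equiv.symm_symm]

theorem comp_one (s : A.Hom X Unit) : A.comp s A.one = s := A.lawful.comp_id s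

theorem one_comp (s : A.Hom Unit X) : A.comp A.one s = s := A.lawful.id_comp s

/-- Scalars are central. -/
theorem comp_scal (a : A.Hom Y X) (s : A.Hom Unit Unit) :
    A.comp a (scal X s) = A.comp (scal Y s) a := by
  have := A.lawful.comm_scal a s A.one
  rwa [comp_one] at this

theorem re_scal (e : X ≃ Y) (s : A.Hom Unit Unit) : re e e (scal X s) = scal Y s := by
  rw [re, ← comp_scal, ofEquiv_comp_symm]

/-- The direct sum of `n` copies of a scalar. -/
def pw (n : ℕ) (s : A.Hom Unit Unit) : A.Hom (Fin n) (Fin n) :=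
  re (Equiv.prodPUnit _) (Equiv.prodPUnit _) (finSum n fun _ => s)

theorem scal_eq_pw {n : ℕ} (e : Fin n ≃ X) (s : A.Hom Unit Unit) : re e e (pw n s) = scal X s := by
  obtain rfl : n = Fintype.card X := by simpa using Fintype.card_congr e
  have h : pw (Fintype.card X) s = re (Fintype.equivFin X) (Fintype.equivFin X) (scal X s) := by
    rw [scal, diag, dsum, re_re, re_re, pw]
    congr 1 <;> ext ⟨i, u⟩ <;> simp
  rw [h, re_scal, re_scal]

theorem scal_unit_sum (s : A.Hom Unit Unit) : scal (Unit ⊕ X) s = A.sum s (scal X s) := by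
  let e := (Fintype.equivFin X).symm
  have h1 : (finSum (Fintype.card X) fun _ => s) =
      re (Equiv.prodPUnit _).symm (Equiv.prodPUnit _).symm (pw (A := A) (Fintype.card X) s) := by
    rw [pw, re_re, Equiv.self_trans_symm, re_refl]
  have h2 : pw (A := A) (Fintype.card X) s = re e.symm e.symm (scal X s) := by
    rw [← scal_eq_pw e, re_re, Equiv.self_trans_symm, re_refl]
  have h3 : ∃ g : Unit ⊕ X ≃ Fin (Fintype.card X + 1),
      pw (Fintype.card X + 1) s = re g g (A.sum s (scal X s)) := by
    refine ⟨((Equiv.refl Unit).sumCongr (e.symm.trans (Equiv.prodPUnit _).symm)).trans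
      ((finProdSucc _ Unit).trans (Equiv.prodPUnit _)), ?_⟩
    · rw [pw, finSum, h1, h2]
      conv_lhs => rw [← re_refl s]
      rw [re_re, re_re, sum_re, re_re, re_refl]
  obtain ⟨g, hg⟩ := h3
  rw [← scal_eq_pw g.symm, hg, re_re, Equiv.self_trans_symm, re_refl]

theorem scal_unit (s : A.Hom Unit Unit) : scal Unit s = s := by
  have h : A.sum s A.zero = re (Equiv.sumEmpty Unit Empty).symm (Equiv.sumEmpty Unit Empty).symm s := by
    rw [← A.lawful.sum_comm]
    conv_rhs => rw [← A.lawful.zero_sum s]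
    rw [re_re]
    congr 1 <;> ext (x | x) <;> first | rfl | exact x.elim
  have h1 := scal_unit_sum (X := Empty) s
  rw [A.lawful.initial (scal Empty s), h] at h1
  rw [← re_scal (Equiv.sumEmpty Unit Empty), h1, re_re, Equiv.symm_trans_self, re_refl]

theorem scal_empty_sum [IsEmpty X] (s : A.Hom Unit Unit) :
    scal (X ⊕ Y) s = A.sum (scal X s) (scal Y s) := by
  have h : re (Equiv.equivOfIsEmpty Empty X) (Equiv.equivOfIsEmpty Empty X) (A.zero) =
    scal X s := by rw [A.lawful.initial (scal X s)]; exact A.lawful.initial _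
  rw [← h]
  conv_rhs => rw [← re_refl (scal Y s)]
  rw [sum_re, ← re_scal (Equiv.emptySum X Y).symm]
  conv_lhs => rw [← A.lawful.zero_sum (scal Y s)]
  rw [re_re]
  congr 1 <;> ext (x | x) <;> first | rfl | exact x.elim

theorem scal_sum (s : A.Hom Unit Unit) : scal (X ⊕ Y) s = A.sum (scal X s) (scal Y s) := by
  refine Fintype.induction_empty_option
    (P := fun X _ => scal (X ⊕ Y) s = A.sum (scal X s) (scal Y s)) ?_ ?_ ?_ X
  · intro X X' _ e h
    let := Fintype.ofEquiv X' e.symm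
    rw [← re_scal (e.sumCongr (Equiv.refl Y)), h, ← re_scal e s]
    conv_rhs => rw [← re_refl (scal Y s)]
    rw [sum_re]
  · exact scal_empty_sum s
  · intro X _ h
    let e : Unit ⊕ X ≃ Option X := (Equiv.sumComm _ _).trans (Equiv.optionEquivSumPUnit X).symm
    rw [← re_scal e s, scal_unit_sum, ← re_scal ((Equiv.sumAssoc Unit X Y).symm.trans
      (e.sumCongr (Equiv.refl Y))), scal_unit_sum, h, ← A.lawful.sum_assoc, re_re]
    conv_rhs => rw [← re_refl (scal Y s)]
    rw [sum_re]
    congr 1 <;> simp [← Equiv.trans_assoc]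

theorem finSum_comp (n : ℕ) (a : Fin n → A.Hom Z Y) (b : Fin n → A.Hom Y X) :
    finSum n (fun i => A.comp (a i) (b i)) = A.comp (finSum n a) (finSum n b) := by
  induction n with
  | zero =>
    have : IsEmpty (Fin 0 × X) := inferInstance
    rw [A.lawful.initial (A.comp _ _)]; rfl
  | succ n ih => rw [finSum, ih, A.lawful.sum_comp, finSum, finSum, comp_re]

theorem dsum_comp (a : W → A.Hom Z Y) (b : W → A.Hom Y X) :
    dsum W (fun i => A.comp (a i) (b i)) = A.comp (dsum W a) (dsum W b) := by
  rw [dsum, finSum_comp, dsum, dsum, comp_re]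

theorem scal_comp (s t : A.Hom Unit Unit) :
    scal X (A.comp s t) = A.comp (scal X s) (scal X t) := by
  rw [scal, diag, dsum_comp, scal, scal, diag, diag, comp_re]

theorem finSum_tr (n : ℕ) (a : Fin n → A.Hom Y X) :
    A.tr (finSum n a) = finSum n (fun i => A.tr (a i)) := by
  induction n with
  | zero => exact A.lawful.initial _
  | succ n ih => rw [finSum, tr_re, A.lawful.tr_sum, ih, finSum]

theorem scal_tr (s : A.Hom Unit Unit) : A.tr (scal X s) = scal X (A.tr s) := by
  rw [scal, diag, dsum, tr_re, tr_re, finSum_tr, scal, diag, dsum]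

theorem scal_one : scal X A.one = A.emb (PEquiv.refl X) := by
  have h (n : ℕ) : (finSum n fun _ => A.one) = A.emb (PEquiv.refl (Fin n × Unit)) := by
    induction n with
    | zero => exact (A.lawful.initial _).symm
    | succ n ih =>
      rw [finSum, ih, one, A.lawful.sum_emb, re, ofEquiv, ofEquiv, ← A.lawful.emb_trans,
        ← A.lawful.emb_trans]
      congr 1
      ext ⟨i, x⟩
      refine Fin.cases ?_ (fun i => ?_) i <;> simp [PEquiv.trans, finProdSucc, pSum]
  rw [scal, diag, dsum, h]
  simp only [re, ofEquiv, ← A.lawful.emb_trans]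
  congr 1
  ext x
  simp [PEquiv.trans]

theorem comm_one (s t : A.Hom Unit Unit) : A.comp s t = A.comp t s := by
  have := comp_scal s t
  rwa [scal_unit] at this

variable (s t : A.Hom Unit Unit)

/-- The action of scalars on arrows. -/
noncomputable def smul (s : A.Hom Unit Unit) (a : A.Hom Y X) : A.Hom Y X := A.comp (scal Y s) a

theorem smul_smul (a : A.Hom Y X) : smul s (smul t a) = smul (A.comp s t) a := by
  rw [smul, smul, smul, scal_comp, A.lawful.comp_assoc]

theorem smul_comm' (a : A.Hom Y X) : smul s (smul t a) = smul t (smul s a) := by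
  rw [smul_smul, smul_smul, comm_one]

theorem one_smul' (a : A.Hom Y X) : smul A.one a = a := by
  rw [smul, scal_one, A.lawful.id_comp]

theorem smul_comp (a : A.Hom Z Y) (b : A.Hom Y X) : A.comp (smul s a) b = smul s (A.comp a b) :=
  A.lawful.comp_assoc _ _ _

theorem comp_smul (a : A.Hom Z Y) (b : A.Hom Y X) : A.comp a (smul s b) = smul s (A.comp a b) := by
  rw [smul, smul, ← A.lawful.comp_assoc, comp_scal, A.lawful.comp_assoc]

theorem smul_sum (a : A.Hom Y₀ X₀) (b : A.Hom Y₁ X₁) :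
    A.sum (smul s a) (smul s b) = smul s (A.sum a b) := by
  rw [smul, smul, smul, scal_sum, A.lawful.sum_comp]

theorem smul_tr (hs : A.tr s = s) (a : A.Hom Y X) : A.tr (smul s a) = smul s (A.tr a) := by
  rw [smul, smul, A.lawful.tr_comp, scal_tr, hs, comp_scal]

theorem smul_unit : smul s t = A.comp s t := by rw [smul, scal_unit]

end Laws

/-- A multiplicative set of symmetric scalars. -/
structure SymMon (A : CFR.{u}) where
  carrier : Set (A.Hom Unit Unit)
  one_mem : A.one ∈ carrier
  mul_mem : ∀ {s t}, s ∈ carrier → t ∈ carrier → A.comp s t ∈ carrier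
  symm : ∀ {s}, s ∈ carrier → A.tr s = s

namespace Loc

open FData

variable {A : CFR.{u}} (S : SymMon A)
variable {X Y Z X₀ X₁ Y₀ Y₁ X' Y' : Type} [Fintype X] [Fintype Y] [Fintype Z]
variable [Fintype X₀] [Fintype X₁] [Fintype Y₀] [Fintype Y₁] [Fintype X'] [Fintype Y']

/-- Two fractions `a / s` and `b / t` are identified when `u t a = u s b` for some `u ∈ S`. -/
def setoid (Y X : Type) [Fintype Y] [Fintype X] : Setoid (A.Hom Y X × S.carrier) where
  r p q := ∃ w ∈ S.carrier, smul w (smul q.2.1 p.1) = smul w (smul p.2.1 q.1)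
  iseqv :=
    { refl := fun _ => ⟨A.one, S.one_mem, rfl⟩
      symm := fun ⟨w, hw, h⟩ => ⟨w, hw, h.symm⟩
      trans := by
        rintro ⟨a, s, hs⟩ ⟨b, t, ht⟩ ⟨c, r, hr⟩ ⟨v, hv, h⟩ ⟨w, hw, h'⟩
        refine ⟨A.comp v (A.comp w t), S.mul_mem hv (S.mul_mem hw ht), ?_⟩
        simp only [← smul_smul] at h h' ⊢
        calc smul v (smul w (smul t (smul r a)))
            = smul w (smul r (smul v (smul t a))) := by
              rw [smul_comm' t r, smul_comm' v w, smul_comm' v r]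
          _ = smul v (smul s (smul w (smul r b))) := by
              rw [h, smul_comm' r v, smul_comm' w v, smul_comm' r s, smul_comm' w s]
          _ = _ := by rw [h', smul_comm' s w, smul_comm' s t] }

/-- Arrows of the localization. -/
def Hom (Y X : Type) [Fintype Y] [Fintype X] : Type u := Quotient (setoid S Y X)

variable {S}

def mul (s t : S.carrier) : S.carrier := ⟨A.comp s.1 t.1, S.mul_mem s.2 t.2⟩

theorem mul_comm' (s t : S.carrier) : mul s t = mul t s := Subtype.ext (comm_one _ _)

variable (S)

/-- The localization as data: the usual formulas for fractions. -/
noncomputable def data : FData.{u} where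
  Hom Y X _ _ := Hom S Y X
  comp {Z Y X} _ _ _ := Quotient.map₂ (fun p q => (A.comp p.1 q.1, mul p.2 q.2)) (by
    rintro ⟨a, s⟩ ⟨a', s'⟩ ⟨v, hv, h⟩ ⟨b, t⟩ ⟨b', t'⟩ ⟨w, hw, h'⟩
    refine ⟨A.comp v w, S.mul_mem hv hw, ?_⟩
    simp only [mul, ← smul_smul] at h h' ⊢
    rw [← comp_smul, ← smul_comp, ← comp_smul, ← smul_comp, h, h', comp_smul, smul_comp,
      comp_smul, smul_comp, smul_comm' w v, smul_comm' t.1])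
  sum {Y₀ Y₁ X₀ X₁} _ _ _ _ := Quotient.map₂
    (fun p q => (A.sum (smul q.2.1 p.1) (smul p.2.1 q.1), mul p.2 q.2)) (by
    rintro ⟨a, s⟩ ⟨a', s'⟩ ⟨v, hv, h⟩ ⟨b, t⟩ ⟨b', t'⟩ ⟨w, hw, h'⟩
    refine ⟨A.comp v w, S.mul_mem hv hw, ?_⟩
    simp only [mul, ← smul_smul] at h h' ⊢
    simp only [← smul_sum]
    congr 1
    · calc _ = smul w (smul t.1 (smul t'.1 (smul v (smul s'.1 a)))) := by
            simp only [smul_comm']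
        _ = _ := by rw [h]; simp only [smul_comm']
    · calc _ = smul v (smul s.1 (smul s'.1 (smul w (smul t'.1 b)))) := by
            simp only [smul_comm']
        _ = _ := by rw [h']; simp only [smul_comm'])
  tr {Y X} _ _ := Quotient.map (fun p => (A.tr p.1, p.2)) (by
    rintro ⟨a, s⟩ ⟨a', s'⟩ ⟨v, hv, h⟩
    refine ⟨v, hv, ?_⟩
    have := congrArg A.tr h
    rwa [smul_tr _ (S.symm hv), smul_tr _ (S.symm hv), smul_tr _ (S.symm s'.2),
      smul_tr _ (S.symm s.2)] at this)
  emb φ := Quotient.mk (setoid S _ _) (A.emb φ, ⟨A.one, S.one_mem⟩)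

variable {S}

/-- The fraction `a / s`. -/
def mk (a : A.Hom Y X) (s : S.carrier) : (data S).Hom Y X := Quotient.mk (setoid S Y X) (a, s)

theorem sound {a b : A.Hom Y X} {s t : S.carrier} (w : A.Hom Unit Unit) (hw : w ∈ S.carrier)
    (h : smul w (smul t.1 a) = smul w (smul s.1 b)) : mk a s = mk b t :=
  Quotient.sound ⟨w, hw, h⟩

theorem mk_smul (a : A.Hom Y X) (s t : S.carrier) : mk (smul t.1 a) (mul t s) = mk a s :=
  sound A.one S.one_mem (by
    simp only [mul, ← smul_smul]
    rw [smul_comm' s.1 t.1])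

theorem ind (x : (data S).Hom Y X) : ∃ a s, x = mk a s := by
  obtain ⟨⟨a, s⟩, rfl⟩ := Quotient.exists_rep x
  exact ⟨a, s, rfl⟩

theorem comp_mk (a : A.Hom Z Y) (b : A.Hom Y X) (s t : S.carrier) :
    (data S).comp (mk a s) (mk b t) = mk (A.comp a b) (mul s t) := rfl

theorem sum_mk (a : A.Hom Y₀ X₀) (b : A.Hom Y₁ X₁) (s : S.carrier) :
    (data S).sum (mk a s) (mk b s) = mk (A.sum a b) s := by
  rw [← mk_smul (A.sum a b) s s, ← smul_sum]; rfl

theorem tr_mk (a : A.Hom Y X) (s : S.carrier) : (data S).tr (mk a s) = mk (A.tr a) s := rfl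

theorem common₂ (x : (data S).Hom Y X) (y : (data S).Hom Y' X') :
    ∃ a b s, x = mk a s ∧ y = mk b s := by
  obtain ⟨a, s, rfl⟩ := ind x
  obtain ⟨b, t, rfl⟩ := ind y
  exact ⟨smul t.1 a, smul s.1 b, mul s t, by rw [mul_comm' s t, mk_smul], by rw [mk_smul]⟩

theorem re_mk (e : Y ≃ Y') (f : X ≃ X') (a : A.Hom Y X) (s : S.carrier) :
    re e f (mk a s) = mk (re e f a) s := by
  refine Eq.trans (b := mk (re e f a) (mul ⟨A.one, S.one_mem⟩ (mul s ⟨A.one, S.one_mem⟩))) rfl ?_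
  congr 1
  exact Subtype.ext ((one_comp _).trans (comp_one _))

theorem empty_mk [IsEmpty X] (a b : A.Hom Y X) (s t : S.carrier) : mk a s = mk b t :=
  sound A.one S.one_mem ((A.lawful.initial _).trans (A.lawful.initial _).symm)

theorem empty_mk' [IsEmpty Y] (a b : A.Hom Y X) (s t : S.carrier) : mk a s = mk b t :=
  sound A.one S.one_mem ((A.lawful.final _).trans (A.lawful.final _).symm)

theorem finSum_mk (n : ℕ) (a : A.Hom Y X) (s : S.carrier) :
    finSum n (fun _ => (mk a s)) = mk (finSum n fun _ => a) s := by
  induction n with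
  | zero => exact empty_mk _ _ _ _
  | succ n ih => rw [finSum, ih, sum_mk, re_mk, finSum]

theorem dsum_mk (a : A.Hom Y X) (s : S.carrier) :
    dsum Z (fun _ => (mk a s)) = mk (dsum Z fun _ => a) s := by
  rw [dsum, finSum_mk, re_mk, dsum]

theorem scal_mk (a : A.Hom Unit Unit) (s : S.carrier) :
    scal X (mk a s : (data S).Hom Unit Unit) = mk (scal X a) s := by
  rw [scal, diag, dsum_mk, re_mk, scal, diag]

theorem mk_congr {a b : A.Hom Y X} {s t : S.carrier} (h : a = b) (h' : s.1 = t.1) :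
    mk a s = mk b t := by
  obtain rfl := h
  obtain rfl := Subtype.ext h'
  rfl

theorem lawful : (data S).Lawful where
  comp_assoc x y z := by
    obtain ⟨a, s, rfl⟩ := ind x
    obtain ⟨b, t, rfl⟩ := ind y
    obtain ⟨c, r, rfl⟩ := ind z
    exact mk_congr (A.lawful.comp_assoc _ _ _) (A.lawful.comp_assoc _ _ _)
  id_comp x := by
    obtain ⟨a, s, rfl⟩ := ind x
    exact mk_congr (A.lawful.id_comp _) (A.lawful.id_comp _)
  comp_id x := by
    obtain ⟨a, s, rfl⟩ := ind x
    exact mk_congr (A.lawful.comp_id _) (A.lawful.comp_id _)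
  emb_trans φ ψ := mk_congr (A.lawful.emb_trans _ _) (A.lawful.comp_id _).symm
  initial x := by
    obtain ⟨a, s, rfl⟩ := ind x
    exact empty_mk _ _ _ _
  final x := by
    obtain ⟨a, s, rfl⟩ := ind x
    exact empty_mk' _ _ _ _
  sum_comp x y z w := by
    obtain ⟨a, c, s, rfl, rfl⟩ := common₂ x z
    obtain ⟨b, d, t, rfl, rfl⟩ := common₂ y w
    rw [comp_mk, comp_mk, sum_mk, sum_mk, sum_mk, comp_mk, A.lawful.sum_comp]
  sum_emb φ ψ := by
    refine (sum_mk _ _ _).trans ?_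
    rw [A.lawful.sum_emb]; rfl
  sum_assoc x y z := by
    obtain ⟨a, b, s, rfl, rfl⟩ := common₂ x y
    obtain ⟨c, t, rfl⟩ := ind z
    rw [← mk_smul a s t, ← mk_smul b s t, ← mk_smul c t s, mul_comm' s t, sum_mk, sum_mk, sum_mk,
      sum_mk, re_mk, A.lawful.sum_assoc]
  sum_comm x y := by
    obtain ⟨a, b, s, rfl, rfl⟩ := common₂ x y
    rw [sum_mk, sum_mk, re_mk, A.lawful.sum_comm]
  zero_sum x := by
    obtain ⟨a, s, rfl⟩ := ind x
    have h : ((data S).zero : (data S).Hom Empty Empty) = mk A.zero s := empty_mk _ _ _ _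
    rw [h, sum_mk, re_mk, A.lawful.zero_sum]
  tr_tr x := by
    obtain ⟨a, s, rfl⟩ := ind x
    rw [tr_mk, tr_mk, A.lawful.tr_tr]
  tr_comp x y := by
    obtain ⟨a, s, rfl⟩ := ind x
    obtain ⟨b, t, rfl⟩ := ind y
    rw [comp_mk, tr_mk, tr_mk, tr_mk, comp_mk, A.lawful.tr_comp, mul_comm']
  tr_sum x y := by
    obtain ⟨a, b, s, rfl, rfl⟩ := common₂ x y
    rw [sum_mk, tr_mk, tr_mk, tr_mk, sum_mk, A.lawful.tr_sum]
  tr_emb φ := mk_congr (A.lawful.tr_emb _) rfl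
  comm_scal x y z := by
    obtain ⟨a, s, rfl⟩ := ind x
    obtain ⟨b, t, rfl⟩ := ind y
    obtain ⟨d, r, rfl⟩ := ind z
    rw [comp_mk, scal_mk, scal_mk, comp_mk, comp_mk, A.lawful.comm_scal, mul_comm']
  comm_dsum x y z := by
    obtain ⟨a, s, rfl⟩ := ind x
    obtain ⟨b, t, rfl⟩ := ind y
    obtain ⟨d, r, rfl⟩ := ind z
    rw [comp_mk, scal_mk, comp_mk, dsum_mk, dsum_mk, dsum_mk, re_mk, comp_mk, comp_mk, re_mk,
      A.lawful.comm_dsum]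
    refine mk_congr rfl ?_
    change A.comp (A.comp _ _) _ = A.comp _ (A.comp _ _)
    rw [A.lawful.comp_assoc, comm_one r.1 s.1]

end Loc

/-- The localization `S⁻¹ A`. -/
noncomputable def loc {A : CFR.{u}} (S : SymMon A) : CFR.{u} := ⟨Loc.data S, Loc.lawful⟩

/-- A homomorphism `A → B` which carries `S` into `T` induces `S⁻¹ A → T⁻¹ B`. -/
noncomputable def locMap {A B : CFR.{u}} (f : FHom A.toFData B.toFData) (S : SymMon A)
    (T : SymMon B) (h : ∀ s ∈ S.carrier, f.app s ∈ T.carrier) :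
    FHom (loc S).toFData (loc T).toFData where
  app {Y X} _ _ := Quotient.map (fun p => (f.app p.1, ⟨f.app p.2.1, h _ p.2.2⟩)) (by
    rintro ⟨a, s⟩ ⟨b, t⟩ ⟨w, hw, e⟩
    refine ⟨f.app w, h w hw, ?_⟩
    have := congrArg f.app e
    simpa only [smul, f.map_comp, f.map_scal] using this)
  map_comp x y := by
    obtain ⟨a, s, rfl⟩ := Loc.ind x
    obtain ⟨b, t, rfl⟩ := Loc.ind y
    exact Loc.mk_congr (f.map_comp _ _) (f.map_comp _ _)
  map_sum x y := by
    obtain ⟨a, b, s, rfl, rfl⟩ := Loc.common₂ x y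
    refine (congrArg _ (Loc.sum_mk a b s)).trans (Eq.trans ?_ (Loc.sum_mk _ _ _).symm)
    exact Loc.mk_congr (f.map_sum _ _) rfl
  map_tr x := by
    obtain ⟨a, s, rfl⟩ := Loc.ind x
    exact Loc.mk_congr (f.map_tr _) rfl
  map_emb φ := Loc.mk_congr (f.map_emb _) (f.map_emb _)

/-! ### Directed colimits -/

/-- A directed system of `𝔽`-rings. -/
structure DirSys (J : Type u) [Preorder J] where
  obj : J → CFR.{u}
  map : ∀ {i j : J}, i ≤ j → FHom (obj i).toFData (obj j).toFData
  map_id : ∀ {Y X : Type} [Fintype Y] [Fintype X] (i : J) (a : (obj i).Hom Y X),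
    (map (le_refl i)).app a = a
  map_map : ∀ {Y X : Type} [Fintype Y] [Fintype X] {i j k : J} (h : i ≤ j) (h' : j ≤ k)
    (a : (obj i).Hom Y X), (map h').app ((map h).app a) = (map (h.trans h')).app a
  directed : ∀ i j : J, ∃ k, i ≤ k ∧ j ≤ k
  nonempty : Nonempty J

namespace DirSys

open FData

variable {J : Type u} [Preorder J] (D : DirSys J)
variable {X Y Z X₀ X₁ Y₀ Y₁ X' Y' : Type} [Fintype X] [Fintype Y] [Fintype Z]
variable [Fintype X₀] [Fintype X₁] [Fintype Y₀] [Fintype Y₁] [Fintype X'] [Fintype Y']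

def setoid (Y X : Type) [Fintype Y] [Fintype X] : Setoid (Σ j, (D.obj j).Hom Y X) where
  r p q := ∃ (k : J) (h : p.1 ≤ k) (h' : q.1 ≤ k), (D.map h).app p.2 = (D.map h').app q.2
  iseqv :=
    { refl := fun p => ⟨p.1, le_rfl, le_rfl, rfl⟩
      symm := fun ⟨k, h, h', e⟩ => ⟨k, h', h, e.symm⟩
      trans := by
        rintro ⟨i, a⟩ ⟨j, b⟩ ⟨l, c⟩ ⟨k, h, h', e⟩ ⟨k', h₁, h₁', e'⟩
        obtain ⟨m, hm, hm'⟩ := D.directed k k'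
        refine ⟨m, h.trans hm, h₁'.trans hm', ?_⟩
        rw [← D.map_map h hm, e, D.map_map, ← D.map_map h₁' hm', ← e', D.map_map] }

theorem rel {i j k : J} (h : i ≤ k) (h' : j ≤ k) {a : (D.obj i).Hom Y X} {b : (D.obj j).Hom Y X}
    (e : (D.map h).app a = (D.map h').app b) :
    Quotient.mk (D.setoid Y X) ⟨i, a⟩ = Quotient.mk (D.setoid Y X) ⟨j, b⟩ :=
  Quotient.sound ⟨k, h, h', e⟩

/-- A chosen upper bound. -/
noncomputable def ub (i j : J) : J := (D.directed i j).choose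

theorem le_ub_left (i j : J) : i ≤ D.ub i j := (D.directed i j).choose_spec.1

theorem le_ub_right (i j : J) : j ≤ D.ub i j := (D.directed i j).choose_spec.2

/-- The colimit: operations are computed at a common stage. -/
noncomputable def colimData : FData.{u} where
  Hom Y X _ _ := Quotient (D.setoid Y X)
  comp {Z Y X} _ _ _ := Quotient.map₂ (fun p q => ⟨D.ub p.1 q.1,
      (D.obj _).comp ((D.map (D.le_ub_left _ _)).app p.2) ((D.map (D.le_ub_right _ _)).app q.2)⟩) (by
    rintro ⟨i, a⟩ ⟨i', a'⟩ ⟨k, h, h', e⟩ ⟨j, b⟩ ⟨j', b'⟩ ⟨l, g, g', f⟩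
    obtain ⟨m, hm, hm'⟩ := D.directed k l
    obtain ⟨n, hn, hn'⟩ := D.directed (D.ub i j) (D.ub i' j')
    obtain ⟨o, ho, ho'⟩ := D.directed m n
    refine ⟨o, hn.trans ho', hn'.trans ho', ?_⟩
    simp only [FHom.map_comp, D.map_map]
    rw [← D.map_map h (hm.trans ho), e, D.map_map, ← D.map_map g (hm'.trans ho), f, D.map_map])
  sum {Y₀ Y₁ X₀ X₁} _ _ _ _ := Quotient.map₂ (fun p q => ⟨D.ub p.1 q.1,
      (D.obj _).sum ((D.map (D.le_ub_left _ _)).app p.2) ((D.map (D.le_ub_right _ _)).app q.2)⟩) (by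
    rintro ⟨i, a⟩ ⟨i', a'⟩ ⟨k, h, h', e⟩ ⟨j, b⟩ ⟨j', b'⟩ ⟨l, g, g', f⟩
    obtain ⟨m, hm, hm'⟩ := D.directed k l
    obtain ⟨n, hn, hn'⟩ := D.directed (D.ub i j) (D.ub i' j')
    obtain ⟨o, ho, ho'⟩ := D.directed m n
    refine ⟨o, hn.trans ho', hn'.trans ho', ?_⟩
    simp only [FHom.map_sum, D.map_map]
    rw [← D.map_map h (hm.trans ho), e, D.map_map, ← D.map_map g (hm'.trans ho), f, D.map_map])
  tr {Y X} _ _ := Quotient.map (fun p => ⟨p.1, (D.obj _).tr p.2⟩) (by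
    rintro ⟨i, a⟩ ⟨i', a'⟩ ⟨k, h, h', e⟩
    refine ⟨k, h, h', ?_⟩
    simp only [FHom.map_tr]
    rw [e])
  emb {Y X} _ _ φ := Quotient.mk (D.setoid Y X) ⟨D.nonempty.some, (D.obj _).emb φ⟩

def ofData (j : J) : FHom (D.obj j).toFData D.colimData where
  app {Y X} _ _ a := Quotient.mk (D.setoid Y X) ⟨j, a⟩
  map_comp a b := D.rel (D.le_ub_left j j) le_rfl (by
    simp only [FHom.map_comp, D.map_map])
  map_sum a b := D.rel (D.le_ub_left j j) le_rfl (by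
    simp only [FHom.map_sum, D.map_map])
  map_tr a := rfl
  map_emb φ := D.rel (D.le_ub_left j D.nonempty.some) (D.le_ub_right _ _) (by
    simp only [FHom.map_emb])

theorem of_map {i j : J} (h : i ≤ j) (a : (D.obj i).Hom Y X) :
    (D.ofData j).app ((D.map h).app a) = (D.ofData i).app a :=
  D.rel le_rfl h (D.map_id _ _)

theorem rep (x : D.colimData.Hom Y X) : ∃ j a, x = (D.ofData j).app a := by
  obtain ⟨⟨j, a⟩, rfl⟩ := Quotient.exists_rep x
  exact ⟨j, a, rfl⟩

theorem rep_ge (i : J) (x : D.colimData.Hom Y X) : ∃ j, i ≤ j ∧ ∃ a, x = (D.ofData j).app a := by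
  obtain ⟨k, a, rfl⟩ := D.rep x
  obtain ⟨j, h, h'⟩ := D.directed i k
  exact ⟨j, h, _, (D.of_map h' a).symm⟩

theorem rep_ge₂ (i : J) (x : D.colimData.Hom Y X) (y : D.colimData.Hom Y' X') :
    ∃ j, i ≤ j ∧ ∃ a b, x = (D.ofData j).app a ∧ y = (D.ofData j).app b := by
  obtain ⟨k, hk, a, rfl⟩ := D.rep_ge i x
  obtain ⟨j, h, b, rfl⟩ := D.rep_ge k y
  exact ⟨j, hk.trans h, _, b, (D.of_map h a).symm, rfl⟩

theorem rep₂ (x : D.colimData.Hom Y X) (y : D.colimData.Hom Y' X') :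
    ∃ j a b, x = (D.ofData j).app a ∧ y = (D.ofData j).app b := by
  obtain ⟨j, -, h⟩ := D.rep_ge₂ D.nonempty.some x y
  exact ⟨j, h⟩

theorem rep₃ (x : D.colimData.Hom Y X) (y : D.colimData.Hom Y' X') (z : D.colimData.Hom Y₀ X₀) :
    ∃ j a b c, x = (D.ofData j).app a ∧ y = (D.ofData j).app b ∧ z = (D.ofData j).app c := by
  obtain ⟨i, a, rfl⟩ := D.rep x
  obtain ⟨j, h, b, c, rfl, rfl⟩ := D.rep_ge₂ i y z
  exact ⟨j, _, b, c, (D.of_map h a).symm, rfl, rfl⟩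

theorem colim_lawful : D.colimData.Lawful where
  comp_assoc x y z := by
    obtain ⟨j, a, b, c, rfl, rfl, rfl⟩ := D.rep₃ x y z
    simp only [← FHom.map_comp, (D.obj j).lawful.comp_assoc]
  id_comp x := by
    obtain ⟨j, a, rfl⟩ := D.rep x
    rw [← (D.ofData j).map_emb, ← FHom.map_comp, (D.obj j).lawful.id_comp]
  comp_id x := by
    obtain ⟨j, a, rfl⟩ := D.rep x
    rw [← (D.ofData j).map_emb, ← FHom.map_comp, (D.obj j).lawful.comp_id]
  emb_trans φ ψ := by
    obtain ⟨j⟩ := D.nonempty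
    simp only [← (D.ofData j).map_emb, ← FHom.map_comp, (D.obj j).lawful.emb_trans]
  initial x := by
    obtain ⟨j, a, rfl⟩ := D.rep x
    rw [(D.obj j).lawful.initial a, FHom.map_zero]
  final x := by
    obtain ⟨j, a, rfl⟩ := D.rep x
    rw [(D.obj j).lawful.final a, FHom.map_zero]
  sum_comp x y z w := by
    obtain ⟨i, a, b, rfl, rfl⟩ := D.rep₂ x y
    obtain ⟨j, h, c, d, rfl, rfl⟩ := D.rep_ge₂ i z w
    rw [← D.of_map h a, ← D.of_map h b]
    simp only [← (D.ofData j).map_comp, ← (D.ofData j).map_sum, (D.obj j).lawful.sum_comp]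
  sum_emb φ ψ := by
    obtain ⟨j⟩ := D.nonempty
    simp only [← (D.ofData j).map_emb, ← FHom.map_sum, (D.obj j).lawful.sum_emb]
  sum_assoc x y z := by
    obtain ⟨j, a, b, c, rfl, rfl, rfl⟩ := D.rep₃ x y z
    simp only [← FHom.map_sum, ← FHom.map_re, (D.obj j).lawful.sum_assoc]
  sum_comm x y := by
    obtain ⟨j, a, b, rfl, rfl⟩ := D.rep₂ x y
    simp only [← FHom.map_sum, ← FHom.map_re, (D.obj j).lawful.sum_comm]
  zero_sum x := by
    obtain ⟨j, a, rfl⟩ := D.rep x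
    rw [← (D.ofData j).map_zero, ← FHom.map_sum, ← FHom.map_re, (D.obj j).lawful.zero_sum]
  tr_tr x := by
    obtain ⟨j, a, rfl⟩ := D.rep x
    simp only [← FHom.map_tr, (D.obj j).lawful.tr_tr]
  tr_comp x y := by
    obtain ⟨j, a, b, rfl, rfl⟩ := D.rep₂ x y
    simp only [← FHom.map_comp, ← FHom.map_tr, (D.obj j).lawful.tr_comp]
  tr_sum x y := by
    obtain ⟨j, a, b, rfl, rfl⟩ := D.rep₂ x y
    simp only [← FHom.map_sum, ← FHom.map_tr, (D.obj j).lawful.tr_sum]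
  tr_emb φ := by
    obtain ⟨j⟩ := D.nonempty
    simp only [← (D.ofData j).map_emb, ← FHom.map_tr, (D.obj j).lawful.tr_emb]
  comm_scal x y z := by
    obtain ⟨j, a, b, c, rfl, rfl, rfl⟩ := D.rep₃ x y z
    simp only [← FHom.map_comp, ← FHom.map_scal, (D.obj j).lawful.comm_scal]
  comm_dsum x y z := by
    obtain ⟨j, a, b, c, rfl, rfl, rfl⟩ := D.rep₃ x y z
    simp only [← FHom.map_comp, ← FHom.map_scal, ← FHom.map_dsum, ← FHom.map_re,
      (D.obj j).lawful.comm_dsum]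

/-- The colimit of a directed system. -/
noncomputable def colim : CFR.{u} := ⟨D.colimData, D.colim_lawful⟩

/-- The canonical homomorphism from a stage to the colimit. -/
def of (j : J) : FHom (D.obj j).toFData D.colim.toFData := D.ofData j

end DirSys

/-! ### Spaces with a sheaf of `𝔽`-rings -/

open TopologicalSpace in
/-- A topological space with a sheaf of commutative `𝔽`-rings with involution. -/
structure FSpace where
  pt : Type u
  [top : TopologicalSpace pt]
  sec : Opens pt → CFR.{u}
  res : ∀ {U V : Opens pt}, V ≤ U → FHom (sec U).toFData (sec V).toFData
  res_id : ∀ {Y X : Type} [Fintype Y] [Fintype X] (U : Opens pt) (s : (sec U).Hom Y X),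
    (res (le_refl U)).app s = s
  res_res : ∀ {Y X : Type} [Fintype Y] [Fintype X] {U V W : Opens pt} (h : V ≤ U) (h' : W ≤ V)
    (s : (sec U).Hom Y X), (res h').app ((res h).app s) = (res (h'.trans h)).app s
  sheaf : ∀ {Y X : Type} [Fintype Y] [Fintype X] {ι : Type u} (V : Opens pt) (U : ι → Opens pt)
    (hU : ∀ i, U i ≤ V) (_ : V ≤ ⨆ i, U i) (s : ∀ i, (sec (U i)).Hom Y X),
    (∀ i j, (res (inf_le_left : U i ⊓ U j ≤ U i)).app (s i) =
      (res (inf_le_right : U i ⊓ U j ≤ U j)).app (s j)) →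
    ∃! t : (sec V).Hom Y X, ∀ i, (res (hU i)).app t = s i

attribute [instance] FSpace.top

open TopologicalSpace

namespace FSpace

/-- A map of spaces with sheaves of `𝔽`-rings: a continuous map with a compatible family of
homomorphisms `O_Y(V) → O_X(U)` for all open `U`, `V` with `f(U) ⊆ V`. -/
structure Map (P Q : FSpace.{u}) where
  toFun : P.pt → Q.pt
  cont : Continuous toFun
  app : ∀ (V : Opens Q.pt) (U : Opens P.pt), (∀ x ∈ U, toFun x ∈ V) →
    FHom (Q.sec V).toFData (P.sec U).toFData
  nat : ∀ {Y X : Type} [Fintype Y] [Fintype X] {V V' : Opens Q.pt} {U U' : Opens P.pt}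
    (hV : V' ≤ V) (hU : U' ≤ U) (h : ∀ x ∈ U, toFun x ∈ V') (s : (Q.sec V).Hom Y X),
    (P.res hU).app ((app V' U h).app ((Q.res hV).app s)) =
      (app V U' fun x hx => hV (h x (hU hx))).app s

/-- The inverse image of an open set. -/
def Map.pre {P Q : FSpace.{u}} (f : Map P Q) (V : Opens Q.pt) : Opens P.pt :=
  ⟨f.toFun ⁻¹' V, V.isOpen.preimage f.cont⟩

theorem Map.app_res {P Q : FSpace.{u}} (f : Map P Q) {Y X : Type} [Fintype Y] [Fintype X]
    {V V' : Opens Q.pt} {U : Opens P.pt} (hV : V' ≤ V) (h : ∀ x ∈ U, f.toFun x ∈ V')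
    (s : (Q.sec V).Hom Y X) : (f.app V' U h).app ((Q.res hV).app s) =
      (f.app V U fun x hx => hV (h x hx)).app s := by
  rw [← f.nat hV le_rfl h, P.res_id]

theorem Map.res_app {P Q : FSpace.{u}} (f : Map P Q) {Y X : Type} [Fintype Y] [Fintype X]
    {V : Opens Q.pt} {U U' : Opens P.pt} (hU : U' ≤ U) (h : ∀ x ∈ U, f.toFun x ∈ V)
    (s : (Q.sec V).Hom Y X) : (P.res hU).app ((f.app V U h).app s) =
      (f.app V U' fun x hx => h x (hU hx)).app s := by
  rw [← f.nat le_rfl hU h, Q.res_id]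

/-- Two sections which agree on an open cover are equal. -/
theorem ext_cover (P : FSpace.{u}) {Y X : Type} [Fintype Y] [Fintype X] {ι : Type u}
    {V : Opens P.pt} (U : ι → Opens P.pt) (hU : ∀ i, U i ≤ V) (hV : V ≤ ⨆ i, U i)
    {s t : (P.sec V).Hom Y X} (h : ∀ i, (P.res (hU i)).app s = (P.res (hU i)).app t) : s = t := by
  refine (P.sheaf V U hU hV (fun i => (P.res (hU i)).app t) fun i j => ?_).unique h fun _ => rfl
  rw [P.res_res, P.res_res]

/-- The open neighbourhoods of a point, ordered by reverse inclusion. -/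
structure Nhd (P : FSpace.{u}) (x : P.pt) where
  U : Opens P.pt
  mem : x ∈ U

instance (P : FSpace.{u}) (x : P.pt) : Preorder (Nhd P x) where
  le a b := b.U ≤ a.U
  le_refl a := le_refl a.U
  le_trans a b c h h' := le_trans h' h

/-- The sections on the open neighbourhoods of a point. -/
def nhdSys (P : FSpace.{u}) (x : P.pt) : DirSys (Nhd P x) where
  obj a := P.sec a.U
  map h := P.res h
  map_id _ _ := P.res_id _ _
  map_map _ _ _ := P.res_res _ _ _
  directed a b := ⟨⟨a.U ⊓ b.U, a.mem, b.mem⟩, (inf_le_left : a.U ⊓ b.U ≤ a.U),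
    (inf_le_right : a.U ⊓ b.U ≤ b.U)⟩
  nonempty := ⟨⟨⊤, trivial⟩⟩

/-- The stalk at a point. -/
noncomputable def stalk (P : FSpace.{u}) (x : P.pt) : CFR.{u} := (P.nhdSys x).colim

/-- The germ at `x` of a section over a neighbourhood of `x`. -/
def germ (P : FSpace.{u}) (U : Opens P.pt) (x : P.pt) (hx : x ∈ U) :
    FHom (P.sec U).toFData (P.stalk x).toFData := (P.nhdSys x).of ⟨U, hx⟩

/-! #### Sheaves of functions to given stalks, with a local condition -/

/-- A family of `𝔽`-rings over a space and, for each open set, a sub-`𝔽`-ring of the functions with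
values in this family, compatible with restriction. -/
structure LocalData (P : Type u) [TopologicalSpace P] where
  St : P → CFR.{u}
  good : ∀ V : Opens P, Sub (prod fun x : V => St x.1)
  good_res : ∀ {Y X : Type} [Fintype Y] [Fintype X] {V W : Opens P} (h : W ≤ V)
    (s : ∀ x : V, (St x.1).Hom Y X), s ∈ (good V).carrier Y X →
    (fun x : W => s ⟨x.1, h x.2⟩) ∈ (good W).carrier Y X

namespace LocalData

variable {P : Type u} [TopologicalSpace P] (D : LocalData P)

/-- The functions on `U` which are locally good. -/
def sub (U : Opens P) : Sub (prod fun x : U => D.St x.1) where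
  carrier Y X _ _ := {s : ∀ x : U, (D.St x.1).Hom Y X | ∀ x ∈ U, ∃ (V : Opens P) (_ : x ∈ V)
    (h : V ≤ U), (fun x : V => s ⟨x.1, h x.2⟩) ∈ (D.good V).carrier Y X}
  comp_mem := by
    intro _ _ _ _ _ _ s t hs ht x hx
    obtain ⟨V, hxV, hV, hs⟩ := hs x hx
    obtain ⟨W, hxW, hW, ht⟩ := ht x hx
    exact ⟨V ⊓ W, ⟨hxV, hxW⟩, inf_le_left.trans hV, (D.good (V ⊓ W)).comp_mem
      (D.good_res inf_le_left _ hs) (D.good_res inf_le_right _ ht)⟩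
  sum_mem := by
    intro _ _ _ _ _ _ _ _ s t hs ht x hx
    obtain ⟨V, hxV, hV, hs⟩ := hs x hx
    obtain ⟨W, hxW, hW, ht⟩ := ht x hx
    exact ⟨V ⊓ W, ⟨hxV, hxW⟩, inf_le_left.trans hV, (D.good (V ⊓ W)).sum_mem
      (D.good_res inf_le_left _ hs) (D.good_res inf_le_right _ ht)⟩
  tr_mem := by
    intro _ _ _ _ s hs x hx
    obtain ⟨V, hxV, hV, hs⟩ := hs x hx
    exact ⟨V, hxV, hV, (D.good V).tr_mem hs⟩
  emb_mem φ x hx := ⟨U, hx, le_rfl, (D.good U).emb_mem φ⟩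

/-- The space with the sheaf of locally good functions. -/
def space : FSpace.{u} where
  pt := P
  sec U := (D.sub U).ring
  res {U V} h :=
    { app := fun s => ⟨fun x => s.1 ⟨x.1, h x.2⟩, fun x hx => by
        obtain ⟨W, hxW, hW, hs⟩ := s.2 x (h hx)
        exact ⟨W ⊓ V, ⟨hxW, hx⟩, inf_le_right, D.good_res inf_le_left _ hs⟩⟩
      map_comp := fun _ _ => rfl
      map_sum := fun _ _ => rfl
      map_tr := fun _ => rfl
      map_emb := fun _ => rfl }
  res_id _ _ := rfl
  res_res _ _ _ := rfl
  sheaf {Y X} _ _ {ι} V U hU hV s hs := by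
    have key : ∀ (x : P) (i j : ι) (hi : x ∈ U i) (hj : x ∈ U j),
        (s i).1 ⟨x, hi⟩ = (s j).1 ⟨x, hj⟩ := fun x i j hi hj =>
      congrFun (congrArg Subtype.val (hs i j)) ⟨x, hi, hj⟩
    have mem : ∀ x : V, ∃ i, x.1 ∈ U i := fun x => Opens.mem_iSup.1 (hV x.2)
    choose c hc using mem
    refine ⟨⟨fun x => (s (c x)).1 ⟨x.1, hc x⟩, fun x hx => ?_⟩, fun i => ?_, fun t ht => ?_⟩
    · obtain ⟨W, hxW, hW, h⟩ := (s (c ⟨x, hx⟩)).2 x (hc ⟨x, hx⟩)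
      refine ⟨W, hxW, hW.trans (hU _), ?_⟩
      convert h using 2
      exact key _ _ _ _ _
    · exact Subtype.ext (funext fun x => key _ _ _ _ _)
    · refine Subtype.ext (funext fun x => ?_)
      exact congrFun (congrArg Subtype.val (ht (c x))) ⟨x.1, hc x⟩

end LocalData

/-! #### Glueing -/

/-- Spaces `C i`, each with a map from a common space `L`, along which they will be glued. -/
structure GlueData (ι : Type u) where
  L : FSpace.{u}
  C : ι → FSpace.{u}
  r : ∀ i, Map L (C i)

namespace GlueData

variable {ι : Type u} (G : GlueData ι)

/-- The images in `C i` and `C j` of a point of `L` are identified. -/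
def Rel (p q : Σ i, (G.C i).pt) : Prop :=
  ∃ x : G.L.pt, p = ⟨p.1, (G.r p.1).toFun x⟩ ∧ q = ⟨q.1, (G.r q.1).toFun x⟩

/-- The points of the glued space. It carries the quotient topology. -/
def Pt : Type u := Quot G.Rel

instance : TopologicalSpace G.Pt := inferInstanceAs (TopologicalSpace (Quot G.Rel))

/-- The map from the `i`-th chart. -/
def inj (i : ι) (x : (G.C i).pt) : G.Pt := Quot.mk _ ⟨i, x⟩

theorem continuous_inj (i : ι) : Continuous (G.inj i) :=
  continuous_quot_mk.comp continuous_sigmaMk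

theorem inj_r (i j : ι) (x : G.L.pt) :
    G.inj i ((G.r i).toFun x) = G.inj j ((G.r j).toFun x) := Quot.sound ⟨x, rfl, rfl⟩

/-- The part of an open set in the `i`-th chart. -/
def pre (i : ι) (U : Opens G.Pt) : Opens (G.C i).pt :=
  ⟨G.inj i ⁻¹' U, U.isOpen.preimage (G.continuous_inj i)⟩

theorem pre_mono (i : ι) {U V : Opens G.Pt} (h : V ≤ U) : G.pre i V ≤ G.pre i U :=
  fun _ hx => h hx

/-- Families of sections on the charts which agree on `L`. -/
def sub (U : Opens G.Pt) : Sub (prod fun i => (G.C i).sec (G.pre i U)) where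
  carrier Y X _ _ := {s : ∀ i, ((G.C i).sec (G.pre i U)).Hom Y X |
    ∀ (i j : ι) (W : Opens G.L.pt) (hi : ∀ x ∈ W, (G.r i).toFun x ∈ G.pre i U)
      (hj : ∀ x ∈ W, (G.r j).toFun x ∈ G.pre j U),
      ((G.r i).app _ W hi).app (s i) = ((G.r j).app _ W hj).app (s j)}
  comp_mem := by
    intro _ _ _ _ _ _ s t hs ht i j W hi hj
    refine (FHom.map_comp _ _ _).trans (Eq.trans ?_ (FHom.map_comp _ _ _).symm)
    rw [hs i j W hi hj, ht i j W hi hj]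
  sum_mem := by
    intro _ _ _ _ _ _ _ _ s t hs ht i j W hi hj
    refine (FHom.map_sum _ _ _).trans (Eq.trans ?_ (FHom.map_sum _ _ _).symm)
    rw [hs i j W hi hj, ht i j W hi hj]
  tr_mem := by
    intro _ _ _ _ s hs i j W hi hj
    refine (FHom.map_tr _ _).trans (Eq.trans ?_ (FHom.map_tr _ _).symm)
    rw [hs i j W hi hj]
  emb_mem φ i j W hi hj := (FHom.map_emb _ φ).trans (FHom.map_emb _ φ).symm

/-- The glued space (the pushout). -/
def glue : FSpace.{u} where
  pt := G.Pt
  sec U := (G.sub U).ring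
  res {U V} h :=
    { app := fun s => ⟨fun i => ((G.C i).res (G.pre_mono i h)).app (s.1 i), fun i j W hi hj => by
        rw [Map.app_res, Map.app_res]; exact s.2 i j W _ _⟩
      map_comp := fun _ _ => Subtype.ext (funext fun i => FHom.map_comp _ _ _)
      map_sum := fun _ _ => Subtype.ext (funext fun i => FHom.map_sum _ _ _)
      map_tr := fun _ => Subtype.ext (funext fun i => FHom.map_tr _ _)
      map_emb := fun _ => Subtype.ext (funext fun i => FHom.map_emb _ _) }
  res_id U s := Subtype.ext (funext fun i => (G.C i).res_id _ _)
  res_res h h' s := Subtype.ext (funext fun i => (G.C i).res_res _ _ _)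
  sheaf {Y X} _ _ {κ} V U hU hV s hs := by
    have cov : ∀ i, G.pre i V ≤ ⨆ k, G.pre i (U k) := fun i x hx => by
      obtain ⟨k, hk⟩ := Opens.mem_iSup.1 (hV hx)
      exact Opens.mem_iSup.2 ⟨k, hk⟩
    have ex : ∀ i, ∃! t : ((G.C i).sec (G.pre i V)).Hom Y X,
        ∀ k, ((G.C i).res (G.pre_mono i (hU k))).app t = (s k).1 i := fun i =>
      (G.C i).sheaf (G.pre i V) (fun k => G.pre i (U k)) (fun k => G.pre_mono i (hU k)) (cov i)
        (fun k => (s k).1 i) fun k l => congrFun (congrArg Subtype.val (hs k l)) i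
    choose t ht ht' using ex
    refine ⟨⟨t, fun i j W hi hj => ?_⟩, fun k => Subtype.ext (funext fun i => ht i k),
      fun t' h' => Subtype.ext (funext fun i => ht' i _ fun k =>
        congrFun (congrArg Subtype.val (h' k)) i)⟩
    refine G.L.ext_cover (fun k => W ⊓ (G.r i).pre (G.pre i (U k))) (fun k => inf_le_left) ?_ ?_
    · intro x hx
      obtain ⟨k, hk⟩ := Opens.mem_iSup.1 (cov i (hi x hx))
      exact Opens.mem_iSup.2 ⟨k, hx, hk⟩
    · intro k
      have hi' : ∀ x ∈ W ⊓ (G.r i).pre (G.pre i (U k)), (G.r i).toFun x ∈ G.pre i (U k) :=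
        fun x hx => hx.2
      have hj' : ∀ x ∈ W ⊓ (G.r i).pre (G.pre i (U k)), (G.r j).toFun x ∈ G.pre j (U k) := by
        rintro x ⟨_, hx⟩
        change G.inj j _ ∈ U k
        rw [← G.inj_r i j x]; exact hx
      rw [Map.res_app, Map.res_app, ← Map.app_res _ (G.pre_mono i (hU k)) hi',
        ← Map.app_res _ (G.pre_mono j (hU k)) hj', ht, ht]
      exact (s k).2 i j _ _ _

/-- A morphism of glueing data. -/
structure Hom (G H : GlueData ι) where
  L : Map G.L H.L
  C : ∀ i, Map (G.C i) (H.C i)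
  pt : ∀ i x, (C i).toFun ((G.r i).toFun x) = (H.r i).toFun (L.toFun x)
  app : ∀ {Y X : Type} [Fintype Y] [Fintype X] (i : ι) (V : Opens (H.C i).pt)
    (U : Opens (G.C i).pt) (W : Opens G.L.pt) (W' : Opens H.L.pt)
    (h₁ : ∀ x ∈ U, (C i).toFun x ∈ V) (h₂ : ∀ x ∈ W, (G.r i).toFun x ∈ U)
    (h₃ : ∀ x ∈ W', (H.r i).toFun x ∈ V) (h₄ : ∀ x ∈ W, L.toFun x ∈ W')
    (s : ((H.C i).sec V).Hom Y X),
    ((G.r i).app U W h₂).app (((C i).app V U h₁).app s) =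
      (L.app W' W h₄).app (((H.r i).app V W' h₃).app s)

namespace Hom

variable {G H : GlueData ι} (f : Hom G H)

/-- The map on points. -/
def toFun : G.Pt → H.Pt := Quot.map (fun p => ⟨p.1, (f.C p.1).toFun p.2⟩) (by
  rintro ⟨i, x⟩ ⟨j, y⟩ ⟨z, hx, hy⟩
  dsimp only at hx hy
  refine ⟨f.L.toFun z, ?_, ?_⟩
  · rw [Sigma.mk.injEq] at hx
    dsimp only
    rw [eq_of_heq hx.2, f.pt]
  · rw [Sigma.mk.injEq] at hy
    dsimp only
    rw [eq_of_heq hy.2, f.pt])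

theorem continuous_toFun : Continuous f.toFun := by
  refine continuous_quot_lift _ ?_
  refine continuous_sigma fun i => ?_
  exact (H.continuous_inj i).comp (f.C i).cont

/-- The induced map of the glued spaces. -/
def map : Map G.glue H.glue where
  toFun := f.toFun
  cont := f.continuous_toFun
  app V U h :=
    have h' : ∀ i, ∀ x ∈ G.pre i U, (f.C i).toFun x ∈ H.pre i V := fun i x hx => h _ hx
    { app := fun s => ⟨fun i => ((f.C i).app (H.pre i V) (G.pre i U) (h' i)).app (s.1 i),
        fun i j W hi hj => by
          have hij : ∀ x ∈ (H.r i).pre (H.pre i V), (H.r j).toFun x ∈ H.pre j V := by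
            intro x hx
            change H.inj j _ ∈ V
            rw [← H.inj_r i j x]; exact hx
          have hW : ∀ x ∈ W, f.L.toFun x ∈ (H.r i).pre (H.pre i V) := fun x hx => by
            change (H.r i).toFun (f.L.toFun x) ∈ H.pre i V
            rw [← f.pt]; exact h' i _ (hi x hx)
          rw [f.app i _ _ W ((H.r i).pre (H.pre i V)) (h' i) hi (fun _ hx => hx) hW,
            f.app j _ _ W ((H.r i).pre (H.pre i V)) (h' j) hj hij hW]
          exact congrArg _ (s.2 i j _ _ _)⟩
      map_comp := fun s t => Subtype.ext (funext fun i =>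
        ((f.C i).app _ _ (h' i)).map_comp (s.1 i) (t.1 i))
      map_sum := fun s t => Subtype.ext (funext fun i =>
        ((f.C i).app _ _ (h' i)).map_sum (s.1 i) (t.1 i))
      map_tr := fun s => Subtype.ext (funext fun i =>
        ((f.C i).app _ _ (h' i)).map_tr (s.1 i))
      map_emb := fun φ => Subtype.ext (funext fun i =>
        ((f.C i).app _ _ (h' i)).map_emb φ) }
  nat hV hU h s := Subtype.ext (funext fun i => (f.C i).nat _ _ _ _)

end Hom

end GlueData

/-! #### Inverse limits -/

/-- An inverse system of spaces with sheaves of `𝔽`-rings over a directed index set. -/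
structure ProSys (I : Type) [Preorder I] where
  X : I → FSpace.{u}
  f : ∀ {N M : I}, N ≤ M → Map (X M) (X N)
  f_id : ∀ (N : I) (x : (X N).pt), (f (le_refl N)).toFun x = x
  f_comp : ∀ {N M P : I} (h : N ≤ M) (h' : M ≤ P) (x : (X P).pt),
    (f h).toFun ((f h').toFun x) = (f (h.trans h')).toFun x
  app_id : ∀ {Y X' : Type} [Fintype Y] [Fintype X'] (N : I) (V : Opens (X N).pt)
    (s : ((X N).sec V).Hom Y X'),
    ((f (le_refl N)).app V V fun x hx => (f_id N x).symm ▸ hx).app s = s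
  app_comp : ∀ {Y X' : Type} [Fintype Y] [Fintype X'] {N M P : I} (h : N ≤ M) (h' : M ≤ P)
    (V : Opens (X N).pt) (U : Opens (X M).pt) (W : Opens (X P).pt)
    (hU : ∀ x ∈ U, (f h).toFun x ∈ V) (hW : ∀ x ∈ W, (f h').toFun x ∈ U)
    (s : ((X N).sec V).Hom Y X'),
    ((f h').app U W hW).app (((f h).app V U hU).app s) =
      ((f (h.trans h')).app V W fun x hx => f_comp h h' x ▸ hU _ (hW x hx)).app s
  directed : ∀ N M : I, ∃ P, N ≤ P ∧ M ≤ P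
  nonempty : Nonempty I

namespace ProSys

variable {I : Type} [Preorder I] (S : ProSys.{u} I)

/-- The points of the limit: coherent families of points. It carries the subspace topology of the
product topology. -/
def Pt : Type u := {x : ∀ N, (S.X N).pt // ∀ (N M : I) (h : N ≤ M), (S.f h).toFun (x M) = x N}

instance : TopologicalSpace S.Pt := inferInstanceAs (TopologicalSpace (Subtype _))

theorem mem_pre (x : S.Pt) {N M : I} (h : N ≤ M) {U : Opens (S.X N).pt} (hx : x.1 N ∈ U) :
    x.1 M ∈ (S.f h).pre U := by
  change (S.f h).toFun (x.1 M) ∈ U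
  rwa [x.2 N M h]

/-- An index together with an open neighbourhood of the corresponding component of `x`. -/
structure Nhd (x : S.Pt) where
  N : I
  U : Opens (S.X N).pt
  mem : x.1 N ∈ U

instance (x : S.Pt) : Preorder (S.Nhd x) where
  le a b := ∃ h : a.N ≤ b.N, ∀ y ∈ b.U, (S.f h).toFun y ∈ a.U
  le_refl a := ⟨le_rfl, fun y hy => (S.f_id _ y).symm ▸ hy⟩
  le_trans a b c h h' := ⟨h.fst.trans h'.fst, fun y hy =>
    S.f_comp h.fst h'.fst y ▸ h.snd _ (h'.snd y hy)⟩

/-- The sections of the `X N` on neighbourhoods of the components of `x`. -/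
def nhdSys (x : S.Pt) : DirSys (S.Nhd x) where
  obj a := (S.X a.N).sec a.U
  map h := (S.f h.fst).app _ _ h.snd
  map_id a s := S.app_id a.N a.U s
  map_map h h' s := S.app_comp h.fst h'.fst _ _ _ h.snd h'.snd s
  directed a b := by
    obtain ⟨P, h, h'⟩ := S.directed a.N b.N
    exact ⟨⟨P, (S.f h).pre a.U ⊓ (S.f h').pre b.U,
      ⟨S.mem_pre x h a.mem, S.mem_pre x h' b.mem⟩⟩,
      ⟨h, fun y hy => hy.1⟩, ⟨h', fun y hy => hy.2⟩⟩
  nonempty := by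
    obtain ⟨N⟩ := S.nonempty
    exact ⟨⟨N, ⊤, trivial⟩⟩

/-- The inverse limit: the sheaf is the colimit of the inverse images of the sheaves of the `X N`.
Its stalk at `x` is the colimit of the stalks of the `X N` at the components of `x`, and its
sections are the functions into the stalks which are locally given by a section of some `X N`. -/
noncomputable def localData : LocalData S.Pt where
  St x := (S.nhdSys x).colim
  good V :=
    { carrier := fun Y X _ _ => {s : ∀ x : V, ((S.nhdSys x.1).colim).Hom Y X |
        ∃ (N : I) (W : Opens (S.X N).pt) (hW : ∀ x ∈ V, x.1 N ∈ W)
          (t : ((S.X N).sec W).Hom Y X),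
          ∀ x : V, s x = ((S.nhdSys x.1).of ⟨N, W, hW x.1 x.2⟩).app t}
      comp_mem := by
        rintro _ _ _ _ _ _ s s' ⟨N, W, hW, t, h⟩ ⟨N', W', hW', t', h'⟩
        obtain ⟨P, g, g'⟩ := S.directed N N'
        refine ⟨P, (S.f g).pre W ⊓ (S.f g').pre W', fun x hx =>
          ⟨S.mem_pre x g (hW x hx), S.mem_pre x g' (hW' x hx)⟩,
          ((S.X P).sec ((S.f g).pre W ⊓ (S.f g').pre W')).comp
            (((S.f g).app W ((S.f g).pre W ⊓ (S.f g').pre W') fun y hy => hy.1).app t)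
            (((S.f g').app W' ((S.f g).pre W ⊓ (S.f g').pre W') fun y hy => hy.2).app t'),
          fun x => ?_⟩
        refine Eq.trans ?_ (FHom.map_comp _ _ _).symm
        refine congrArg₂ (S.nhdSys x.1).colim.comp ((h x).trans ?_) ((h' x).trans ?_)
        · exact ((S.nhdSys x.1).of_map (i := ⟨N, W, hW x.1 x.2⟩) (j := ⟨P, (S.f g).pre W ⊓ (S.f g').pre W',
            ⟨S.mem_pre x.1 g (hW x.1 x.2), S.mem_pre x.1 g' (hW' x.1 x.2)⟩⟩)
            ⟨g, fun y hy => hy.1⟩ t).symm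
        · exact ((S.nhdSys x.1).of_map (i := ⟨N', W', hW' x.1 x.2⟩) (j := ⟨P, (S.f g).pre W ⊓ (S.f g').pre W',
            ⟨S.mem_pre x.1 g (hW x.1 x.2), S.mem_pre x.1 g' (hW' x.1 x.2)⟩⟩)
            ⟨g', fun y hy => hy.2⟩ t').symm
      sum_mem := by
        rintro _ _ _ _ _ _ _ _ s s' ⟨N, W, hW, t, h⟩ ⟨N', W', hW', t', h'⟩
        obtain ⟨P, g, g'⟩ := S.directed N N'
        refine ⟨P, (S.f g).pre W ⊓ (S.f g').pre W', fun x hx =>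
          ⟨S.mem_pre x g (hW x hx), S.mem_pre x g' (hW' x hx)⟩,
          ((S.X P).sec ((S.f g).pre W ⊓ (S.f g').pre W')).sum
            (((S.f g).app W ((S.f g).pre W ⊓ (S.f g').pre W') fun y hy => hy.1).app t)
            (((S.f g').app W' ((S.f g).pre W ⊓ (S.f g').pre W') fun y hy => hy.2).app t'),
          fun x => ?_⟩
        refine Eq.trans ?_ (FHom.map_sum _ _ _).symm
        refine congrArg₂ (S.nhdSys x.1).colim.sum ((h x).trans ?_) ((h' x).trans ?_)
        · exact ((S.nhdSys x.1).of_map (i := ⟨N, W, hW x.1 x.2⟩) (j := ⟨P, (S.f g).pre W ⊓ (S.f g').pre W',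
            ⟨S.mem_pre x.1 g (hW x.1 x.2), S.mem_pre x.1 g' (hW' x.1 x.2)⟩⟩)
            ⟨g, fun y hy => hy.1⟩ t).symm
        · exact ((S.nhdSys x.1).of_map (i := ⟨N', W', hW' x.1 x.2⟩) (j := ⟨P, (S.f g).pre W ⊓ (S.f g').pre W',
            ⟨S.mem_pre x.1 g (hW x.1 x.2), S.mem_pre x.1 g' (hW' x.1 x.2)⟩⟩)
            ⟨g', fun y hy => hy.2⟩ t').symm
      tr_mem := by
        rintro _ _ _ _ s ⟨N, W, hW, t, h⟩
        refine ⟨N, W, hW, ((S.X N).sec W).tr t, fun x => ?_⟩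
        exact (congrArg (S.nhdSys x.1).colim.tr (h x)).trans
          (((S.nhdSys x.1).of ⟨N, W, hW x.1 x.2⟩).map_tr t).symm
      emb_mem := fun φ => by
        obtain ⟨N⟩ := S.nonempty
        exact ⟨N, ⊤, fun _ _ => trivial, ((S.X N).sec ⊤).emb φ, fun x =>
          (((S.nhdSys x.1).of ⟨N, ⊤, trivial⟩).map_emb φ).symm⟩ }
  good_res := by
    rintro _ _ _ _ V V' h s ⟨N, W, hW, t, hs⟩
    exact ⟨N, W, fun x hx => hW x (h hx), t, fun x => hs ⟨x.1, h x.2⟩⟩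

/-- The inverse limit. -/
noncomputable def lim : FSpace.{u} := S.localData.space

end ProSys

end FSpace

/-! ### Symmetric ideals and the symmetric spectrum -/

section Ideals

variable {A B : CFR.{u}}

/-- Ideals of an `𝔽`-ring: sets of scalars closed under `b ∘ (⊕_x a x) ∘ d`. -/
def IsIdeal (I : Set (A.Hom Unit Unit)) : Prop :=
  ∀ (X : Type) [Fintype X] (a : X → A.Hom Unit Unit) (b : A.Hom Unit X) (d : A.Hom X Unit),
    (∀ x, a x ∈ I) → A.comp b (A.comp (FData.diag X a) d) ∈ I

/-- The ideal generated by a set of scalars. -/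
def span (T : Set (A.Hom Unit Unit)) : Set (A.Hom Unit Unit) :=
  {s | ∀ I : Set (A.Hom Unit Unit), IsIdeal I → T ⊆ I → s ∈ I}

theorem span_isIdeal (T : Set (A.Hom Unit Unit)) : IsIdeal (span T) :=
  fun X _ a b d h I hI hT => hI X a b d fun x => h x I hI hT

theorem subset_span (T : Set (A.Hom Unit Unit)) : T ⊆ span T := fun _ hs _ _ hT => hT hs

theorem span_le {T I : Set (A.Hom Unit Unit)} (hI : IsIdeal I) (h : T ⊆ I) : span T ⊆ I :=
  fun _ hs => hs I hI h

theorem IsIdeal.preimage {I : Set (B.Hom Unit Unit)} (hI : IsIdeal I)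
    (f : FHom A.toFData B.toFData) : IsIdeal {s : A.Hom Unit Unit | f.app s ∈ I} := by
  intro X _ a b d h
  change f.app _ ∈ I
  rw [f.map_comp, f.map_comp, f.map_diag]
  exact hI X _ _ _ h

/-- Symmetric primes: ideals generated by their symmetric elements such that the symmetric scalars
outside of the ideal form a multiplicative set. -/
@[ext]
structure SymPrime (A : CFR.{u}) where
  carrier : Set (A.Hom Unit Unit)
  isIdeal : IsIdeal carrier
  symmetric : carrier = span {s | s ∈ carrier ∧ A.tr s = s}
  one_notMem : A.one ∉ carrier
  mul_notMem : ∀ s t : A.Hom Unit Unit, A.tr s = s → A.tr t = t → s ∉ carrier → t ∉ carrier →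
    A.comp s t ∉ carrier

/-- The multiplicative set of the symmetric scalars outside of a symmetric prime. -/
def SymPrime.compl (p : SymPrime A) : SymMon A where
  carrier := {s | A.tr s = s ∧ s ∉ p.carrier}
  one_mem := ⟨A.lawful.tr_emb _, p.one_notMem⟩
  mul_mem hs ht := ⟨by rw [A.lawful.tr_comp, hs.1, ht.1, comm_one],
    p.mul_notMem _ _ hs.1 ht.1 hs.2 ht.2⟩
  symm hs := hs.1

/-- The basic open set `D⁺(f)`. -/
def basicOpen (A : CFR.{u}) (f : A.Hom Unit Unit) : Set (SymPrime A) := {p | f ∉ p.carrier}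

/-- The Zariski topology, with the sets `D⁺(f)`, for symmetric `f`, as a basis. -/
instance : TopologicalSpace (SymPrime A) :=
  TopologicalSpace.generateFrom {U | ∃ f, A.tr f = f ∧ U = basicOpen A f}

/-- The structure sheaf: functions into the localizations which are locally fractions. -/
noncomputable def specData (A : CFR.{u}) : FSpace.LocalData (SymPrime A) where
  St p := loc p.compl
  good V :=
    { carrier := fun Y X _ _ => {s : ∀ p : V, (loc p.1.compl).Hom Y X |
        ∃ (a : A.Hom Y X) (f : A.Hom Unit Unit) (hf : ∀ p : V, f ∈ p.1.compl.carrier),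
          ∀ p : V, s p = Loc.mk a ⟨f, hf p⟩}
      comp_mem := by
        rintro _ _ _ _ _ _ s t ⟨a, f, hf, hs⟩ ⟨b, g, hg, ht⟩
        exact ⟨A.comp a b, A.comp f g, fun p => p.1.compl.mul_mem (hf p) (hg p), fun p =>
          congrArg₂ (loc p.1.compl).comp (hs p) (ht p)⟩
      sum_mem := by
        rintro _ _ _ _ _ _ _ _ s t ⟨a, f, hf, hs⟩ ⟨b, g, hg, ht⟩
        exact ⟨A.sum (smul g a) (smul f b), A.comp f g,
          fun p => p.1.compl.mul_mem (hf p) (hg p), fun p =>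
          congrArg₂ (loc p.1.compl).sum (hs p) (ht p)⟩
      tr_mem := by
        rintro _ _ _ _ s ⟨a, f, hf, hs⟩
        exact ⟨A.tr a, f, hf, fun p => congrArg (loc p.1.compl).tr (hs p)⟩
      emb_mem := fun φ => ⟨A.emb φ, A.one, fun p => p.1.compl.one_mem, fun p => rfl⟩ }
  good_res := by
    rintro _ _ _ _ V W h s ⟨a, f, hf, hs⟩
    exact ⟨a, f, fun p => hf ⟨p.1, h p.2⟩, fun p => hs ⟨p.1, h p.2⟩⟩

/-- The symmetric spectrum `spec⁺(A)`. -/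
noncomputable def Spec (A : CFR.{u}) : FSpace.{u} := (specData A).space

theorem mem_span_comap (f : FHom A.toFData B.toFData) (q : SymPrime B) (s : A.Hom Unit Unit)
    (hs : s ∈ span {s : A.Hom Unit Unit | f.app s ∈ q.carrier ∧ A.tr s = s}) :
    f.app s ∈ q.carrier :=
  span_le (q.isIdeal.preimage f) (fun _ h => h.1) hs

/-- The map on symmetric primes: `f* q` is generated by the symmetric elements of `f⁻¹ q`. -/
def SymPrime.comap (f : FHom A.toFData B.toFData) (q : SymPrime B) : SymPrime A where
  carrier := span {s | f.app s ∈ q.carrier ∧ A.tr s = s}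
  isIdeal := span_isIdeal _
  symmetric := by
    refine Set.Subset.antisymm ?_ (span_le (span_isIdeal _) fun s hs => hs.1)
    exact span_le (span_isIdeal _) fun s hs => subset_span _ ⟨subset_span _ hs, hs.2⟩
  one_notMem h := q.one_notMem (by
    have := mem_span_comap f q _ h
    rwa [FData.one, f.map_emb] at this)
  mul_notMem s t hs ht h h' h'' := by
    have key := mem_span_comap f q _ h''
    rw [f.map_comp] at key
    refine q.mul_notMem (f.app s) (f.app t) (by rw [← f.map_tr, hs]) (by rw [← f.map_tr, ht])
      (fun h1 => h (subset_span _ ⟨h1, hs⟩)) (fun h1 => h' (subset_span _ ⟨h1, ht⟩)) key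

theorem compl_comap (f : FHom A.toFData B.toFData) (q : SymPrime B) :
    ∀ s ∈ (q.comap f).compl.carrier, f.app s ∈ q.compl.carrier := fun s hs =>
  ⟨by rw [← f.map_tr, hs.1], fun h => hs.2 (subset_span _ ⟨h, hs.1⟩)⟩

theorem continuous_comap (f : FHom A.toFData B.toFData) : Continuous (SymPrime.comap f) := by
  refine continuous_generateFrom_iff.2 ?_
  rintro _ ⟨g, hg, rfl⟩
  refine TopologicalSpace.isOpen_generateFrom_of_mem ⟨f.app g, by rw [← f.map_tr, hg], ?_⟩
  ext q
  exact not_congr ⟨mem_span_comap f q g, fun h => subset_span _ ⟨h, hg⟩⟩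

/-- The map `spec⁺(B) → spec⁺(A)` given by a homomorphism `A → B`. -/
noncomputable def specMap (f : FHom A.toFData B.toFData) : FSpace.Map (Spec B) (Spec A) where
  toFun := SymPrime.comap f
  cont := continuous_comap f
  app V U h :=
    { app := fun s => ⟨fun q => (locMap f _ _ (compl_comap f q.1)).app
          (s.1 ⟨q.1.comap f, h q.1 q.2⟩), fun q hq => by
        obtain ⟨W, hqW, hW, a, g, hg, hs⟩ := s.2 (q.comap f) (h q hq)
        refine ⟨⟨SymPrime.comap f ⁻¹' W, W.isOpen.preimage (continuous_comap f)⟩ ⊓ U,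
          ⟨hqW, hq⟩, inf_le_right, f.app a, f.app g,
          fun p => compl_comap f p.1 g (hg ⟨_, p.2.1⟩), fun p => ?_⟩
        exact congrArg _ (hs ⟨p.1.comap f, p.2.1⟩)⟩
      map_comp := fun s t => Subtype.ext (funext fun q =>
        (locMap f _ _ (compl_comap f q.1)).map_comp (s.1 ⟨q.1.comap f, h q.1 q.2⟩)
          (t.1 ⟨q.1.comap f, h q.1 q.2⟩))
      map_sum := fun s t => Subtype.ext (funext fun q =>
        (locMap f _ _ (compl_comap f q.1)).map_sum (s.1 ⟨q.1.comap f, h q.1 q.2⟩)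
          (t.1 ⟨q.1.comap f, h q.1 q.2⟩))
      map_tr := fun s => Subtype.ext (funext fun q =>
        (locMap f _ _ (compl_comap f q.1)).map_tr (s.1 ⟨q.1.comap f, h q.1 q.2⟩))
      map_emb := fun φ => Subtype.ext (funext fun q =>
        (locMap f _ _ (compl_comap f q.1)).map_emb φ) }
  nat _ _ _ _ := rfl

end Ideals

section SpecMap

variable {A B C D : CFR.{u}}

theorem SymPrime.comap_comap (f : FHom A.toFData B.toFData) (g : FHom B.toFData C.toFData)
    (k : FHom A.toFData C.toFData)
    (h : ∀ s : A.Hom Unit Unit, g.app (f.app s) = k.app s) (q : SymPrime C) :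
    (q.comap g).comap f = q.comap k := by
  refine SymPrime.ext ?_
  change span _ = span _
  congr 1
  ext s
  refine and_congr_left fun hs => ⟨fun h' => ?_, fun h' => ?_⟩
  · rw [← h]
    exact mem_span_comap g q _ h'
  · refine subset_span _ ⟨?_, by rw [← f.map_tr, hs]⟩
    rwa [h]

theorem SymPrime.comap_id (f : FHom A.toFData A.toFData)
    (h : ∀ s : A.Hom Unit Unit, f.app s = s) (q : SymPrime A) : q.comap f = q := by
  refine SymPrime.ext ?_
  change span _ = _
  conv_rhs => rw [q.symmetric]
  simp only [h]

variable {X Y : Type} [Fintype X] [Fintype Y]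

theorem locMap_id (f : FHom A.toFData A.toFData)
    (h : ∀ {Y X : Type} [Fintype Y] [Fintype X] (a : A.Hom Y X), f.app a = a)
    {p q : SymPrime A} (e : p = q) (hpq : ∀ s ∈ p.compl.carrier, f.app s ∈ q.compl.carrier)
    {V : Set (SymPrime A)} (s : ∀ x : V, (loc x.1.compl).Hom Y X) (hp : p ∈ V) (hq : q ∈ V) :
    (locMap f p.compl q.compl hpq).app (s ⟨p, hp⟩) = s ⟨q, hq⟩ := by
  subst e
  obtain ⟨a, t, hs⟩ := Loc.ind (s ⟨p, hp⟩)
  rw [hs]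
  exact Loc.mk_congr (h _) (h _)

theorem specMap_id (f : FHom A.toFData A.toFData)
    (h : ∀ {Y X : Type} [Fintype Y] [Fintype X] (a : A.Hom Y X), f.app a = a)
    (V : Opens (Spec A).pt) (hV : ∀ x ∈ V, (specMap f).toFun x ∈ V) (s : ((Spec A).sec V).Hom Y X) :
    ((specMap f).app V V hV).app s = s :=
  Subtype.ext (funext fun q => 
    locMap_id f h (SymPrime.comap_id f h q.1) (compl_comap f q.1) s.1 (hV q.1 q.2) q.2)

theorem locMap_comp (f : FHom A.toFData B.toFData) (g : FHom B.toFData D.toFData)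
    (k : FHom A.toFData D.toFData)
    (h : ∀ {Y X : Type} [Fintype Y] [Fintype X] (a : A.Hom Y X), g.app (f.app a) = k.app a)
    {p p' : SymPrime A} (e : p = p') {q : SymPrime B} {r : SymPrime D}
    (h₁ : ∀ s ∈ p.compl.carrier, f.app s ∈ q.compl.carrier)
    (h₂ : ∀ s ∈ q.compl.carrier, g.app s ∈ r.compl.carrier)
    (h₃ : ∀ s ∈ p'.compl.carrier, k.app s ∈ r.compl.carrier)
    {V : Set (SymPrime A)} (s : ∀ x : V, (loc x.1.compl).Hom Y X) (hp : p ∈ V) (hp' : p' ∈ V) :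
    (locMap g q.compl r.compl h₂).app ((locMap f p.compl q.compl h₁).app (s ⟨p, hp⟩)) =
      (locMap k p'.compl r.compl h₃).app (s ⟨p', hp'⟩) := by
  subst e
  obtain ⟨a, t, hs⟩ := Loc.ind (s ⟨p, hp⟩)
  rw [hs]
  exact Loc.mk_congr (h _) (h _)

theorem specMap_comp (f : FHom A.toFData B.toFData) (g : FHom B.toFData D.toFData)
    (k : FHom A.toFData D.toFData)
    (h : ∀ {Y X : Type} [Fintype Y] [Fintype X] (a : A.Hom Y X), g.app (f.app a) = k.app a)
    (V : Opens (Spec A).pt) (U : Opens (Spec B).pt) (W : Opens (Spec D).pt)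
    (hU : ∀ x ∈ U, (specMap f).toFun x ∈ V) (hW : ∀ x ∈ W, (specMap g).toFun x ∈ U)
    (hWV : ∀ x ∈ W, (specMap k).toFun x ∈ V) (s : ((Spec A).sec V).Hom Y X) :
    ((specMap g).app U W hW).app (((specMap f).app V U hU).app s) =
      ((specMap k).app V W hWV).app s :=
  Subtype.ext (funext fun q => locMap_comp f g k h 
    (SymPrime.comap_comap f g k h q.1) (compl_comap f _) (compl_comap g _) (compl_comap k _) s.1
    (hU _ (hW q.1 q.2)) (hWV q.1 q.2))

end SpecMap

/-! ### The compactification -/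

section Charts

variable {F : CFR.{u}} {ι : Type u}

/-- Affine charts `A i ⊆ F`, `i ∈ ι`, and a sub-`𝔽`-ring `L` which contains all of them. -/
structure Charts (F : CFR.{u}) (ι : Type u) where
  L : Sub F
  A : ι → Sub F
  le : ∀ i, A i ≤ L

namespace Charts

/-- The spectra of the `A i`, and the maps from the spectrum of `L`. -/
noncomputable def glueData (c : Charts F ι) : FSpace.GlueData ι where
  L := Spec c.L.ring
  C i := Spec (c.A i).ring
  r i := specMap (Sub.inclusion (c.le i))

/-- The spectra of the `A i` glued along the spectrum of `L`. -/
noncomputable def space (c : Charts F ι) : FSpace.{u} := c.glueData.glue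

/-- The point of the glued space given by a symmetric prime of `A i`. -/
noncomputable def point (c : Charts F ι) (i : ι) (p : SymPrime (c.A i).ring) : c.space.pt :=
  c.glueData.inj i p

/-- Inclusions of charts give a morphism of glueing data. -/
noncomputable def hom {c d : Charts F ι} (hL : c.L ≤ d.L) (hA : ∀ i, c.A i ≤ d.A i) :
    FSpace.GlueData.Hom d.glueData c.glueData where
  L := specMap (Sub.inclusion hL)
  C i := specMap (Sub.inclusion (hA i))
  pt i x := (SymPrime.comap_comap (Sub.inclusion (hA i)) (Sub.inclusion (d.le i))
    (Sub.inclusion ((hA i).trans (d.le i))) (fun _ => rfl) x).trans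
    (SymPrime.comap_comap (Sub.inclusion (c.le i)) (Sub.inclusion hL)
      (Sub.inclusion ((hA i).trans (d.le i))) (fun _ => rfl) x).symm
  app i V U W W' h₁ h₂ h₃ h₄ s := by
    have h : ∀ x ∈ W, (specMap (Sub.inclusion ((hA i).trans (d.le i)))).toFun x ∈ V := by
      intro x hx
      have := h₁ _ (h₂ x hx)
      rwa [← show _ = (specMap (Sub.inclusion ((hA i).trans (d.le i)))).toFun x from
        SymPrime.comap_comap (Sub.inclusion (hA i)) (Sub.inclusion (d.le i)) _ (fun _ => rfl) x]
    exact (specMap_comp (Sub.inclusion (hA i)) (Sub.inclusion (d.le i))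
      (Sub.inclusion ((hA i).trans (d.le i))) (fun _ => rfl) V U W h₁ h₂ h s).trans
      (specMap_comp (Sub.inclusion (c.le i)) (Sub.inclusion hL)
      (Sub.inclusion ((hA i).trans (d.le i))) (fun _ => rfl) V W' W h₃ h₄ h s).symm

theorem hom_id (c : Charts F ι) (x : c.space.pt) :
    (hom (le_refl c.L) fun i => le_refl (c.A i)).map.toFun x = x := by
  obtain ⟨⟨i, p⟩, rfl⟩ := Quot.exists_rep x
  exact congrArg (c.glueData.inj i) (SymPrime.comap_id _ (fun _ => rfl) p)

theorem hom_comp {c d e : Charts F ι} (hL : c.L ≤ d.L) (hA : ∀ i, c.A i ≤ d.A i)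
    (hL' : d.L ≤ e.L) (hA' : ∀ i, d.A i ≤ e.A i) (x : e.space.pt) :
    (hom hL hA).map.toFun ((hom hL' hA').map.toFun x) =
      (hom (hL.trans hL') fun i => (hA i).trans (hA' i)).map.toFun x := by
  obtain ⟨⟨i, p⟩, rfl⟩ := Quot.exists_rep x
  exact congrArg (c.glueData.inj i) (SymPrime.comap_comap _ _ _ (fun _ => rfl) p)

theorem mem_of_eq {P : FSpace.{u}} {U : Opens P.pt} {x y : P.pt} (h : x = y) (hy : y ∈ U) :
    x ∈ U := h ▸ hy

variable {I : Type} [Preorder I]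

/-- An increasing family of charts gives an inverse system of spaces. -/
noncomputable def proSys (c : I → Charts F ι) (hL : ∀ {N M : I}, N ≤ M → (c N).L ≤ (c M).L)
    (hA : ∀ {N M : I}, N ≤ M → ∀ i, (c N).A i ≤ (c M).A i)
    (directed : ∀ N M : I, ∃ P, N ≤ P ∧ M ≤ P) (nonempty : Nonempty I) : FSpace.ProSys.{u} I where
  X N := (c N).space
  f h := (hom (hL h) (hA h)).map
  f_id _ _ := hom_id _ _
  f_comp _ _ _ := hom_comp _ _ _ _ _
  app_id N V _ := Subtype.ext (funext fun i => specMap_id _ (fun _ => rfl) _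
    (fun x hx => mem_of_eq (P := (c N).space) (U := V) (hom_id (c N) ((c N).glueData.inj i x)) hx) _)
  app_comp {_ _ _ _ N _ _} h h' V _ _ hU hW _ := Subtype.ext (funext fun i =>
    specMap_comp _ _ _ (fun _ => rfl) _ _ _
      (fun x hx => hU ((c _).glueData.inj i x) hx) (fun x hx => hW ((c _).glueData.inj i x) hx)
      (fun x hx => mem_of_eq (P := (c N).space) (U := V)
        (hom_comp (hL h) (hA h) (hL h') (hA h') ((c _).glueData.inj i x)).symm
        (hU _ (hW ((c _).glueData.inj i x) hx))) _)
  directed := directed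
  nonempty := nonempty

end Charts

end Charts

/-- The square free integers `N = p₁ ⋯ p_l > 1`. -/
structure SqFree where
  N : ℕ
  squarefree : Squarefree N
  one_lt : 1 < N

/-- The square free integers are ordered by divisibility. -/
instance : Preorder SqFree where
  le N M := N.N ∣ M.N
  le_refl N := dvd_rfl
  le_trans N M P h h' := dvd_trans h h'

theorem SqFree.directed (N M : SqFree) : ∃ P : SqFree, N ≤ P ∧ M ≤ P :=
  ⟨⟨Nat.lcm N.N M.N, by
      have hN : N.N ≠ 0 := N.squarefree.ne_zero
      have hM : M.N ≠ 0 := M.squarefree.ne_zero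
      rw [Nat.squarefree_iff_factorization_le_one (Nat.lcm_ne_zero hN hM)]
      intro p
      rw [Nat.factorization_lcm hN hM]
      exact sup_le ((Nat.squarefree_iff_factorization_le_one hN).1 N.squarefree p)
        ((Nat.squarefree_iff_factorization_le_one hM).1 M.squarefree p),
    lt_of_lt_of_le N.one_lt (Nat.le_of_dvd (Nat.lcm_pos (by have := N.one_lt; omega)
      (by have := M.one_lt; omega)) (Nat.dvd_lcm_left _ _))⟩,
    Nat.dvd_lcm_left _ _, Nat.dvd_lcm_right _ _⟩

theorem SqFree.nonempty : Nonempty SqFree := ⟨⟨2, Nat.prime_two.squarefree, one_lt_two⟩⟩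

section Compactification

variable (R K : Type u) [CommRing R] [Field K] [Algebra R K]

/-- `𝔽(R[1/N])` as a sub-`𝔽`-ring of `𝔽(K)`. -/
noncomputable def invert (N : ℕ) : Sub (mat K) :=
  .ofSubring (Algebra.adjoin R {(N : K)⁻¹}).toSubring

/-- `𝔽(R)` as a sub-`𝔽`-ring of `𝔽(K)`. -/
noncomputable def integers : Sub (mat K) := .ofSubring (algebraMap R K).range

theorem integers_le (N : ℕ) : integers R K ≤ invert R K N := by
  intro Y X _ _ a ha y x
  obtain ⟨r, hr⟩ := ha y x
  rw [← hr]
  exact Subalgebra.algebraMap_mem _ r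

theorem invert_mono [CharZero K] {N M : ℕ} (h : N ∣ M) (hM : M ≠ 0) : invert R K N ≤ invert R K M := by
  intro Y X _ _ a ha y x
  refine (Algebra.adjoin_le ?_ : Algebra.adjoin R {(N : K)⁻¹} ≤ Algebra.adjoin R {(M : K)⁻¹})
    (ha y x)
  obtain ⟨k, rfl⟩ := h
  rintro _ rfl
  have hk : (k : K) ≠ 0 := by
    rintro h
    exact hM (by simp [Nat.cast_eq_zero.1 h])
  have : (N : K)⁻¹ = k * ((N * k : ℕ) : K)⁻¹ := by
    push_cast
    rw [mul_inv, mul_comm, mul_assoc, inv_mul_cancel₀ hk, mul_one]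
  rw [this]
  exact mul_mem (natCast_mem _ k) (Algebra.subset_adjoin rfl)

/-- The charts `𝔽(R)` and `𝔽(R[1/N]) ∩ O σ`, for `σ ∈ γ`, which are to be glued along
`𝔽(R[1/N])`. -/
noncomputable def charts {γ : Type u} (O : γ → Sub (mat K)) (N : SqFree) : Charts (mat K) (Option γ) where
  L := invert R K N.N
  A i := i.elim (integers R K) fun σ => invert R K N.N ⊓ O σ
  le i := by
    cases i with
    | none => exact integers_le R K N.N
    | some σ => exact fun Y X _ _ a ha => ha.1

variable [CharZero K] {γ : Type u} (O : γ → Sub (mat K))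

/-- The inverse system of the spaces `X_N`. -/
noncomputable def compactSys : FSpace.ProSys.{u} SqFree :=
  Charts.proSys (charts R K O) (fun {N M} h => invert_mono R K h (by have := M.one_lt; omega))
    (fun {N M} h i => by
      cases i with
      | none => exact le_rfl
      | some σ => exact fun Y X _ _ a ha =>
          ⟨invert_mono R K h (by have := M.one_lt; omega) Y X ha.1, ha.2⟩)
    SqFree.directed SqFree.nonempty

/-- The compactification of `spec R`: the inverse limit of the spaces `X_N`. -/
noncomputable def compactSpec : FSpace.{u} := (compactSys R K O).lim

variable {R K O} in
/-- The component in `X_N` of a point of the limit. -/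
noncomputable def component (x : (compactSpec R K O).pt) (N : SqFree) : (charts R K O N).space.pt :=
  x.1 N

end Compactification

/-! ### Examples of `𝔽`-rings, and valuations -/

section UnitBall

variable (𝕜 : Type u) [RCLike 𝕜]
variable {X Y : Type} [Fintype X] [Fintype Y]

variable {𝕜} in
/-- The matrix `a` maps the unit `L₂`-ball into the unit `L₂`-ball. -/
def IsContraction (a : Matrix Y X 𝕜) : Prop :=
  ∀ v : X → 𝕜, ∑ x, ‖v x‖ ^ 2 ≤ 1 → ∑ y, ‖a.mulVec v y‖ ^ 2 ≤ 1

variable {𝕜}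

theorem isContraction_iff (a : Matrix Y X 𝕜) :
    IsContraction a ↔ ∀ v : X → 𝕜, ∑ y, ‖a.mulVec v y‖ ^ 2 ≤ ∑ x, ‖v x‖ ^ 2 := by
  refine ⟨fun h v => ?_, fun h v hv => (h v).trans hv⟩
  rcases (Finset.sum_nonneg fun x _ => sq_nonneg ‖v x‖ : 0 ≤ ∑ x, ‖v x‖ ^ 2).eq_or_lt with h0 | h0
  · have hv : v = 0 := by
      funext x
      have := (Finset.sum_eq_zero_iff_of_nonneg fun x _ => sq_nonneg ‖v x‖).1 h0.symm x
        (Finset.mem_univ x)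
      simpa using this
    simp [hv]
  · set c := ∑ x, ‖v x‖ ^ 2 with hc
    have hs : (0 : ℝ) < Real.sqrt c := Real.sqrt_pos.2 h0
    have hn : ‖(((Real.sqrt c)⁻¹ : ℝ) : 𝕜)‖ ^ 2 = c⁻¹ := by
      rw [RCLike.norm_ofReal, sq_abs, inv_pow, Real.sq_sqrt h0.le]
    have key := h ((((Real.sqrt c)⁻¹ : ℝ) : 𝕜) • v) (by
      simp only [Pi.smul_apply, smul_eq_mul, norm_mul, mul_pow, ← Finset.mul_sum, hn, ← hc]
      rw [inv_mul_cancel₀ h0.ne'])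
    simp only [Matrix.mulVec_smul, Pi.smul_apply, smul_eq_mul, norm_mul, mul_pow,
      ← Finset.mul_sum, hn] at key
    rwa [inv_mul_le_iff₀ h0, mul_one] at key

theorem IsContraction.transpose {a : Matrix Y X 𝕜} (ha : IsContraction a) :
    IsContraction a.transpose := by
  rw [isContraction_iff] at ha ⊢
  intro w
  set v : X → 𝕜 := fun x => star (a.transpose.mulVec w x) with hv
  have hnv : ∑ x, ‖v x‖ ^ 2 = ∑ x, ‖a.transpose.mulVec w x‖ ^ 2 := by simp [hv]
  have h1 : ((∑ x, ‖v x‖ ^ 2 : ℝ) : 𝕜) = ∑ y, w y * a.mulVec v y := by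
    have : ∑ y, w y * a.mulVec v y = ∑ x, a.transpose.mulVec w x * v x := by
      change w ⬝ᵥ a.mulVec v = a.transpose.mulVec w ⬝ᵥ v
      rw [Matrix.dotProduct_mulVec, Matrix.mulVec_transpose]
    rw [this]
    push_cast
    refine Finset.sum_congr rfl fun x _ => ?_
    rw [hv]
    simp [RCLike.mul_conj]
  have h2 : ∑ x, ‖v x‖ ^ 2 ≤ ∑ y, ‖w y‖ * ‖a.mulVec v y‖ := by
    have h3 : ‖((∑ x, ‖v x‖ ^ 2 : ℝ) : 𝕜)‖ = ∑ x, ‖v x‖ ^ 2 := by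
      rw [RCLike.norm_ofReal, abs_of_nonneg (Finset.sum_nonneg fun x _ => sq_nonneg _)]
    rw [← h3, h1]
    exact (norm_sum_le _ _).trans (Finset.sum_le_sum fun y _ => norm_mul_le _ _)
  rw [← hnv]
  have h4 := Finset.sum_mul_sq_le_sq_mul_sq Finset.univ (fun y => ‖w y‖) fun y => ‖a.mulVec v y‖
  have h5 := ha v
  have h6 : 0 ≤ ∑ x, ‖v x‖ ^ 2 := Finset.sum_nonneg fun x _ => sq_nonneg _
  have h7 : 0 ≤ ∑ y, ‖w y‖ ^ 2 := Finset.sum_nonneg fun x _ => sq_nonneg _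
  by_contra! h
  have h8 : (∑ x, ‖v x‖ ^ 2) ^ 2 ≤ (∑ y, ‖w y‖ ^ 2) * ∑ x, ‖v x‖ ^ 2 :=
    (pow_le_pow_left₀ h6 h2 2).trans (h4.trans (mul_le_mul_of_nonneg_left h5 h7))
  nlinarith

theorem IsContraction.mul {Z : Type} [Fintype Z] {a : Matrix Z Y 𝕜} {b : Matrix Y X 𝕜}
    (ha : IsContraction a) (hb : IsContraction b) : IsContraction (a * b) := by
  intro v hv
  have := ha _ (hb v hv)
  rwa [Matrix.mulVec_mulVec] at this

theorem IsContraction.fromBlocks {X₀ X₁ Y₀ Y₁ : Type} [Fintype X₀] [Fintype X₁] [Fintype Y₀]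
    [Fintype Y₁] {a : Matrix Y₀ X₀ 𝕜} {b : Matrix Y₁ X₁ 𝕜} (ha : IsContraction a)
    (hb : IsContraction b) : IsContraction (Matrix.fromBlocks a 0 0 b) := by
  refine (isContraction_iff _).2 fun v => ?_
  have ha' := (isContraction_iff a).1 ha (v ∘ Sum.inl)
  have hb' := (isContraction_iff b).1 hb (v ∘ Sum.inr)
  rw [Matrix.fromBlocks_mulVec]
  simp only [Fintype.sum_sum_type, Sum.elim_inl, Sum.elim_inr, Matrix.zero_mulVec, add_zero,
    zero_add]
  exact add_le_add ha' hb'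

variable (𝕜)

/-- `ℤ_ℝ ⊆ 𝔽(ℝ)`, for `𝕜 = ℝ`, and `ℤ_ℂ ⊆ 𝔽(ℂ)`, for `𝕜 = ℂ`: the matrices which map the unit
`L₂`-ball into the unit `L₂`-ball. -/
noncomputable def unitBall : Sub (mat 𝕜) where
  carrier Y X _ _ := {a : Matrix Y X 𝕜 | IsContraction a}
  comp_mem ha hb := IsContraction.mul ha hb
  sum_mem ha hb := IsContraction.fromBlocks ha hb
  tr_mem ha := IsContraction.transpose ha
  emb_mem {Y X} _ _ φ := by
    classical
    refine (isContraction_iff (𝕜 := 𝕜)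
      (Matrix.of fun y x => if φ x = some y then (1 : 𝕜) else 0)).2 fun v => ?_
    have h : ∀ y, ‖(Matrix.of fun y x => if φ x = some y then (1 : 𝕜) else 0).mulVec v y‖ ^ 2 =
        ∑ x, if φ x = some y then ‖v x‖ ^ 2 else 0 := by
      intro y
      simp only [Matrix.mulVec, dotProduct, Matrix.of_apply, ite_mul, one_mul, zero_mul]
      by_cases hy : ∃ x, φ x = some y
      · obtain ⟨x, hx⟩ := hy
        have h' : ∀ x', φ x' = some y → x' = x := fun x' hx' => φ.inj hx' hx
        rw [Finset.sum_eq_single x, Finset.sum_eq_single x, if_pos hx, if_pos hx]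
        · intro x' _ hne; rw [if_neg fun e => hne (h' x' e)]
        · simp
        · intro x' _ hne; rw [if_neg fun e => hne (h' x' e)]
        · simp
      · push Not at hy
        simp [hy]
    simp only [h]
    rw [Finset.sum_comm]
    refine Finset.sum_le_sum fun x _ => ?_
    cases hx : φ x with
    | none => simp
    | some y => simp

end UnitBall

/-- `K ∩ σ⁻¹(ℤ_ℝ)` or `K ∩ σ⁻¹(ℤ_ℂ)`: the matrices over `K` which are mapped by `σ` to a matrix in
the sub-`𝔽`-ring `unitBall 𝕜`. -/
noncomputable def archimedean {K : Type u} [Field K] {𝕜 : Type} [RCLike 𝕜] (σ : K →+* 𝕜) :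
    Sub (mat K) where
  carrier Y X _ _ := {a : Matrix Y X K | IsContraction (a.map σ)}
  comp_mem {Z Y X} _ _ _ a b ha hb :=
    (congrArg IsContraction (Matrix.map_mul (L := (a : Matrix Z Y K)) (M := (b : Matrix Y X K))
      (f := σ))).mpr (IsContraction.mul ha hb)
  sum_mem {Y₀ Y₁ X₀ X₁} _ _ _ _ a b ha hb := by
    have h := Matrix.fromBlocks_map (a : Matrix Y₀ X₀ K) 0 0 (b : Matrix Y₁ X₁ K) σ
    rw [Matrix.map_zero _ (map_zero σ), Matrix.map_zero _ (map_zero σ)] at h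
    exact (congrArg IsContraction h).mpr (IsContraction.fromBlocks ha hb)
  tr_mem ha := IsContraction.transpose ha
  emb_mem {Y X} _ _ φ := by
    classical
    have h : (Matrix.of fun (y : Y) (x : X) => if φ x = some y then (1 : K) else 0).map σ =
        Matrix.of fun y x => if φ x = some y then (1 : 𝕜) else 0 := by
      ext y x
      simp only [Matrix.map_apply, Matrix.of_apply]
      split
      exacts [map_one σ, map_zero σ]
    have h' : IsContraction (Matrix.of fun (y : Y) (x : X) => if φ x = some y then (1 : 𝕜) else 0) := by
      exact (unitBall 𝕜).emb_mem φ
    rw [← h] at h'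
    exact h'

/-- The `𝔽`-ring `𝔽{M}` of a commutative monoid `M`: matrices with entries in `M ∪ {0}`, with at
most one non-zero entry in every row and every column. The entries are multiplied and added in the
semiring `ℕ[M]`. -/
noncomputable def monomial (M : Type u) [CommMonoid M] : Sub (mat (MonoidAlgebra ℕ M)) where
  carrier Y X _ _ := {a : Matrix Y X (MonoidAlgebra ℕ M) |
    (∀ y x, a y x = 0 ∨ ∃ m, a y x = MonoidAlgebra.of ℕ M m) ∧
    (∀ y x x', a y x ≠ 0 → a y x' ≠ 0 → x = x') ∧
    (∀ y y' x, a y x ≠ 0 → a y' x ≠ 0 → y = y')}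
  comp_mem {Z Y X} _ _ _ a b ha hb := by
    let a : Matrix Z Y (MonoidAlgebra ℕ M) := a
    let b : Matrix Y X (MonoidAlgebra ℕ M) := b
    have key : ∀ z x, (a * b : Matrix Z X (MonoidAlgebra ℕ M)) z x ≠ 0 →
        ∃ y, a z y ≠ 0 ∧ b y x ≠ 0 := by
      intro z x h
      rw [Matrix.mul_apply] at h
      obtain ⟨y, -, hy⟩ := Finset.exists_ne_zero_of_sum_ne_zero h
      exact ⟨y, left_ne_zero_of_mul hy, right_ne_zero_of_mul hy⟩
    refine ⟨fun z x => ?_, fun z x x' h h' => ?_, fun z z' x h h' => ?_⟩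
    · by_cases h : (a * b : Matrix Z X (MonoidAlgebra ℕ M)) z x = 0
      · exact Or.inl h
      · right
        obtain ⟨y, h1, h2⟩ := key z x h
        obtain ⟨m, hm⟩ : ∃ m, a z y = MonoidAlgebra.of ℕ M m := (ha.1 z y).resolve_left h1
        obtain ⟨n, hn⟩ : ∃ n, b y x = MonoidAlgebra.of ℕ M n := (hb.1 y x).resolve_left h2
        refine ⟨m * n, ?_⟩
        change (a * b : Matrix Z X (MonoidAlgebra ℕ M)) z x = _
        rw [Matrix.mul_apply, Finset.sum_eq_single y, hm, hn, map_mul]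
        · intro y' _ hne
          have : a z y' = 0 := by
            by_contra h'
            exact hne (ha.2.1 z y' y h' h1)
          rw [this, zero_mul]
        · simp
    · obtain ⟨y, h1, h2⟩ := key z x h
      obtain ⟨y', h1', h2'⟩ := key z x' h'
      obtain rfl := ha.2.1 z y y' h1 h1'
      exact hb.2.1 y x x' h2 h2'
    · obtain ⟨y, h1, h2⟩ := key z x h
      obtain ⟨y', h1', h2'⟩ := key z' x h'
      obtain rfl := hb.2.2 y y' x h2 h2'
      exact ha.2.2 z z' y h1 h1'
  sum_mem {Y₀ Y₁ X₀ X₁} _ _ _ _ a b ha hb := by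
    refine ⟨?_, ?_, ?_⟩
    · rintro (y | y) (x | x)
      exacts [ha.1 y x, Or.inl rfl, Or.inl rfl, hb.1 y x]
    · rintro (y | y) (x | x) (x' | x') h h'
      exacts [congrArg _ (ha.2.1 y x x' h h'), (h' rfl).elim, (h rfl).elim, (h rfl).elim,
        (h rfl).elim, (h rfl).elim, (h' rfl).elim, congrArg _ (hb.2.1 y x x' h h')]
    · rintro (y | y) (y' | y') (x | x) h h'
      exacts [congrArg _ (ha.2.2 y y' x h h'), (h rfl).elim, (h' rfl).elim, (h rfl).elim,
        (h rfl).elim, (h' rfl).elim, (h rfl).elim, congrArg _ (hb.2.2 y y' x h h')]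
  tr_mem ha := ⟨fun y x => ha.1 x y, fun y x x' => ha.2.2 x x' y, fun y y' x => ha.2.1 x y y'⟩
  emb_mem {Y X} _ _ φ := by
    classical
    have h : ∀ y x, (matData (MonoidAlgebra ℕ M)).emb φ y x ≠ 0 → φ x = some y := by
      intro y x h
      rw [mat_emb_apply] at h
      by_contra h'
      exact h (if_neg h')
    refine ⟨fun y x => ?_, fun y x x' h1 h2 => φ.inj (h y x h1) (h y x' h2), fun y y' x h1 h2 =>
      Option.some.inj ((h y x h1).symm.trans (h y' x h2))⟩
    change (if φ x = some y then (1 : MonoidAlgebra ℕ M) else 0) = 0 ∨ _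
    by_cases hx : φ x = some y
    · exact Or.inr ⟨1, (if_pos hx).trans (map_one _).symm⟩
    · exact Or.inl (if_neg hx)

/-- Valuation sub-`𝔽`-rings (with involution) `B ⊆ F`: they are full and tame, and contain `a` or
the inverse of `a` for each invertible scalar `a`. -/
structure IsVal {F : CFR.{u}} (B : Sub F) : Prop where
  full : ∀ (Y X : Type) [Fintype Y] [Fintype X] (a : F.Hom Y X),
    ∃ d ∈ B.carrier Unit Unit, d ≠ F.zero ∧ F.comp (FData.scal Y d) a ∈ B.carrier Y X
  tame : ∀ (Y X : Type) [Fintype Y] [Fintype X], B.carrier Y X =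
    {a | ∀ b' ∈ B.carrier Unit Y, ∀ b ∈ B.carrier X Unit,
      F.comp b' (F.comp a b) ∈ B.carrier Unit Unit}
  mem_or_inv_mem : ∀ a a' : F.Hom Unit Unit, F.comp a a' = F.one → F.comp a' a = F.one →
    a ∈ B.carrier Unit Unit ∨ a' ∈ B.carrier Unit Unit

/-- `𝔽(R_p)` as a sub-`𝔽`-ring of `𝔽(K)`, where `K` is the field of fractions of `R`. -/
noncomputable def localAt {R : Type u} (K : Type u) [CommRing R] [IsDomain R] [Field K] [Algebra R K]
    [IsFractionRing R K] (p : PrimeSpectrum R) : Sub (mat K) :=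
  .ofSubring (Localization.subalgebra.ofField K p.asIdeal.primeCompl
    p.asIdeal.primeCompl_le_nonZeroDivisors).toSubring

section Points

variable {R K : Type u} [CommRing R] [Field K] [CharZero K] [Algebra R K]
variable {γ : Type u} {O : γ → Sub (mat K)}

/-- The point `x` of the limit is the one given by the prime ideal `p` of `R`: its component in
`X_N` is the point of the chart `spec R` given by the symmetric prime of `𝔽(R)` that consists of the
elements of `p`. -/
def IsFinitePrime (p : PrimeSpectrum R) (x : (compactSpec R K O).pt) : Prop :=
  ∀ N : SqFree, ∃ 𝔭 : SymPrime ((charts R K O N).A none).ring,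
    (∀ s, s ∈ 𝔭.carrier ↔ ∃ r ∈ p.asIdeal, algebraMap R K r = (Sub.incl _).app s () ()) ∧
    component x N = (charts R K O N).point none 𝔭

/-- The point `x` of the limit is the one given by `σ`: its component in `X_N` is the point of the
chart `spec (R[1/N] ∩ O σ)` given by the unique maximal ideal of `R[1/N] ∩ O σ`. -/
def IsInfinitePrime (σ : γ) (x : (compactSpec R K O).pt) : Prop :=
  ∀ N : SqFree, ∃ 𝔪 : SymPrime ((charts R K O N).A (some σ)).ring,
    (∀ I : Set (((charts R K O N).A (some σ)).ring.Hom Unit Unit), IsIdeal I →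
      ((charts R K O N).A (some σ)).ring.one ∉ I → I ⊆ 𝔪.carrier) ∧
    component x N = (charts R K O N).point (some σ) 𝔪

end Points

/-- The compactification of `spec ℤ`, with `ℤ_(η) = ℚ ∩ ℤ_ℝ`. -/
noncomputable def SpecZ : FSpace.{0} :=
  compactSpec ℤ ℚ fun _ : Unit => archimedean (algebraMap ℚ ℝ)

open NumberField in
/-- The compactification of `spec 𝓞_K`, with `O_σ = K ∩ σ⁻¹(ℤ_ℂ)` for the embeddings
`σ : K → ℂ` up to complex conjugation. -/
noncomputable def SpecOK (K : Type u) [Field K] [NumberField K] : FSpace.{u} :=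
  compactSpec (𝓞 K) K fun σ : InfinitePlace K => archimedean σ.embedding

end FOne

set_option linter.unusedSectionVars false

namespace FOne
open TopologicalSpace

/-! ### Homomorphisms out of colimits and localizations -/

/-! Everything takes place inside 𝔽(K). All scalars of a sub-𝔽-ring of 𝔽(K) are symmetric, and 0 is
a symmetric prime that lies in every non-empty open set. So the spectra, their glueings and the
limit have a generic point, and a section over a non-empty open set is one arrow of 𝔽(K) subject to
a condition at each point. `Model` records this description; `specModel`, `glueModel` and `limModel`
carry it through the three constructions.

Points and topology. Inverting 1/N turns 𝔽(R[1/N]) ∩ O_σ into 𝔽(R[1/N]), so its symmetric primes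
without 1/N are the primes of R that do not contain N (`IsChart.exists_finPrime`). A symmetric prime
that contains 1/N is the open unit ball: if |s| < 1, then N s^m lies in the ring for large m, and
s^m is a multiple of 1/N (`eq_infPrime`). Elements of absolute value one are units, because their
inverses are their complex conjugates and conjugation preserves integrality
(`inv_mem_scalars_of_norm_eq_one`); hence the ball is the largest proper ideal. All X_N thus have
the same points. What N changes is the topology: a neighbourhood of σ in X_N can omit only primes
that contain N. Since any finite set of non-zero primes is contained in the set of primes over a
suitable N, the limit has the co-finite topology with generic point (`isOpen_limPt_iff`), and its
stalk at σ is all of O_σ, because every matrix over K is defined over some R[1/N].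

Global sections. By Kronecker's theorem a scalar that is integral at all places is zero or a root of
unity, and rows and columns of length at most one leave room for one such non-zero entry.

Valuations. A valuation sub-𝔽-ring B is determined by its rows, which are their own dual under the
dot product. If the scalars of B are closed under addition, they form a valuation ring of K, hence a
local ring of R, and B consists of all matrices over it. Otherwise some e in B satisfies e(a + b) ∈
B for all scalars a, b of B. The least power of e that brings x into B is a quasi-morphism in x; its
homogenization gives an absolute value f with {f < 1} ⊆ B ⊆ {f ≤ 1} on scalars
(`IsVal.exists_absoluteValue`). It cannot be bounded on the integers
(`IsVal.add_mem_of_natCast_le_one`), so it belongs to an infinite place.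

It remains to put the elements w with |w| = 1 into B (`IsVal.mem_of_norm_eq_one`). This uses a
rational prime p that is not of the form |β|², written as a sum of four squares. Such p exists
because otherwise almost all primes would split in some quadratic extension F/E, and ζ_E² ≤ C ζ_F
near 1 contradicts the simple poles of both zeta functions (`exists_prime_ne_norm`). -/

theorem FHom.map_smul {A B : CFR.{u}} (f : FHom A.toFData B.toFData) {Y X : Type} [Fintype Y]
    [Fintype X] (s : A.Hom Unit Unit) (a : A.Hom Y X) :
    f.app (smul s a) = smul (f.app s) (f.app a) := by
  rw [smul, f.map_comp, f.map_scal, smul]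

/-- The homomorphism out of a directed colimit given by a compatible family. -/
def DirSys.desc {J : Type u} [Preorder J] (D : DirSys J) {B : FData.{u}}
    (f : ∀ j, FHom (D.obj j).toFData B)
    (hf : ∀ {Y X : Type} [Fintype Y] [Fintype X] {i j : J} (h : i ≤ j) (a : (D.obj i).Hom Y X),
      (f j).app ((D.map h).app a) = (f i).app a) : FHom D.colim.toFData B where
  app {Y X} _ _ := Quotient.lift (fun p => (f p.1).app p.2) (by
    rintro ⟨i, a⟩ ⟨j, b⟩ ⟨k, h, h', e⟩
    exact (hf h a).symm.trans ((congrArg _ e).trans (hf h' b)))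
  map_comp x y := by
    obtain ⟨j, a, b, rfl, rfl⟩ := D.rep₂ x y
    exact (congrArg _ ((D.ofData j).map_comp a b).symm).trans ((f j).map_comp a b)
  map_sum x y := by
    obtain ⟨j, a, b, rfl, rfl⟩ := D.rep₂ x y
    exact (congrArg _ ((D.ofData j).map_sum a b).symm).trans ((f j).map_sum a b)
  map_tr x := by
    obtain ⟨j, a, rfl⟩ := D.rep x
    exact (f j).map_tr a
  map_emb φ := (f _).map_emb φ

theorem DirSys.exists_of {J : Type u} [Preorder J] (D : DirSys J) {Y X : Type} [Fintype Y]
    [Fintype X] (x : D.colim.Hom Y X) : ∃ j a, x = (D.of j).app a := D.rep x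

theorem DirSys.of_map' {J : Type u} [Preorder J] (D : DirSys J) {Y X : Type} [Fintype Y]
    [Fintype X] {i j : J} (h : i ≤ j) (a : (D.obj i).Hom Y X) :
    (D.of j).app ((D.map h).app a) = (D.of i).app a := D.of_map h a

/-! ### The value of a fraction as a matrix over K -/

section Fractions

variable {K : Type u} [Field K]
variable {X Y Z : Type} [Fintype X] [Fintype Y] [Fintype Z]

/-- An arrow of `𝔽(K)` as a matrix. -/
def toM (a : (mat K).Hom Y X) : Matrix Y X K := a

/-- A matrix as an arrow of `𝔽(K)`. -/
def ofM (a : Matrix Y X K) : (mat K).Hom Y X := a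

@[simp] theorem toM_ofM (a : Matrix Y X K) : toM (ofM a) = a := rfl

theorem toM_injective {a b : (mat K).Hom Y X} (h : toM a = toM b) : a = b := h

theorem toM_comp (a : (mat K).Hom Z Y) (b : (mat K).Hom Y X) :
    toM ((mat K).comp a b) = toM a * toM b := rfl

theorem toM_sum {X' Y' : Type} [Fintype X'] [Fintype Y'] (a : (mat K).Hom Y X)
    (b : (mat K).Hom Y' X') : toM ((mat K).sum a b) = Matrix.fromBlocks (toM a) 0 0 (toM b) := rfl

/-- The entry of a scalar of `𝔽(K)`. -/
def entry (s : (mat K).Hom Unit Unit) : K := toM s () ()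

/-- The scalar of `𝔽(K)` with a given entry. -/
def ofEntry (r : K) : (mat K).Hom Unit Unit := ofM (Matrix.of fun _ _ => r)

@[simp] theorem entry_ofEntry (r : K) : entry (ofEntry r) = r := rfl

@[simp] theorem ofEntry_entry (s : (mat K).Hom Unit Unit) : ofEntry (entry s) = s := rfl

theorem entry_injective {s t : (mat K).Hom Unit Unit} (h : entry s = entry t) : s = t := by
  rw [← ofEntry_entry s, h, ofEntry_entry]

theorem entry_comp (s t : (mat K).Hom Unit Unit) :
    entry ((mat K).comp s t) = entry s * entry t := by
  rw [entry, toM_comp, Matrix.mul_apply]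
  simp [entry]

@[simp] theorem entry_one : entry ((mat K).one) = (1 : K) := by
  classical
  refine (mat_emb_apply (B := K) _ _ _).trans ?_
  simp

@[simp] theorem entry_zero : entry ((mat K).zero) = (0 : K) := by
  classical
  refine (mat_emb_apply (B := K) _ _ _).trans ?_
  exact if_neg (by rintro ⟨⟩)

/-- Multiplication of a matrix by an element of `K`. -/
def kmul (c : K) (a : (mat K).Hom Y X) : (mat K).Hom Y X := ofM (c • toM a)

@[simp] theorem toM_kmul (c : K) (a : (mat K).Hom Y X) : toM (kmul c a) = c • toM a := rfl

theorem kmul_kmul (c d : K) (a : (mat K).Hom Y X) : kmul c (kmul d a) = kmul (c * d) a :=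
  toM_injective (by simp [_root_.smul_smul])

@[simp] theorem one_kmul (a : (mat K).Hom Y X) : kmul 1 a = a := toM_injective (by simp)

theorem kmul_comp (c d : K) (a : (mat K).Hom Z Y) (b : (mat K).Hom Y X) :
    (mat K).comp (kmul c a) (kmul d b) = kmul (c * d) ((mat K).comp a b) :=
  toM_injective (by simp [toM_comp, _root_.smul_smul, mul_comm])

theorem tr_kmul (c : K) (a : (mat K).Hom Y X) : (mat K).tr (kmul c a) = kmul c ((mat K).tr a) :=
  rfl

theorem smul_eq_kmul (s : (mat K).Hom Unit Unit) (a : (mat K).Hom Y X) :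
    smul s a = kmul (entry s) a := by
  classical
  refine mat_ext fun y x => ?_
  refine (mat_comp_apply _ _ y x).trans ?_
  have h (z : Y) : toM (FData.scal Y s) y z = if y = z then entry s else 0 :=
    mat_scal_apply (B := K) s y z
  change ∑ z, toM (FData.scal Y s) y z * toM a z x = entry s * toM a y x
  simp [h]

theorem scal_comp_eq_kmul (s : (mat K).Hom Unit Unit) (a : (mat K).Hom Y X) :
    (mat K).comp (FData.scal Y s) a = kmul (entry s) a := smul_eq_kmul s a

theorem kmul_sum {X' Y' : Type} [Fintype X'] [Fintype Y'] (c : K) (a : (mat K).Hom Y X)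
    (b : (mat K).Hom Y' X') :
    (mat K).sum (kmul c a) (kmul c b) = kmul c ((mat K).sum a b) :=
  toM_injective (by simp [toM_sum, Matrix.fromBlocks_smul])

/-- The value in `𝔽(K)` of a fraction. -/
noncomputable def locVal {A : CFR.{u}} (S : SymMon A) (f : FHom A.toFData (mat K).toFData)
    (hf : ∀ s ∈ S.carrier, entry (f.app s) ≠ 0) : FHom (loc S).toFData (mat K).toFData where
  app {Y X} _ _ := Quotient.lift
    (fun p => kmul (entry (f.app p.2.1))⁻¹ (f.app p.1)) (by
      rintro ⟨a, s⟩ ⟨b, t⟩ ⟨w, hw, h⟩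
      have h' := congrArg f.app h
      simp only [f.map_smul, smul_eq_kmul] at h'
      -- Elements of S have non-zero values in K, so the auxiliary factor w can be cancelled.
      have h0 := congrArg (kmul (entry (f.app w))⁻¹) h'
      simp only [kmul_kmul] at h0
      have e1 := hf w hw
      have e2 := hf s.1 s.2
      have e3 := hf t.1 t.2
      rw [inv_mul_cancel_left₀ e1, inv_mul_cancel_left₀ e1] at h0
      have h1 := congrArg (kmul ((entry (f.app t.1))⁻¹ * (entry (f.app s.1))⁻¹)) h0
      simp only [kmul_kmul] at h1
      convert! h1 using 2
      all_goals field_simp)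
  map_comp x y := by
    obtain ⟨a, s, rfl⟩ := Loc.ind x
    obtain ⟨b, t, rfl⟩ := Loc.ind y
    change kmul (entry (f.app (A.comp s.1 t.1)))⁻¹ (f.app (A.comp a b)) = (mat K).comp (kmul _ _)
      (kmul _ _)
    rw [kmul_comp, f.map_comp, f.map_comp, entry_comp, mul_inv]
  map_sum x y := by
    obtain ⟨a, b, s, rfl, rfl⟩ := Loc.common₂ x y
    refine (congrArg _ (Loc.sum_mk a b s)).trans ?_
    change kmul (entry (f.app s.1))⁻¹ (f.app (A.sum a b)) = (mat K).sum (kmul _ _)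
      (kmul _ _)
    rw [f.map_sum, kmul_sum]
  map_tr x := by
    obtain ⟨a, s, rfl⟩ := Loc.ind x
    change kmul (entry (f.app s.1))⁻¹ (f.app (A.tr a)) = _
    rw [f.map_tr, ← tr_kmul]; rfl
  map_emb φ := by
    change kmul (entry (f.app A.one))⁻¹ (f.app (A.emb φ)) = _
    rw [FData.one, f.map_emb, f.map_emb]
    change kmul (entry ((mat K).one))⁻¹ _ = _
    rw [entry_one, inv_one, one_kmul]

theorem locVal_mk {A : CFR.{u}} (S : SymMon A) (f : FHom A.toFData (mat K).toFData)
    (hf : ∀ s ∈ S.carrier, entry (f.app s) ≠ 0) (a : A.Hom Y X) (s : S.carrier) :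
    (locVal S f hf).app (Loc.mk a s) = kmul (entry (f.app s.1))⁻¹ (f.app a) := rfl

/-- Equal values of a/s and b/t give t a = s b in 𝔽(K), hence in A, and the fractions are identified
with the auxiliary factor 1. -/
theorem locVal_injective {A : CFR.{u}} (S : SymMon A) (f : FHom A.toFData (mat K).toFData)
    (hf : ∀ s ∈ S.carrier, entry (f.app s) ≠ 0) (hi : f.Injective) :
    (locVal S f hf).Injective := by
  intro Y X _ _ x y h
  obtain ⟨a, s, rfl⟩ := Loc.ind x
  obtain ⟨b, t, rfl⟩ := Loc.ind y
  rw [locVal_mk, locVal_mk] at h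
  refine Loc.sound A.one S.one_mem (congrArg _ (hi _ _ ?_))
  rw [f.map_smul, f.map_smul, smul_eq_kmul, smul_eq_kmul]
  have h1 := congrArg (kmul (entry (f.app t.1) * entry (f.app s.1))) h
  simp only [kmul_kmul] at h1
  have e2 := hf s.1 s.2
  have e3 := hf t.1 t.2
  convert! h1 using 2
  all_goals field_simp

end Fractions
end FOne

namespace FOne
open TopologicalSpace

/-! ### Spaces whose sections are matrices over a field -/

namespace FSpace

/-- A description of the sheaf of an irreducible space: sections over non-empty open sets are
identified by `val` with the arrows of `F` which lie in `loc x` for all points `x` of the set. -/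
structure Model (P : FSpace.{u}) (F : CFR.{u}) where
  gen : P.pt
  gen_mem : ∀ (U : Opens P.pt) (x : P.pt), x ∈ U → gen ∈ U
  val : ∀ U : Opens P.pt, gen ∈ U → FHom (P.sec U).toFData F.toFData
  val_res : ∀ {Y X : Type} [Fintype Y] [Fintype X] {U V : Opens P.pt} (h : V ≤ U) (hV : gen ∈ V)
    (s : (P.sec U).Hom Y X), (val V hV).app ((P.res h).app s) = (val U (h hV)).app s
  val_inj : ∀ (U : Opens P.pt) (h : gen ∈ U), (val U h).Injective
  loc : ∀ (_ : P.pt) (Y X : Type) [Fintype Y] [Fintype X], Set (F.Hom Y X)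
  mem_range : ∀ {Y X : Type} [Fintype Y] [Fintype X] (U : Opens P.pt) (h : gen ∈ U)
    (a : F.Hom Y X), (∃ s, (val U h).app s = a) ↔ ∀ x ∈ U, a ∈ loc x Y X

namespace Model

variable {P Q : FSpace.{u}} {F : CFR.{u}} (m : Model P F)

/-- The homomorphism from the stalk to `F`. -/
def stalkVal (x : P.pt) : FHom (P.stalk x).toFData F.toFData :=
  (P.nhdSys x).desc (fun a => m.val a.U (m.gen_mem _ _ a.mem)) fun {_ _} _ _ {_ b} h s =>
    m.val_res h (m.gen_mem _ _ b.mem) s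

variable {X Y : Type} [Fintype X] [Fintype Y]

/-- Two germs live on a common neighbourhood, where `val` separates sections. -/
theorem stalkVal_injective (x : P.pt) : (m.stalkVal x).Injective := by
  intro Y X _ _ s t h
  obtain ⟨a, s, rfl⟩ := (P.nhdSys x).exists_of s
  obtain ⟨b, t, rfl⟩ := (P.nhdSys x).exists_of t
  obtain ⟨c, hac, hbc⟩ := (P.nhdSys x).directed a b
  rw [← (P.nhdSys x).of_map' hac, ← (P.nhdSys x).of_map' hbc]
  refine congrArg _ (m.val_inj c.U (m.gen_mem _ _ c.mem) _ _ ?_)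
  exact (m.val_res hac (m.gen_mem _ _ c.mem) s).trans (h.trans
    (m.val_res hbc (m.gen_mem _ _ c.mem) t).symm)

theorem mem_range_stalkVal (x : P.pt) (a : F.Hom Y X) :
    a ∈ (Sub.range (m.stalkVal x)).carrier Y X ↔
      ∃ U : Opens P.pt, x ∈ U ∧ ∀ y ∈ U, a ∈ m.loc y Y X := by
  constructor
  · rintro ⟨s, rfl⟩
    obtain ⟨b, s, rfl⟩ := (P.nhdSys x).exists_of s
    exact ⟨b.U, b.mem, (m.mem_range b.U (m.gen_mem _ _ b.mem) _).1 ⟨s, rfl⟩⟩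
  · rintro ⟨U, hU, h⟩
    obtain ⟨s, hs⟩ := (m.mem_range U (m.gen_mem _ _ hU) a).2 h
    exact ⟨(P.germ U x hU).app s, hs⟩

end Model

/-- Compatibility of a map with models. -/
structure Map.Compat {P Q : FSpace.{u}} {F : CFR.{u}} (f : Map P Q) (m : Model P F)
    (n : Model Q F) : Prop where
  gen : f.toFun m.gen = n.gen
  val : ∀ {Y X : Type} [Fintype Y] [Fintype X] (V : Opens Q.pt) (U : Opens P.pt)
    (h : ∀ x ∈ U, f.toFun x ∈ V) (hU : m.gen ∈ U) (hV : n.gen ∈ V) (s : (Q.sec V).Hom Y X),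
    (m.val U hU).app ((f.app V U h).app s) = (n.val V hV).app s

/-- The empty family covers the empty set, so the sheaf axiom leaves one section there. -/
theorem sec_subsingleton (P : FSpace.{u}) {Y X : Type} [Fintype Y] [Fintype X] {U : Opens P.pt}
    (hU : ∀ x, x ∉ U) (s t : (P.sec U).Hom Y X) : s = t :=
  P.ext_cover (ι := PEmpty) (fun i => i.elim) (fun i => i.elim) (fun x hx => (hU x hx).elim)
    fun i => i.elim

end FSpace

open FSpace

/-! #### The spectrum -/

section SpecModel

variable {K : Type u} [Field K] {A : CFR.{u}} {f : FHom A.toFData (mat K).toFData}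
variable {X Y : Type} [Fintype X] [Fintype Y]

theorem entry_ideal (a : X → (mat K).Hom Unit Unit) (b : (mat K).Hom Unit X)
    (d : (mat K).Hom X Unit) :
    entry ((mat K).comp b ((mat K).comp (FData.diag X a) d)) =
      ∑ x, toM b () x * (entry (a x) * toM d x ()) := by
  classical
  have h (x z : X) : toM (FData.diag X a) x z = if x = z then entry (a x) else 0 :=
    mat_diag_apply (B := K) a x z
  rw [entry, toM_comp, toM_comp, Matrix.mul_apply]
  simp [Matrix.mul_apply, h]

/-- A 1 × 1 matrix is its own transpose. The symmetry conditions on primes and on basic open sets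
are therefore void. -/
theorem tr_eq_of_injective (hf : f.Injective) (s : A.Hom Unit Unit) : A.tr s = s :=
  hf _ _ (f.map_tr s)

/-- The combination of an empty family. -/
theorem zero_mem_of_isIdeal {I : Set (A.Hom Unit Unit)} (hI : IsIdeal I) : A.zero ∈ I := by
  have := hI Empty (fun x => x.elim) A.zero A.zero fun x => x.elim
  rwa [A.lawful.final (A.comp (FData.diag Empty _) _), FData.zero, FData.zero,
    ← A.lawful.emb_trans, PEquiv.bot_trans] at this

/-- A symmetric prime, in the case that all scalars are symmetric. -/
def SymPrime.ofIsIdeal (hf : f.Injective) (I : Set (A.Hom Unit Unit)) (hI : IsIdeal I)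
    (h1 : A.one ∉ I) (hmul : ∀ s t, s ∉ I → t ∉ I → A.comp s t ∉ I) : SymPrime A where
  carrier := I
  isIdeal := hI
  symmetric := Set.Subset.antisymm
    (fun s hs => subset_span _ ⟨hs, tr_eq_of_injective hf s⟩) (span_le hI fun _ hs => hs.1)
  one_notMem := h1
  mul_notMem s t _ _ := hmul s t

/-- The symmetric prime `0`. -/
def zeroPrime (hf : f.Injective) : SymPrime A :=
  SymPrime.ofIsIdeal hf {s | entry (f.app s) = 0} (by
    intro X _ a b d h
    change entry (f.app _) = 0
    rw [f.map_comp, f.map_comp, f.map_diag, entry_ideal]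
    refine Finset.sum_eq_zero fun x _ => ?_
    rw [show entry (f.app (a x)) = 0 from h x, zero_mul, mul_zero]) (by
    change entry (f.app A.one) ≠ 0
    rw [FData.one, f.map_emb]
    exact entry_one.trans_ne one_ne_zero) (by
    intro s t hs ht
    change entry (f.app _) ≠ 0
    rw [f.map_comp, entry_comp]
    exact mul_ne_zero hs ht)

theorem entry_ne_zero (hf : f.Injective) (p : SymPrime A) {s : A.Hom Unit Unit}
    (hs : s ∉ p.carrier) : entry (f.app s) ≠ 0 := by
  intro h
  refine hs ?_
  have : s = A.zero := hf _ _ (by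
    rw [f.map_zero]; exact entry_injective (h.trans entry_zero.symm))
  rw [this]
  exact zero_mem_of_isIdeal p.isIdeal

/-- Every prime contains the scalar 0, so an element outside of some prime is non-zero and lies
outside of the zero prime. This makes the zero prime the generic point. -/
theorem zeroPrime_mem (hf : f.Injective) {U : Set (SymPrime A)} (hU : IsOpen U) {p : SymPrime A}
    (hp : p ∈ U) : zeroPrime hf ∈ U := by
  induction hU with
  | basic U hU =>
    obtain ⟨g, -, rfl⟩ := hU
    exact entry_ne_zero hf p hp
  | univ => trivial
  | inter U V _ _ h h' => exact ⟨h hp.1, h' hp.2⟩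
  | sUnion S _ h =>
    obtain ⟨U, hU, hpU⟩ := hp
    exact ⟨U, hU, h U hU hpU⟩

/-- The homomorphism from the local ring to `𝔽(K)`. -/
noncomputable def primeVal (hf : f.Injective) (p : SymPrime A) :
    FHom (loc p.compl).toFData (mat K).toFData :=
  locVal p.compl f fun _ hs => entry_ne_zero hf p hs.2

theorem primeVal_injective (hf : f.Injective) (p : SymPrime A) : (primeVal hf p).Injective :=
  locVal_injective _ _ _ hf

theorem primeVal_mk (hf : f.Injective) (p : SymPrime A) (a : A.Hom Y X) (s : p.compl.carrier) :
    (primeVal hf p).app (Loc.mk a s) = kmul (entry (f.app s.1))⁻¹ (f.app a) := rfl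

/-- Near p a section is a single fraction, on a neighbourhood that also contains the zero prime.
This is why a section amounts to one matrix over K. -/
theorem primeVal_const (hf : f.Injective) {U : Opens (Spec A).pt} (s : ((Spec A).sec U).Hom Y X)
    (p : SymPrime A) (hp : p ∈ U) (h0 : zeroPrime hf ∈ U) :
    (primeVal hf p).app (s.1 ⟨p, hp⟩) = (primeVal hf (zeroPrime hf)).app (s.1 ⟨_, h0⟩) := by
  obtain ⟨V, hpV, hV, a, g, hg, hs⟩ := s.2 p hp
  have h1 : s.1 ⟨p, hp⟩ = Loc.mk a ⟨g, hg ⟨p, hpV⟩⟩ := hs ⟨p, hpV⟩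
  have h2 : s.1 ⟨_, h0⟩ = Loc.mk a ⟨g, hg ⟨_, zeroPrime_mem hf V.isOpen hpV⟩⟩ := hs ⟨_, _⟩
  rw [h1, h2, primeVal_mk, primeVal_mk]

/-- The fractions of `A` in `𝔽(K)` with denominator outside of a symmetric prime. -/
def locSet (f : FHom A.toFData (mat K).toFData) (p : SymPrime A) (Y X : Type) [Fintype Y]
    [Fintype X] : Set ((mat K).Hom Y X) :=
  {a | ∃ g, g ∉ p.carrier ∧ ∃ b : A.Hom Y X, f.app b = kmul (entry (f.app g)) a}

/-- The spectrum of a sub-`𝔽`-ring of `𝔽(K)`. -/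
noncomputable def specModel (hf : f.Injective) : Model (Spec A) (mat K) where
  gen := zeroPrime hf
  gen_mem U x hx := zeroPrime_mem hf U.isOpen hx
  val U h :=
    { app := fun s => (primeVal hf (zeroPrime hf)).app (s.1 ⟨_, h⟩)
      map_comp := fun _ _ => (primeVal hf (zeroPrime hf)).map_comp _ _
      map_sum := fun _ _ => (primeVal hf (zeroPrime hf)).map_sum _ _
      map_tr := fun _ => (primeVal hf (zeroPrime hf)).map_tr _
      map_emb := fun _ => (primeVal hf (zeroPrime hf)).map_emb _ }
  val_res _ _ _ := rfl
  val_inj U h Y X _ _ s t hst := by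
    refine Subtype.ext (funext fun p => primeVal_injective hf p.1 _ _ ?_)
    exact (primeVal_const hf s p.1 p.2 h).trans (hst.trans (primeVal_const hf t p.1 p.2 h).symm)
  loc p Y X _ _ := locSet f p Y X
  mem_range {Y X} _ _ U h a := by
    constructor
    · rintro ⟨s, rfl⟩ p hp
      obtain ⟨b, g, hs⟩ := Loc.ind (s.1 ⟨p, hp⟩)
      refine ⟨g.1, g.2.2, b, ?_⟩
      change _ = kmul _ ((primeVal hf (zeroPrime hf)).app (s.1 ⟨_, h⟩))
      have e : (primeVal hf (zeroPrime hf)).app (s.1 ⟨_, h⟩) = kmul (entry (f.app g.1))⁻¹ (f.app b) :=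
        (primeVal_const hf s p hp h).symm.trans (congrArg _ hs)
      rw [e, kmul_kmul, mul_inv_cancel₀ (entry_ne_zero hf p g.2.2), one_kmul]
    · intro ha
      have ha' : ∀ p, ∃ (g : A.Hom Unit Unit) (b : A.Hom Y X), p ∈ U →
          g ∉ p.carrier ∧ f.app b = kmul (entry (f.app g)) a := fun p => by
        by_cases hp : p ∈ U
        · obtain ⟨g, hg, b, hb⟩ := ha p hp
          exact ⟨g, b, fun _ => ⟨hg, hb⟩⟩
        · exact ⟨A.one, A.zero, fun h => (hp h).elim⟩
      choose g b hgb using ha'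
      have hg := fun p hp => (hgb p hp).1
      have hb := fun p hp => (hgb p hp).2
      -- Fractions chosen at different primes have the same value a, hence agree in every local ring
      -- where both make sense. The chosen germs are thus locally a single fraction.
      have key (p : SymPrime A) (hp : p ∈ U) (q : SymPrime A) (hq : q ∈ U) (hgq : g p ∉ q.carrier) :
          Loc.mk (S := q.compl) (b q) ⟨g q, tr_eq_of_injective hf _, hg q hq⟩ =
            Loc.mk (S := q.compl) (b p) ⟨g p, tr_eq_of_injective hf _, hgq⟩ := by
        refine primeVal_injective hf q _ _ ?_
        rw [primeVal_mk, primeVal_mk, hb q hq, hb p hp, kmul_kmul, kmul_kmul,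
          inv_mul_cancel₀ (entry_ne_zero hf q (hg q hq)),
          inv_mul_cancel₀ (entry_ne_zero hf p (hg p hp))]
      refine ⟨⟨fun p => Loc.mk (S := p.1.compl) (b p.1) ⟨g p.1, tr_eq_of_injective hf _, hg p.1 p.2⟩,
        fun p hp => ?_⟩, ?_⟩
      · exact ⟨⟨basicOpen A (g p), isOpen_generateFrom_of_mem
          ⟨g p, tr_eq_of_injective hf _, rfl⟩⟩ ⊓ U, ⟨hg p hp, hp⟩, inf_le_right, b p, g p,
          fun q => ⟨tr_eq_of_injective hf _, q.2.1⟩, fun q => key p hp q.1 q.2.2 q.2.1⟩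
      · refine (primeVal_mk hf _ _ _).trans ?_
        rw [hb _ h, kmul_kmul, inv_mul_cancel₀ (entry_ne_zero hf _ (hg _ h)), one_kmul]

/-- As all scalars are symmetric, the preimage of a prime is already generated by its symmetric
elements. -/
theorem comap_carrier {B : CFR.{u}} (hf : f.Injective) (g : FHom A.toFData B.toFData)
    (q : SymPrime B) : (q.comap g).carrier = {s | g.app s ∈ q.carrier} :=
  Set.Subset.antisymm (fun s hs => mem_span_comap g q s hs)
    fun s hs => subset_span _ ⟨hs, tr_eq_of_injective hf s⟩

theorem specMap_compat {B : CFR.{u}} {f' : FHom B.toFData (mat K).toFData} (hf : f.Injective)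
    (hf' : f'.Injective) (g : FHom A.toFData B.toFData)
    (h : ∀ {Y X : Type} [Fintype Y] [Fintype X] (a : A.Hom Y X), f'.app (g.app a) = f.app a) :
    (specMap g).Compat (specModel hf') (specModel hf) where
  gen := SymPrime.ext ((comap_carrier hf g _).trans (by
    ext s
    change entry (f'.app (g.app s)) = 0 ↔ entry (f.app s) = 0
    rw [h]))
  val V U hUV hU hV s := by
    change (primeVal hf' (zeroPrime hf')).app ((locMap g _ _ (compl_comap g _)).app
      (s.1 ⟨(zeroPrime hf').comap g, hUV _ hU⟩)) = (primeVal hf (zeroPrime hf)).app (s.1 ⟨_, hV⟩)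
    obtain ⟨b, t, hs⟩ := Loc.ind (s.1 ⟨(zeroPrime hf').comap g, hUV _ hU⟩)
    refine Eq.trans ?_ (primeVal_const hf s _ (hUV _ hU) hV)
    refine (congrArg _ (congrArg _ hs)).trans (Eq.trans ?_ (congrArg _ hs).symm)
    change kmul (entry (f'.app (g.app t.1)))⁻¹ (f'.app (g.app b)) = kmul _ _
    rw [h, h]

end SpecModel

end FOne

namespace FOne
open TopologicalSpace
open FSpace

/-! #### Glueing -/

section GlueModel

variable {F : CFR.{u}} {ι : Type u} {G : GlueData ι} {m : Model G.L F} {n : ∀ i, Model (G.C i) F}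
variable {X Y : Type} [Fintype X] [Fintype Y]

theorem FSpace.GlueData.inj_gen (hr : ∀ i, (G.r i).Compat m (n i)) (i j : ι) :
    G.inj i (n i).gen = G.inj j (n j).gen := by
  rw [← (hr i).gen, ← (hr j).gen]
  exact G.inj_r i j _

/-- The members of a compatible family agree on `L`, whose generic point maps to that of every
chart. So `glueModel` may read off the value in an arbitrary chart. -/
theorem FSpace.GlueData.val_eq (hr : ∀ i, (G.r i).Compat m (n i)) (U : Opens G.Pt)
    (s : (G.glue.sec U).Hom Y X) (i j : ι) (hi : (n i).gen ∈ G.pre i U)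
    (hj : (n j).gen ∈ G.pre j U) :
    ((n i).val _ hi).app (s.1 i) = ((n j).val _ hj).app (s.1 j) := by
  have h0 : m.gen ∈ (G.r i).pre (G.pre i U) := by
    change (G.r i).toFun m.gen ∈ G.pre i U
    rwa [(hr i).gen]
  have h1 : ∀ x ∈ (G.r i).pre (G.pre i U), (G.r j).toFun x ∈ G.pre j U := by
    intro x hx
    change G.inj j _ ∈ U
    rw [← G.inj_r i j x]; exact hx
  rw [← (hr i).val _ ((G.r i).pre (G.pre i U)) (fun _ hx => hx) h0 hi,
    ← (hr j).val _ ((G.r i).pre (G.pre i U)) h1 h0 hj]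
  exact congrArg _ (s.2 i j _ _ _)

/-- The glued space. -/
def glueModel (hr : ∀ i, (G.r i).Compat m (n i)) (i₀ : ι) : Model G.glue F where
  gen := G.inj i₀ (n i₀).gen
  gen_mem U x hx := by
    obtain ⟨⟨i, p⟩, rfl⟩ := Quot.exists_rep x
    rw [GlueData.inj_gen hr i₀ i]
    exact (n i).gen_mem (G.pre i U) p hx
  val U h := ((n i₀).val (G.pre i₀ U) h).comp
    ((projData (fun i => (G.C i).sec (G.pre i U)) i₀).comp (G.sub U).incl)
  val_res h hV s := (n i₀).val_res (G.pre_mono i₀ h) hV (s.1 i₀)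
  val_inj U h Y X _ _ s t hst := by
    refine Subtype.ext (funext fun i => ?_)
    have hi : (n i).gen ∈ G.pre i U := by
      change G.inj i (n i).gen ∈ U
      rw [GlueData.inj_gen hr i i₀]; exact h
    refine (n i).val_inj _ hi _ _ ?_
    exact (GlueData.val_eq hr U s i i₀ hi h).trans
      (hst.trans (GlueData.val_eq hr U t i₀ i h hi))
  loc x Y X _ _ := {a | ∀ i p, G.inj i p = x → a ∈ (n i).loc p Y X}
  mem_range {Y X} _ _ U h a := by
    have hi (i : ι) : (n i).gen ∈ G.pre i U := by
      change G.inj i (n i).gen ∈ U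
      rw [GlueData.inj_gen hr i i₀]; exact h
    constructor
    · rintro ⟨s, rfl⟩ x hx i p rfl
      exact ((n i).mem_range _ (hi i) _).1 ⟨s.1 i, GlueData.val_eq hr U s i i₀ (hi i) h⟩ p hx
    · intro ha
      have ex (i : ι) := ((n i).mem_range (G.pre i U) (hi i) a).2 fun p hp => ha _ hp i p rfl
      choose s hs using ex
      refine ⟨⟨s, fun i j W hWi hWj => ?_⟩, hs i₀⟩
      -- An open set of `L` without the generic point is empty and has only one section.
      by_cases hW : m.gen ∈ W
      · refine m.val_inj W hW _ _ ?_
        rw [(hr i).val _ W hWi hW (hi i), (hr j).val _ W hWj hW (hi j), hs, hs]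
      · exact sec_subsingleton _ (fun x hx => hW (m.gen_mem _ _ hx)) _ _

theorem glueHom_compat {H : GlueData ι} {m' : Model H.L F} {n' : ∀ i, Model (H.C i) F}
    (hr : ∀ i, (G.r i).Compat m (n i)) (hr' : ∀ i, (H.r i).Compat m' (n' i)) (i₀ : ι)
    (f : GlueData.Hom G H) (hC : ∀ i, (f.C i).Compat (n i) (n' i)) :
    f.map.Compat (glueModel hr i₀) (glueModel hr' i₀) where
  gen := congrArg (H.inj i₀) (hC i₀).gen
  val _ _ _ hU hV s := (hC i₀).val _ _ _ hU hV (s.1 i₀)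

end GlueModel

/-! #### Inverse limits -/

section LimModel

variable {F : CFR.{u}} {I : Type} [Preorder I] {S : ProSys.{u} I} {m : ∀ N, Model (S.X N) F}
variable {X Y : Type} [Fintype X] [Fintype Y]

theorem FSpace.ProSys.continuous_val (N : I) : Continuous fun x : S.Pt => x.1 N := by
  have h : Continuous (Subtype.val : S.Pt → ∀ N, (S.X N).pt) := continuous_induced_dom
  exact (continuous_apply N).comp h

/-- The homomorphism to `F` from the stalk at a point of the limit. -/
def FSpace.ProSys.stVal (hf : ∀ {N M} (h : N ≤ M), (S.f h).Compat (m M) (m N)) (x : S.Pt) :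
    FHom (S.nhdSys x).colim.toFData F.toFData :=
  (S.nhdSys x).desc (fun a => (m a.N).val a.U ((m a.N).gen_mem _ _ a.mem)) fun {_ _} _ _ {a b} h s =>
    (hf h.fst).val _ _ _ ((m b.N).gen_mem _ _ b.mem) ((m a.N).gen_mem _ _ a.mem) s

theorem FSpace.ProSys.stVal_injective (hf : ∀ {N M} (h : N ≤ M), (S.f h).Compat (m M) (m N)) (x : S.Pt) :
    (S.stVal hf x).Injective := by
  intro Y X _ _ s t h
  obtain ⟨a, s, rfl⟩ := (S.nhdSys x).exists_of s
  obtain ⟨b, t, rfl⟩ := (S.nhdSys x).exists_of t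
  obtain ⟨c, hac, hbc⟩ := (S.nhdSys x).directed a b
  rw [← (S.nhdSys x).of_map' hac, ← (S.nhdSys x).of_map' hbc] at h ⊢
  exact congrArg _ ((m c.N).val_inj c.U ((m c.N).gen_mem _ _ c.mem) _ _ h)

/-- Specialization in a subspace of a product is tested on components, and each component of the
given family is generic. -/
theorem FSpace.ProSys.gen_mem (hf : ∀ {N M} (h : N ≤ M), (S.f h).Compat (m M) (m N)) {U : Set S.Pt}
    (hU : IsOpen U) {x : S.Pt} (hx : x ∈ U) :
    (⟨fun N => (m N).gen, fun _ _ h => (hf h).gen⟩ : S.Pt) ∈ U := by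
  refine Specializes.mem_open ?_ hU hx
  have h : Topology.IsInducing (Subtype.val : S.Pt → ∀ N, (S.X N).pt) := ⟨rfl⟩
  refine h.specializes_iff.1 (specializes_pi.2 ?_)
  exact fun N => specializes_iff_forall_open.2 fun V hV hxV => (m N).gen_mem ⟨V, hV⟩ _ hxV

/-- Near x a section comes from one section of some X_N, which has the same value at x and at the
generic point. -/
theorem FSpace.ProSys.stVal_const (hf : ∀ {N M} (h : N ≤ M), (S.f h).Compat (m M) (m N))
    {U : Opens S.lim.pt} (s : (S.lim.sec U).Hom Y X) (x y : S.Pt) (hx : x ∈ U) (hy : y ∈ U) :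
    (S.stVal hf x).app (s.1 ⟨x, hx⟩) = (S.stVal hf y).app (s.1 ⟨y, hy⟩) := by
  have key (x : S.Pt) (hx : x ∈ U) : (S.stVal hf x).app (s.1 ⟨x, hx⟩) =
      (S.stVal hf _).app (s.1 ⟨_, S.gen_mem hf U.isOpen hx⟩) := by
    obtain ⟨V, hxV, hV, N, W, hW, t, hs⟩ := s.2 x hx
    exact (congrArg _ (hs ⟨x, hxV⟩)).trans
      (congrArg (S.stVal hf _).app (hs ⟨_, S.gen_mem hf V.isOpen hxV⟩)).symm
  rw [key x hx, key y hy]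

/-- The inverse limit. -/
noncomputable def limModel (hf : ∀ {N M} (h : N ≤ M), (S.f h).Compat (m M) (m N)) :
    Model S.lim F where
  gen := ⟨fun N => (m N).gen, fun _ _ h => (hf h).gen⟩
  gen_mem U _ hx := S.gen_mem hf U.isOpen hx
  val U h :=
    { app := fun s => (S.stVal hf _).app (s.1 ⟨_, h⟩)
      map_comp := fun _ _ => (S.stVal hf _).map_comp _ _
      map_sum := fun _ _ => (S.stVal hf _).map_sum _ _
      map_tr := fun _ => (S.stVal hf _).map_tr _
      map_emb := fun _ => (S.stVal hf _).map_emb _ }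
  val_res _ _ _ := rfl
  val_inj U h Y X _ _ s t hst := by
    refine Subtype.ext (funext fun x => S.stVal_injective hf x.1 _ _ ?_)
    exact (S.stVal_const hf s x.1 _ x.2 h).trans (hst.trans (S.stVal_const hf t _ x.1 h x.2))
  loc x Y X _ _ := {a | ∃ (N : I) (W : Opens (S.X N).pt), x.1 N ∈ W ∧ ∀ y ∈ W, a ∈ (m N).loc y Y X}
  mem_range {Y X} _ _ U h a := by
    constructor
    · rintro ⟨s, rfl⟩ x hx
      obtain ⟨V, hxV, hV, N, W, hW, t, hs⟩ := s.2 x hx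
      refine ⟨N, W, hW x hxV, ((m N).mem_range W ((m N).gen_mem _ _ (hW x hxV)) _).1 ⟨t, ?_⟩⟩
      exact (congrArg (S.stVal hf x).app (hs ⟨x, hxV⟩)).symm.trans (S.stVal_const hf s x _ hx h)
    · intro ha
      have ha' (x : U) : ∃ (N : I) (W : Opens (S.X N).pt) (hx : x.1.1 N ∈ W)
          (t : ((S.X N).sec W).Hom Y X), ((m N).val W ((m N).gen_mem _ _ hx)).app t = a := by
        obtain ⟨N, W, hx, h⟩ := ha x.1 x.2
        obtain ⟨t, ht⟩ := ((m N).mem_range W ((m N).gen_mem _ _ hx) a).2 h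
        exact ⟨N, W, hx, t, ht⟩
      choose N W hW t ht using ha'
      refine ⟨⟨fun x => ((S.nhdSys x.1).of ⟨N x, W x, hW x⟩).app (t x), fun x hx => ?_⟩, ht _⟩
      have hV : IsOpen {y : S.Pt | y.1 (N ⟨x, hx⟩) ∈ W ⟨x, hx⟩} :=
        (W ⟨x, hx⟩).isOpen.preimage (S.continuous_val _)
      refine ⟨⟨_, hV⟩ ⊓ U, ⟨hW ⟨x, hx⟩, hx⟩, inf_le_right, N ⟨x, hx⟩, W ⟨x, hx⟩, fun y hy => hy.1,
        t ⟨x, hx⟩, fun y => ?_⟩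
      -- The sections chosen at x and at y have the same value a, so their germs at y agree.
      exact S.stVal_injective hf y.1 _ _ ((ht ⟨y.1, y.2.2⟩).trans (ht ⟨x, hx⟩).symm)

end LimModel

end FOne

namespace FOne
open TopologicalSpace

/-! ### Scalars and symmetric primes of sub-`𝔽`-rings of `𝔽(K)` -/

theorem Sub.incl_injective {F : CFR.{u}} (A : Sub F) : A.incl.Injective :=
  fun _ _ _ _ _ _ h => Subtype.ext h

/-- An arrow of `F` which lies in `A`, as an arrow of `A`. -/
def Sub.elt {F : CFR.{u}} (A : Sub F) {X Y : Type} [Fintype X] [Fintype Y] (a : F.Hom Y X)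
    (ha : a ∈ A.carrier Y X) : A.ring.Hom Y X := ⟨a, ha⟩

theorem Sub.incl_elt {F : CFR.{u}} (A : Sub F) {X Y : Type} [Fintype X] [Fintype Y] (a : F.Hom Y X)
    (ha : a ∈ A.carrier Y X) : A.incl.app (A.elt a ha) = a := rfl

theorem Sub.incl_mem {F : CFR.{u}} (A : Sub F) {X Y : Type} [Fintype X] [Fintype Y]
    (s : A.ring.Hom Y X) : A.incl.app s ∈ A.carrier Y X := s.2

section Scalars

variable {K : Type u} [Field K] (A : Sub (mat K)) {X Y : Type} [Fintype X] [Fintype Y]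

/-- The diagonal matrix with entries c can be formed inside A, since direct sums can. -/
theorem kmul_mem {c : K} (hc : ofEntry c ∈ A.carrier Unit Unit) {a : (mat K).Hom Y X}
    (ha : a ∈ A.carrier Y X) : kmul c a ∈ A.carrier Y X := by
  have h := A.incl_mem (FData.scal Y (A.elt _ hc))
  rw [FHom.map_scal, A.incl_elt] at h
  have := A.comp_mem h ha
  rwa [scal_comp_eq_kmul] at this

/-- The scalars of `A`, as elements of `K`. -/
def Sub.scalars : Set K := {x | ofEntry x ∈ A.carrier Unit Unit}

variable {A}

theorem entry_mem_scalars {s : (mat K).Hom Unit Unit} :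
    entry s ∈ A.scalars ↔ s ∈ A.carrier Unit Unit := Iff.rfl

theorem mem_scalars {x : K} : x ∈ A.scalars ↔ ofEntry x ∈ A.carrier Unit Unit := Iff.rfl

theorem one_mem_scalars : (1 : K) ∈ A.scalars := by
  rw [← entry_one, entry_mem_scalars]; exact A.emb_mem _

theorem zero_mem_scalars : (0 : K) ∈ A.scalars := by
  rw [← entry_zero, entry_mem_scalars]; exact A.emb_mem _

theorem mul_mem_scalars {x y : K} (hx : x ∈ A.scalars) (hy : y ∈ A.scalars) : x * y ∈ A.scalars :=
  kmul_mem A hx hy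

theorem pow_mem_scalars {x : K} (hx : x ∈ A.scalars) (k : ℕ) : x ^ k ∈ A.scalars := by
  induction k with
  | zero => rw [pow_zero]; exact one_mem_scalars
  | succ k ih => rw [pow_succ]; exact mul_mem_scalars ih hx

/-- The value of a scalar of `A`. -/
noncomputable def sval (s : A.ring.Hom Unit Unit) : K := entry (A.incl.app s)

theorem sval_mem (s : A.ring.Hom Unit Unit) : sval s ∈ A.scalars := A.incl_mem s

theorem sval_injective {s t : A.ring.Hom Unit Unit} (h : sval s = sval t) : s = t :=
  A.incl_injective _ _ (entry_injective h)

/-- The scalar of `A` with a given value. -/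
noncomputable def selt {x : K} (hx : x ∈ A.scalars) : A.ring.Hom Unit Unit := A.elt (ofEntry x) hx

theorem sval_selt {x : K} (hx : x ∈ A.scalars) : sval (selt hx) = x := rfl

theorem sval_comp (s t : A.ring.Hom Unit Unit) : sval (A.ring.comp s t) = sval s * sval t := by
  rw [sval, FHom.map_comp, entry_comp]; rfl

theorem sval_one : sval (A.ring.one) = (1 : K) := by
  rw [sval, FData.one, FHom.map_emb]; exact entry_one

theorem sval_zero : sval (A.ring.zero) = (0 : K) := by
  rw [sval, FHom.map_zero]; exact entry_zero

theorem sval_ideal (a : X → A.ring.Hom Unit Unit) (b : A.ring.Hom Unit X) (d : A.ring.Hom X Unit) :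
    sval (A.ring.comp b (A.ring.comp (FData.diag X a) d)) =
      ∑ x, toM (A.incl.app b) () x * (sval (a x) * toM (A.incl.app d) x ()) := by
  rw [sval, FHom.map_comp, FHom.map_comp, FHom.map_diag, entry_ideal]; rfl

theorem IsIdeal.sum_mem {I : Set (A.ring.Hom Unit Unit)} (hI : IsIdeal I) {b : (mat K).Hom Unit X}
    (hb : b ∈ A.carrier Unit X) {d : (mat K).Hom X Unit} (hd : d ∈ A.carrier X Unit) {a : X → K}
    (ha : ∀ x, ∃ s ∈ I, sval s = a x) :
    ∃ s ∈ I, sval s = ∑ x, toM b () x * (a x * toM d x ()) := by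
  choose s hs hsa using ha
  refine ⟨_, hI X s (A.elt b hb) (A.elt d hd) hs, ?_⟩
  rw [sval_ideal]
  simp only [hsa, Sub.incl_elt]

theorem IsIdeal.mul_mem {I : Set (A.ring.Hom Unit Unit)} (hI : IsIdeal I) {s : A.ring.Hom Unit Unit}
    (hs : s ∈ I) (t : A.ring.Hom Unit Unit) : A.ring.comp s t ∈ I := by
  have h := hI Unit (fun _ => s) A.ring.one t fun _ => hs
  rw [one_comp] at h
  change A.ring.comp (FData.scal Unit s) t ∈ I at h
  rwa [scal_unit] at h

/-- The values of the elements of a symmetric prime. -/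
def SymPrime.vals (P : SymPrime A.ring) : Set K := {x | ∃ s ∈ P.carrier, sval s = x}

theorem SymPrime.sval_mem_vals (P : SymPrime A.ring) {s : A.ring.Hom Unit Unit} :
    sval s ∈ P.vals ↔ s ∈ P.carrier :=
  ⟨fun ⟨_, ht, h⟩ => sval_injective h ▸ ht, fun hs => ⟨s, hs, rfl⟩⟩

theorem SymPrime.ext_vals {P Q : SymPrime A.ring} (h : P.vals = Q.vals) : P = Q :=
  SymPrime.ext (Set.ext fun s => by rw [← P.sval_mem_vals, h, Q.sval_mem_vals])

section

variable (P : SymPrime A.ring) {x y : K}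

theorem SymPrime.vals_subset : P.vals ⊆ A.scalars := by
  rintro _ ⟨s, -, rfl⟩
  exact sval_mem s

theorem SymPrime.mul_mem_vals (hx : x ∈ A.scalars) (hy : y ∈ P.vals) : x * y ∈ P.vals := by
  obtain ⟨s, hs, rfl⟩ := hy
  refine ⟨_, P.isIdeal.mul_mem hs (selt hx), ?_⟩
  rw [sval_comp, sval_selt, mul_comm]

theorem SymPrime.mem_or_mem_vals (hx : x ∈ A.scalars) (hy : y ∈ A.scalars)
    (h : x * y ∈ P.vals) : x ∈ P.vals ∨ y ∈ P.vals := by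
  rw [← sval_selt hx, ← sval_selt hy, ← sval_comp, P.sval_mem_vals] at h
  by_contra! hc
  rw [← sval_selt hx, ← sval_selt hy, P.sval_mem_vals, P.sval_mem_vals] at hc
  exact P.mul_notMem _ _ (tr_eq_of_injective A.incl_injective _)
    (tr_eq_of_injective A.incl_injective _) hc.1 hc.2 h

theorem SymPrime.one_notMem_vals : (1 : K) ∉ P.vals := by
  rw [← sval_one, P.sval_mem_vals]
  exact P.one_notMem

theorem SymPrime.zero_mem_vals : (0 : K) ∈ P.vals := by
  rw [← sval_zero, P.sval_mem_vals]
  exact zero_mem_of_isIdeal P.isIdeal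

theorem SymPrime.mem_of_pow_mem_vals (hx : x ∈ A.scalars) {k : ℕ} (h : x ^ k ∈ P.vals) :
    x ∈ P.vals := by
  induction k with
  | zero => rw [pow_zero] at h; exact (P.one_notMem_vals h).elim
  | succ k ih =>
    rw [pow_succ] at h
    exact (P.mem_or_mem_vals (pow_mem_scalars hx k) hx h).elim ih id

end

/-- A symmetric prime given by its values. -/
noncomputable def SymPrime.ofVals (A : Sub (mat K)) (I : Set K)
    (hI : ∀ (X : Type) [Fintype X] (b : (mat K).Hom Unit X) (d : (mat K).Hom X Unit) (a : X → K),
      b ∈ A.carrier Unit X → d ∈ A.carrier X Unit → (∀ x, a x ∈ I) → (∀ x, a x ∈ A.scalars) →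
      ∑ x, toM b () x * (a x * toM d x ()) ∈ I)
    (h1 : (1 : K) ∉ I) (hmul : ∀ x ∈ A.scalars, ∀ y ∈ A.scalars, x ∉ I → y ∉ I → x * y ∉ I) :
    SymPrime A.ring :=
  SymPrime.ofIsIdeal A.incl_injective {s | sval s ∈ I} (by
    intro X _ a b d h
    change sval _ ∈ I
    rw [sval_ideal]
    exact hI X _ _ _ (A.incl_mem b) (A.incl_mem d) h fun x => sval_mem _) (by
    change sval _ ∉ I
    rwa [sval_one]) (by
    intro s t hs ht
    change sval _ ∉ I
    rw [sval_comp]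
    exact hmul _ (sval_mem s) _ (sval_mem t) hs ht)

theorem mem_basicOpen {g : A.ring.Hom Unit Unit} {P : SymPrime A.ring} :
    P ∈ basicOpen A.ring g ↔ sval g ∉ P.vals := by rw [P.sval_mem_vals]; rfl

theorem isOpen_basicOpen (g : A.ring.Hom Unit Unit) : IsOpen (basicOpen A.ring g) :=
  isOpen_generateFrom_of_mem ⟨g, tr_eq_of_injective A.incl_injective _, rfl⟩

theorem mem_locSet {P : SymPrime A.ring} {a : (mat K).Hom Y X} :
    a ∈ locSet A.incl P Y X ↔ ∃ x ∈ A.scalars, x ∉ P.vals ∧ kmul x a ∈ A.carrier Y X := by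
  constructor
  · rintro ⟨g, hg, b, hb⟩
    refine ⟨sval g, sval_mem g, fun h => hg (P.sval_mem_vals.1 h), ?_⟩
    rw [sval, ← hb]; exact A.incl_mem b
  · rintro ⟨x, hx, hxP, ha⟩
    refine ⟨selt hx, fun h => hxP ?_, A.elt _ ha, rfl⟩
    rw [← sval_selt hx, P.sval_mem_vals]; exact h

end Scalars

/-! ### Local rings -/

section LocalRings

variable {R K : Type u} [CommRing R] [IsDomain R] [Field K] [Algebra R K] [IsFractionRing R K]
variable {X Y : Type} [Fintype X] [Fintype Y]

/-- The local ring `R_p` in `K`. -/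
noncomputable def locRing (K : Type u) [Field K] [Algebra R K] [IsFractionRing R K]
    (p : PrimeSpectrum R) : Subring K :=
  (Localization.subalgebra.ofField K p.asIdeal.primeCompl
    p.asIdeal.primeCompl_le_nonZeroDivisors).toSubring

/-- The maximal ideal of `R_p`, as a subset of `K`. -/
def maxSet (K : Type u) [Field K] [Algebra R K] (p : PrimeSpectrum R) : Set K :=
  {x | ∃ a ∈ p.asIdeal, ∃ b ∉ p.asIdeal, x * algebraMap R K b = algebraMap R K a}

theorem algebraMap_ne_zero {p : PrimeSpectrum R} {b : R} (hb : b ∉ p.asIdeal) :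
    algebraMap R K b ≠ 0 := by
  rw [Ne, IsFractionRing.to_map_eq_zero_iff (K := K)]
  rintro rfl
  exact hb p.asIdeal.zero_mem

variable (p : PrimeSpectrum R)

theorem mem_locRing {x : K} :
    x ∈ locRing K p ↔ ∃ a, ∃ b ∉ p.asIdeal, x * algebraMap R K b = algebraMap R K a := by
  constructor
  · rintro ⟨a, b, hb, rfl⟩
    exact ⟨a, b, hb, inv_mul_cancel_right₀ (algebraMap_ne_zero hb) _⟩
  · rintro ⟨a, b, hb, h⟩
    exact ⟨a, b, hb, by rw [← h, mul_inv_cancel_right₀ (algebraMap_ne_zero hb)]⟩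

theorem algebraMap_mem_locRing (r : R) : algebraMap R K r ∈ locRing K p :=
  (mem_locRing p).2 ⟨r, 1, p.isPrime.one_notMem, by simp⟩

theorem mul_mem_maxSet {x y : K} (hx : x ∈ locRing K p) (hy : y ∈ maxSet K p) :
    x * y ∈ maxSet K p := by
  obtain ⟨a, b, hb, h⟩ := (mem_locRing p).1 hx
  obtain ⟨c, hc, d, hd, h'⟩ := hy
  refine ⟨a * c, p.asIdeal.mul_mem_left a hc, b * d, p.isPrime.mul_notMem hb hd, ?_⟩
  rw [map_mul, map_mul, ← h, ← h']; ring

theorem zero_mem_maxSet : (0 : K) ∈ maxSet K p :=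
  ⟨0, p.asIdeal.zero_mem, 1, p.isPrime.one_notMem, by simp⟩

theorem add_mem_maxSet {x y : K} (hx : x ∈ maxSet K p) (hy : y ∈ maxSet K p) :
    x + y ∈ maxSet K p := by
  obtain ⟨a, ha, b, hb, h⟩ := hx
  obtain ⟨c, hc, d, hd, h'⟩ := hy
  refine ⟨a * d + c * b, p.asIdeal.add_mem (p.asIdeal.mul_mem_right d ha)
    (p.asIdeal.mul_mem_right b hc), b * d, p.isPrime.mul_notMem hb hd, ?_⟩
  rw [map_mul, map_add, map_mul, map_mul, ← h, ← h']; ring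

theorem sum_mem_maxSet {ι : Type*} (s : Finset ι) (f : ι → K) (h : ∀ i ∈ s, f i ∈ maxSet K p) :
    ∑ i ∈ s, f i ∈ maxSet K p :=
  Finset.sum_induction f (· ∈ maxSet K p) (fun _ _ => add_mem_maxSet p) (zero_mem_maxSet p) h

theorem algebraMap_mem_maxSet {r : R} : algebraMap R K r ∈ maxSet K p ↔ r ∈ p.asIdeal := by
  constructor
  · rintro ⟨a, ha, b, hb, h⟩
    rw [← map_mul] at h
    rw [← IsFractionRing.injective R K h] at ha
    exact (p.isPrime.mem_or_mem ha).resolve_right hb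
  · exact fun h => ⟨r, h, 1, p.isPrime.one_notMem, by simp⟩

theorem one_notMem_maxSet : (1 : K) ∉ maxSet K p := by
  rw [← map_one (algebraMap R K), algebraMap_mem_maxSet]
  exact p.isPrime.one_notMem

theorem inv_mem_locRing {x : K} (hx : x ∈ locRing K p) (h : x ∉ maxSet K p) :
    x⁻¹ ∈ locRing K p := by
  obtain ⟨a, b, hb, e⟩ := (mem_locRing p).1 hx
  have ha : a ∉ p.asIdeal := fun ha => h ⟨a, ha, b, hb, e⟩
  refine (mem_locRing p).2 ⟨b, a, ha, ?_⟩
  have hx0 : x ≠ 0 := by rintro rfl; exact h (zero_mem_maxSet p)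
  rw [← e, inv_mul_cancel_left₀ hx0]

theorem mul_notMem_maxSet {x y : K} (hx : x ∈ locRing K p) (h : x ∉ maxSet K p)
    (h' : y ∉ maxSet K p) : x * y ∉ maxSet K p := by
  intro hxy
  have hx0 : x ≠ 0 := by rintro rfl; exact h (zero_mem_maxSet p)
  have := mul_mem_maxSet p (inv_mem_locRing p hx h) hxy
  rw [inv_mul_cancel_left₀ hx0] at this
  exact h' this

/-- The product of the denominators of all entries; it avoids p because p is prime. -/
theorem exists_common_denominator {a : (mat K).Hom Y X} (ha : a ∈ (localAt K p).carrier Y X) :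
    ∃ b ∉ p.asIdeal, kmul (algebraMap R K b) a ∈ (integers R K).carrier Y X := by
  choose r s hs h using fun y x => (mem_locRing p).1 (ha y x)
  classical
  refine ⟨∏ y, ∏ x, s y x, ?_, fun y x => ?_⟩
  · rw [p.isPrime.prod_mem_iff]
    rintro ⟨y, -, hy⟩
    rw [p.isPrime.prod_mem_iff] at hy
    obtain ⟨x, -, hx⟩ := hy
    exact hs y x hx
  · obtain ⟨c, hc⟩ : s y x ∣ ∏ y, ∏ x, s y x :=
      (Finset.dvd_prod_of_mem (s y) (Finset.mem_univ x)).trans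
        (Finset.dvd_prod_of_mem (fun y => ∏ x, s y x) (Finset.mem_univ y))
    refine ⟨c * r y x, ?_⟩
    change _ = algebraMap R K _ * toM a y x
    rw [hc, map_mul, map_mul, ← h y x]
    change _ * (toM a y x * _) = _
    ring

/-- The symmetric prime of a sub-`𝔽`-ring of `𝔽(R_p)` given by the maximal ideal of `R_p`. -/
noncomputable def finPrime {A : Sub (mat K)} (hA : A ≤ localAt K p) : SymPrime A.ring :=
  SymPrime.ofVals A (maxSet K p) (by
    intro X _ b d a hb hd h _
    refine sum_mem_maxSet p _ _ fun x _ => ?_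
    refine mul_mem_maxSet p (hA _ _ hb () x) ?_
    rw [mul_comm]
    exact mul_mem_maxSet p (hA _ _ hd x ()) (h x)) (one_notMem_maxSet p)
    fun _ hs _ _ => mul_notMem_maxSet p (hA _ _ hs () ())

theorem mem_finPrime {A : Sub (mat K)} (hA : A ≤ localAt K p) (s : A.ring.Hom Unit Unit) :
    s ∈ (finPrime p hA).carrier ↔ sval s ∈ maxSet K p := Iff.rfl

theorem mem_vals_finPrime {A : Sub (mat K)} (hA : A ≤ localAt K p) {x : K} (hx : x ∈ A.scalars) :
    x ∈ (finPrime p hA).vals ↔ x ∈ maxSet K p := by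
  rw [← sval_selt hx, SymPrime.sval_mem_vals]; exact Iff.rfl

theorem scalars_subset_locRing {A : Sub (mat K)} (hA : A ≤ localAt K p) {x : K}
    (hx : x ∈ A.scalars) : x ∈ locRing K p := hA _ _ hx () ()

end LocalRings

/-! ### Matrices over `R[1/N]` -/

section Invert

variable {R K : Type u} [CommRing R] [IsDomain R] [Field K] [CharZero K] [Algebra R K]
variable [IsFractionRing R K] {X Y : Type} [Fintype X] [Fintype Y]

theorem algebraMap_mem_adjoin (N : ℕ) (r : R) :
    algebraMap R K r ∈ Algebra.adjoin R {(N : K)⁻¹} :=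
  (Algebra.adjoin R {(N : K)⁻¹}).algebraMap_mem r

theorem mem_adjoin_inv {N : ℕ} (hN : N ≠ 0) {x : K} :
    x ∈ Algebra.adjoin R {(N : K)⁻¹} ↔ ∃ k : ℕ, ∃ r, (N : K) ^ k * x = algebraMap R K r := by
  have h0 : (N : K) ≠ 0 := Nat.cast_ne_zero.2 hN
  constructor
  · intro hx
    induction hx using Algebra.adjoin_induction with
    | mem x hx =>
      obtain rfl := hx
      exact ⟨1, 1, by rw [pow_one, mul_inv_cancel₀ h0, map_one]⟩
    | algebraMap r => exact ⟨0, r, by simp⟩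
    | add x y _ _ hx hy =>
      obtain ⟨k, r, hk⟩ := hx
      obtain ⟨l, s, hl⟩ := hy
      refine ⟨k + l, N ^ l * r + N ^ k * s, ?_⟩
      simp only [map_add, map_mul, map_pow, map_natCast, ← hk, ← hl]; ring
    | mul x y _ _ hx hy =>
      obtain ⟨k, r, hk⟩ := hx
      obtain ⟨l, s, hl⟩ := hy
      refine ⟨k + l, r * s, ?_⟩
      rw [map_mul, ← hk, ← hl]; ring
  · rintro ⟨k, r, h⟩
    have : x = (N : K)⁻¹ ^ k * algebraMap R K r := by
      rw [← h, inv_pow, inv_mul_cancel_left₀ (pow_ne_zero _ h0)]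
    rw [this]
    exact mul_mem (pow_mem (Algebra.subset_adjoin (Set.mem_singleton _)) _)
      (algebraMap_mem_adjoin N r)

theorem ofEntry_mem_invert {N : ℕ} {x : K} :
    ofEntry x ∈ (invert R K N).carrier Unit Unit ↔ x ∈ Algebra.adjoin R {(N : K)⁻¹} :=
  ⟨fun h => h () (), fun h _ _ => h⟩

theorem invert_le_localAt {N : ℕ} (hN : N ≠ 0) {p : PrimeSpectrum R} (hp : (N : R) ∉ p.asIdeal) :
    invert R K N ≤ localAt K p := by
  intro Y X _ _ a ha y x
  obtain ⟨k, r, h⟩ := (mem_adjoin_inv hN).1 (ha y x)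
  refine (mem_locRing p).2 ⟨r, N ^ k, fun h' => hp (p.isPrime.mem_of_pow_mem k h'), ?_⟩
  rw [← h, map_pow, map_natCast, mul_comm]

theorem integers_le_localAt (p : PrimeSpectrum R) : integers R K ≤ localAt K p := by
  intro Y X _ _ a ha y x
  obtain ⟨r, h⟩ := ha y x
  rw [← h]
  exact algebraMap_mem_locRing p r

theorem kmul_mem_invert {N : ℕ} {c : K} (hc : c ∈ Algebra.adjoin R {(N : K)⁻¹})
    {a : (mat K).Hom Y X} (ha : a ∈ (invert R K N).carrier Y X) :
    kmul c a ∈ (invert R K N).carrier Y X := fun y x => mul_mem hc (ha y x)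

end Invert

/-! ### Charts -/

/-- A sub-`𝔽`-ring `A` of `𝔽(K)` with localization `A[1/f] = 𝔽(R[1/N])`. -/
structure IsChart (R : Type u) {K : Type u} [CommRing R] [Field K] [Algebra R K] (A : Sub (mat K))
    (N : ℕ) (f : K) : Prop where
  ne_zero : N ≠ 0
  f_ne_zero : f ≠ 0
  le : A ≤ invert R K N
  f_mem : f ∈ A.scalars
  inv_mem : f⁻¹ ∈ Algebra.adjoin R {(N : K)⁻¹}
  exists_pow : ∀ {Y X : Type} [Fintype Y] [Fintype X] (a : (mat K).Hom Y X),
    a ∈ (invert R K N).carrier Y X → ∃ k : ℕ, kmul (f ^ k) a ∈ A.carrier Y X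

namespace IsChart

variable {R K : Type u} [CommRing R] [IsDomain R] [Field K] [CharZero K] [Algebra R K]
variable [IsFractionRing R K] {X Y : Type} [Fintype X] [Fintype Y]
variable {A : Sub (mat K)} {N : ℕ} {f : K} (h : IsChart R A N f)

include h

theorem pow_mem (k : ℕ) : f ^ k ∈ A.scalars := pow_mem_scalars h.f_mem k

theorem lift {x : K} (hx : x ∈ Algebra.adjoin R {(N : K)⁻¹}) : ∃ k : ℕ, f ^ k * x ∈ A.scalars :=
  h.exists_pow _ (ofEntry_mem_invert.2 hx)

theorem le_localAt {q : PrimeSpectrum R} (hq : (N : R) ∉ q.asIdeal) : A ≤ localAt K q :=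
  h.le.trans (invert_le_localAt h.ne_zero hq)

/-- f is a unit of R[1/N], hence of the local ring at q. -/
theorem f_notMem {q : PrimeSpectrum R} (hq : (N : R) ∉ q.asIdeal) (k : ℕ) :
    f ^ k ∉ maxSet K q := by
  intro hf
  have h1 : f⁻¹ ^ k ∈ locRing K q := _root_.pow_mem
    (invert_le_localAt h.ne_zero hq Unit Unit (ofEntry_mem_invert.2 h.inv_mem) () ()) k
  have h2 := mul_mem_maxSet q h1 hf
  rw [inv_pow, inv_mul_cancel₀ (pow_ne_zero _ h.f_ne_zero)] at h2
  exact one_notMem_maxSet q h2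

theorem mul_pow_notMem {q : PrimeSpectrum R} (hq : (N : R) ∉ q.asIdeal) {x : K}
    (hx : x ∉ maxSet K q) (k : ℕ) : f ^ k * x ∉ maxSet K q :=
  mul_notMem_maxSet q (scalars_subset_locRing q (h.le_localAt hq) (h.pow_mem k))
    (h.f_notMem hq k) hx

/-- A matrix over R_q has a denominator b in R outside of q. One power of f brings b times the
matrix into A, another one brings b itself into A. Powers of f are units at q, so f^(k + l) b is an
admissible denominator. -/
theorem locSet_finPrime {q : PrimeSpectrum R} (hq : (N : R) ∉ q.asIdeal) (hA : A ≤ localAt K q) :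
    locSet A.incl (finPrime q hA) Y X = (localAt K q).carrier Y X := by
  ext a
  rw [mem_locSet]
  constructor
  · rintro ⟨g, hg, hgP, hb⟩ y x
    rw [mem_vals_finPrime q hA hg] at hgP
    have h0 : g ≠ 0 := by rintro rfl; exact hgP (zero_mem_maxSet q)
    have h3 : toM a y x = g⁻¹ * toM (kmul g a) y x := by
      rw [toM_kmul, Matrix.smul_apply, smul_eq_mul, inv_mul_cancel_left₀ h0]
    change toM a y x ∈ locRing K q
    rw [h3]
    exact mul_mem (inv_mem_locRing q (scalars_subset_locRing q hA hg) hgP) (hA _ _ hb y x)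
  · intro ha
    obtain ⟨b, hb, hba⟩ := exists_common_denominator q ha
    obtain ⟨k, hk⟩ := h.exists_pow _ (integers_le R K N Y X hba)
    obtain ⟨l, hl⟩ := h.lift (algebraMap_mem_adjoin (K := K) N b)
    have hg : f ^ (k + l) * algebraMap R K b ∈ A.scalars := by
      rw [pow_add, mul_assoc]; exact mul_mem_scalars (h.pow_mem k) hl
    refine ⟨_, hg, ?_, ?_⟩
    · rw [mem_vals_finPrime q hA hg]
      refine h.mul_pow_notMem hq ?_ _
      rwa [algebraMap_mem_maxSet]
    · have := kmul_mem A (h.pow_mem l) hk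
      rw [kmul_kmul, kmul_kmul] at this
      rwa [add_comm, pow_add]

/-- The symmetric primes which do not contain `f` come from `R`. -/
theorem exists_finPrime (P : SymPrime A.ring) (hP : f ∉ P.vals) :
    ∃ (q : PrimeSpectrum R) (hq : (N : R) ∉ q.asIdeal), P = finPrime q (h.le_localAt hq) := by
  have h0 : (N : K) ≠ 0 := Nat.cast_ne_zero.2 h.ne_zero
  -- D is the extension of P to R[1/N] = A[1/f], where sums are available.
  let D : K → Prop := fun x => ∃ k : ℕ, f ^ k * x ∈ P.vals
  have powP (k : ℕ) : f ^ k ∉ P.vals := fun hk => hP (P.mem_of_pow_mem_vals h.f_mem hk)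
  have Dmul {x y : K} (hx : x ∈ Algebra.adjoin R {(N : K)⁻¹}) (hy : D y) : D (x * y) := by
    obtain ⟨k, hk⟩ := h.lift hx
    obtain ⟨l, hl⟩ := hy
    have e : f ^ (k + l) * (x * y) = f ^ k * x * (f ^ l * y) := by ring
    refine ⟨k + l, ?_⟩
    rw [e]
    exact P.mul_mem_vals hk hl
  have Dadd {x y : K} (hx : D x) (hy : D y) : D (x + y) := by
    obtain ⟨k, hk⟩ := hx
    obtain ⟨l, hl⟩ := hy
    have m1 := P.mul_mem_vals (h.pow_mem l) hk
    have m2 := P.mul_mem_vals (h.pow_mem k) hl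
    -- A need not be closed under addition, but f^j times the row (1, 1) lies in A for some j. Used
    -- as a row and as a column it produces f^(2j) times a sum.
    obtain ⟨j, hj⟩ := h.exists_pow (ofM (Matrix.of fun _ _ => 1 : Matrix Unit Bool K))
      (fun _ _ => one_mem _)
    have := P.isIdeal.sum_mem hj (A.tr_mem hj)
      (a := fun i => if i then f ^ l * (f ^ k * x) else f ^ k * (f ^ l * y))
      (by rintro (_ | _) <;> assumption)
    rw [Fintype.sum_bool] at this
    refine ⟨k + l + 2 * j, ?_⟩
    change _ ∈ SymPrime.vals P at this
    convert! this using 1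
    change _ = f ^ j * 1 * (f ^ l * (f ^ k * x) * (f ^ j * 1)) +
      f ^ j * 1 * (f ^ k * (f ^ l * y) * (f ^ j * 1))
    ring
  have Dprime {x y : K} (hx : x ∈ Algebra.adjoin R {(N : K)⁻¹})
      (hy : y ∈ Algebra.adjoin R {(N : K)⁻¹}) (hxy : D (x * y)) : D x ∨ D y := by
    obtain ⟨k, hk⟩ := h.lift hx
    obtain ⟨l, hl⟩ := h.lift hy
    obtain ⟨m, hm⟩ := hxy
    have m1 := P.mul_mem_vals (h.pow_mem (k + l)) hm
    have e : f ^ (k + l) * (f ^ m * (x * y)) = f ^ m * ((f ^ k * x) * (f ^ l * y)) := by ring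
    rw [e] at m1
    rcases P.mem_or_mem_vals (h.pow_mem m) (mul_mem_scalars hk hl) m1 with m3 | m3
    · exact (powP m m3).elim
    · exact (P.mem_or_mem_vals hk hl m3).imp (fun m => ⟨k, m⟩) fun m => ⟨l, m⟩
  have Done : ¬ D 1 := by
    rintro ⟨k, hk⟩
    rw [mul_one] at hk
    exact powP k hk
  have Dzero : D 0 := ⟨0, by rw [mul_zero]; exact P.zero_mem_vals⟩
  have Diff {x : K} (hx : x ∈ A.scalars) : x ∈ P.vals ↔ D x := by
    constructor
    · exact fun hs => ⟨0, by rwa [pow_zero, one_mul]⟩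
    · rintro ⟨k, hk⟩
      exact (P.mem_or_mem_vals (h.pow_mem k) hx hk).resolve_left (powP k)
  have algm (r : R) : algebraMap R K r ∈ Algebra.adjoin R {(N : K)⁻¹} :=
    algebraMap_mem_adjoin (K := K) N r
  let I : Ideal R :=
    { carrier := {r | D (algebraMap R K r)}
      add_mem' := fun {a b} ha hb => by
        change D (algebraMap R K (a + b)); rw [map_add]; exact Dadd ha hb
      zero_mem' := by change D (algebraMap R K 0); rw [map_zero]; exact Dzero
      smul_mem' := fun c r hr => by
        change D (algebraMap R K (c * r)); rw [map_mul]; exact Dmul (algm c) hr }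
  have hI : I.IsPrime := by
    refine ⟨fun hI => Done ?_, fun {a b} hab => ?_⟩
    · rw [← map_one (algebraMap R K)]
      exact (Ideal.eq_top_iff_one I).1 hI
    · refine Dprime (algm a) (algm b) ?_
      rw [← map_mul]; exact hab
  have hN : (N : R) ∉ I := by
    intro hN
    have hN' : D (algebraMap R K N) := hN
    rw [map_natCast] at hN'
    refine Done ?_
    rw [← inv_mul_cancel₀ h0]
    exact Dmul (Algebra.subset_adjoin (Set.mem_singleton _)) hN'
  refine ⟨⟨I, hI⟩, hN, SymPrime.ext_vals (Set.ext fun x => ?_)⟩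
  by_cases hx : x ∈ A.scalars
  swap
  · exact ⟨fun h => (hx (P.vals_subset h)).elim, fun h => (hx (SymPrime.vals_subset _ h)).elim⟩
  rw [Diff hx, mem_vals_finPrime _ _ hx]
  have hs : x ∈ Algebra.adjoin R {(N : K)⁻¹} := h.le _ _ hx () ()
  constructor
  · intro hD
    obtain ⟨k, r, hr⟩ := (mem_adjoin_inv h.ne_zero).1 hs
    refine ⟨r, ?_, (N : R) ^ k, fun hk => hN (hI.mem_of_pow_mem k hk), ?_⟩
    · change D (algebraMap R K r)
      rw [← hr]
      have : (N : K) ^ k ∈ Algebra.adjoin R {(N : K)⁻¹} := _root_.pow_mem (natCast_mem _ N) k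
      exact Dmul this hD
    · rw [← hr, map_pow, map_natCast, mul_comm]
  · rintro ⟨a, ha, b, hb, e⟩
    exact (Dprime hs (algm b) (e ▸ ha)).resolve_right hb

theorem finPrime_injective {q q' : PrimeSpectrum R} (hq : (N : R) ∉ q.asIdeal)
    (hq' : (N : R) ∉ q'.asIdeal)
    (e : finPrime q (h.le_localAt hq) = finPrime q' (h.le_localAt hq')) : q = q' := by
  have key {q q' : PrimeSpectrum R} (hq : (N : R) ∉ q.asIdeal) (hq' : (N : R) ∉ q'.asIdeal)
      (e : finPrime q (h.le_localAt hq) = finPrime q' (h.le_localAt hq')) :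
      q.asIdeal ≤ q'.asIdeal := by
    intro r hr
    obtain ⟨k, hk⟩ := h.lift (algebraMap_mem_adjoin (K := K) N r)
    have h1 : f ^ k * algebraMap R K r ∈ (finPrime q (h.le_localAt hq)).vals := by
      rw [mem_vals_finPrime _ _ hk]
      refine mul_mem_maxSet q (scalars_subset_locRing q (h.le_localAt hq) (h.pow_mem k)) ?_
      rwa [algebraMap_mem_maxSet]
    rw [e, mem_vals_finPrime _ _ hk] at h1
    by_contra hr'
    refine h.mul_pow_notMem hq' ?_ k h1
    rwa [algebraMap_mem_maxSet]
  exact PrimeSpectrum.ext (le_antisymm (key hq hq' e) (key hq' hq e.symm))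

/-- The primes of the chart which come from `R`, with finitely many of them removed, are an open
set. -/
theorem isOpen_compl (hdim : ∀ q : PrimeSpectrum R, q ≠ ⊥ → q.asIdeal.IsMaximal)
    (T : Set (PrimeSpectrum R)) (hT : T.Finite) (h0 : ⊥ ∉ T) :
    IsOpen {P : SymPrime A.ring | ∃ (q : PrimeSpectrum R) (hq : (N : R) ∉ q.asIdeal), q ∉ T ∧
      P = finPrime q (h.le_localAt hq)} := by
  rw [isOpen_iff_forall_mem_open]
  rintro _ ⟨q, hq, hqT, rfl⟩
  -- The members of T are maximal and different from q, so none is contained in q; multiply elements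
  -- that witness this.
  have ex : ∃ r, r ∉ q.asIdeal ∧ ∀ t ∈ T, r ∈ t.asIdeal := by
    have h1 (t : hT.toFinset) : ∃ r ∈ t.1.asIdeal, r ∉ q.asIdeal := by
      have ht : t.1 ∈ T := hT.mem_toFinset.1 t.2
      by_contra! hc
      have := (hdim t.1 (fun e => h0 (e ▸ ht))).eq_of_le q.isPrime.ne_top hc
      exact hqT (PrimeSpectrum.ext this ▸ ht)
    choose r hr hr' using h1
    refine ⟨∏ t, r t, ?_, fun t ht => ?_⟩
    · rw [q.isPrime.prod_mem_iff]
      rintro ⟨t, -, ht⟩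
      exact hr' t ht
    · exact Ideal.mem_of_dvd _ (Finset.dvd_prod_of_mem r
        (Finset.mem_univ ⟨t, hT.mem_toFinset.2 ht⟩)) (hr ⟨t, hT.mem_toFinset.2 ht⟩)
  obtain ⟨r, hr, hrT⟩ := ex
  obtain ⟨k, hk⟩ := h.lift (algebraMap_mem_adjoin (K := K) N r)
  -- f^k r lies in A already. The extra factor f keeps the primes that contain f out of the basic
  -- open set, so that all its members come from R.
  have hg : f ^ (k + 1) * algebraMap R K r ∈ A.scalars := by
    rw [pow_succ', mul_assoc]; exact mul_mem_scalars h.f_mem hk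
  refine ⟨basicOpen A.ring (selt hg), ?_, isOpen_basicOpen _, ?_⟩
  · intro P hP
    rw [mem_basicOpen, sval_selt] at hP
    have hfP : f ∉ P.vals := by
      intro hf
      refine hP ?_
      rw [pow_succ', mul_assoc, mul_comm]
      exact P.mul_mem_vals hk hf
    obtain ⟨q', hq', rfl⟩ := h.exists_finPrime P hfP
    refine ⟨q', hq', fun ht => hP ?_, rfl⟩
    rw [mem_vals_finPrime _ _ hg]
    refine mul_mem_maxSet q' (scalars_subset_locRing q' (h.le_localAt hq') (h.pow_mem _)) ?_
    rw [algebraMap_mem_maxSet]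
    exact hrT q' ht
  · rw [mem_basicOpen, sval_selt, mem_vals_finPrime _ _ hg]
    refine h.mul_pow_notMem hq ?_ _
    rwa [algebraMap_mem_maxSet]

end IsChart

end FOne

namespace FOne
open TopologicalSpace
open FSpace

/-! ### Contractions -/

section Contraction

variable {𝕜 : Type*} [RCLike 𝕜] {X Y : Type} [Fintype X] [Fintype Y]

theorem isContraction_col (a : Matrix X Unit 𝕜) : IsContraction a ↔ ∑ x, ‖a x ()‖ ^ 2 ≤ 1 := by
  have h (v : Unit → 𝕜) : ∑ x, ‖a.mulVec v x‖ ^ 2 = (∑ x, ‖a x ()‖ ^ 2) * ‖v ()‖ ^ 2 := by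
    rw [Finset.sum_mul]
    refine Finset.sum_congr rfl fun x _ => ?_
    simp [Matrix.mulVec, dotProduct, mul_pow]
  rw [isContraction_iff]
  constructor
  · intro ha
    have := ha fun _ => 1
    rw [h] at this
    simpa using this
  · intro ha v
    rw [h]
    simpa using mul_le_mul_of_nonneg_right ha (sq_nonneg ‖v ()‖)

theorem isContraction_row (a : Matrix Unit X 𝕜) : IsContraction a ↔ ∑ x, ‖a () x‖ ^ 2 ≤ 1 := by
  have h := isContraction_col a.transpose
  simp only [Matrix.transpose_apply] at h
  rw [← h]
  exact ⟨fun h => h.transpose, fun h => by simpa using h.transpose⟩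

/-- The operator norm is at most the Hilbert–Schmidt norm, by Cauchy–Schwarz in every row. -/
theorem norm_sq_mulVec_le (a : Matrix Y X 𝕜) (v : X → 𝕜) :
    ∑ y, ‖a.mulVec v y‖ ^ 2 ≤ (∑ y, ∑ x, ‖a y x‖ ^ 2) * ∑ x, ‖v x‖ ^ 2 := by
  rw [Finset.sum_mul]
  refine Finset.sum_le_sum fun y _ => ?_
  have h1 : ‖a.mulVec v y‖ ≤ ∑ x, ‖a y x‖ * ‖v x‖ :=
    (norm_sum_le _ _).trans (Finset.sum_le_sum fun x _ => norm_mul_le _ _)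
  exact (pow_le_pow_left₀ (norm_nonneg _) h1 2).trans
    (Finset.sum_mul_sq_le_sq_mul_sq Finset.univ (fun x => ‖a y x‖) fun x => ‖v x‖)

end Contraction

/-! ### The ring of an archimedean place and its open unit ball -/

section Archimedean

variable {K : Type u} [Field K] {𝕜 : Type} [RCLike 𝕜] {σ : K →+* 𝕜}
variable {X Y : Type} [Fintype X] [Fintype Y]

theorem mem_archimedean_col {a : (mat K).Hom X Unit} :
    a ∈ (archimedean σ).carrier X Unit ↔ ∑ x, ‖σ (toM a x ())‖ ^ 2 ≤ 1 :=
  isContraction_col ((toM a).map σ)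

theorem mem_archimedean_row {a : (mat K).Hom Unit X} :
    a ∈ (archimedean σ).carrier Unit X ↔ ∑ x, ‖σ (toM a () x)‖ ^ 2 ≤ 1 :=
  isContraction_row ((toM a).map σ)

theorem mem_scalars_archimedean {x : K} : x ∈ (archimedean σ).scalars ↔ ‖σ x‖ ≤ 1 := by
  rw [mem_scalars, mem_archimedean_col]
  simp [ofEntry]

theorem mem_archimedean {a : (mat K).Hom Y X} : a ∈ (archimedean σ).carrier Y X ↔
    ∀ v : X → 𝕜, ∑ y, ‖((toM a).map σ).mulVec v y‖ ^ 2 ≤ ∑ x, ‖v x‖ ^ 2 :=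
  isContraction_iff ((toM a).map σ)

theorem norm_le_one {A : Sub (mat K)} (hA : A ≤ archimedean σ) {x : K} (hx : x ∈ A.scalars) :
    ‖σ x‖ ≤ 1 := mem_scalars_archimedean.1 (hA _ _ hx)

/-- C is 1 + S with S the squared Hilbert–Schmidt norm: |c|(1 + S) ≤ 1 implies |c|² S ≤ 1. This
avoids a square root and is positive for the zero matrix too. -/
theorem exists_kmul_mem_archimedean (a : (mat K).Hom Y X) :
    ∃ C : ℝ, 0 < C ∧ ∀ c : K, ‖σ c‖ ≤ C⁻¹ → kmul c a ∈ (archimedean σ).carrier Y X := by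
  refine ⟨1 + ∑ y, ∑ x, ‖(toM a).map σ y x‖ ^ 2, by positivity, fun c hc => mem_archimedean.2 fun v => ?_⟩
  have hS : 0 ≤ ∑ y, ∑ x, ‖(toM a).map σ y x‖ ^ 2 :=
    Finset.sum_nonneg fun y _ => Finset.sum_nonneg fun x _ => sq_nonneg _
  have hv : 0 ≤ ∑ x, ‖v x‖ ^ 2 := Finset.sum_nonneg fun x _ => sq_nonneg _
  have h := norm_sq_mulVec_le ((toM a).map σ) v
  have e : (toM (kmul c a)).map σ = σ c • (toM a).map σ := by
    ext y x; simp [toM_kmul]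
  rw [e]
  simp only [Matrix.smul_mulVec, Pi.smul_apply, smul_eq_mul, norm_mul, mul_pow, ← Finset.mul_sum]
  set S := ∑ y, ∑ x, ‖(toM a).map σ y x‖ ^ 2
  have h1 : ‖σ c‖ * (1 + S) ≤ 1 := by
    rwa [← le_div_iff₀ (by positivity), one_div]
  have h0 := norm_nonneg (σ c)
  have h2 : ‖σ c‖ ^ 2 * S ≤ 1 := by nlinarith [mul_nonneg h0 hS]
  calc _ ≤ ‖σ c‖ ^ 2 * (S * ∑ x, ‖v x‖ ^ 2) := mul_le_mul_of_nonneg_left h (sq_nonneg _)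
    _ = (‖σ c‖ ^ 2 * S) * ∑ x, ‖v x‖ ^ 2 := by ring
    _ ≤ 1 * ∑ x, ‖v x‖ ^ 2 := mul_le_mul_of_nonneg_right h2 hv
    _ = _ := one_mul _

/-- The symmetric prime of a sub-`𝔽`-ring of `archimedean σ` given by the open unit ball. -/
noncomputable def infPrime (σ : K →+* 𝕜) {A : Sub (mat K)} (hA : A ≤ archimedean σ) :
    SymPrime A.ring :=
  SymPrime.ofVals A {x | ‖σ x‖ < 1} (by
    intro X _ b d a hb hd ha _
    change ‖σ _‖ < 1
    have hb' := mem_archimedean_row.1 (hA _ _ hb)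
    have hd' := mem_archimedean_col.1 (hA _ _ hd)
    -- A uniform bound c < 1 exists because X is finite; for empty X it is 0.
    obtain ⟨c, hc0, hc1, hc⟩ : ∃ c : ℝ, 0 ≤ c ∧ c < 1 ∧ ∀ x, ‖σ (a x)‖ ≤ c := by
      rcases isEmpty_or_nonempty X with h | h
      · exact ⟨0, le_rfl, one_pos, fun x => isEmptyElim x⟩
      · obtain ⟨x, hx⟩ := Finite.exists_max fun x => ‖σ (a x)‖
        exact ⟨‖σ (a x)‖, norm_nonneg _, ha x, hx⟩
    -- By 2uv ≤ u² + v² the sum over x is at most c times the mean of the squared lengths of b and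
    -- d, which are at most 1.
    have h1 (x : X) : ‖σ (toM b () x * (a x * toM d x ()))‖ ≤
        c * ((‖σ (toM b () x)‖ ^ 2 + ‖σ (toM d x ())‖ ^ 2) / 2) := by
      rw [map_mul, map_mul, norm_mul, norm_mul]
      have h2 := two_mul_le_add_sq ‖σ (toM b () x)‖ ‖σ (toM d x ())‖
      calc _ = ‖σ (a x)‖ * (‖σ (toM b () x)‖ * ‖σ (toM d x ())‖) := by ring
        _ ≤ c * ((‖σ (toM b () x)‖ ^ 2 + ‖σ (toM d x ())‖ ^ 2) / 2) :=
          mul_le_mul (hc x) (by linarith) (by positivity) hc0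
    rw [map_sum]
    refine ((norm_sum_le _ _).trans (Finset.sum_le_sum fun x _ => h1 x)).trans_lt ?_
    rw [← Finset.mul_sum, ← Finset.sum_div, Finset.sum_add_distrib]
    nlinarith) (by simp) (by
    intro x _ y _ hx hy
    simp only [Set.mem_ofPred_eq, not_lt, map_mul, norm_mul] at *
    nlinarith)

theorem mem_vals_infPrime {A : Sub (mat K)} (hA : A ≤ archimedean σ) {x : K} (hx : x ∈ A.scalars) :
    x ∈ (infPrime σ hA).vals ↔ ‖σ x‖ < 1 := by
  rw [← sval_selt hx, SymPrime.sval_mem_vals]; exact Iff.rfl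

theorem sval_mem_infPrime {A : Sub (mat K)} (hA : A ≤ archimedean σ) {s : A.ring.Hom Unit Unit} :
    s ∈ (infPrime σ hA).carrier ↔ ‖σ (sval s)‖ < 1 := Iff.rfl

end Archimedean

/-! ### The rings R[1/N] ∩ O_σ and their symmetric primes -/

section Intersection

variable {R K : Type u} [CommRing R] [IsDomain R] [Field K] [CharZero K] [Algebra R K]
variable [IsFractionRing R K] {𝕜 : Type} [RCLike 𝕜] {σ : K →+* 𝕜} {N : ℕ}
variable {X Y : Type} [Fintype X] [Fintype Y]

theorem inf_le_archimedean : invert R K N ⊓ archimedean σ ≤ archimedean σ :=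
  fun _ _ _ _ _ h => h.2

theorem mem_scalars_inf {x : K} : x ∈ (invert R K N ⊓ archimedean σ).scalars ↔
    x ∈ Algebra.adjoin R {(N : K)⁻¹} ∧ ‖σ x‖ ≤ 1 :=
  Iff.trans (b := ofEntry x ∈ (invert R K N).carrier Unit Unit ∧ x ∈ (archimedean σ).scalars) Iff.rfl
    (and_congr ofEntry_mem_invert mem_scalars_archimedean)

theorem inv_mem_adjoin : (N : K)⁻¹ ∈ Algebra.adjoin R {(N : K)⁻¹} :=
  Algebra.subset_adjoin (Set.mem_singleton _)

theorem norm_map_natCast : ‖σ N‖ = N := by rw [map_natCast, RCLike.norm_natCast]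

theorem inv_mem_scalars (hN : N ≠ 0) : (N : K)⁻¹ ∈ (invert R K N ⊓ archimedean σ).scalars := by
  refine mem_scalars_inf.2 ⟨inv_mem_adjoin, ?_⟩
  rw [map_inv₀, norm_inv, norm_map_natCast]
  exact inv_le_one_of_one_le₀ (Nat.one_le_cast.2 (Nat.one_le_iff_ne_zero.2 hN))

theorem isChart_integers : IsChart R (integers R K) 1 1 where
  ne_zero := one_ne_zero
  f_ne_zero := one_ne_zero
  le := integers_le R K 1
  f_mem := one_mem_scalars
  inv_mem := by rw [inv_one]; exact one_mem _
  exists_pow a ha := by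
    refine ⟨0, ?_⟩
    rw [pow_zero, one_kmul]
    intro y x
    obtain ⟨k, r, h⟩ := (mem_adjoin_inv one_ne_zero).1 (ha y x)
    rw [Nat.cast_one, one_pow, one_mul] at h
    exact ⟨r, h.symm⟩

theorem isChart_invert (hN : N ≠ 0) : IsChart R (invert R K N) N 1 where
  ne_zero := hN
  f_ne_zero := one_ne_zero
  le := le_rfl
  f_mem := one_mem_scalars
  inv_mem := by rw [inv_one]; exact one_mem _
  exists_pow a ha := ⟨0, by rwa [pow_zero, one_kmul]⟩

/-- Since N > 1, multiplication by a high power of 1/N shrinks any matrix over R[1/N] to a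
contraction at σ, and does not leave R[1/N]. -/
theorem isChart_inf (hN : 1 < N) : IsChart R (invert R K N ⊓ archimedean σ) N (N : K)⁻¹ where
  ne_zero := by omega
  f_ne_zero := inv_ne_zero (Nat.cast_ne_zero.2 (by omega))
  le := fun _ _ _ _ _ h => h.1
  f_mem := inv_mem_scalars (by omega)
  inv_mem := by rw [inv_inv]; exact natCast_mem _ N
  exists_pow a ha := by
    obtain ⟨C, hC0, hC⟩ := exists_kmul_mem_archimedean (σ := σ) a
    obtain ⟨k, hk⟩ := pow_unbounded_of_one_lt C (Nat.one_lt_cast.2 hN : (1 : ℝ) < N)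
    refine ⟨k, kmul_mem_invert (_root_.pow_mem inv_mem_adjoin k) ha, hC _ ?_⟩
    rw [map_pow, map_inv₀, norm_pow, norm_inv, norm_map_natCast, inv_pow]
    exact inv_anti₀ hC0 hk.le

theorem inv_mem_infPrime (hN : 1 < N) :
    (N : K)⁻¹ ∈ (infPrime σ (inf_le_archimedean (R := R) (N := N))).vals := by
  rw [mem_vals_infPrime _ (inv_mem_scalars (by omega)), map_inv₀, norm_inv, norm_map_natCast]
  exact inv_lt_one_of_one_lt₀ (Nat.one_lt_cast.2 hN)

variable [IsIntegralClosure R ℤ K]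

/-- The elements of absolute value one of `R[1/N] ∩ archimedean σ` are units. -/
theorem inv_mem_scalars_of_norm_eq_one (hN : N ≠ 0) {x : K}
    (hx : x ∈ (invert R K N ⊓ archimedean σ).scalars) (h1 : ‖σ x‖ = 1) :
    x⁻¹ ∈ (invert R K N ⊓ archimedean σ).scalars := by
  refine mem_scalars_inf.2 ⟨?_, by rw [map_inv₀, norm_inv, h1, inv_one]⟩
  obtain ⟨k, r, hr⟩ := (mem_adjoin_inv hN).1 (mem_scalars_inf.1 hx).1
  refine (mem_adjoin_inv hN).2 ⟨k, ?_⟩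
  have hr' : IsIntegral ℤ ((N : K) ^ k * x) := IsIntegralClosure.isIntegral_iff.2 ⟨r, hr.symm⟩
  -- On the unit circle the inverse is the complex conjugate, and conjugation preserves integrality
  -- over ℤ. So N^k x⁻¹ is integral along with N^k x.
  have h2 : ((starRingEnd 𝕜).comp σ) ((N : K) ^ k * x) = σ ((N : K) ^ k * x⁻¹) := by
    have h3 : σ x⁻¹ = starRingEnd 𝕜 (σ x) := by
      rw [map_inv₀, RCLike.inv_def, h1]; simp
    rw [RingHom.comp_apply, map_mul, map_mul, map_mul, h3]
    simp
  have h4 : IsIntegral ℤ (σ ((N : K) ^ k * x⁻¹)) := by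
    rw [← h2]
    exact hr'.map ((starRingEnd 𝕜).comp σ).toIntAlgHom
  have h5 : IsIntegral ℤ ((N : K) ^ k * x⁻¹) :=
    (isIntegral_algHom_iff σ.toIntAlgHom σ.injective).1 h4
  obtain ⟨y, hy⟩ := IsIntegralClosure.isIntegral_iff (A := R).1 h5
  exact ⟨y, hy.symm⟩

/-- The open unit ball is the unique maximal ideal of `R[1/N] ∩ archimedean σ`. -/
theorem subset_infPrime (hN : N ≠ 0) {I : Set ((invert R K N ⊓ archimedean σ).ring.Hom Unit Unit)}
    (hI : IsIdeal I) (h1 : (invert R K N ⊓ archimedean σ).ring.one ∉ I) :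
    I ⊆ (infPrime σ inf_le_archimedean).carrier := by
  intro s hs
  rw [sval_mem_infPrime]
  -- An element of absolute value one is a unit of the ring and lies in no proper ideal.
  refine lt_of_le_of_ne (norm_le_one inf_le_archimedean (sval_mem s)) fun h => h1 ?_
  have h' := inv_mem_scalars_of_norm_eq_one hN (sval_mem s) h
  have h0 : sval s ≠ 0 := by rintro h0; simp [h0] at h
  have := hI.mul_mem hs (selt h')
  rwa [show (invert R K N ⊓ archimedean σ).ring.comp s (selt h') =
    (invert R K N ⊓ archimedean σ).ring.one from sval_injective (by
      rw [sval_comp, sval_selt, sval_one, mul_inv_cancel₀ h0])] at this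

/-- The open unit ball is the only symmetric prime which contains `1/N`. -/
theorem eq_infPrime (hN : 1 < N) {P : SymPrime (invert R K N ⊓ archimedean σ).ring}
    (hP : (N : K)⁻¹ ∈ P.vals) : P = infPrime σ inf_le_archimedean := by
  have hN0 : (N : K) ≠ 0 := Nat.cast_ne_zero.2 (by omega)
  refine SymPrime.ext (Set.Subset.antisymm (subset_infPrime (by omega) P.isIdeal P.one_notMem) ?_)
  intro s hs
  rw [sval_mem_infPrime] at hs
  have hs' := sval_mem s
  have hN' : (0 : ℝ) < N := Nat.cast_pos.2 (by omega)
  -- Once |s|^m < 1/N, the product N s^m lies in the ring, so s^m = (N s^m)(1/N) lies in P.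
  obtain ⟨m, hm⟩ := exists_pow_lt_of_lt_one (inv_pos.2 hN') hs
  have h1 : N * sval s ^ m ∈ (invert R K N ⊓ archimedean σ).scalars := by
    refine mem_scalars_inf.2 ⟨mul_mem (natCast_mem _ N)
      (_root_.pow_mem (mem_scalars_inf.1 hs').1 m), ?_⟩
    rw [map_mul, norm_mul, norm_map_natCast, map_pow, norm_pow]
    calc (N : ℝ) * ‖σ (sval s)‖ ^ m ≤ N * (N : ℝ)⁻¹ := mul_le_mul_of_nonneg_left hm.le hN'.le
      _ = 1 := mul_inv_cancel₀ hN'.ne'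
  have h2 := P.mul_mem_vals h1 hP
  rw [mul_comm, inv_mul_cancel_left₀ hN0] at h2
  exact P.sval_mem_vals.1 (P.mem_of_pow_mem_vals hs' h2)

/-- Denominators outside of the open unit ball are units, so localizing changes nothing. -/
theorem locSet_infPrime (hN : N ≠ 0) :
    locSet (invert R K N ⊓ archimedean σ).incl (infPrime σ inf_le_archimedean) Y X =
      (invert R K N ⊓ archimedean σ).carrier Y X := by
  ext a
  rw [mem_locSet]
  constructor
  · rintro ⟨x, hx, hxP, ha⟩
    rw [mem_vals_infPrime _ hx, not_lt] at hxP
    have h1 := le_antisymm (norm_le_one inf_le_archimedean hx) hxP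
    have h0 : x ≠ 0 := by rintro rfl; simp at h1
    have := kmul_mem _ (mem_scalars.1 (inv_mem_scalars_of_norm_eq_one hN hx h1)) ha
    rwa [kmul_kmul, inv_mul_cancel₀ h0, one_kmul] at this
  · refine fun ha => ⟨1, one_mem_scalars, SymPrime.one_notMem_vals _, ?_⟩
    rwa [one_kmul]

end Intersection

end FOne

namespace FOne
open TopologicalSpace
open FSpace

/-! ### The topology of the compactification -/

/-! ### Finiteness of primes and denominators -/

section Arithmetic

variable {R : Type u} [CommRing R] [IsDedekindDomain R]

theorem finite_setOf_mem {r : R} (hr : r ≠ 0) : {q : PrimeSpectrum R | r ∈ q.asIdeal}.Finite := by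
  have h := Ideal.finite_factors (I := Ideal.span {r}) (by simpa using hr)
  refine (h.image fun v => (⟨v.asIdeal, v.isPrime⟩ : PrimeSpectrum R)).subset fun q hq => ?_
  exact ⟨⟨q.asIdeal, q.isPrime, by rintro h0; rw [Set.mem_ofPred_eq, h0] at hq; exact hr hq⟩,
    Ideal.dvd_span_singleton.2 hq, rfl⟩

theorem isMaximal_of_ne_bot (q : PrimeSpectrum R) (hq : q ≠ ⊥) : q.asIdeal.IsMaximal :=
  q.isPrime.isMaximal fun h => hq (PrimeSpectrum.ext h)

variable (K : Type u) [Field K] [CharZero K] [Algebra R K] [IsFractionRing R K]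
variable [IsIntegralClosure R ℤ K]

include K

theorem natCast_ne_zero {n : ℕ} (hn : n ≠ 0) : (n : R) ≠ 0 := by
  intro h
  have := congrArg (algebraMap R K) h
  rw [map_natCast, map_zero, Nat.cast_eq_zero] at this
  exact hn this

/-- R is integral over ℤ, so a non-zero prime meets ℤ in a non-zero ideal; it contains a prime
factor of any non-zero integer in it. -/
theorem exists_prime_mem {q : PrimeSpectrum R} (hq : q ≠ ⊥) :
    ∃ p : ℕ, p.Prime ∧ (p : R) ∈ q.asIdeal := by
  have key (n : ℕ) : n ≠ 0 → (n : R) ∈ q.asIdeal → ∃ p : ℕ, p.Prime ∧ (p : R) ∈ q.asIdeal := by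
    induction n using induction_on_primes with
    | zero => exact fun h => (h rfl).elim
    | one => exact fun _ h => (q.isPrime.one_notMem (by simpa using h)).elim
    | prime_mul p n hp ih =>
      intro h0 h
      rw [Nat.cast_mul] at h
      rcases q.isPrime.mem_or_mem h with h | h
      · exact ⟨p, hp, h⟩
      · exact ih (right_ne_zero_of_mul h0) h
  obtain ⟨r, hr, hr0⟩ := Submodule.exists_mem_ne_zero_of_ne_bot
    (fun h => hq (PrimeSpectrum.ext h) : q.asIdeal ≠ ⊥)
  have hr' : IsIntegral ℤ r := IsIntegralClosure.isIntegral ℤ K r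
  obtain ⟨n, hn, hn0⟩ := Submodule.exists_mem_ne_zero_of_ne_bot
    (Ideal.comap_ne_bot_of_integral_mem hr0 hr hr')
  rw [Ideal.mem_comap, eq_intCast] at hn
  refine key n.natAbs (Int.natAbs_ne_zero.2 hn0) ?_
  have h : (n : R) ∣ ((n.natAbs : ℤ) : R) := Int.cast_dvd_cast _ _ Int.dvd_natAbs_self
  rw [Int.cast_natCast] at h
  exact q.asIdeal.mem_of_dvd h hn

/-- Least common multiples of rational primes, one in each member of T. With this N the members of T
can be removed from neighbourhoods of an infinite place in X_N. -/
theorem exists_sqFree {T : Set (PrimeSpectrum R)} (hT : T.Finite) (h0 : ⊥ ∉ T) :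
    ∃ N : SqFree, ∀ q ∈ T, (N.N : R) ∈ q.asIdeal := by
  induction T, hT using Set.Finite.induction_on with
  | empty => exact ⟨SqFree.nonempty.some, fun _ h => h.elim⟩
  | @insert q T _ _ ih =>
    obtain ⟨N, hN⟩ := ih fun h => h0 (Or.inr h)
    obtain ⟨p, hp, hpq⟩ := exists_prime_mem (R := R) K (q := q) fun h => h0 (Or.inl h.symm)
    obtain ⟨M, hNM, hpM⟩ := SqFree.directed N ⟨p, hp.squarefree, hp.one_lt⟩
    have up {a b : ℕ} (h : a ∣ b) {q : PrimeSpectrum R} (ha : (a : R) ∈ q.asIdeal) :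
        (b : R) ∈ q.asIdeal := q.asIdeal.mem_of_dvd (Nat.cast_dvd_cast h) ha
    refine ⟨M, ?_⟩
    rintro q' (rfl | hq')
    · exact up hpM hpq
    · exact up hNM (hN q' hq')

variable {K} {X Y : Type} [Fintype X] [Fintype Y]

theorem mem_localAt_bot (a : (mat K).Hom Y X) :
    a ∈ (localAt K (⊥ : PrimeSpectrum R)).carrier Y X := by
  intro y x
  obtain ⟨r, s, hs, h⟩ := IsFractionRing.div_surjective (A := R) (toM a y x)
  refine (mem_locRing _).2 ⟨r, s, fun h0 => nonZeroDivisors.ne_zero hs h0, ?_⟩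
  change toM a y x * _ = _
  rw [← h, div_mul_cancel₀]
  exact IsFractionRing.to_map_ne_zero_of_mem_nonZeroDivisors hs

theorem exists_denominator (a : (mat K).Hom Y X) :
    ∃ b : R, b ≠ 0 ∧ kmul (algebraMap R K b) a ∈ (integers R K).carrier Y X := by
  obtain ⟨b, hb, h⟩ := exists_common_denominator (⊥ : PrimeSpectrum R) (mem_localAt_bot a)
  exact ⟨b, hb, h⟩

/-- Only the primes that contain a fixed common denominator can fail. -/
theorem finite_notMem_localAt (a : (mat K).Hom Y X) :
    {q : PrimeSpectrum R | a ∉ (localAt K q).carrier Y X}.Finite := by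
  obtain ⟨b, hb, h⟩ := exists_denominator (R := R) a
  refine (finite_setOf_mem hb).subset fun q hq => ?_
  by_contra hbq
  refine hq fun y x => ?_
  obtain ⟨r, hr⟩ := h y x
  refine (mem_locRing _).2 ⟨r, b, hbq, ?_⟩
  rw [hr, mul_comm]; rfl

/-- Choose N in all primes over a common denominator b. Then N lies in the radical of (b), so b
divides a power of N. -/
theorem exists_mem_invert (a : (mat K).Hom Y X) :
    ∃ N : SqFree, a ∈ (invert R K N.N).carrier Y X := by
  obtain ⟨b, hb, h⟩ := exists_denominator (R := R) a
  obtain ⟨N, hN⟩ := exists_sqFree (R := R) K (finite_setOf_mem hb) (by exact hb)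
  have hNb : (N.N : R) ∈ (Ideal.span {b}).radical := by
    rw [Ideal.radical_eq_sInf, Submodule.mem_sInf]
    rintro J ⟨hJ, hJ'⟩
    exact hN ⟨J, hJ'⟩ (hJ (Ideal.mem_span_singleton_self b))
  obtain ⟨k, hk⟩ := hNb
  obtain ⟨c, hc⟩ := Ideal.mem_span_singleton.1 hk
  refine ⟨N, fun y x => (mem_adjoin_inv (by have := N.one_lt; omega)).2 ⟨k, ?_⟩⟩
  obtain ⟨r, hr⟩ := h y x
  refine ⟨c * r, ?_⟩
  rw [map_mul, hr, ← map_natCast (algebraMap R K), ← map_pow, hc, map_mul]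
  change _ = _ * (algebraMap R K b * toM a y x)
  change _ * toM a y x = _
  ring

end Arithmetic

/-! #### The places -/

section Space

variable (R K : Type u) [CommRing R] [IsDedekindDomain R] [Field K] [CharZero K] [Algebra R K]
variable [IsFractionRing R K] [IsIntegralClosure R ℤ K]
variable {γ : Type u} {𝕜 : Type} [RCLike 𝕜] (τ : γ → K →+* 𝕜)

/-- The charts of `X_N`. -/
noncomputable abbrev archCharts (N : SqFree) : Charts (mat K) (Option γ) :=
  charts R K (fun σ => archimedean (τ σ)) N

variable {R K τ}

theorem SqFree.ne_zero (N : SqFree) : N.N ≠ 0 := N.squarefree.ne_zero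

theorem comap_finPrime {A B : Sub (mat K)} (h : A ≤ B) {q : PrimeSpectrum R}
    (hB : B ≤ localAt K q) :
    (finPrime q hB).comap (Sub.inclusion h) = finPrime q (h.trans hB) :=
  SymPrime.ext (comap_carrier A.incl_injective _ _)

theorem comap_infPrime {A B : Sub (mat K)} (h : A ≤ B) {σ : K →+* 𝕜}
    (hB : B ≤ archimedean σ) :
    (infPrime σ hB).comap (Sub.inclusion h) = infPrime σ (h.trans hB) :=
  SymPrime.ext (comap_carrier A.incl_injective _ _)

theorem one_notMem_asIdeal (q : PrimeSpectrum R) : ((1 : ℕ) : R) ∉ q.asIdeal := by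
  rw [Nat.cast_one]; exact q.isPrime.one_notMem

theorem exists_eq_finPrime_integers (P : SymPrime (integers R K).ring) :
    ∃ q : PrimeSpectrum R, P = finPrime q (integers_le_localAt q) := by
  obtain ⟨q, _, h⟩ := isChart_integers.exists_finPrime P P.one_notMem_vals
  exact ⟨q, h⟩

theorem exists_eq_finPrime_invert {N : ℕ} (hN : N ≠ 0) (P : SymPrime (invert R K N).ring) :
    ∃ (q : PrimeSpectrum R) (hq : (N : R) ∉ q.asIdeal), P = finPrime q (invert_le_localAt hN hq) :=
  (isChart_invert hN).exists_finPrime P P.one_notMem_vals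

theorem exists_eq_finPrime_inf {N : ℕ} (hN : 1 < N) {σ : K →+* 𝕜}
    (P : SymPrime (invert R K N ⊓ archimedean σ).ring) (hP : (N : K)⁻¹ ∉ P.vals) :
    ∃ (q : PrimeSpectrum R) (hq : (N : R) ∉ q.asIdeal),
      P = finPrime q ((isChart_inf hN).le_localAt hq) :=
  (isChart_inf hN).exists_finPrime P hP

/-- The place of a point of the chart `spec R`. -/
noncomputable def placeFin (P : SymPrime (integers R K).ring) : PrimeSpectrum R :=
  (exists_eq_finPrime_integers P).choose

open Classical in
/-- The place of a point of the chart of `σ`. -/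
noncomputable def placeInf (τ : γ → K →+* 𝕜) (N : SqFree) (σ : γ)
    (P : SymPrime (invert R K N.N ⊓ archimedean (τ σ)).ring) : PrimeSpectrum R ⊕ γ :=
  if h : (N.N : K)⁻¹ ∈ P.vals then Sum.inr σ
  else Sum.inl (exists_eq_finPrime_inf N.one_lt P h).choose

/-- The place of a point of a chart. -/
noncomputable def chartPlace (N : SqFree) :
    (Σ i : Option γ, SymPrime ((archCharts R K τ N).A i).ring) → PrimeSpectrum R ⊕ γ
  | ⟨none, P⟩ => Sum.inl (placeFin P)
  | ⟨some σ, P⟩ => placeInf τ N σ P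

theorem placeFin_finPrime (q : PrimeSpectrum R) :
    placeFin (K := K) (finPrime q (integers_le_localAt q)) = q := by
  have h := (exists_eq_finPrime_integers (K := K) (finPrime q (integers_le_localAt q))).choose_spec
  exact (isChart_integers.finPrime_injective (one_notMem_asIdeal _) (one_notMem_asIdeal _) h).symm

theorem inv_notMem_finPrime (N : SqFree) {σ : K →+* 𝕜} {q : PrimeSpectrum R}
    (hq : (N.N : R) ∉ q.asIdeal) :
    (N.N : K)⁻¹ ∉ (finPrime q ((isChart_inf (σ := σ) N.one_lt).le_localAt hq)).vals := by
  rw [mem_vals_finPrime _ _ (inv_mem_scalars N.ne_zero), ← pow_one (N.N : K)⁻¹]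
  exact (isChart_inf (σ := σ) N.one_lt).f_notMem hq 1

theorem placeInf_finPrime (N : SqFree) (σ : γ) {q : PrimeSpectrum R} (hq : (N.N : R) ∉ q.asIdeal) :
    placeInf τ N σ (finPrime q ((isChart_inf N.one_lt).le_localAt hq)) = Sum.inl q := by
  have h0 := inv_notMem_finPrime N (σ := τ σ) hq
  obtain ⟨hq', h⟩ := (exists_eq_finPrime_inf N.one_lt _ h0).choose_spec
  exact (dif_neg h0).trans
    (congrArg Sum.inl ((isChart_inf N.one_lt).finPrime_injective hq hq' h).symm)

theorem placeInf_infPrime (N : SqFree) (σ : γ) :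
    placeInf (R := R) τ N σ (infPrime (τ σ) inf_le_archimedean) = Sum.inr σ :=
  dif_pos (inv_mem_infPrime N.one_lt)

theorem inf_prime_cases (N : SqFree) {σ : K →+* 𝕜}
    (P : SymPrime (invert R K N.N ⊓ archimedean σ).ring) :
    P = infPrime σ inf_le_archimedean ∨ ∃ (q : PrimeSpectrum R) (hq : (N.N : R) ∉ q.asIdeal),
      P = finPrime q ((isChart_inf N.one_lt).le_localAt hq) := by
  by_cases h : (N.N : K)⁻¹ ∈ P.vals
  · exact .inl (eq_infPrime N.one_lt h)
  · exact .inr (exists_eq_finPrime_inf N.one_lt P h)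

/-- The place of a point of `X_N`. -/
noncomputable def place (N : SqFree) : (archCharts R K τ N).space.pt → PrimeSpectrum R ⊕ γ :=
  Quot.lift (chartPlace N) (by
    -- A point of the overlap spec R[1/N] comes from a prime of R and has that prime as its place in
    -- every chart. So places are well defined on the glued space.
    have key (i : Option γ) (q : PrimeSpectrum R) (hq : (N.N : R) ∉ q.asIdeal) :
        chartPlace (τ := τ) N ⟨i, (finPrime q (invert_le_localAt N.ne_zero hq)).comap
          (Sub.inclusion ((archCharts R K τ N).le i))⟩ = Sum.inl q := by
      cases i with
      | none =>
        exact congrArg Sum.inl ((congrArg placeFin (comap_finPrime (integers_le R K N.N)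
          (invert_le_localAt N.ne_zero hq))).trans (placeFin_finPrime q))
      | some σ =>
        exact (congrArg (placeInf τ N σ) (comap_finPrime (isChart_inf N.one_lt).le
          (invert_le_localAt N.ne_zero hq))).trans (placeInf_finPrime N σ hq)
    rintro ⟨i, _⟩ ⟨j, _⟩ ⟨P, hi, hj⟩
    rw [hi, hj]
    obtain ⟨q, hq, rfl⟩ := exists_eq_finPrime_invert N.ne_zero P
    exact (key i q hq).trans (key j q hq).symm)

variable (τ) in
/-- The point of `X_N` given by a place. -/
noncomputable def placePt (N : SqFree) : PrimeSpectrum R ⊕ γ → (archCharts R K τ N).space.pt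
  | .inl q => (archCharts R K τ N).point none (finPrime q (integers_le_localAt q))
  | .inr σ => (archCharts R K τ N).point (some σ) (infPrime (τ σ) inf_le_archimedean)

theorem place_placePt (N : SqFree) (v : PrimeSpectrum R ⊕ γ) : place N (placePt (K := K) τ N v) = v := by
  cases v with
  | inl q => exact congrArg Sum.inl (placeFin_finPrime q)
  | inr σ => exact placeInf_infPrime N σ

/-- A prime that does not contain N comes from the overlap, and the glueing identifies its images in
the two charts. -/
theorem placePt_inl_eq (N : SqFree) (σ : γ) {q : PrimeSpectrum R} (hq : (N.N : R) ∉ q.asIdeal) :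
    (archCharts R K τ N).point (some σ) (finPrime q ((isChart_inf N.one_lt).le_localAt hq)) =
      placePt τ N (.inl q) := by
  have h := (archCharts R K τ N).glueData.inj_r (some σ) none
    (finPrime q (invert_le_localAt N.ne_zero hq))
  refine Eq.trans ?_ (h.trans ?_)
  · exact congrArg _ (comap_finPrime _ _).symm
  · exact congrArg _ (comap_finPrime _ _)

theorem exists_placePt (N : SqFree) (x : (archCharts R K τ N).space.pt) :
    ∃ v, x = placePt τ N v := by
  obtain ⟨⟨i, P⟩, rfl⟩ := Quot.exists_rep x
  cases i with
  | none =>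
    obtain ⟨q, hq⟩ := exists_eq_finPrime_integers P
    exact ⟨.inl q, congrArg ((archCharts R K τ N).point none) hq⟩
  | some σ =>
    rcases inf_prime_cases N P with h | ⟨q, hq, h⟩
    · exact ⟨.inr σ, congrArg ((archCharts R K τ N).point (some σ)) h⟩
    · exact ⟨.inl q, (congrArg ((archCharts R K τ N).point (some σ)) h).trans (placePt_inl_eq N σ hq)⟩

theorem placePt_place (N : SqFree) (x : (archCharts R K τ N).space.pt) :
    placePt τ N (place N x) = x := by
  obtain ⟨v, rfl⟩ := exists_placePt N x
  rw [place_placePt]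

variable (R K τ) in
/-- The inverse system of the `X_N`. -/
noncomputable abbrev archSys : ProSys.{u} SqFree := compactSys R K fun σ => archimedean (τ σ)

theorem archSys_placePt {N M : SqFree} (h : N ≤ M) (v : PrimeSpectrum R ⊕ γ) :
    ((archSys R K τ).f h).toFun (placePt τ M v) = placePt τ N v := by
  cases v with
  | inl q =>
    exact congrArg ((archCharts R K τ N).point none) (comap_finPrime le_rfl (integers_le_localAt q))
  | inr σ =>
    exact congrArg ((archCharts R K τ N).point (some σ)) (comap_infPrime _ inf_le_archimedean)

variable (τ) in
/-- The point of the limit given by a place. -/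
noncomputable def limPt (v : PrimeSpectrum R ⊕ γ) : (archSys R K τ).Pt :=
  ⟨fun N => placePt τ N v, fun _ _ h => archSys_placePt h v⟩

theorem limPt_injective : Function.Injective (limPt (R := R) τ) := by
  intro v w h
  have N : SqFree := SqFree.nonempty.some
  have h1 : placePt τ N v = placePt τ N w := congrFun (congrArg Subtype.val h) N
  rw [← place_placePt (τ := τ) N v, h1, place_placePt]

/-- The places of the components of a coherent family do not depend on N, since the transition maps
preserve places and any two indices have a common multiple. -/
theorem limPt_surjective : Function.Surjective (limPt (R := R) τ) := by
  intro x
  have key {N M : SqFree} (h : N ≤ M) : place N (x.1 N) = place M (x.1 M) := by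
    have h1 := x.2 N M h
    have h2 : x.1 M = placePt τ M (place M (x.1 M)) := (placePt_place M (x.1 M)).symm
    have h3 := archSys_placePt (τ := τ) h (place M (x.1 M))
    rw [← h1, h2, h3, place_placePt, place_placePt]
  let N₀ : SqFree := SqFree.nonempty.some
  refine ⟨place N₀ (x.1 N₀), Subtype.ext (funext fun N => ?_)⟩
  obtain ⟨M, h, h'⟩ := SqFree.directed N₀ N
  change placePt τ N (place N₀ (x.1 N₀)) = x.1 N
  rw [key h, ← key h']
  exact placePt_place N (x.1 N)

theorem isFinitePrime_limPt (q : PrimeSpectrum R) :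
    IsFinitePrime (O := fun σ => archimedean (τ σ)) q (limPt τ (.inl q)) := by
  refine fun N => ⟨finPrime q (integers_le_localAt q), fun s => ?_, rfl⟩
  refine (mem_finPrime q (integers_le_localAt q) s).trans ?_
  constructor
  · intro h
    obtain ⟨r, hr⟩ := Sub.incl_mem (integers R K) s () ()
    have hr' : algebraMap R K r = sval (A := integers R K) s := hr
    rw [← hr', algebraMap_mem_maxSet] at h
    exact ⟨r, h, hr⟩
  · rintro ⟨r, hr, h⟩
    rw [← algebraMap_mem_maxSet (K := K), h] at hr
    exact hr

theorem isInfinitePrime_limPt (σ : γ) :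
    IsInfinitePrime (R := R) (O := fun σ => archimedean (τ σ)) σ (limPt τ (.inr σ)) :=
  fun N => ⟨infPrime (τ σ) inf_le_archimedean, fun _ hI h1 => subset_infPrime N.ne_zero hI h1, rfl⟩

/-- The set is examined in each chart. The chart of σ consists of σ and the primes that do not
contain N, so it lies in the set entirely if σ ∈ W, by the condition on N. If σ ∉ W, what is left
are primes from R with finitely many removed. -/
theorem isOpen_place (N : SqFree) {W : Set (PrimeSpectrum R ⊕ γ)} (h0 : .inl ⊥ ∈ W)
    (hW : {q : PrimeSpectrum R | Sum.inl q ∉ W}.Finite)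
    (hN : ∀ σ, .inr σ ∈ W → ∀ q : PrimeSpectrum R, .inl q ∉ W → (N.N : R) ∈ q.asIdeal) :
    IsOpen {x : (archCharts R K τ N).space.pt | place N x ∈ W} := by
  refine isOpen_coinduced.2 (isOpen_sigma_iff.2 fun i => ?_)
  cases i with
  | none =>
    change IsOpen {P : SymPrime (integers R K).ring | Sum.inl (placeFin P) ∈ W}
    convert! isChart_integers.isOpen_compl (K := K) isMaximal_of_ne_bot _ hW (by simpa using h0) using 1
    ext P
    obtain ⟨q, rfl⟩ := exists_eq_finPrime_integers P
    rw [Set.mem_ofPred_eq, placeFin_finPrime]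
    constructor
    · exact fun h => ⟨q, one_notMem_asIdeal q, fun h' => h' h, rfl⟩
    · rintro ⟨q', hq', h, e⟩
      have := isChart_integers.finPrime_injective (one_notMem_asIdeal _) hq' e
      subst this
      simpa using h
  | some σ =>
    change IsOpen {P : SymPrime (invert R K N.N ⊓ archimedean (τ σ)).ring | placeInf τ N σ P ∈ W}
    by_cases hσ : Sum.inr σ ∈ W
    · convert! isOpen_univ using 1
      refine Set.eq_univ_of_forall fun P => ?_
      rw [Set.mem_ofPred_eq]
      rcases inf_prime_cases N P with rfl | ⟨q, hq, rfl⟩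
      · rw [placeInf_infPrime]; exact hσ
      · rw [placeInf_finPrime N σ hq]
        by_contra hc
        exact hq (hN σ hσ q hc)
    · convert! (isChart_inf (σ := τ σ) N.one_lt).isOpen_compl isMaximal_of_ne_bot _ hW
        (by simpa using h0) using 1
      ext P
      rw [Set.mem_ofPred_eq]
      rcases inf_prime_cases N P with rfl | ⟨q, hq, rfl⟩
      · rw [placeInf_infPrime]
        refine iff_of_false hσ ?_
        rintro ⟨q, hq, -, e⟩
        have h := inv_mem_infPrime (R := R) (σ := τ σ) N.one_lt
        rw [e] at h
        exact inv_notMem_finPrime N hq h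
      · rw [placeInf_finPrime N σ hq]
        constructor
        · exact fun h => ⟨q, hq, fun h' => h' h, rfl⟩
        · rintro ⟨q', hq', h, e⟩
          have := (isChart_inf (σ := τ σ) N.one_lt).finPrime_injective hq hq' e
          subst this
          simpa using h

end Space

end FOne

namespace FOne
open TopologicalSpace
open FSpace

/-! ### Cofinite topologies with a generic point -/

section Cofinite

variable {X : Type*} [TopologicalSpace X] {g : X}
  (h : ∀ U : Set X, IsOpen U ↔ U = ∅ ∨ (g ∈ U ∧ Uᶜ.Finite))

include h

theorem isClosed_of_cofinite {Z : Set X} (hZ : Z.Finite) (hg : g ∉ Z) : IsClosed Z := by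
  rw [← isOpen_compl_iff, h]
  exact .inr ⟨hg, by rwa [compl_compl]⟩

/-- A proper closed set is finite and does not contain g. Its subsets are closed as well, so if
irreducible it is a point. The whole space is irreducible because of g, and {x} below it gives a
chain of length one. -/
theorem topologicalKrullDim_of_cofinite {x : X} (hx : x ≠ g) : topologicalKrullDim X = 1 := by
  refine le_antisymm ?_ ?_
  · refine Order.krullDim_le_one_iff.2 fun Z => ?_
    rcases (h (Z : Set X)ᶜ).1 Z.isClosed.isOpen_compl with h0 | ⟨hg, hf⟩
    · refine .inr fun Z' _ => ?_
      intro y _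
      by_contra hy
      have : y ∈ (Z : Set X)ᶜ := hy
      rw [h0] at this
      exact this
    · rw [compl_compl] at hf
      left
      obtain ⟨y, hy⟩ := Z.isIrreducible.1
      have hsub : ∀ z ∈ (Z : Set X), z = y := by
        intro z hz
        by_contra hzy
        obtain ⟨w, hwZ, hw, hw'⟩ := Z.isIrreducible.2 _ _
          (isClosed_of_cofinite h (Z := (Z : Set X) \ {y}) (hf.subset Set.sdiff_subset)
            fun hg' => hg hg'.1).isOpen_compl
          (isClosed_of_cofinite h (Z := {y}) (Set.finite_singleton y)
            fun hg' => hg (by rw [Set.mem_singleton_iff.1 hg']; exact hy)).isOpen_compl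
          ⟨y, hy, fun h => h.2 rfl⟩ ⟨z, hz, hzy⟩
        exact hw ⟨hwZ, hw'⟩
      intro Z' hZ' z hz
      obtain ⟨z', hz'⟩ := Z'.isIrreducible.1
      rw [hsub z hz, ← hsub z' (hZ' hz')]
      exact hz'
  · refine Order.one_le_krullDim_iff.2 ?_
    have hg {U : Set X} (hU : IsOpen U) (hne : U.Nonempty) : g ∈ U := by
      rcases (h U).1 hU with rfl | hU
      · exact (Set.not_nonempty_empty hne).elim
      · exact hU.1
    refine ⟨⟨{x}, isIrreducible_singleton, isClosed_of_cofinite h (Set.finite_singleton x) hx.symm⟩,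
      ⟨Set.univ, ⟨⟨g, trivial⟩, ?_⟩, isClosed_univ⟩, ?_⟩
    · rintro U V hU hV ⟨y, -, hy⟩ ⟨z, -, hz⟩
      exact ⟨g, trivial, hg hU ⟨y, hy⟩, hg hV ⟨z, hz⟩⟩
    · refine lt_of_le_of_ne (fun _ _ => trivial) fun e => ?_
      have : g ∈ ({x} : Set X) := by
        have := congrArg (fun Z : IrreducibleCloseds X => (Z : Set X)) e
        change {x} = Set.univ at this
        rw [this]; trivial
      exact hx this.symm

end Cofinite

/-! ### Open sets of the limit -/

section Space

variable {R K : Type u} [CommRing R] [IsDedekindDomain R] [Field K] [CharZero K] [Algebra R K]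
variable [IsFractionRing R K] [IsIntegralClosure R ℤ K]
variable {γ : Type u} {𝕜 : Type} [RCLike 𝕜] {τ : γ → K →+* 𝕜}

/-- A basic open set omits the primes that contain one element r. Here r ≠ 0, because the zero prime
is not omitted, and a non-zero element lies in finitely many primes. -/
theorem finite_finPrime_notMem {V : Set (SymPrime (integers R K).ring)} (hV : IsOpen V)
    (h0 : finPrime ⊥ (integers_le_localAt ⊥) ∈ V) :
    {q : PrimeSpectrum R | finPrime q (integers_le_localAt q) ∉ V}.Finite := by
  induction hV with
  | basic V hV =>
    obtain ⟨g, -, rfl⟩ := hV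
    obtain ⟨r, hr⟩ := Sub.incl_mem (integers R K) g () ()
    have hr' : algebraMap R K r = sval g := hr
    have key (q : PrimeSpectrum R) :
        finPrime q (integers_le_localAt q) ∉ basicOpen (integers R K).ring g ↔ r ∈ q.asIdeal := by
      rw [mem_basicOpen, not_not, mem_vals_finPrime _ _ (sval_mem g), ← hr', algebraMap_mem_maxSet]
    have hr0 : r ≠ 0 := by
      rintro rfl
      exact (key ⊥).2 (Submodule.zero_mem _) h0
    refine (finite_setOf_mem hr0).subset fun q hq => (key q).1 hq
  | univ => simp
  | inter U V _ _ hU hV =>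
    refine ((hU h0.1).union (hV h0.2)).subset fun q hq => ?_
    by_contra hc
    simp only [Set.mem_union, Set.mem_ofPred_eq, not_or, not_not] at hc
    exact hq hc
  | sUnion S _ ih =>
    obtain ⟨V, hV, h0⟩ := h0
    exact (ih V hV h0).subset fun q hq hqV => hq ⟨V, hV, hqV⟩

/-- The map from `spec R` to the limit. -/
noncomputable def limIntegers (τ : γ → K →+* 𝕜) (P : SymPrime (integers R K).ring) :
    (archSys R K τ).Pt :=
  ⟨fun N => (archCharts R K τ N).point none P, fun N _ _ =>
    congrArg ((archCharts R K τ N).point none) (SymPrime.comap_id _ (fun _ => rfl) P)⟩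

theorem continuous_limIntegers : Continuous (limIntegers (R := R) τ) :=
  Continuous.subtype_mk (continuous_pi fun N =>
    (archCharts R K τ N).glueData.continuous_inj none) _

theorem zeroPrime_eq {A : Sub (mat K)} (hA : A ≤ localAt K (⊥ : PrimeSpectrum R)) :
    zeroPrime A.incl_injective = finPrime ⊥ hA := by
  refine SymPrime.ext (Set.ext fun s => ?_)
  rw [mem_finPrime]
  change sval s = 0 ↔ _
  constructor
  · intro h; rw [h]; exact zero_mem_maxSet _
  · rintro ⟨a, ha, b, hb, h⟩
    have ha' : a = 0 := ha
    rw [ha', map_zero] at h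
    exact (mul_eq_zero.1 h).resolve_right (algebraMap_ne_zero hb)

/-! #### The sheaf -/

theorem specMap_inclusion_compat {A B : Sub (mat K)} (h : A ≤ B) :
    (specMap (Sub.inclusion h)).Compat (specModel B.incl_injective)
      (specModel A.incl_injective) :=
  specMap_compat A.incl_injective B.incl_injective _ fun _ => rfl

/-- The sections of the sheaf of `X_N`. -/
noncomputable def archModel (R : Type u) {K : Type u} [CommRing R] [IsDedekindDomain R] [Field K]
    [CharZero K] [Algebra R K] [IsFractionRing R K] [IsIntegralClosure R ℤ K] {γ : Type u}
    {𝕜 : Type} [RCLike 𝕜] (τ : γ → K →+* 𝕜) (N : SqFree) :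
    Model (archCharts R K τ N).space (mat K) :=
  glueModel (m := specModel (Sub.incl_injective _)) (n := fun _ => specModel (Sub.incl_injective _))
    (fun i => specMap_inclusion_compat ((archCharts R K τ N).le i)) none

theorem archModel_compat {N M : SqFree} (h : N ≤ M) :
    ((archSys R K τ).f h).Compat (archModel R τ M) (archModel R τ N) :=
  glueHom_compat (fun i => specMap_inclusion_compat ((archCharts R K τ M).le i))
    (fun i => specMap_inclusion_compat ((archCharts R K τ N).le i)) none _
    fun _ => specMap_inclusion_compat _

/-- The sections of the sheaf of the limit. -/
noncomputable def archLimModel (R : Type u) {K : Type u} [CommRing R] [IsDedekindDomain R] [Field K]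
    [CharZero K] [Algebra R K] [IsFractionRing R K] [IsIntegralClosure R ℤ K] {γ : Type u}
    {𝕜 : Type} [RCLike 𝕜] (τ : γ → K →+* 𝕜) : Model (archSys R K τ).lim (mat K) :=
  limModel fun {_ _} h => archModel_compat h

theorem archLimModel_gen : (archLimModel R τ).gen = limPt τ (.inl ⊥) :=
  Subtype.ext (funext fun N => congrArg ((archCharts R K τ N).point none)
    (zeroPrime_eq (integers_le_localAt ⊥)))

/-- The open sets of the limit. -/
theorem isOpen_limPt_iff [Finite γ] (U : Set (archSys R K τ).Pt) :
    IsOpen U ↔ U = ∅ ∨ (limPt τ (.inl ⊥) ∈ U ∧ Uᶜ.Finite) := by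
  constructor
  · intro hU
    rcases U.eq_empty_or_nonempty with h | ⟨x, hx⟩
    · exact .inl h
    right
    have h0 : limPt τ (.inl ⊥) ∈ U := by
      rw [← archLimModel_gen]
      exact (archLimModel R τ).gen_mem ⟨U, hU⟩ x hx
    refine ⟨h0, ?_⟩
    -- Pulled back to spec R, the set omits finitely many primes. Besides these only the finitely
    -- many infinite places can be missing.
    have h1 := finite_finPrime_notMem (hU.preimage continuous_limIntegers) h0
    refine (((h1.image Sum.inl).union (Set.finite_range Sum.inr)).image (limPt τ)).subset ?_
    intro y hy
    obtain ⟨v, rfl⟩ := limPt_surjective y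
    refine ⟨v, ?_, rfl⟩
    cases v with
    | inl q => exact .inl ⟨q, hy, rfl⟩
    | inr σ => exact .inr ⟨σ, rfl⟩
  · rintro (rfl | ⟨h0, hU⟩)
    · exact isOpen_empty
    have hT : {q : PrimeSpectrum R | limPt τ (.inl q) ∉ U}.Finite :=
      (hU.preimage (limPt_injective.comp Sum.inl_injective).injOn :)
    -- When N lies in all omitted primes, the set comes from an open set of X_N, whichever infinite
    -- places it contains.
    obtain ⟨N, hN⟩ := exists_sqFree K hT (by simpa using h0)
    have h1 := isOpen_place (τ := τ) N (W := limPt τ ⁻¹' U) h0 hT fun _ _ q hq => hN q hq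
    convert! h1.preimage ((archSys R K τ).continuous_val N) using 1
    ext x
    obtain ⟨v, rfl⟩ := limPt_surjective x
    change _ ↔ limPt τ (place N (placePt τ N v)) ∈ U
    rw [place_placePt]

variable {X Y : Type} [Fintype X] [Fintype Y]

/-- A prime that does not contain N may be seen in several charts; all of them give the same local
ring. -/
theorem archModel_loc_inl (N : SqFree) (q : PrimeSpectrum R) :
    (archModel R τ N).loc (placePt τ N (.inl q)) Y X = (localAt K q).carrier Y X := by
  have hnone := isChart_integers.locSet_finPrime (K := K) (X := X) (Y := Y) (one_notMem_asIdeal q)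
    (integers_le_localAt q)
  ext a
  constructor
  · intro h
    rw [← hnone]
    exact h none _ rfl
  · intro h i P hP
    have hP' := congrArg (place N) hP
    rw [place_placePt] at hP'
    cases i with
    | none =>
      obtain ⟨q', hq'⟩ := exists_eq_finPrime_integers P
      have h1 : Sum.inl (placeFin P) = Sum.inl q := hP'
      rw [hq', placeFin_finPrime, Sum.inl.injEq] at h1
      subst h1
      change a ∈ locSet (integers R K).incl P Y X
      rw [hq', hnone]
      exact h
    | some σ =>
      have h1 : placeInf τ N σ P = Sum.inl q := hP'
      change a ∈ locSet (invert R K N.N ⊓ archimedean (τ σ)).incl P Y X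
      rcases inf_prime_cases N P with e | ⟨q', hq, e⟩
      · rw [e, placeInf_infPrime] at h1
        cases h1
      · rw [e, placeInf_finPrime N σ hq, Sum.inl.injEq] at h1
        subst h1
        rw [e, (isChart_inf N.one_lt).locSet_finPrime hq]
        exact h

theorem archModel_loc_inr (N : SqFree) (σ : γ) :
    (archModel R τ N).loc (placePt τ N (.inr σ)) Y X =
      (invert R K N.N ⊓ archimedean (τ σ)).carrier Y X := by
  ext a
  constructor
  · intro h
    rw [← locSet_infPrime N.ne_zero]
    exact h (some σ) _ rfl
  · intro h i P hP
    have hP' := congrArg (place N) hP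
    rw [place_placePt] at hP'
    cases i with
    | none => cases hP'
    | some σ' =>
      have h1 : placeInf τ N σ' P = Sum.inr σ := hP'
      rcases inf_prime_cases N P with e | ⟨q', hq, e⟩
      · rw [e, placeInf_infPrime, Sum.inr.injEq] at h1
        subst h1
        change a ∈ locSet (invert R K N.N ⊓ archimedean (τ σ')).incl P Y X
        rw [e, locSet_infPrime N.ne_zero]
        exact h
      · rw [e, placeInf_finPrime N σ' hq] at h1
        cases h1

/-- A matrix is integral at all but finitely many primes. The primes where it is integral, without
any infinite place, form an open set of every X_N. -/
theorem archLimModel_loc_inl (q : PrimeSpectrum R) :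
    (archLimModel R τ).loc (limPt τ (.inl q)) Y X = (localAt K q).carrier Y X := by
  ext a
  constructor
  · rintro ⟨N, W, hW, h⟩
    rw [← archModel_loc_inl (τ := τ) N]
    exact h _ hW
  · intro h
    let N : SqFree := SqFree.nonempty.some
    let W : Set (PrimeSpectrum R ⊕ γ) := {v | ∃ q', v = .inl q' ∧ a ∈ (localAt K q').carrier Y X}
    have hW := isOpen_place (τ := τ) N (W := W) ⟨⊥, rfl, mem_localAt_bot a⟩
      ((finite_notMem_localAt a).subset fun q hq h => hq ⟨q, rfl, h⟩) (by rintro σ ⟨q, h, -⟩; cases h)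
    refine ⟨N, ⟨_, hW⟩, ?_, ?_⟩
    · change place N (placePt τ N (.inl q)) ∈ W
      rw [place_placePt]
      exact ⟨q, rfl, h⟩
    · rintro y ⟨q', h', ha⟩
      rw [← placePt_place N y, h', archModel_loc_inl]
      exact ha

/-- In X_N the condition at σ is membership in R[1/N] ∩ O_σ. The restriction on denominators
disappears in the limit, because every matrix is defined over some R[1/N]. -/
theorem archLimModel_loc_inr (σ : γ) :
    (archLimModel R τ).loc (limPt τ (.inr σ)) Y X = (archimedean (τ σ)).carrier Y X := by
  ext a
  constructor
  · rintro ⟨N, W, hW, h⟩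
    have := h _ hW
    change a ∈ (archModel R τ N).loc (placePt τ N (.inr σ)) Y X at this
    rw [archModel_loc_inr] at this
    exact this.2
  · intro h
    obtain ⟨N, hN⟩ := exists_mem_invert (R := R) a
    have hN0 : (N.N : R) ≠ 0 := natCast_ne_zero K N.ne_zero
    let W : Set (PrimeSpectrum R ⊕ γ) :=
      {v | v = .inr σ ∨ ∃ q : PrimeSpectrum R, v = .inl q ∧ (N.N : R) ∉ q.asIdeal}
    have hW := isOpen_place (τ := τ) N (W := W) (.inr ⟨⊥, rfl, hN0⟩)
      ((finite_setOf_mem hN0).subset fun q hq => by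
        by_contra h; exact hq (.inr ⟨q, rfl, h⟩))
      (fun σ _ q hq => by by_contra h; exact hq (.inr ⟨q, rfl, h⟩))
    refine ⟨N, ⟨_, hW⟩, ?_, ?_⟩
    · change place N (placePt τ N (.inr σ)) ∈ W
      rw [place_placePt]
      exact .inl rfl
    · intro y hy
      rw [← placePt_place N y]
      rcases hy with h' | ⟨q, h', hq⟩
      · rw [h', archModel_loc_inr]
        exact ⟨hN, h⟩
      · rw [h', archModel_loc_inl]
        exact invert_le_localAt N.ne_zero hq _ _ hN

/-- The homomorphism from a stalk of the limit to `𝔽(K)`. -/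
noncomputable abbrev stalkVal (R : Type u) {K : Type u} [CommRing R] [IsDedekindDomain R] [Field K]
    [CharZero K] [Algebra R K] [IsFractionRing R K] [IsIntegralClosure R ℤ K] {γ : Type u}
    {𝕜 : Type} [RCLike 𝕜] (τ : γ → K →+* 𝕜) (x : (archSys R K τ).lim.pt) :
    FHom ((archSys R K τ).lim.stalk x).toFData (mat K).toFData :=
  (archLimModel R τ).stalkVal x

/-- The condition of `limModel` at a point is by construction a condition on a neighbourhood in some
X_N, so it is an open one. -/
theorem mem_range_stalkVal_iff (x : (archSys R K τ).lim.pt) (a : (mat K).Hom Y X) :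
    a ∈ (Sub.range (stalkVal R τ x)).carrier Y X ↔ a ∈ (archLimModel R τ).loc x Y X := by
  rw [Model.mem_range_stalkVal]
  constructor
  · rintro ⟨U, hU, h⟩
    exact h x hU
  · rintro ⟨N, W, hW, h⟩
    exact ⟨⟨_, W.isOpen.preimage ((archSys R K τ).continuous_val N)⟩, hW, fun y hy => ⟨N, W, hy, h⟩⟩

theorem range_stalkVal_inl (q : PrimeSpectrum R) :
    Sub.range (stalkVal R τ (limPt τ (.inl q))) = localAt K q := by
  ext Y X _ _ a
  exact (mem_range_stalkVal_iff _ a).trans (Set.ext_iff.1 (archLimModel_loc_inl q) a)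

theorem range_stalkVal_inr (σ : γ) :
    Sub.range (stalkVal R τ (limPt τ (.inr σ))) = archimedean (τ σ) := by
  ext Y X _ _ a
  exact (mem_range_stalkVal_iff _ a).trans (Set.ext_iff.1 (archLimModel_loc_inr σ) a)

theorem range_stalkVal_germ (U : Opens (archSys R K τ).lim.pt) (x : (archSys R K τ).lim.pt)
    (hx : x ∈ U) :
    (Sub.range ((stalkVal R τ x).comp ((archSys R K τ).lim.germ U x hx))).carrier Y X =
      {a | (∀ q : PrimeSpectrum R, limPt τ (.inl q) ∈ U → a ∈ (localAt K q).carrier Y X) ∧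
        ∀ σ : γ, limPt τ (.inr σ) ∈ U → a ∈ (archimedean (τ σ)).carrier Y X} := by
  ext a
  refine ((archLimModel R τ).mem_range U ((archLimModel R τ).gen_mem _ _ hx) a).trans ?_
  constructor
  · refine fun h => ⟨fun q hq => ?_, fun σ hσ => ?_⟩
    · rw [← archLimModel_loc_inl (τ := τ)]
      exact h _ hq
    · rw [← archLimModel_loc_inr (R := R)]
      exact h _ hσ
  · intro h y hy
    obtain ⟨v, rfl⟩ := limPt_surjective y
    cases v with
    | inl q => rw [archLimModel_loc_inl]; exact h.1 q hy
    | inr σ => rw [archLimModel_loc_inr]; exact h.2 σ hy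

end Space

end FOne

namespace FOne
open TopologicalSpace
open FSpace

/-! ### Valuation sub-`𝔽`-rings -/

section Rows

variable {K : Type u} [Field K] {X Y : Type} [Fintype X] [Fintype Y]

/-- A vector as a row. -/
def rowM (b : X → K) : (mat K).Hom Unit X := ofM (Matrix.of fun _ x => b x)

/-- The rows of a sub-`𝔽`-ring. -/
def Sub.rows (B : Sub (mat K)) (X : Type) [Fintype X] : Set (X → K) :=
  {b | rowM b ∈ B.carrier Unit X}

theorem mem_rows {B : Sub (mat K)} {b : X → K} : b ∈ B.rows X ↔ rowM b ∈ B.carrier Unit X := Iff.rfl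

theorem mem_rows_iff_tr {B : Sub (mat K)} {b : X → K} :
    b ∈ B.rows X ↔ (mat K).tr (rowM b) ∈ B.carrier X Unit :=
  ⟨fun h => B.tr_mem h, fun h => by
    have := B.tr_mem h
    rwa [(mat K).lawful.tr_tr] at this⟩

theorem row_mem_rows {B : Sub (mat K)} {b : (mat K).Hom Unit X} (hb : b ∈ B.carrier Unit X) :
    (fun x => toM b () x) ∈ B.rows X := hb

theorem col_mem_rows {B : Sub (mat K)} {b : (mat K).Hom X Unit} (hb : b ∈ B.carrier X Unit) :
    (fun x => toM b x ()) ∈ B.rows X := B.tr_mem hb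

theorem entry_comp_comp (b' : (mat K).Hom Unit Y) (a : (mat K).Hom Y X) (b : (mat K).Hom X Unit) :
    entry ((mat K).comp b' ((mat K).comp a b)) =
      ∑ y, toM b' () y * ∑ x, toM a y x * toM b x () := by
  rw [entry, toM_comp, toM_comp, Matrix.mul_apply]
  simp only [Matrix.mul_apply]

theorem sum_mem_scalars {B : Sub (mat K)} {a : (mat K).Hom Y X} (ha : a ∈ B.carrier Y X)
    {b' : Y → K} (hb' : b' ∈ B.rows Y) {b : X → K} (hb : b ∈ B.rows X) :
    ∑ y, b' y * ∑ x, toM a y x * b x ∈ B.scalars := by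
  have h := B.comp_mem hb' (B.comp_mem ha (mem_rows_iff_tr.1 hb))
  rw [← entry_mem_scalars, entry_comp_comp] at h
  exact h

theorem dot_mem_scalars {B : Sub (mat K)} {b' b : X → K} (hb' : b' ∈ B.rows X)
    (hb : b ∈ B.rows X) : ∑ x, b' x * b x ∈ B.scalars := by
  have h := B.comp_mem hb' (mem_rows_iff_tr.1 hb)
  rw [← entry_mem_scalars, entry, toM_comp, Matrix.mul_apply] at h
  exact h

theorem single_mem_rows [DecidableEq X] (B : Sub (mat K)) (x : X) :
    (Pi.single x 1 : X → K) ∈ B.rows X := by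
  classical
  let φ : X ≃. Unit := PEquiv.single x ()
  have h := B.emb_mem φ
  rw [mem_rows]
  convert! h using 1
  refine toM_injective (Matrix.ext fun u z => ?_)
  refine Eq.trans ?_ (mat_emb_apply (B := K) φ u z).symm
  by_cases hz : z = x
  · subst hz
    rw [if_pos (by simp [φ])]
    simp [rowM]
  · rw [if_neg]
    · simp [rowM, hz]
    · simp [φ, PEquiv.single_apply_of_ne (Ne.symm hz)]

end Rows

section Tame

variable {K : Type u} [Field K] {X Y : Type} [Fintype X] [Fintype Y] {B : Sub (mat K)}

/-- The axioms in terms of elements of K. Columns are transposes of rows, so rows suffice. -/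
theorem isVal_of_tame (full : ∀ (Y X : Type) [Fintype Y] [Fintype X] (a : (mat K).Hom Y X),
      ∃ d ∈ B.scalars, d ≠ 0 ∧ kmul d a ∈ B.carrier Y X)
    (tame : ∀ (Y X : Type) [Fintype Y] [Fintype X] (a : (mat K).Hom Y X),
      (∀ b' ∈ B.rows Y, ∀ b ∈ B.rows X, ∑ y, b' y * ∑ x, toM a y x * b x ∈ B.scalars) →
      a ∈ B.carrier Y X)
    (inv : ∀ x : K, x ≠ 0 → x ∈ B.scalars ∨ x⁻¹ ∈ B.scalars) : IsVal B where
  full Y X _ _ a := by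
    obtain ⟨d, hd, hd0, ha⟩ := full Y X a
    refine ⟨ofEntry d, hd, fun h => hd0 ?_, ?_⟩
    · rw [← entry_ofEntry d, h, entry_zero]
    · rwa [scal_comp_eq_kmul]
  tame Y X _ _ := by
    refine Set.Subset.antisymm (fun a ha b' hb' b hb => B.comp_mem hb' (B.comp_mem ha hb))
      fun a ha => tame Y X a fun b' hb' b hb => ?_
    have h := ha _ hb' _ (mem_rows_iff_tr.1 hb)
    rw [← entry_mem_scalars, entry_comp_comp] at h
    exact h
  mem_or_inv_mem a a' h _ := by
    have h1 := congrArg entry h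
    rw [entry_comp, entry_one] at h1
    have h0 : entry a ≠ 0 := left_ne_zero_of_mul_eq_one h1
    rw [← entry_mem_scalars, ← entry_mem_scalars, eq_inv_of_mul_eq_one_right h1]
    exact inv _ h0

namespace IsVal

variable (hB : IsVal B)

include hB

theorem exists_kmul_mem (a : (mat K).Hom Y X) :
    ∃ d ∈ B.scalars, d ≠ 0 ∧ kmul d a ∈ B.carrier Y X := by
  obtain ⟨d, hd, hd0, ha⟩ := hB.full Y X a
  refine ⟨entry d, hd, fun h => hd0 (entry_injective (by rw [h, entry_zero])), ?_⟩
  rwa [scal_comp_eq_kmul] at ha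

theorem mem_or_inv {x : K} (hx : x ≠ 0) : x ∈ B.scalars ∨ x⁻¹ ∈ B.scalars := by
  refine hB.mem_or_inv_mem (ofEntry x) (ofEntry x⁻¹) ?_ ?_ <;>
  · refine entry_injective ?_
    rw [entry_comp, entry_one, entry_ofEntry, entry_ofEntry]
    field_simp

theorem mem_iff {a : (mat K).Hom Y X} : a ∈ B.carrier Y X ↔
    ∀ b' ∈ B.rows Y, ∀ b ∈ B.rows X, ∑ y, b' y * ∑ x, toM a y x * b x ∈ B.scalars := by
  refine ⟨fun ha b' hb' b hb => sum_mem_scalars ha hb' hb, fun h => ?_⟩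
  rw [hB.tame]
  intro b' hb' b hb
  rw [← entry_mem_scalars, entry_comp_comp]
  exact h _ (row_mem_rows hb') _ (col_mem_rows hb)

/-- Tameness for a one-point target: the set of rows is its own dual under the dot product. The
classification rests on this. -/
theorem mem_rows_iff {b : X → K} : b ∈ B.rows X ↔ ∀ b' ∈ B.rows X, ∑ x, b x * b' x ∈ B.scalars := by
  refine ⟨fun h b' hb' => dot_mem_scalars h hb', fun h => ?_⟩
  rw [mem_rows, hB.mem_iff]
  intro c hc b' hb'
  rw [Fintype.sum_unique]
  exact mul_mem_scalars (show c () ∈ B.scalars from hc) (h b' hb')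

/-- By tameness the rows and the scalars determine all arrows, and scalars are rows over a point. -/
theorem ext_rows {B' : Sub (mat K)} (hB' : IsVal B')
    (h : ∀ (X : Type) [Fintype X], B.rows X = B'.rows X) : B = B' := by
  have hs : B.scalars = B'.scalars := by
    ext x
    have := Set.ext_iff.1 (h Unit) fun _ => x
    exact this
  ext Y X _ _ a
  rw [hB.mem_iff, hB'.mem_iff, h, h, hs]

end IsVal

end Tame

/-! #### Local rings -/

section LocalAt

variable {R K : Type u} [CommRing R] [IsDedekindDomain R] [Field K] [CharZero K] [Algebra R K]
variable [IsFractionRing R K] [IsIntegralClosure R ℤ K]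

/-- The local ring at (0) is K; at any other prime it is a discrete valuation ring. -/
theorem mem_or_inv_mem_locRing (q : PrimeSpectrum R) (x : K) :
    x ∈ locRing K q ∨ x⁻¹ ∈ locRing K q := by
  by_cases hq : q.asIdeal = ⊥
  · left
    obtain ⟨r, s, hs, h⟩ := IsFractionRing.div_surjective (A := R) x
    refine (mem_locRing _).2 ⟨r, s, fun h0 => nonZeroDivisors.ne_zero hs (by rwa [hq] at h0), ?_⟩
    rw [← h, div_mul_cancel₀]
    exact IsFractionRing.to_map_ne_zero_of_mem_nonZeroDivisors hs
  · let A := Localization.subalgebra.ofField K q.asIdeal.primeCompl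
      q.asIdeal.primeCompl_le_nonZeroDivisors
    have : IsLocalization.AtPrime A q.asIdeal :=
      Localization.subalgebra.isLocalization_ofField K _ q.asIdeal.primeCompl_le_nonZeroDivisors
    have : IsFractionRing A K :=
      Localization.subalgebra.isFractionRing_ofField K _ q.asIdeal.primeCompl_le_nonZeroDivisors
    have : IsDiscreteValuationRing A :=
      IsLocalization.AtPrime.isDiscreteValuationRing_of_dedekind_domain R hq A
    rcases ValuationRing.isInteger_or_isInteger A x with ⟨a, ha⟩ | ⟨a, ha⟩
    · left; rw [← ha]; exact a.2
    · right; rw [← ha]; exact a.2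

theorem mem_scalars_localAt {q : PrimeSpectrum R} {x : K} :
    x ∈ (localAt K q).scalars ↔ x ∈ locRing K q := ⟨fun h => h () (), fun h _ _ => h⟩

/-- Fullness comes from common denominators. For tameness, unit vectors pick out single entries. -/
theorem isVal_localAt (q : PrimeSpectrum R) : IsVal (localAt K q) := by
  refine isVal_of_tame (fun Y X _ _ a => ?_) (fun Y X _ _ a h y x => ?_) fun x _ => ?_
  · obtain ⟨b, hb, h⟩ := exists_common_denominator (⊥ : PrimeSpectrum R) (mem_localAt_bot a)
    have hb0 : b ≠ 0 := hb
    refine ⟨algebraMap R K b, mem_scalars_localAt.2 (algebraMap_mem_locRing q b), ?_,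
      integers_le_localAt q _ _ h⟩
    rwa [Ne, IsFractionRing.to_map_eq_zero_iff (K := K)]
  · classical
    have := h _ (single_mem_rows _ y) _ (single_mem_rows _ x)
    simp only [Pi.single_apply, mul_ite, mul_one, mul_zero, Finset.sum_ite_eq', Finset.mem_univ,
      if_true, ite_mul, one_mul, zero_mul] at this
    exact mem_scalars_localAt.1 this
  · rw [mem_scalars_localAt, mem_scalars_localAt]
    exact mem_or_inv_mem_locRing q x

end LocalAt

/-! #### Archimedean places -/

section Arch

variable {K : Type u} [Field K] [CharZero K] {𝕜 : Type} [RCLike 𝕜] {σ : K →+* 𝕜}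
variable {X Y : Type} [Fintype X] [Fintype Y]

theorem mem_rows_archimedean {b : X → K} :
    b ∈ (archimedean σ).rows X ↔ ∑ x, ‖σ (b x)‖ ^ 2 ≤ 1 := mem_archimedean_row

/-- If σ(x) is not real, then 1 and σ(x) span 𝕜 over ℝ, so ℚ + ℚσ(x) is dense. -/
theorem denseRange_or_im_eq_zero (σ : K →+* 𝕜) : DenseRange σ ∨ ∀ x, RCLike.im (σ x) = 0 := by
  by_contra! h
  obtain ⟨hd, x, hx⟩ := h
  refine hd ?_
  have h1 : DenseRange (fun p : ℚ × ℚ => ((p.1 : ℝ), (p.2 : ℝ))) :=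
    Rat.denseRange_cast.prodMap Rat.denseRange_cast
  have h2 : Function.Surjective fun p : ℝ × ℝ => (p.1 : 𝕜) + (p.2 : 𝕜) * σ x := by
    intro z
    obtain ⟨c, hc⟩ : ∃ c : ℝ, c * RCLike.im (σ x) = RCLike.im z :=
      ⟨RCLike.im z / RCLike.im (σ x), div_mul_cancel₀ _ hx⟩
    refine ⟨(RCLike.re z - c * RCLike.re (σ x), c), ?_⟩
    apply RCLike.ext
    · simp
    · simp [hc]
  have h3 : Continuous fun p : ℝ × ℝ => (p.1 : 𝕜) + (p.2 : 𝕜) * σ x :=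
    (RCLike.continuous_ofReal.comp continuous_fst).add
      ((RCLike.continuous_ofReal.comp continuous_snd).mul continuous_const)
  have h4 := h2.denseRange.comp h1 h3
  refine h4.mono ?_
  rintro _ ⟨p, rfl⟩
  exact ⟨p.1 + p.2 * x, by simp⟩

/-- The hypothesis bounds the bilinear form on vectors over K of length at most one. Lengths of
vectors over K need not lie in K, so u and v are divided by rationals q and r slightly larger than
their lengths; then r and q are brought down to the lengths, one after the other. -/
theorem norm_sum_sq_le {a : (mat K).Hom Y X}
    (h : ∀ b' ∈ (archimedean σ).rows Y, ∀ b ∈ (archimedean σ).rows X,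
      ∑ y, b' y * ∑ x, toM a y x * b x ∈ (archimedean σ).scalars) (u : Y → K) (v : X → K) :
    ‖∑ y, σ (u y) * ∑ x, σ (toM a y x) * σ (v x)‖ ^ 2 ≤
      (∑ y, ‖σ (u y)‖ ^ 2) * ∑ x, ‖σ (v x)‖ ^ 2 := by
  set P := ∑ y, ‖σ (u y)‖ ^ 2 with hP
  set Q := ∑ x, ‖σ (v x)‖ ^ 2 with hQ
  set t := ‖∑ y, σ (u y) * ∑ x, σ (toM a y x) * σ (v x)‖ with ht
  have hP0 : 0 ≤ P := Finset.sum_nonneg fun _ _ => sq_nonneg _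
  have hQ0 : 0 ≤ Q := Finset.sum_nonneg fun _ _ => sq_nonneg _
  have scale {Z : Type} [Fintype Z] (w : Z → K) (q : ℚ) (hq : √(∑ z, ‖σ (w z)‖ ^ 2) < q) :
      (fun z => (q : K)⁻¹ * w z) ∈ (archimedean σ).rows Z := by
    rw [mem_rows_archimedean]
    have hq0 : (0 : ℝ) < q := (Real.sqrt_nonneg _).trans_lt hq
    simp only [map_mul, norm_mul, mul_pow, ← Finset.mul_sum, map_inv₀, norm_inv, map_ratCast]
    have : ‖(q : 𝕜)‖ = q := by
      rw [← RCLike.ofReal_ratCast, RCLike.norm_ofReal, abs_of_pos hq0]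
    rw [this, inv_pow, inv_mul_le_iff₀ (by positivity), mul_one]
    rw [← Real.sqrt_le_left hq0.le]
    exact hq.le
  have key (q r : ℚ) (hq : √P < q) (hr : √Q < r) : t ≤ q * r := by
    have hq0 : (0 : ℝ) < q := (Real.sqrt_nonneg _).trans_lt hq
    have hr0 : (0 : ℝ) < r := (Real.sqrt_nonneg _).trans_lt hr
    have h1 := mem_scalars_archimedean.1 (h _ (scale u q hq) _ (scale v r hr))
    have hn (s : ℚ) (hs : (0 : ℝ) < s) : ‖(s : 𝕜)‖ = s := by
      rw [← RCLike.ofReal_ratCast, RCLike.norm_ofReal, abs_of_pos hs]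
    have e : σ (∑ y, (q : K)⁻¹ * u y * ∑ x, toM a y x * ((r : K)⁻¹ * v x)) =
        (q : 𝕜)⁻¹ * (r : 𝕜)⁻¹ * ∑ y, σ (u y) * ∑ x, σ (toM a y x) * σ (v x) := by
      simp only [map_sum, map_mul, map_inv₀, map_ratCast, Finset.mul_sum]
      refine Finset.sum_congr rfl fun y _ => Finset.sum_congr rfl fun x _ => ?_
      ring
    rw [e, norm_mul, norm_mul, norm_inv, norm_inv, hn q hq0, hn r hr0, ← mul_inv,
      inv_mul_le_iff₀ (by positivity), mul_one] at h1
    exact h1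
  have key2 (q : ℚ) (hq : √P < q) : t ≤ q * √Q := by
    have hq0 : (0 : ℝ) < q := (Real.sqrt_nonneg _).trans_lt hq
    rw [← div_le_iff₀' hq0]
    refine le_of_forall_lt_rat_imp_le fun r hr => ?_
    rw [div_le_iff₀' hq0]
    exact key q r hq hr
  have key3 : t ≤ √P * √Q := by
    rcases (Real.sqrt_nonneg Q).eq_or_lt with h0 | h0
    · obtain ⟨q, hq⟩ := exists_rat_gt √P
      have := key2 q hq
      rw [← h0] at this ⊢
      simpa using this
    · rw [← div_le_iff₀ h0]
      refine le_of_forall_lt_rat_imp_le fun q hq => ?_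
      rw [div_le_iff₀ h0]
      exact key2 q hq
  calc t ^ 2 ≤ (√P * √Q) ^ 2 := pow_le_pow_left₀ (norm_nonneg _) key3 2
    _ = P * Q := by rw [mul_pow, Real.sq_sqrt hP0, Real.sq_sqrt hQ0]

theorem norm_sum_star_mul (w : Y → 𝕜) : ‖∑ y, star (w y) * w y‖ = ∑ y, ‖w y‖ ^ 2 := by
  have : ∑ y, star (w y) * w y = ((∑ y, ‖w y‖ ^ 2 : ℝ) : 𝕜) := by
    push_cast
    exact Finset.sum_congr rfl fun y _ => RCLike.conj_mul _
  rw [this, RCLike.norm_ofReal, abs_of_nonneg (Finset.sum_nonneg fun _ _ => sq_nonneg _)]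

theorem le_of_sq_le_mul {S T : ℝ} (hT : 0 ≤ T) (h : S ^ 2 ≤ S * T) : S ≤ T := by
  by_contra! hc
  nlinarith

/-- By density the bound holds for all vectors over 𝕜. For u the conjugate of a v it reads |av|⁴ ≤
|av|²|v|². -/
theorem isContraction_of_denseRange (hd : DenseRange σ) {a : Matrix Y X 𝕜}
    (h : ∀ (u : Y → K) (v : X → K), ‖∑ y, σ (u y) * ∑ x, a y x * σ (v x)‖ ^ 2 ≤
      (∑ y, ‖σ (u y)‖ ^ 2) * ∑ x, ‖σ (v x)‖ ^ 2) : IsContraction a := by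
  have dY : DenseRange fun (u : Y → K) y => σ (u y) := DenseRange.piMap fun _ => hd
  have dX : DenseRange fun (u : X → K) y => σ (u y) := DenseRange.piMap fun _ => hd
  have key (u : Y → 𝕜) (v : X → 𝕜) : ‖∑ y, u y * ∑ x, a y x * v x‖ ^ 2 ≤
      (∑ y, ‖u y‖ ^ 2) * ∑ x, ‖v x‖ ^ 2 := by
    refine dY.induction_on u (isClosed_le (by fun_prop) (by fun_prop)) fun u => ?_
    refine dX.induction_on v (isClosed_le (by fun_prop) (by fun_prop)) fun v => ?_
    exact h u v
  rw [isContraction_iff]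
  intro v
  have h1 := key (fun y => star (a.mulVec v y)) v
  have h2 : ∑ y, star (a.mulVec v y) * ∑ x, a y x * v x =
      ∑ y, star (a.mulVec v y) * a.mulVec v y := rfl
  rw [h2, norm_sum_star_mul] at h1
  simp only [norm_star] at h1
  exact le_of_sq_le_mul
    (Finset.sum_nonneg fun _ _ => sq_nonneg _) h1

/-- A real matrix acts separately on real and imaginary parts, whose squared lengths add up. -/
theorem isContraction_of_real {a : Matrix Y X 𝕜} {a' : Matrix Y X ℝ} (ha : a = a'.map (↑))
    (h : IsContraction a') : IsContraction a := by
  rw [isContraction_iff] at h ⊢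
  intro v
  have h1 (y : Y) : ‖a.mulVec v y‖ ^ 2 = ‖a'.mulVec (fun x => RCLike.re (v x)) y‖ ^ 2 +
      ‖a'.mulVec (fun x => RCLike.im (v x)) y‖ ^ 2 := by
    rw [RCLike.norm_sq_eq_def, Real.norm_eq_abs, Real.norm_eq_abs, sq_abs, sq_abs, ha]
    simp [Matrix.mulVec, dotProduct]
    ring
  have h2 (x : X) : ‖v x‖ ^ 2 = ‖RCLike.re (v x)‖ ^ 2 + ‖RCLike.im (v x)‖ ^ 2 := by
    rw [RCLike.norm_sq_eq_def, Real.norm_eq_abs, Real.norm_eq_abs, sq_abs, sq_abs]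
    ring
  simp only [h1, h2, Finset.sum_add_distrib]
  exact add_le_add (h _) (h _)

theorem isVal_archimedean (σ : K →+* 𝕜) : IsVal (archimedean σ) := by
  refine isVal_of_tame (fun Y X _ _ a => ?_) (fun Y X _ _ a h => ?_) fun x hx => ?_
  · obtain ⟨C, hC0, hC⟩ := exists_kmul_mem_archimedean (σ := σ) a
    obtain ⟨n, hn⟩ := exists_nat_gt (max C 1)
    have hn1 : (1 : ℝ) < n := (le_max_right _ _).trans_lt hn
    have e : ‖σ (n : K)⁻¹‖ = (n : ℝ)⁻¹ := by rw [map_inv₀, norm_inv, norm_map_natCast]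
    refine ⟨(n : K)⁻¹, mem_scalars_archimedean.2 ?_, inv_ne_zero (Nat.cast_ne_zero.2 ?_), hC _ ?_⟩
    · rw [e]; exact inv_le_one_of_one_le₀ hn1.le
    · rintro rfl; simp at hn1; linarith
    · rw [e]; exact inv_anti₀ hC0 ((le_max_left _ _).trans hn.le)
  · have hK := norm_sum_sq_le h
    change IsContraction ((toM a).map σ)
    -- If σ(K) is real it need not be dense in 𝕜. Then the matrix is real and is tested on rational
    -- vectors, which are dense among the real ones.
    rcases denseRange_or_im_eq_zero σ with hd | hi
    · exact isContraction_of_denseRange hd hK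
    · refine isContraction_of_real (a' := (toM a).map fun x => RCLike.re (σ x)) ?_ ?_
      · ext y x
        refine RCLike.ext ?_ ?_ <;> simp [hi]
      · refine isContraction_of_denseRange (σ := Rat.castHom ℝ) Rat.denseRange_cast fun u v => ?_
        have := hK (fun y => (u y : K)) fun x => (v x : K)
        have e (q : ℚ) : σ (q : K) = ((q : ℝ) : 𝕜) := by simp
        have e' (x : K) : σ x = ((RCLike.re (σ x) : ℝ) : 𝕜) := by
          refine RCLike.ext ?_ ?_ <;> simp [hi]
        have e1 : ∑ y, σ (u y) * ∑ x, σ (toM a y x) * σ (v x) =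
            ((∑ y, (u y : ℝ) * ∑ x, RCLike.re (σ (toM a y x)) * (v x : ℝ) : ℝ) : 𝕜) := by
          push_cast
          refine Finset.sum_congr rfl fun y _ => ?_
          rw [map_ratCast]
          refine congrArg _ (Finset.sum_congr rfl fun x _ => ?_)
          exact congrArg₂ (· * ·) (e' _) (map_ratCast σ _)
        rw [e1] at this
        simp only [e, RCLike.norm_ofReal] at this
        exact this
  · rw [mem_scalars_archimedean, mem_scalars_archimedean, map_inv₀, norm_inv]
    rcases le_total ‖σ x‖ 1 with h | h
    · exact .inl h
    · exact .inr (inv_le_one_of_one_le₀ h)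

end Arch

end FOne

namespace FOne
open TopologicalSpace
open FSpace

/-! #### Rational primes which are not norms from a quadratic extension -/

section EulerSum

open scoped NNReal ENNReal

variable {α β : Type*}

/-- The sum over all finite products of elements of `α`, weighted by `w`. -/
noncomputable def eulerSum (w : α → ℝ≥0∞) : ℝ≥0∞ := ∑' m : Multiset α, (m.map w).prod

theorem eulerSum_le {w : α → ℝ≥0∞} {w' : β → ℝ≥0∞} {j : α → β} (hj : Function.Injective j)
    (h : ∀ a, w a ≤ w' (j a)) : eulerSum w ≤ eulerSum w' := by
  refine le_trans (ENNReal.tsum_le_tsum fun m => ?_)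
    (ENNReal.tsum_comp_le_tsum_of_injective (Multiset.map_injective hj) _)
  rw [Multiset.map_map]
  induction m using Multiset.induction with
  | empty => simp
  | cons a m ih =>
    simp only [Multiset.map_cons, Multiset.prod_cons]
    exact mul_le_mul' (h a) ih

/-- A multiset in a disjoint union is a pair of multisets. This is the factorization of an Euler
product along a partition of the primes. -/
theorem eulerSum_sum (w : α ⊕ β → ℝ≥0∞) :
    eulerSum w = eulerSum (w ∘ Sum.inl) * eulerSum (w ∘ Sum.inr) := by
  let e : Multiset α × Multiset β → Multiset (α ⊕ β) := fun p => p.1.map Sum.inl + p.2.map Sum.inr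
  have he : Function.Bijective e := by
    refine ⟨fun p q h => ?_, fun m => ?_⟩
    · have h1 (p : Multiset α × Multiset β) : (e p).filterMap Sum.getLeft? = p.1 := by
        simp only [e, Multiset.filterMap_add, Multiset.filterMap_map]
        rw [show (Sum.getLeft? ∘ Sum.inl : α → Option α) = some from rfl,
          show (Sum.getLeft? ∘ Sum.inr : β → Option α) = fun _ => none from rfl]
        simp [Multiset.filterMap_some, Multiset.eq_zero_iff_forall_notMem]
      have h2 (p : Multiset α × Multiset β) : (e p).filterMap Sum.getRight? = p.2 := by
        simp only [e, Multiset.filterMap_add, Multiset.filterMap_map]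
        rw [show (Sum.getRight? ∘ Sum.inr : β → Option β) = some from rfl,
          show (Sum.getRight? ∘ Sum.inl : α → Option β) = fun _ => none from rfl]
        simp [Multiset.filterMap_some, Multiset.eq_zero_iff_forall_notMem]
      exact Prod.ext (by rw [← h1, h, h1]) (by rw [← h2, h, h2])
    · induction m using Multiset.induction with
      | empty => exact ⟨(0, 0), rfl⟩
      | cons a m ih =>
        obtain ⟨p, rfl⟩ := ih
        rcases a with a | a
        · exact ⟨(a ::ₘ p.1, p.2), by simp [e]⟩
        · exact ⟨(p.1, a ::ₘ p.2), by simp [e]⟩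
  rw [eulerSum, ← (Equiv.ofBijective e he).tsum_eq, ENNReal.tsum_prod', eulerSum, eulerSum,
    ← ENNReal.tsum_mul_right]
  refine tsum_congr fun m => ?_
  rw [← ENNReal.tsum_mul_left]
  refine tsum_congr fun n => ?_
  simp [e]

/-- A multiset on one element is a multiplicity, so this is a geometric series. -/
theorem eulerSum_unit_le {w : Unit → ℝ≥0∞} (hw : w () ≤ 2⁻¹) : eulerSum w ≤ 2 := by
  have h (m : Multiset Unit) : (m.map w).prod = w () ^ Multiset.card m := by
    rw [show w = fun _ => w () from rfl, Multiset.map_const', Multiset.prod_replicate]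
  have hb : Function.Injective (Multiset.card : Multiset Unit → ℕ) := by
    intro m n hmn
    rw [Multiset.eq_replicate_card.2 (fun b (_ : b ∈ m) => Subsingleton.elim b ()),
      Multiset.eq_replicate_card.2 (fun b (_ : b ∈ n) => Subsingleton.elim b ()), hmn]
  calc eulerSum w = ∑' m : Multiset Unit, w () ^ Multiset.card m := tsum_congr h
    _ ≤ ∑' n : ℕ, w () ^ n := ENNReal.tsum_comp_le_tsum_of_injective hb _
    _ ≤ ∑' n : ℕ, 2⁻¹ ^ n := ENNReal.tsum_le_tsum fun n => pow_le_pow_left' hw n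
    _ = 2 := by
      rw [ENNReal.tsum_geometric, ENNReal.one_sub_inv_two, inv_inv]

/-- Every element contributes a factor of at most 2. -/
theorem eulerSum_ne_top [Finite α] (w : α → ℝ≥0∞) (hw : ∀ a, w a ≤ 2⁻¹) :
    eulerSum w ≤ 2 ^ Nat.card α := by
  induction α using Finite.induction_empty_option with
  | of_equiv e ih =>
    rw [← Nat.card_congr e]
    exact (eulerSum_le e.symm.injective fun a => (congrArg w (e.apply_symm_apply a)).ge).trans
      (ih (w ∘ e) fun a => hw _)
  | h_empty =>
    rw [eulerSum, tsum_eq_single 0 fun m hm => absurd (Multiset.eq_zero_of_forall_notMem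
      fun x => x.elim) hm]
    simp
  | @h_option α _ ih =>
    have h1 := eulerSum_le (w := w) (w' := w ∘ (Equiv.optionEquivSumPUnit.{0} α).symm)
      (Equiv.optionEquivSumPUnit.{0} α).injective fun a => by simp
    refine h1.trans ?_
    rw [eulerSum_sum, Nat.card_congr (Equiv.optionEquivSumPUnit.{0} α), Nat.card_sum, pow_add]
    refine mul_le_mul' (ih _ fun a => hw _) ?_
    refine (eulerSum_le (j := fun _ => ()) (w' := fun _ => w none)
      (fun _ _ _ => Subsingleton.elim _ _) fun a => le_rfl).trans ?_
    simpa using eulerSum_unit_le (w := fun _ => w none) (hw _)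

end EulerSum

/-! ### Dedekind zeta functions as sums over ideals and over products of primes -/

section IdealSum

open scoped NNReal ENNReal
open NumberField UniqueFactorizationMonoid

variable (K : Type*) [Field K] [NumberField K]

/-- The weight `N(I)⁻ˢ` of an ideal. -/
noncomputable def idealWeight (s : ℝ) (I : Ideal (𝓞 K)) : ℝ≥0∞ :=
  ((I.absNorm : ℝ≥0) ^ (-s) : ℝ≥0)

/-- The nonzero prime ideals. -/
abbrev Primes : Type _ := {P : Ideal (𝓞 K) // Prime P}

variable {K}

theorem idealWeight_multiset_prod (s : ℝ) (m : Multiset (Ideal (𝓞 K))) :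
    idealWeight K s m.prod = (m.map (idealWeight K s)).prod := by
  induction m using Multiset.induction with
  | empty => simp [idealWeight]
  | cons a m ih =>
    rw [Multiset.prod_cons, Multiset.map_cons, Multiset.prod_cons, ← ih]
    simp [idealWeight, NNReal.mul_rpow]

theorem idealWeight_le {L : Type*} [Field L] [NumberField L] {s : ℝ} (hs : 0 ≤ s)
    {I : Ideal (𝓞 K)} {J : Ideal (𝓞 L)} (h : J.absNorm ≤ I.absNorm) (hJ : J ≠ ⊥) :
    idealWeight K s I ≤ idealWeight L s J := by
  rw [idealWeight, idealWeight, ENNReal.coe_le_coe, NNReal.rpow_neg, NNReal.rpow_neg]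
  refine inv_anti₀ (NNReal.rpow_pos ?_) (NNReal.rpow_le_rpow (by exact_mod_cast h) hs)
  have : J.absNorm ≠ 0 := fun h0 => hJ (Ideal.absNorm_eq_zero_iff.1 h0)
  positivity

theorem idealWeight_le_half {s : ℝ} (hs : 1 ≤ s) (P : Primes K) :
    idealWeight K s P.1 ≤ 2⁻¹ := by
  have h1 : (2 : ℝ≥0) ≤ P.1.absNorm := by
    have : P.1.absNorm ≠ 0 := fun h0 => P.2.ne_zero (Ideal.absNorm_eq_zero_iff.1 h0)
    have h2 : P.1.absNorm ≠ 1 := fun h0 => P.2.not_isUnit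
      (Ideal.isUnit_iff.2 (Ideal.absNorm_eq_one_iff.1 h0))
    exact_mod_cast (by omega : 2 ≤ P.1.absNorm)
  have : ((P.1.absNorm : ℝ≥0) ^ (-s)) ≤ 2⁻¹ := by
    rw [NNReal.rpow_neg]
    refine inv_anti₀ (by norm_num) ?_
    calc (2 : ℝ≥0) ≤ P.1.absNorm := h1
      _ = (P.1.absNorm : ℝ≥0) ^ (1 : ℝ) := (NNReal.rpow_one _).symm
      _ ≤ _ := NNReal.rpow_le_rpow_of_exponent_le (le_trans (by norm_num) h1) hs
  rw [idealWeight]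
  calc _ ≤ ((2⁻¹ : ℝ≥0) : ℝ≥0∞) := ENNReal.coe_le_coe.2 this
    _ = 2⁻¹ := by rw [ENNReal.coe_inv (by norm_num)]; rfl

/-- Every non-zero ideal is the product of its multiset of prime factors. The zero ideal has weight
0 because s ≠ 0. -/
theorem tsum_idealWeight_le {s : ℝ} (hs : 0 < s) :
    ∑' I, idealWeight K s I ≤ eulerSum fun P : Primes K => idealWeight K s P.1 := by
  classical
  have hsupp : Function.support (idealWeight K s) ⊆ {I | I ≠ ⊥} := by
    intro I hI h
    refine hI ?_
    subst h
    simp [idealWeight, hs.ne']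
  rw [← tsum_subtype_eq_of_support_subset hsupp]
  let f : {I : Ideal (𝓞 K) | I ≠ ⊥} → Multiset (Primes K) := fun I =>
    (normalizedFactors I.1).pmap Subtype.mk fun P hP => prime_of_normalized_factor P hP
  have hf (I) : ((f I).map Subtype.val).prod = I.1 := by
    rw [Multiset.map_pmap, Multiset.pmap_eq_map, Multiset.map_id']
    exact associated_iff_eq.1 (prod_normalizedFactors I.2)
  have hinj : Function.Injective f := fun I J h => Subtype.ext (by rw [← hf, h, hf])
  refine le_trans (ENNReal.tsum_le_tsum fun I => ?_)
    (ENNReal.tsum_comp_le_tsum_of_injective hinj _)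
  rw [← hf I, idealWeight_multiset_prod, Multiset.map_map]
  rfl

/-- Uniqueness of factorization: different multisets of primes have different products. -/
theorem eulerSum_le_tsum (s : ℝ) :
    eulerSum (fun P : Primes K => idealWeight K s P.1) ≤ ∑' I, idealWeight K s I := by
  have hinj : Function.Injective fun m : Multiset (Primes K) => (m.map Subtype.val).prod := by
    intro m n h
    refine Multiset.map_injective Subtype.val_injective ?_
    have key (m : Multiset (Primes K)) :
        normalizedFactors (m.map Subtype.val).prod = m.map Subtype.val :=
      normalizedFactors_prod_of_prime fun P hP => by
        obtain ⟨Q, _, rfl⟩ := Multiset.mem_map.1 hP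
        exact Q.2
    rw [← key, ← key n]
    exact congrArg _ h
  refine le_trans (ENNReal.tsum_le_tsum fun m => ?_)
    (ENNReal.tsum_comp_le_tsum_of_injective hinj _)
  rw [idealWeight_multiset_prod, Multiset.map_map]
  rfl

/-- Ideals are grouped by norm. Convergence comes from `h0`, since a divergent series would be
assigned the value 0. -/
theorem tsum_idealWeight_eq {s : ℝ} (hs : 0 < s) (h0 : dedekindZeta K s ≠ 0) :
    ∑' I, idealWeight K s I ≠ ⊤ ∧ ((∑' I, idealWeight K s I).toReal : ℂ) = dedekindZeta K s := by
  let a : ℕ → ℝ≥0 := fun n => Nat.card {I : Ideal (𝓞 K) // I.absNorm = n} * (n : ℝ≥0) ^ (-s)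
  have h1 : ∑' I, idealWeight K s I = ∑' n, (a n : ℝ≥0∞) := by
    rw [← (Equiv.sigmaFiberEquiv (Ideal.absNorm (S := 𝓞 K))).tsum_eq, ENNReal.tsum_sigma']
    refine tsum_congr fun n => ?_
    have h (I : {I : Ideal (𝓞 K) // I.absNorm = n}) :
        idealWeight K s ((Equiv.sigmaFiberEquiv (Ideal.absNorm (S := 𝓞 K))) ⟨n, I⟩) =
          (((n : ℝ≥0) ^ (-s) : ℝ≥0) : ℝ≥0∞) := by
      simp [idealWeight, Equiv.sigmaFiberEquiv, I.2]
    rw [tsum_congr h, ENNReal.tsum_const]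
    rcases Nat.eq_zero_or_pos n with rfl | hn
    · simp [a, hs.ne']
    · have := Ideal.finite_setOfPred_absNorm_eq (S := 𝓞 K) n
      have : Finite {I : Ideal (𝓞 K) // I.absNorm = n} := this
      simp only [a, ENNReal.coe_mul]
      congr 1
      rw [ENat.card_eq_coe_natCard]
      simp
  have h2 (n : ℕ) : LSeries.term (fun n ↦ (Nat.card {I : Ideal (𝓞 K) // I.absNorm = n} : ℂ)) s n =
      ((a n : ℝ) : ℂ) := by
    rw [LSeries.term_def]
    split_ifs with hn
    · simp [a, hn, hs.ne']
    · rw [div_eq_mul_inv, ← Complex.cpow_neg]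
      simp only [a, NNReal.coe_mul, NNReal.coe_natCast, NNReal.coe_rpow, Complex.ofReal_mul,
        Complex.ofReal_natCast, Complex.ofReal_cpow (Nat.cast_nonneg n), Complex.ofReal_neg]
  have h3 : Summable fun n => ((a n : ℝ) : ℂ) := by
    by_contra h
    refine h0 ?_
    rw [dedekindZeta, LSeries, tsum_congr h2, tsum_eq_zero_of_not_summable h]
  have h4 : Summable a := by
    rw [← NNReal.summable_coe]
    exact Complex.summable_ofReal.1 h3
  rw [h1, ← ENNReal.coe_tsum h4]
  refine ⟨ENNReal.coe_ne_top, ?_⟩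
  rw [dedekindZeta, LSeries, tsum_congr h2, ENNReal.coe_toReal, NNReal.coe_tsum, Complex.ofReal_tsum]

end IdealSum
end FOne

namespace FOne
open TopologicalSpace
open FSpace

/-! ### Conjugate primes in a quadratic extension -/

section QuadraticPrimes

open scoped NNReal ENNReal
open NumberField

variable {E F : Type*} [Field E] [NumberField E] [Field F] [NumberField F] [Algebra E F]

theorem Primes.ne_bot (P : Primes F) : P.1 ≠ ⊥ := P.2.ne_zero

theorem Primes.isPrime (P : Primes F) : P.1.IsPrime := Ideal.isPrime_of_prime P.2

theorem Primes.isMaximal (P : Primes F) : P.1.IsMaximal := P.isPrime.isMaximal P.ne_bot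

/-- The inverse image of a prime under an automorphism. -/
noncomputable def Primes.conj (c : F ≃ₐ[E] F) (P : Primes F) : Primes F :=
  ⟨P.1.comap (RingOfIntegers.mapAlgEquiv c), by
    have := P.isPrime
    refine Ideal.prime_of_isPrime (fun h => P.ne_bot ?_) (Ideal.comap_isPrime _ _)
    exact Ideal.comap_injective_of_surjective _ (RingOfIntegers.mapAlgEquiv c).surjective
      (h.trans (Ideal.comap_bot_of_injective _ (RingOfIntegers.mapAlgEquiv c).injective).symm)⟩

variable (E) in
/-- The prime below a prime. -/
noncomputable def Primes.under (P : Primes F) : Primes E :=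
  ⟨P.1.under (𝓞 E), by
    have := P.isPrime
    exact Ideal.prime_of_isPrime (Ideal.IsIntegral.comap_ne_bot (𝓞 E) P.ne_bot) inferInstance⟩

theorem Primes.under_conj (c : F ≃ₐ[E] F) (P : Primes F) : (P.conj c).under E = P.under E := by
  refine Subtype.ext (Ideal.ext fun x => ?_)
  change RingOfIntegers.mapAlgEquiv c (algebraMap (𝓞 E) (𝓞 F) x) ∈ P.1 ↔ _
  rw [AlgEquiv.commutes]
  rfl

theorem Primes.under_surjective : Function.Surjective (Primes.under E : Primes F → Primes E) := by
  intro p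
  have := p.isMaximal
  obtain ⟨Q, hQ, hQp⟩ := Ideal.exists_maximal_ideal_liesOver_of_isIntegral (S := 𝓞 F) p.1
  refine ⟨⟨Q, Ideal.prime_of_isPrime (fun h => p.ne_bot ?_) hQ.isPrime⟩, Subtype.ext hQp.over.symm⟩
  rw [hQp.over, h, Ideal.under, Ideal.comap_bot_of_injective]
  exact FaithfulSMul.algebraMap_injective _ _

theorem Primes.injective_conj (c : F ≃ₐ[E] F) : Function.Injective (Primes.conj c) := by
  intro P Q h
  exact Subtype.ext (Ideal.comap_injective_of_surjective _
    (RingOfIntegers.mapAlgEquiv c).surjective (congrArg Subtype.val h))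

theorem Primes.absNorm_conj (c : F ≃ₐ[E] F) (P : Primes F) :
    (P.conj c).1.absNorm = P.1.absNorm := by
  rw [Ideal.absNorm_apply, Ideal.absNorm_apply, Submodule.cardQuot_apply, Submodule.cardQuot_apply]
  refine Nat.card_congr (Ideal.quotientEquiv _ _
    (RingOfIntegers.mapAlgEquiv c : 𝓞 F ≃ₐ[𝓞 E] 𝓞 F).toRingEquiv ?_).toEquiv
  exact (Ideal.map_comap_of_surjective _ (RingOfIntegers.mapAlgEquiv c).surjective P.1).symm

/-- P and its conjugate are different primes over the same prime 𝔭 of E, so their product divides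
the extension of 𝔭, which has norm N(𝔭)². Hence N(P)² divides N(𝔭)². -/
theorem Primes.absNorm_le (hEF : Module.finrank E F = 2) (c : F ≃ₐ[E] F) {P : Primes F}
    (hP : P.conj c ≠ P) : P.1.absNorm ≤ (P.under E).1.absNorm := by
  have hdvd (Q : Primes F) (h : Q.under E = P.under E) :
      Q.1 ∣ (P.under E).1.map (algebraMap (𝓞 E) (𝓞 F)) := by
    rw [Ideal.dvd_iff_le, Ideal.map_le_iff_le_comap, ← h]
    exact le_rfl
  have h1 : P.1 * (P.conj c).1 ∣ (P.under E).1.map (algebraMap (𝓞 E) (𝓞 F)) := by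
    refine IsCoprime.mul_dvd ?_ (hdvd P rfl) (hdvd _ (P.under_conj c))
    rw [Ideal.isCoprime_iff_sup_eq]
    exact P.isMaximal.coprime_of_ne (P.conj c).isMaximal fun h => hP (Subtype.ext h.symm)
  have h2 := Ideal.absNorm_dvd_absNorm_of_le (Ideal.dvd_iff_le.1 h1)
  rw [Ideal.absNorm_algebraMap, ← IsFractionRing.finrank_eq (𝓞 E) E (𝓞 F) F, hEF, map_mul,
    P.absNorm_conj, ← sq] at h2
  exact Nat.le_of_dvd (Nat.pos_of_ne_zero fun h => (P.under E).ne_bot (Ideal.absNorm_eq_zero_iff.1 h))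
    ((Nat.pow_dvd_pow_iff two_ne_zero).1 h2)

/-- As P is fixed by c, the valuations of s and c(s) at P agree and that of p = s c(s) is even. It
is positive, hence at least 2. -/
theorem Primes.sq_dvd (c : F ≃ₐ[E] F) {P : Primes F} (hP : P.conj c = P) {p : ℕ} (hp : p ≠ 0)
    {s : F} (hs : s * c s = p) (hpP : (p : 𝓞 F) ∈ P.1) : P.1 ^ 2 ∣ Ideal.span {(p : 𝓞 F)} := by
  let c' : 𝓞 F ≃ₐ[𝓞 E] 𝓞 F := RingOfIntegers.mapAlgEquiv c
  -- With s = a/m all multiplicities are those of integers, hence natural numbers.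
  obtain ⟨a, m, hm, rfl⟩ := IsFractionRing.div_surjective (A := 𝓞 F) s
  have hm0 : m ≠ 0 := nonZeroDivisors.ne_zero hm
  have hc (x : 𝓞 F) : c (algebraMap (𝓞 F) F x) = algebraMap (𝓞 F) F (c' x) := rfl
  have e : a * c' a = p * (m * c' m) := by
    refine IsFractionRing.injective (𝓞 F) F ?_
    have hmF : algebraMap (𝓞 F) F m ≠ 0 := by simpa using hm0
    have hmF' : algebraMap (𝓞 F) F (c' m) ≠ 0 := by simpa using hm0
    rw [map_div₀, hc, hc, div_mul_div_comm, div_eq_iff (mul_ne_zero hmF hmF')] at hs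
    simpa using hs
  have ha0 : a ≠ 0 := by
    rintro rfl
    simp [hp, hm0] at e
  let v (x : 𝓞 F) : ℕ∞ := emultiplicity P.1 (Ideal.span {x})
  have hv (x : 𝓞 F) : v (c' x) = v x := by
    have h1 : (P.1.map c') = P.1 := by
      conv_lhs => rw [← hP]
      exact Ideal.map_comap_of_surjective _ c'.surjective P.1
    refine emultiplicity_eq_emultiplicity_iff.2 fun n => ?_
    rw [Ideal.dvd_span_singleton, Ideal.dvd_span_singleton]
    have h2 : (P.1 ^ n).map c' = P.1 ^ n := by rw [Ideal.map_pow, h1]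
    conv_lhs => rw [← h2]
    rw [Ideal.mem_map_iff_of_surjective _ c'.surjective]
    refine ⟨?_, fun h => ⟨x, h, rfl⟩⟩
    rintro ⟨y, hy, h⟩
    rwa [← c'.injective h]
  have hmul (x y : 𝓞 F) : v (x * y) = v x + v y := by
    simp only [v]
    rw [← Ideal.span_singleton_mul_span_singleton, emultiplicity_mul P.2]
  have hfin (x : 𝓞 F) (hx : x ≠ 0) : ∃ n : ℕ, v x = n := by
    have : FiniteMultiplicity P.1 (Ideal.span {x}) :=
      FiniteMultiplicity.of_not_isUnit P.2.not_isUnit (by simpa using hx)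
    exact ⟨_, this.emultiplicity_eq_multiplicity⟩
  have e2 := congrArg v e
  rw [hmul, hmul, hmul, hv, hv] at e2
  obtain ⟨i, hi⟩ := hfin a ha0
  obtain ⟨j, hj⟩ := hfin m hm0
  obtain ⟨k, hk⟩ := hfin (p : 𝓞 F) (by exact_mod_cast hp)
  have h1 : 1 ≤ v (p : 𝓞 F) := by
    have := le_emultiplicity_of_pow_dvd (a := P.1) (b := Ideal.span {(p : 𝓞 F)}) (k := 1)
      (by rw [pow_one]; exact Ideal.dvd_span_singleton.2 hpP)
    exact_mod_cast this
  refine pow_dvd_of_le_emultiplicity ?_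
  change ((2 : ℕ) : ℕ∞) ≤ v p
  rw [hi, hj, hk] at e2
  rw [hk] at h1 ⊢
  norm_cast at e2 h1 ⊢
  omega

attribute [local instance] FractionRing.liftAlgebra in
-- The square of a fixed prime P divides its rational prime, so P is ramified over ℚ and divides the
-- different, which has finitely many prime factors.
theorem Primes.finite_conj_eq (c : F ≃ₐ[E] F) (hc : ∀ p : ℕ, p.Prime → ∃ s : F, s * c s = p) :
    {P : Primes F | P.conj c = P}.Finite := by
  have hD : differentIdeal ℤ (𝓞 F) ≠ ⊥ := differentIdeal_ne_bot
  have := (Ideal.finite_factors hD).image fun v => v.asIdeal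
  refine Set.Finite.of_finite_image (f := Subtype.val) (this.subset ?_) Subtype.val_injective.injOn
  rintro _ ⟨P, hP, rfl⟩
  have := P.isPrime
  refine ⟨⟨P.1, P.isPrime, P.ne_bot⟩, ?_, rfl⟩
  obtain ⟨p, hp, hpP⟩ : ∃ p : ℕ, p.Prime ∧ (p : 𝓞 F) ∈ P.1 :=
    exists_prime_mem (R := 𝓞 F) F (q := ⟨P.1, P.isPrime⟩)
      fun h => P.ne_bot (congrArg PrimeSpectrum.asIdeal h)
  obtain ⟨s, hs⟩ := hc p hp
  have h := Primes.sq_dvd c hP hp.ne_zero hs hpP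
  have hmax : (Ideal.span {(p : ℤ)}).IsMaximal :=
    PrincipalIdealRing.isMaximal_of_irreducible (Nat.prime_iff_prime_int.1 hp).irreducible
  have := pow_sub_one_dvd_differentIdeal_aux ℤ ℚ F (p := Ideal.span {(p : ℤ)}) P.1 two_ne_zero
    (by simpa using hp.ne_zero) (by rw [Ideal.map_span, Set.image_singleton]; simpa using h)
  simpa using this

theorem two_pow_mul_sq (n : ℕ) (a : ℝ≥0∞) : (2 ^ n * a) ^ 2 = (4 ^ n : ℕ) * (a * a) := by
  rw [mul_pow, ← pow_mul, mul_comm n 2, pow_mul, sq a]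
  norm_num

/-- Let T be the finite set of primes of E below the fixed primes. Outside of T each prime has two
conjugate primes above it of no larger norm, so the square of the Euler sum over the complement of T
is bounded by that of F. The primes in T cost at most 2^|T| in each of the two factors, as all
weights are at most 1/2. -/
theorem eulerSum_sq_le (hEF : Module.finrank E F = 2) (c : F ≃ₐ[E] F)
    (hc : {P : Primes F | P.conj c = P}.Finite) : ∃ C : ℕ, ∀ s : ℝ, 1 ≤ s →
      (eulerSum fun P : Primes E => idealWeight E s P.1) ^ 2 ≤
        C * eulerSum fun P : Primes F => idealWeight F s P.1 := by
  classical
  let T : Set (Primes E) := Primes.under E '' {P : Primes F | P.conj c = P}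
  have hT : Finite T := hc.image _
  obtain ⟨g, hg⟩ := (Primes.under_surjective (E := E) (F := F)).hasRightInverse
  have hgT (p : (Tᶜ : Set (Primes E))) : (g p).conj c ≠ g p := fun h => p.2 ⟨g p, h, hg p⟩
  refine ⟨4 ^ Nat.card T, fun s hs => ?_⟩
  let w : Primes E → ℝ≥0∞ := fun P => idealWeight E s P.1
  have h1 : eulerSum w ≤ 2 ^ Nat.card T * eulerSum fun p : (Tᶜ : Set (Primes E)) => w p := by
    refine (eulerSum_le (w' := w ∘ Equiv.Set.sumCompl T) (Equiv.Set.sumCompl T).symm.injective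
      fun p => by simp).trans ?_
    rw [eulerSum_sum]
    exact mul_le_mul' (eulerSum_ne_top _ fun p => idealWeight_le_half hs _) le_rfl
  let j : (Tᶜ : Set (Primes E)) ⊕ (Tᶜ : Set (Primes E)) → Primes F :=
    Sum.elim (fun p => g p) fun p => (g p).conj c
  have hju (x) : (j x).under E = Sum.elim Subtype.val Subtype.val x := by
    rcases x with p | p
    · exact hg p
    · exact (Primes.under_conj _ _).trans (hg p)
  have hj : Function.Injective j := by
    intro x y h
    have h' := (hju x).symm.trans ((congrArg _ h).trans (hju y))
    rcases x with p | p <;> rcases y with q | q <;> obtain rfl : p = q := Subtype.ext h'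
    · rfl
    · exact absurd h.symm (hgT p)
    · exact absurd h (hgT p)
    · rfl
  let v : (Tᶜ : Set (Primes E)) → ℝ≥0∞ := fun p => w p
  let w' : Primes F → ℝ≥0∞ := fun P => idealWeight F s P.1
  have hw (x) : Sum.elim v v x ≤ w' (j x) := by
    refine le_trans (b := w ((j x).under E)) (by rw [hju]; rcases x with p | p <;> exact le_rfl) ?_
    refine idealWeight_le (by linarith) ?_ (j x).ne_bot
    refine Primes.absNorm_le hEF c ?_
    rcases x with p | p
    · exact hgT p
    · exact fun h => hgT p (Primes.injective_conj c h)
  have h2 : eulerSum v * eulerSum v ≤ eulerSum w' := (eulerSum_sum (Sum.elim v v)).ge.trans (eulerSum_le hj hw)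
  refine (pow_le_pow_left' h1 2).trans ?_
  rw [two_pow_mul_sq]
  exact mul_le_mul' le_rfl h2

open Filter Topology in
theorem eventually_dedekindZeta_ne_zero (K : Type*) [Field K] [NumberField K] :
    ∀ᶠ s : ℝ in 𝓝[>] 1, dedekindZeta K s ≠ 0 := by
  filter_upwards [(tendsto_sub_one_mul_dedekindZeta_nhdsGT K).eventually_ne
    (Complex.ofReal_ne_zero.2 (dedekindZeta_residue_ne_zero K))] with s hs
  exact right_ne_zero_of_mul hs

open Filter Topology in
-- If every p were a norm, all but finitely many primes would split, and ζ_E² ≤ C ζ_F for s > 1 near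
-- 1. But ζ_E² has a pole of order two at 1 and ζ_F a simple one: after multiplication by (s − 1)²
-- the left side tends to a positive number and the right side to 0.
theorem exists_prime_ne_norm (hEF : Module.finrank E F = 2) (c : F ≃ₐ[E] F) :
    ∃ p : ℕ, p.Prime ∧ ∀ s : F, s * c s ≠ p := by
  by_contra! hc
  obtain ⟨C, hC⟩ := eulerSum_sq_le hEF c (Primes.finite_conj_eq c hc)
  have tE := tendsto_sub_one_mul_dedekindZeta_nhdsGT E
  have tF := tendsto_sub_one_mul_dedekindZeta_nhdsGT F
  have tE' : Tendsto (fun s : ℝ => ((s - 1) * (dedekindZeta E s).re) ^ 2) (𝓝[>] 1)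
      (𝓝 (dedekindZeta_residue E ^ 2)) := by
    refine (((Complex.continuous_re.tendsto _).comp tE).congr fun s => ?_).pow 2
    simp [← Complex.ofReal_one, ← Complex.ofReal_sub]
  have tF' : Tendsto (fun s : ℝ => C * ((s - 1) * ((s - 1) * (dedekindZeta F s).re))) (𝓝[>] 1)
      (𝓝 (C * (0 * dedekindZeta_residue F))) := by
    refine ((Tendsto.mul ?_ (((Complex.continuous_re.tendsto _).comp tF).congr fun s => ?_))).const_mul _
    · have : Tendsto (fun s : ℝ => s - 1) (𝓝 1) (𝓝 (1 - 1)) :=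
        (continuous_id.sub continuous_const).tendsto 1
      rw [sub_self] at this
      exact this.mono_left nhdsWithin_le_nhds
    · simp [← Complex.ofReal_one, ← Complex.ofReal_sub]
  have hle : ∀ᶠ s : ℝ in 𝓝[>] 1, ((s - 1) * (dedekindZeta E s).re) ^ 2 ≤
      C * ((s - 1) * ((s - 1) * (dedekindZeta F s).re)) := by
    filter_upwards [eventually_dedekindZeta_ne_zero E,
      eventually_dedekindZeta_ne_zero F, self_mem_nhdsWithin] with s hE hF hs
    have hs1 : (1 : ℝ) < s := hs
    obtain ⟨hE1, hE2⟩ := tsum_idealWeight_eq (by linarith) hE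
    obtain ⟨hF1, hF2⟩ := tsum_idealWeight_eq (by linarith) hF
    have h : (∑' I, idealWeight E s I) ^ 2 ≤ C * ∑' I, idealWeight F s I :=
      (pow_le_pow_left' (tsum_idealWeight_le (by linarith)) 2).trans
        ((hC s hs1.le).trans (mul_le_mul' le_rfl (eulerSum_le_tsum s)))
    have h' := ENNReal.toReal_mono (ENNReal.mul_ne_top (ENNReal.natCast_ne_top C) hF1) h
    rw [ENNReal.toReal_pow, ENNReal.toReal_mul, ENNReal.toReal_natCast] at h'
    rw [← hE2, ← hF2, Complex.ofReal_re, Complex.ofReal_re]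
    nlinarith [mul_le_mul_of_nonneg_left h' (sq_nonneg (s - 1))]
  have := le_of_tendsto_of_tendsto tE' tF' hle
  rw [zero_mul, mul_zero] at this
  exact absurd (pow_pos (dedekindZeta_residue_pos E) 2) this.not_gt

/-- By Artin's theorem F has degree two over the fixed field of a non-trivial involution. -/
theorem exists_prime_ne_mul_involution (c : F ≃+* F) (hc : ∀ x, c (c x) = x) {x : F}
    (hx : c x ≠ x) : ∃ p : ℕ, p.Prime ∧ ∀ s : F, s * c s ≠ p := by
  let c₀ : F ≃ₐ[ℚ] F := { c with commutes' := fun q => map_ratCast c q }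
  let E := IntermediateField.fixedField (Subgroup.zpowers c₀)
  have h2 : Module.finrank E F = 2 := by
    rw [IntermediateField.finrank_fixedField_eq_card, Nat.card_zpowers]
    refine orderOf_eq_prime (AlgEquiv.ext fun y => hc y) fun h => hx ?_
    exact congrArg (fun f : F ≃ₐ[ℚ] F => f x) h
  let c₁ : F ≃ₐ[E] F := { c with
    commutes' := fun e => e.2 ⟨c₀, Subgroup.mem_zpowers c₀⟩ }
  exact exists_prime_ne_norm h2 c₁

end QuadraticPrimes

end FOne

namespace FOne
open TopologicalSpace
open FSpace

/-! #### Closure properties of valuation sub-`𝔽`-rings -/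

section ValClosure

variable {K : Type u} [Field K] {X Y Z : Type} [Fintype X] [Fintype Y] [Fintype Z]
variable {B : Sub (mat K)}

theorem diag_mem {d : X → K} (hd : ∀ x, d x ∈ B.scalars) :
    FData.diag X (fun x => (ofEntry (d x) : (mat K).Hom Unit Unit)) ∈ B.carrier X X := by
  have h := B.incl_mem (FData.diag X fun x => B.elt _ (mem_scalars.1 (hd x)))
  rwa [FHom.map_diag] at h

theorem dsum_mem {a : Z → (mat K).Hom Y X} (ha : ∀ z, a z ∈ B.carrier Y X) :
    FData.dsum Z a ∈ B.carrier (Z × Y) (Z × X) := by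
  have h := B.incl_mem (FData.dsum Z fun z => B.elt _ (ha z))
  rwa [FHom.map_dsum] at h

theorem diag_mul_mem_rows {d b : X → K} (hd : ∀ x, d x ∈ B.scalars) (hb : b ∈ B.rows X) :
    (fun x => d x * b x) ∈ B.rows X := by
  classical
  have h := row_mem_rows (B.comp_mem hb (diag_mem hd))
  convert h using 1
  ext x
  rw [toM_comp, Matrix.mul_apply]
  refine (mul_comm _ _).trans ((Finset.sum_eq_single x (fun y _ hy => ?_) (by simp)).trans ?_).symm
  · exact (congrArg _ ((mat_diag_apply _ _ _).trans (if_neg hy))).trans (mul_zero _)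
  · exact congrArg _ ((mat_diag_apply _ _ _).trans (if_pos rfl))

theorem coord_mem_scalars {b : X → K} (hb : b ∈ B.rows X) (x : X) : b x ∈ B.scalars := by
  classical
  have h := dot_mem_scalars hb (single_mem_rows B x)
  simpa [Pi.single_apply] using h

namespace IsVal

variable (hB : IsVal B)

include hB

/-- If x⁻¹ is a scalar, then so is x = x^n (x⁻¹)^(n − 1). -/
theorem mem_of_pow_mem {x : K} {n : ℕ} (hn : n ≠ 0) (h : x ^ n ∈ B.scalars) : x ∈ B.scalars := by
  rcases eq_or_ne x 0 with rfl | hx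
  · exact zero_mem_scalars
  · rcases hB.mem_or_inv hx with h' | h'
    · exact h'
    · have := mul_mem_scalars h (pow_mem_scalars h' (n - 1))
      obtain ⟨m, rfl⟩ := Nat.exists_eq_succ_of_ne_zero hn
      rwa [pow_succ, inv_pow, Nat.succ_sub_one, mul_right_comm, mul_inv_cancel₀ (pow_ne_zero _ hx),
        one_mul] at this

theorem neg_mem {x : K} (hx : x ∈ B.scalars) : -x ∈ B.scalars := by
  have h : (-1 : K) ∈ B.scalars :=
    hB.mem_of_pow_mem two_ne_zero (by rw [neg_one_sq]; exact one_mem_scalars)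
  rw [← neg_one_mul]
  exact mul_mem_scalars h hx

/-- Sums of two scalars are scalars up to a fixed denominator. -/
theorem exists_mul_add_mem : ∃ e ∈ B.scalars, e ≠ 0 ∧
    ∀ a ∈ B.scalars, ∀ b ∈ B.scalars, e * (a + b) ∈ B.scalars := by
  -- Fullness brings d·(1, 1) into B. With diag(a, b) between this row and its transpose one obtains
  -- d²(a + b), so e = d².
  obtain ⟨d, hd, hd0, h⟩ := hB.exists_kmul_mem (rowM fun _ : Bool => (1 : K))
  refine ⟨d * d, mul_mem_scalars hd hd, mul_ne_zero hd0 hd0, fun a ha b hb => ?_⟩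
  have h1 := row_mem_rows h
  have h2 := diag_mul_mem_rows (B := B) (d := fun i : Bool => bif i then a else b)
    (by rintro (_ | _) <;> assumption) h1
  have h3 := dot_mem_scalars h2 h1
  rw [Fintype.sum_bool] at h3
  have e : (toM (kmul d (rowM fun _ : Bool => (1 : K)))) = fun _ _ => d := by
    rw [toM_kmul]
    ext i j
    exact mul_one d
  rw [e] at h3
  convert h3 using 1
  simp
  ring

/-- Entries of rows are scalars. When scalars can be added, any vector of scalars pairs with all
rows into the scalars, and self-duality makes it a row. -/
theorem mem_rows_of_add_mem (hadd : ∀ a ∈ B.scalars, ∀ b ∈ B.scalars, a + b ∈ B.scalars)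
    {b : X → K} : b ∈ B.rows X ↔ ∀ x, b x ∈ B.scalars := by
  refine ⟨fun h => coord_mem_scalars h, fun h => hB.mem_rows_iff.2 fun b' hb' => ?_⟩
  exact Finset.sum_induction _ (· ∈ B.scalars) (fun a b ha hb => hadd a ha b hb) zero_mem_scalars
    fun x _ => mul_mem_scalars (h x) (coord_mem_scalars hb' x)

end IsVal

end ValClosure

/-! #### Valuation rings of number fields -/

section ValuationRings

variable {R K : Type u} [CommRing R] [IsDedekindDomain R] [Field K] [NumberField K] [Algebra R K]
variable [IsFractionRing R K] [IsIntegralClosure R ℤ K]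

/-- Valuation rings are integrally closed, and R is integral over ℤ. -/
theorem algebraMap_mem_of_mem_or_inv (A : Subring K) (hA : ∀ x : K, x ∈ A ∨ x⁻¹ ∈ A) (r : R) :
    algebraMap R K r ∈ A := by
  let V : ValuationSubring K := { A with mem_or_inv_mem' := hA }
  have h : IsIntegral ℤ (algebraMap R K r) :=
    (IsIntegralClosure.isIntegral_iff (A := R)).2 ⟨r, rfl⟩
  obtain ⟨y, hy⟩ := (IsIntegrallyClosed.isIntegral_iff (R := V) (K := K)).1 (h.tower_top (A := V))
  rw [← hy]
  exact y.2

variable (R) in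
-- q is the centre of the valuation ring A on R, and R_q ⊆ A. If x in A were not in R_q, then x⁻¹ =
-- a/b with a ∈ q and b ∉ q, and b = x a would lie in the maximal ideal of A, against b ∉ q.
theorem exists_eq_locRing (A : Subring K) (hA : ∀ x : K, x ∈ A ∨ x⁻¹ ∈ A) :
    ∃ q : PrimeSpectrum R, A = locRing K q := by
  let V : ValuationSubring K := { A with mem_or_inv_mem' := hA }
  have hR := algebraMap_mem_of_mem_or_inv (R := R) A hA
  let f : R →+* V := (algebraMap R K).codRestrict V hR
  have hu (r : R) (hr : r ∉ (IsLocalRing.maximalIdeal V).comap f) : (algebraMap R K r)⁻¹ ∈ A := by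
    have h1 : IsUnit (f r) := by simpa using hr
    obtain ⟨y, hy⟩ := h1.exists_right_inv
    have : algebraMap R K r * y = 1 := congrArg Subtype.val hy
    rw [← eq_inv_of_mul_eq_one_right this]
    exact y.2
  refine ⟨⟨(IsLocalRing.maximalIdeal V).comap f, inferInstance⟩, le_antisymm (fun x hx => ?_) ?_⟩
  · set q : PrimeSpectrum R := ⟨(IsLocalRing.maximalIdeal V).comap f, inferInstance⟩
    rcases mem_or_inv_mem_locRing q x with h | h
    · exact h
    · by_cases hm : x⁻¹ ∈ maxSet K q
      · obtain ⟨a, ha, b, hb, e⟩ := hm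
        rcases eq_or_ne x 0 with rfl | hx0
        · exact zero_mem _
        · refine absurd ?_ hb
          have e2 : f b = ⟨x, hx⟩ * f a := Subtype.ext (by
            change algebraMap R K b = x * algebraMap R K a
            rw [← e, mul_inv_cancel_left₀ hx0])
          change f b ∈ IsLocalRing.maximalIdeal V
          rw [e2]
          exact Ideal.mul_mem_left _ _ ha
      · rw [← inv_inv x]
        exact inv_mem_locRing q h hm
  · intro x hx
    obtain ⟨a, b, hb, e⟩ := (mem_locRing _).1 hx
    rw [(eq_mul_inv_iff_mul_eq₀ (algebraMap_ne_zero hb)).2 e]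
    exact mul_mem (hR a) (hu b hb)

variable (R K) in
include K in
-- R is a free ℤ-module of finite rank.
theorem finite_quotient {I : Ideal R} (hI : I ≠ ⊥) : Finite (R ⧸ I) := by
  have := IsIntegralClosure.finite ℤ ℚ K R
  have : Module.IsTorsionFree ℤ R := by
    have : CharZero R := (algebraMap R K).charZero
    infer_instance
  have : Module.Free ℤ R := inferInstance
  exact Ideal.finiteQuotientOfFreeOfNeBot I hI

theorem exists_one_add_mul_pow {A : Subring K} {s y : K} (hs : s ∈ A) (hy : y ∈ A) (n : ℕ) :
    ∃ z ∈ A, (1 + s * y) ^ n = 1 + s * z := by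
  induction n with
  | zero => exact ⟨0, zero_mem _, by simp⟩
  | succ n ih =>
    obtain ⟨z, hz, e⟩ := ih
    refine ⟨z + y + s * y * z, add_mem (add_mem hz hy) (mul_mem (mul_mem hs hy) hz), ?_⟩
    rw [pow_succ, e]
    ring

/-- Every unit of a localization has a power which is congruent to one modulo a given element. -/
theorem exists_pow_sub_one_mem {q : PrimeSpectrum R} {u : K} (hu0 : u ≠ 0) (hu : u ∈ locRing K q)
    (hu' : u⁻¹ ∈ locRing K q) {s : K} (hs : s ∈ locRing K q) (hs0 : s ≠ 0) :
    ∃ M ≠ 0, ∃ y ∈ locRing K q, u ^ M = 1 + s * y := by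
  obtain ⟨c, d, hd, hcd⟩ := (mem_locRing q).1 hs
  have hc : c ≠ 0 := by
    rintro rfl
    rw [map_zero] at hcd
    exact mul_ne_zero hs0 (algebraMap_ne_zero hd) hcd
  -- With s = c/d, the ring R/(c) is finite, so the powers of an element a of R outside of q repeat
  -- modulo c.
  have hfin := finite_quotient R K (I := Ideal.span {c}) (by simpa using hc)
  have key (a : R) (ha : a ∉ q.asIdeal) : ∃ M ≠ 0, ∃ y ∈ locRing K q, algebraMap R K a ^ M = 1 + s * y := by
    obtain ⟨i, j, hij, h⟩ := Set.finite_univ.exists_lt_map_eq_of_forall_mem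
      (f := fun i : ℕ => Ideal.Quotient.mk (Ideal.span {c}) (a ^ i)) (fun _ => Set.mem_univ _)
    rw [eq_comm, Ideal.Quotient.eq, Ideal.mem_span_singleton] at h
    obtain ⟨y, hy⟩ := h
    refine ⟨j - i, by omega, algebraMap R K d * algebraMap R K y * (algebraMap R K a ^ i)⁻¹, ?_, ?_⟩
    · refine mul_mem (mul_mem (algebraMap_mem_locRing q _) (algebraMap_mem_locRing q _)) ?_
      rw [← map_pow]
      refine inv_mem_locRing q (algebraMap_mem_locRing q _) ?_
      rw [algebraMap_mem_maxSet]
      exact fun h => ha (q.isPrime.mem_of_pow_mem _ h)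
    · have ha0 := pow_ne_zero i (algebraMap_ne_zero (K := K) ha)
      have e := congrArg (algebraMap R K) hy
      rw [map_mul, ← hcd, map_sub, map_pow, map_pow] at e
      rw [pow_sub₀ _ (algebraMap_ne_zero ha) hij.le, ← sub_eq_iff_eq_add', ← mul_inv_cancel₀ ha0,
        ← sub_mul, e]
      ring
  obtain ⟨a, b, hb, hab⟩ := (mem_locRing q).1 hu
  have hb0 := algebraMap_ne_zero (K := K) hb
  have ha : a ∉ q.asIdeal := by
    intro ha
    have h1 : u ∈ maxSet K q := ⟨a, ha, b, hb, hab⟩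
    have h2 := mul_mem_maxSet q hu' h1
    rw [inv_mul_cancel₀ hu0] at h2
    exact one_notMem_maxSet q h2
  obtain ⟨m, hm, y, hy, hay⟩ := key a ha
  obtain ⟨n, hn, z, hz, hbz⟩ := key b hb
  -- Here u = a/b, and the product of the exponents found for a and for b serves both.
  obtain ⟨y', hy', e1⟩ := exists_one_add_mul_pow hs hy n
  obtain ⟨z', hz', e2⟩ := exists_one_add_mul_pow hs hz m
  rw [← hay, ← pow_mul] at e1
  rw [← hbz, ← pow_mul, mul_comm n m] at e2
  have hbM := pow_ne_zero (m * n) hb0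
  refine ⟨m * n, mul_ne_zero hm hn, (y' - z') * (algebraMap R K b ^ (m * n))⁻¹, ?_, ?_⟩
  · refine mul_mem (sub_mem hy' hz') ?_
    rw [← map_pow]
    refine inv_mem_locRing q (algebraMap_mem_locRing q _) ?_
    rw [algebraMap_mem_maxSet]
    exact fun h => hb (q.isPrime.mem_of_pow_mem _ h)
  · rw [(eq_mul_inv_iff_mul_eq₀ hb0).2 hab, mul_pow, inv_pow, e1, ← mul_assoc, eq_comm,
      ← sub_eq_zero]
    field_simp
    rw [e2]
    ring

end ValuationRings

end FOne

namespace FOne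
open TopologicalSpace
open FSpace

/-! #### The absolute value of a valuation sub-`𝔽`-ring -/

section Artin

variable {K : Type*} [Field K] {f : K → ℝ}

/-- If x > y > 0, then (x/y)^n outgrows 4(n + 1); for y = 0 the case n = 1 suffices. -/
theorem le_of_pow_le {x y : ℝ} (hy : 0 ≤ y)
    (h : ∀ n : ℕ, x ^ n ≤ 4 * (n + 1) * y ^ n) : x ≤ y := by
  by_contra! hlt
  rcases hy.eq_or_lt with rfl | hy0
  · have := h 1
    simp at this
    linarith
  have hr : 1 < x / y := (one_lt_div hy0).2 hlt
  have h1 := (tendsto_pow_const_div_const_pow_of_one_lt 1 hr).add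
    (tendsto_pow_const_div_const_pow_of_one_lt 0 hr)
  have h2 := (h1.const_mul 4).eventually (gt_mem_nhds (by norm_num : (4 * (0 + 0) : ℝ) < 1))
  obtain ⟨n, hn⟩ := h2.exists
  have hp : 0 < (x / y) ^ n := by positivity
  rw [← add_div, ← mul_div_assoc, div_lt_one hp, div_pow, lt_div_iff₀ (by positivity)] at hn
  have := h n
  simp only [pow_one, pow_zero] at hn
  linarith

/-- Bisection bounds sums of 2^m terms. A sum of n terms is padded with zeros up to the next power
of two, which is at most 2n. -/
theorem map_sum_le_of_le_two_mul_max (h0 : f 0 = 0) (hnn : ∀ x, 0 ≤ f x)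
    (hadd : ∀ x y, f (x + y) ≤ 2 * max (f x) (f y)) (n : ℕ) (l : ℕ → K) {M : ℝ}
    (hM : ∀ i, f (l i) ≤ M) : f (∑ i ∈ Finset.range n, l i) ≤ 2 * n * M := by
  have key (m : ℕ) : ∀ l : ℕ → K, (∀ i, f (l i) ≤ M) →
      f (∑ i ∈ Finset.range (2 ^ m), l i) ≤ 2 ^ m * M := by
    induction m with
    | zero => intro l hl; simpa using hl 0
    | succ m ih =>
      intro l hl
      rw [pow_succ, mul_two, Finset.sum_range_add]
      refine (hadd _ _).trans ?_
      rw [pow_succ, mul_comm _ (2 : ℝ), mul_assoc]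
      exact mul_le_mul_of_nonneg_left (max_le (ih _ hl) (ih _ fun i => hl _)) zero_le_two
  have hM0 : 0 ≤ M := (hnn _).trans (hM 0)
  rcases Nat.eq_zero_or_pos n with rfl | hn
  · simp [h0]
  have h1 : 2 ^ Nat.log 2 n ≤ n := Nat.pow_log_le_self 2 hn.ne'
  have h2 : n < 2 ^ (Nat.log 2 n + 1) := Nat.lt_pow_succ_log_self one_lt_two n
  have h3 := key (Nat.log 2 n + 1) (fun i => if i < n then l i else 0) fun i => by
    split_ifs
    · exact hM i
    · rw [h0]; exact hM0
  rw [← Finset.sum_filter] at h3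
  have h4 : (Finset.range (2 ^ (Nat.log 2 n + 1))).filter (· < n) = Finset.range n := by
    ext i
    simp only [Finset.mem_filter, Finset.mem_range]
    omega
  rw [h4] at h3
  refine h3.trans (mul_le_mul_of_nonneg_right ?_ hM0)
  rw [pow_succ, mul_comm]
  exact mul_le_mul_of_nonneg_left (by exact_mod_cast h1) zero_le_two

/-- Artin's argument: in the binomial expansion of (x + y)^n the n + 1 terms cost a factor 2(n + 1)
and the integer coefficients a factor 2; both are lost on taking n-th roots. -/
theorem map_add_le_of_le_two_mul_max (h0 : f 0 = 0) (h1 : f 1 = 1) (hnn : ∀ x, 0 ≤ f x)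
    (hmul : ∀ x y, f (x * y) = f x * f y)
    (hadd : ∀ x y, f (x + y) ≤ 2 * max (f x) (f y)) (x y : K) : f (x + y) ≤ f x + f y := by
  have hpow (z : K) (n : ℕ) : f (z ^ n) = f z ^ n := by
    induction n with
    | zero => simp [h1]
    | succ n ih => rw [pow_succ, hmul, ih, pow_succ]
  have hnat (n : ℕ) : f n ≤ 2 * n := by
    have := map_sum_le_of_le_two_mul_max h0 hnn hadd n (fun _ => 1) (M := 1) fun _ => h1.le
    simpa using this
  refine le_of_pow_le (add_nonneg (hnn _) (hnn _)) fun n => ?_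
  rw [← hpow, add_pow]
  have := map_sum_le_of_le_two_mul_max h0 hnn hadd (n + 1)
    (fun i => if i ≤ n then x ^ i * y ^ (n - i) * (n.choose i : K) else 0)
    (M := 2 * (f x + f y) ^ n) fun i => ?_
  · rw [Finset.sum_congr rfl fun i hi => if_pos (Nat.lt_succ_iff.1 (Finset.mem_range.1 hi))] at this
    refine this.trans (le_of_eq ?_)
    push_cast
    ring
  · split_ifs with hi
    · rw [hmul, hmul, hpow, hpow]
      have hb : f x ^ i * f y ^ (n - i) * (n.choose i : ℝ) ≤ (f x + f y) ^ n := by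
        rw [add_pow]
        exact Finset.single_le_sum (f := fun i => f x ^ i * f y ^ (n - i) * (n.choose i : ℝ))
          (fun j _ => mul_nonneg (mul_nonneg (pow_nonneg (hnn _) _) (pow_nonneg (hnn _) _))
            (Nat.cast_nonneg _)) (Finset.mem_range.2 (Nat.lt_succ_of_le hi))
      calc _ ≤ f x ^ i * f y ^ (n - i) * (2 * (n.choose i : ℝ)) :=
            mul_le_mul_of_nonneg_left (hnat _)
              (mul_nonneg (pow_nonneg (hnn _) _) (pow_nonneg (hnn _) _))
        _ ≤ _ := by linarith
    · rw [h0]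
      exact mul_nonneg zero_le_two (pow_nonneg (add_nonneg (hnn _) (hnn _)) n)

end Artin

/-! ### Homogenization of quasi-morphisms -/

section QuasiValuation

open Filter Topology

variable {G : Type*} [CommGroup G] {N : G → ℤ}

/-- A quasi-morphism to the integers is close to a homomorphism to the real numbers. -/
theorem exists_tendsto_homogenization (hN : ∀ x y, N (x * y) ≤ N x + N y)
    (hN' : ∀ x y, N x + N y - 1 ≤ N (x * y)) :
    ∃ L : G → ℝ, (∀ x, Tendsto (fun n : ℕ => (N (x ^ n) : ℝ) / n) atTop (𝓝 (L x))) ∧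
      ∀ x y, L (x * y) = L x + L y := by
  have hlow (x : G) (n : ℕ) (hn : 1 ≤ n) : n * (N x - 1) ≤ N (x ^ n) := by
    induction n, hn using Nat.le_induction with
    | base => simp
    | succ n hn ih =>
      have := hN' (x ^ n) x
      rw [← pow_succ] at this
      push_cast
      linarith
  -- N(x^n) is subadditive in n and bounded below by a linear function, so by Fekete's lemma
  -- N(x^n)/n converges.
  have hsub (x : G) : Subadditive fun n : ℕ => (N (x ^ n) : ℝ) := fun m n => by
    change (N (x ^ (m + n)) : ℝ) ≤ N (x ^ m) + N (x ^ n)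
    rw [pow_add]
    exact_mod_cast hN (x ^ m) (x ^ n)
  have hbdd (x : G) : BddBelow (Set.range fun n : ℕ => (N (x ^ n) : ℝ) / n) := by
    refine ⟨min 0 (N x - 1), ?_⟩
    rintro _ ⟨n, rfl⟩
    rcases Nat.eq_zero_or_pos n with rfl | hn
    · simp
    · refine (min_le_right _ _).trans ?_
      change _ ≤ (N (x ^ n) : ℝ) / n
      rw [le_div_iff₀' (by exact_mod_cast hn)]
      exact_mod_cast hlow x n hn
  have ht (x : G) := (hsub x).tendsto_lim (hbdd x)
  refine ⟨fun x => (hsub x).lim, ht, fun x y => ?_⟩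
  -- The defect of N is at most 1 for all pairs of powers and disappears after division by n.
  have h1 := (ht (x * y)).sub ((ht x).add (ht y))
  have h2 : Tendsto (fun n : ℕ => (N ((x * y) ^ n) : ℝ) / n - (N (x ^ n) / n + N (y ^ n) / n))
      atTop (𝓝 0) := by
    refine squeeze_zero_norm (a := fun n : ℕ => 1 / (n : ℝ)) (fun n => ?_)
      tendsto_one_div_atTop_nhds_zero_nat
    rw [← add_div, ← sub_div, norm_div, Real.norm_natCast]
    refine div_le_div_of_nonneg_right ?_ (Nat.cast_nonneg n)
    rw [mul_pow, Real.norm_eq_abs, abs_le]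
    have ha := hN (x ^ n) (y ^ n)
    have hb := hN' (x ^ n) (y ^ n)
    constructor
    · have : (N (x ^ n) + N (y ^ n) - 1 : ℝ) ≤ N (x ^ n * y ^ n) := by exact_mod_cast hb
      linarith
    · have : (N (x ^ n * y ^ n) : ℝ) ≤ N (x ^ n) + N (y ^ n) := by exact_mod_cast ha
      linarith
  exact sub_eq_zero.1 (tendsto_nhds_unique h1 h2)

end QuasiValuation

/-! ### The absolute value when sums of scalars leave B -/

namespace IsVal

variable {R K : Type u} [CommRing R] [IsDedekindDomain R] [Field K] [NumberField K] [Algebra R K]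
variable [IsFractionRing R K] [IsIntegralClosure R ℤ K]
variable {B : Sub (mat K)} (hB : IsVal B)

include hB

variable (R) in
include R in
-- B[1/e] is closed under addition and is a valuation ring, hence a local ring of R; the claim is
-- that it equals K. For x outside of it, some power e^(−2M) has the form 1 + x⁻¹y with x⁻¹y in B.
-- Then e(1 + x⁻¹y) = e^(1 − 2M) lies in B, which forces e⁻¹ into B.
theorem exists_pow_mul_mem {e : K} (he : e ∈ B.scalars) (he0 : e ≠ 0)
    (hadd : ∀ a ∈ B.scalars, ∀ b ∈ B.scalars, e * (a + b) ∈ B.scalars) (hi : e⁻¹ ∉ B.scalars)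
    (x : K) : ∃ k : ℕ, e ^ k * x ∈ B.scalars := by
  let O : Subring K :=
    { carrier := {x | ∃ k : ℕ, e ^ k * x ∈ B.scalars}
      mul_mem' := by
        rintro x y ⟨k, hk⟩ ⟨l, hl⟩
        refine ⟨k + l, ?_⟩
        rw [pow_add, mul_mul_mul_comm]
        exact mul_mem_scalars hk hl
      one_mem' := ⟨0, by rw [pow_zero, mul_one]; exact one_mem_scalars⟩
      add_mem' := by
        rintro x y ⟨k, hk⟩ ⟨l, hl⟩
        refine ⟨k + l + 1, ?_⟩
        have h := hadd _ (mul_mem_scalars (pow_mem_scalars he l) hk) _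
          (mul_mem_scalars (pow_mem_scalars he k) hl)
        convert h using 1
        ring
      zero_mem' := ⟨0, by rw [mul_zero]; exact zero_mem_scalars⟩
      neg_mem' := by
        rintro x ⟨k, hk⟩
        refine ⟨k, ?_⟩
        rw [mul_neg]
        exact hB.neg_mem hk }
  have hV {x : K} (hx : x ∈ B.scalars) : x ∈ O := ⟨0, by rwa [pow_zero, one_mul]⟩
  have hO (x : K) : x ∈ O ∨ x⁻¹ ∈ O := by
    rcases eq_or_ne x 0 with rfl | hx
    · exact .inl (zero_mem O)
    · exact (hB.mem_or_inv hx).imp hV hV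
  obtain ⟨q, hq⟩ := exists_eq_locRing R O hO
  change x ∈ O
  by_contra hx
  have hx0 : x ≠ 0 := by rintro rfl; exact hx (zero_mem O)
  have hxi : x⁻¹ ∈ O := (hO x).resolve_left hx
  have heO : e⁻¹ ∈ O := ⟨1, by rw [pow_one, mul_inv_cancel₀ he0]; exact one_mem_scalars⟩
  have heO' : e ^ 2 ∈ O := pow_mem (hV he) 2
  have heO2 : e⁻¹ ^ 2 ∈ O := pow_mem heO 2
  rw [hq] at hxi heO2 heO'
  -- The square of e⁻¹ is used because one factor e is spent on the sum: the exponent 1 − 2M is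
  -- negative even for M = 1.
  obtain ⟨M, hM, y, hy, e1⟩ := exists_pow_sub_one_mem (u := e⁻¹ ^ 2) (by positivity) heO2
    (by rwa [inv_pow, inv_inv]) hxi (inv_ne_zero hx0)
  rw [← hq] at hy
  -- Otherwise x y⁻¹ would lie in B, and x = (x y⁻¹) y in B[1/e].
  have h1 : x⁻¹ * y ∈ B.scalars := by
    rcases eq_or_ne y 0 with rfl | hy0
    · rw [mul_zero]; exact zero_mem_scalars
    · refine (hB.mem_or_inv (mul_ne_zero (inv_ne_zero hx0) hy0)).resolve_right fun h => hx ?_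
      have := mul_mem (hV h) hy
      rwa [mul_inv, inv_inv, inv_mul_cancel_right₀ hy0] at this
  have h2 := hadd 1 one_mem_scalars _ h1
  rw [← e1, ← pow_mul] at h2
  obtain ⟨m, rfl⟩ := Nat.exists_eq_succ_of_ne_zero hM
  have h3 := mul_mem_scalars h2 (pow_mem_scalars he (2 * m))
  refine hi ?_
  convert h3 using 1
  rw [Nat.mul_succ, pow_add, inv_pow e (2 * m)]
  field_simp

theorem zpow_mem_iff {e : K} (he : e ∈ B.scalars) (he0 : e ≠ 0) (hi : e⁻¹ ∉ B.scalars) (k : ℤ) :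
    e ^ k ∈ B.scalars ↔ 0 ≤ k := by
  constructor
  · intro h
    by_contra! hk
    obtain ⟨n, hn⟩ := Int.eq_ofNat_of_zero_le (show 0 ≤ -1 - k by omega)
    have := mul_mem_scalars h (pow_mem_scalars he n)
    rw [← zpow_natCast, ← zpow_add₀ he0, ← hn, show k + (-1 - k) = -1 by ring, zpow_neg_one] at this
    exact hi this
  · intro hk
    obtain ⟨n, rfl⟩ := Int.eq_ofNat_of_zero_le hk
    rw [zpow_natCast]
    exact pow_mem_scalars he n

/-- The exponents k with e^k x in B are closed upwards, and bounded below because some e^j x⁻¹ lies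
in B. -/
theorem exists_order {e : K} (he : e ∈ B.scalars) (he0 : e ≠ 0)
    (hfull : ∀ x, ∃ k : ℕ, e ^ k * x ∈ B.scalars) (hi : e⁻¹ ∉ B.scalars) (x : Kˣ) :
    ∃ n : ℤ, ∀ k : ℤ, e ^ k * x ∈ B.scalars ↔ n ≤ k := by
  have hup {k l : ℤ} (h : k ≤ l) (hk : e ^ k * x ∈ B.scalars) : e ^ l * x ∈ B.scalars := by
    have := mul_mem_scalars ((hB.zpow_mem_iff he he0 hi (l - k)).2 (by omega)) hk
    rwa [← mul_assoc, ← zpow_add₀ he0, sub_add_cancel] at this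
  obtain ⟨j, hj⟩ := hfull (x : K)⁻¹
  obtain ⟨i, hi'⟩ := hfull x
  obtain ⟨n, hn, hmin⟩ := Int.exists_least_of_bdd (P := fun k => e ^ k * x ∈ B.scalars)
    ⟨-j, fun k hk => by
      have := mul_mem_scalars hk hj
      rw [mul_mul_mul_comm, mul_inv_cancel₀ x.ne_zero, mul_one, ← zpow_natCast, ← zpow_add₀ he0,
        hB.zpow_mem_iff he he0 hi] at this
      omega⟩ ⟨i, by rwa [zpow_natCast]⟩
  exact ⟨n, fun k => ⟨hmin k, fun h => hup h hn⟩⟩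

variable (R) in
include R in
open Classical Filter Topology in
-- Let N(x) be the least exponent with e^N(x) x in B. The valuation property makes N a homomorphism
-- up to an error of 1; let L be its homogenization and f = 2^L. Then f ≤ 1 on B, and f(1 + x) ≤ 2
-- for x in B because e(1 + x) lies in B. Artin's argument turns this into the triangle inequality.
theorem exists_absoluteValue (hna : ∃ a ∈ B.scalars, ∃ b ∈ B.scalars, a + b ∉ B.scalars) :
    ∃ f : AbsoluteValue K ℝ, (∃ x, 1 < f x) ∧ (∀ x, f x < 1 → x ∈ B.scalars) ∧
      ∀ x ∈ B.scalars, f x ≤ 1 := by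
  obtain ⟨e, he, he0, hadd⟩ := hB.exists_mul_add_mem
  -- If e were a unit of B, the scalars would be closed under addition.
  have hi : e⁻¹ ∉ B.scalars := by
    intro h
    obtain ⟨a, ha, b, hb, hab⟩ := hna
    have := mul_mem_scalars h (hadd a ha b hb)
    rw [inv_mul_cancel_left₀ he0] at this
    exact hab this
  have hfull := hB.exists_pow_mul_mem R he he0 hadd hi
  choose N hN using hB.exists_order he he0 hfull hi
  have hmul (x y : Kˣ) : N (x * y) ≤ N x + N y := by
    rw [← hN, Units.val_mul, zpow_add₀ he0, mul_mul_mul_comm]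
    exact mul_mem_scalars ((hN _ _).2 le_rfl) ((hN _ _).2 le_rfl)
  -- By minimality e^(N(y) − 1) y is not in B, so its inverse is. If N(xy) were at most N(x) + N(y)
  -- − 2, multiplication by this inverse would put e^(N(x) − 1) x into B.
  have hmul' (x y : Kˣ) : N x + N y - 1 ≤ N (x * y) := by
    by_contra! h
    have h1 : e ^ (N x + N y - 2) * (x * y : Kˣ) ∈ B.scalars := (hN _ _).2 (by omega)
    have h2 : e ^ (N y - 1) * (y : K) ∉ B.scalars := fun h => by
      have := (hN _ _).1 h
      omega
    have h3 := (hB.mem_or_inv (mul_ne_zero (zpow_ne_zero _ he0) y.ne_zero)).resolve_left h2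
    have h4 := mul_mem_scalars h1 h3
    have h5 : e ^ (N x + N y - 2) * (x * y : Kˣ) * (e ^ (N y - 1) * (y : K))⁻¹ =
        e ^ (N x - 1) * x := by
      rw [show N x + N y - 2 = (N x - 1) + (N y - 1) by ring, zpow_add₀ he0, Units.val_mul]
      have := zpow_ne_zero (N y - 1) he0
      have := y.ne_zero
      field_simp
    rw [h5, hN] at h4
    omega
  obtain ⟨L, hL, hLmul⟩ := exists_tendsto_homogenization hmul hmul'
  have hL1 : L 1 = 0 := by
    have := hLmul 1 1
    rw [one_mul] at this
    linarith
  have hNpow (x : Kˣ) (n : ℕ) : N (x ^ n) ≤ n * max (N x) 0 := by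
    induction n with
    | zero =>
      rw [pow_zero, ← hN]
      simpa using one_mem_scalars
    | succ n ih =>
      rw [pow_succ]
      push_cast
      linarith [hmul (x ^ n) x, le_max_left (N x) 0]
  have hLle (x : Kˣ) : L x ≤ max (N x) 0 := by
    refine le_of_tendsto (hL x) (Eventually.of_forall fun n => ?_)
    rcases Nat.eq_zero_or_pos n with rfl | hn
    · simp
    · rw [div_le_iff₀' (by exact_mod_cast hn)]
      exact_mod_cast hNpow x n
  have hLV (x : Kˣ) (hx : (x : K) ∈ B.scalars) : L x ≤ 0 := by
    have : N x ≤ 0 := (hN _ _).1 (by simpa using hx)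
    refine (hLle x).trans ?_
    rw [max_eq_right this]
    simp
  -- N(e^(−n)) ≥ n, so f(e⁻¹) ≥ 2 and f is not trivial.
  have hLe : 1 ≤ L (Units.mk0 e⁻¹ (inv_ne_zero he0)) := by
    refine ge_of_tendsto (hL _) ?_
    filter_upwards [eventually_gt_atTop 0] with n hn
    rw [le_div_iff₀' (by exact_mod_cast hn), mul_one]
    have h1 := (hN (Units.mk0 e⁻¹ (inv_ne_zero he0) ^ n) _).2 le_rfl
    rw [Units.val_pow_eq_pow_val, Units.val_mk0, inv_pow, ← zpow_natCast e n, ← zpow_neg,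
      ← zpow_add₀ he0, hB.zpow_mem_iff he he0 hi] at h1
    have : (n : ℤ) ≤ N (Units.mk0 e⁻¹ (inv_ne_zero he0) ^ n) := by linarith
    exact_mod_cast this
  let f : K → ℝ := fun x => if h : x = 0 then 0 else 2 ^ L (Units.mk0 x h)
  have f0 : f 0 = 0 := dif_pos rfl
  have fx {x : K} (h : x ≠ 0) : f x = 2 ^ L (Units.mk0 x h) := dif_neg h
  have fpos {x : K} (h : x ≠ 0) : 0 < f x := by
    rw [fx h]; positivity
  have fnn (x : K) : 0 ≤ f x := by
    rcases eq_or_ne x 0 with rfl | h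
    · rw [f0]
    · exact (fpos h).le
  have f1 : f 1 = 1 := by
    rw [fx one_ne_zero, Units.mk0_one, hL1, Real.rpow_zero]
  have fmul (x y : K) : f (x * y) = f x * f y := by
    rcases eq_or_ne x 0 with rfl | hx
    · rw [zero_mul, f0, zero_mul]
    rcases eq_or_ne y 0 with rfl | hy
    · rw [mul_zero, f0, mul_zero]
    rw [fx hx, fx hy, fx (mul_ne_zero hx hy), ← Real.rpow_add two_pos, ← hLmul]
    congr
    ext
    rfl
  have fV (x : K) (hx : x ∈ B.scalars) : f x ≤ 1 := by
    rcases eq_or_ne x 0 with rfl | h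
    · rw [f0]; exact zero_le_one
    · rw [fx h]
      exact Real.rpow_le_one_of_one_le_of_nonpos one_le_two (hLV _ hx)
  have fone (x : K) (hx : x ∈ B.scalars) : f (1 + x) ≤ 2 := by
    rcases eq_or_ne (1 + x) 0 with h | h
    · rw [h, f0]; exact zero_le_two
    · rw [fx h]
      conv_rhs => rw [← Real.rpow_one 2]
      refine Real.rpow_le_rpow_of_exponent_le one_le_two ((hLle _).trans ?_)
      have : N (Units.mk0 (1 + x) h) ≤ 1 := (hN _ _).1 (by
        rw [zpow_one]
        exact hadd 1 one_mem_scalars x hx)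
      exact_mod_cast max_le this zero_le_one
  have fadd (x y : K) : f (x + y) ≤ 2 * max (f x) (f y) := by
    have key {x y : K} (hy : y ≠ 0) (h : x * y⁻¹ ∈ B.scalars) : f (x + y) ≤ 2 * max (f x) (f y) := by
      rw [show x + y = (1 + x * y⁻¹) * y by field_simp; ring, fmul]
      exact mul_le_mul (fone _ h) (le_max_right _ _) (fnn _) zero_le_two
    rcases eq_or_ne x 0 with rfl | hx
    · rw [zero_add]
      linarith [le_max_right (f 0) (f y), fnn y]
    rcases eq_or_ne y 0 with rfl | hy
    · rw [add_zero]
      linarith [le_max_left (f x) (f 0), fnn x]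
    rcases hB.mem_or_inv (mul_ne_zero hx (inv_ne_zero hy)) with h | h
    · exact key hy h
    · rw [add_comm, max_comm]
      refine key hx ?_
      rwa [mul_inv, inv_inv, mul_comm] at h
  have f_eq (x : K) : f x = 0 ↔ x = 0 :=
    ⟨fun h => by_contra fun hx => (fpos hx).ne' h, fun h => by rw [h, f0]⟩
  refine ⟨⟨⟨f, fmul⟩, fnn, f_eq, map_add_le_of_le_two_mul_max f0 f1 fnn fmul fadd⟩, ⟨e⁻¹, ?_⟩,
    fun x hx => ?_, fV⟩
  · change 1 < f e⁻¹
    rw [fx (inv_ne_zero he0)]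
    exact Real.one_lt_rpow one_lt_two (by linarith)
  · change f x < 1 at hx
    by_contra h
    have hx0 : x ≠ 0 := by rintro rfl; exact h zero_mem_scalars
    have h1 := fV _ ((hB.mem_or_inv hx0).resolve_left h)
    have h2 := fmul x x⁻¹
    rw [mul_inv_cancel₀ hx0, f1] at h2
    nlinarith [fnn x⁻¹, fnn x]

end IsVal

end FOne

namespace FOne
open TopologicalSpace
open FSpace

/-! #### The non-archimedean case -/

/-- The binomial expansion of (x + y)^n has n + 1 terms, each at most max(f x, f y)^n. -/
theorem add_le_max_of_natCast_le_one {K : Type*} [Field K] {f : AbsoluteValue K ℝ}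
    (hf : ∀ n : ℕ, f n ≤ 1) (x y : K) : f (x + y) ≤ max (f x) (f y) := by
  have h0 : 0 ≤ max (f x) (f y) := (f.nonneg x).trans (le_max_left _ _)
  refine le_of_pow_le h0 fun n => ?_
  rw [← map_pow, add_pow]
  refine (f.sum_le _ _).trans ?_
  refine (Finset.sum_le_card_nsmul _ _ (max (f x) (f y) ^ n) fun i hi => ?_).trans ?_
  · have hi' : i ≤ n := Nat.lt_succ_iff.1 (Finset.mem_range.1 hi)
    rw [map_mul, map_mul, map_pow, map_pow, ← Nat.add_sub_of_le hi', pow_add, Nat.add_sub_of_le hi']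
    calc f x ^ i * f y ^ (n - i) * f (n.choose i)
        ≤ f x ^ i * f y ^ (n - i) * 1 := mul_le_mul_of_nonneg_left (hf _)
          (mul_nonneg (pow_nonneg (f.nonneg _) _) (pow_nonneg (f.nonneg _) _))
      _ ≤ _ := by
        rw [mul_one]
        exact mul_le_mul (pow_le_pow_left₀ (f.nonneg _) (le_max_left _ _) _)
          (pow_le_pow_left₀ (f.nonneg _) (le_max_right _ _) _) (pow_nonneg (f.nonneg _) _)
          (pow_nonneg h0 _)
  · rw [Finset.card_range, nsmul_eq_mul]
    push_cast
    have : 0 ≤ ((n : ℝ) + 1) * max (f x) (f y) ^ n := mul_nonneg (by positivity) (pow_nonneg h0 n)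
    linarith

namespace IsVal

variable {R K : Type u} [CommRing R] [IsDedekindDomain R] [Field K] [NumberField K] [Algebra R K]
variable [IsFractionRing R K] [IsIntegralClosure R ℤ K]
variable {B : Sub (mat K)} (hB : IsVal B)

include hB

variable (R) in
include R in
-- Suppose that sums leave B. Then B has no row of length two with an entry of value one next to a
-- non-zero entry (`key`). But this very fact implies that (1, x₀⁻¹) pairs with every row into B, so
-- by self-duality it is such a row.
theorem add_mem_of_natCast_le_one {f : AbsoluteValue K ℝ} (hf : ∃ x, 1 < f x)
    (hlt : ∀ x, f x < 1 → x ∈ B.scalars) (hle : ∀ x ∈ B.scalars, f x ≤ 1)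
    (hn : ∀ n : ℕ, f n ≤ 1) : ∀ a ∈ B.scalars, ∀ b ∈ B.scalars, a + b ∈ B.scalars := by
  have hmax := add_le_max_of_natCast_le_one hn
  by_contra hna
  let A : Subring K :=
    { carrier := {x | f x ≤ 1}
      mul_mem' := fun {x y} hx hy => by
        change f (x * y) ≤ 1
        rw [map_mul]
        exact mul_le_one₀ hx (f.nonneg _) hy
      one_mem' := (map_one f).le
      add_mem' := fun {x y} hx hy => (hmax x y).trans (max_le hx hy)
      zero_mem' := (map_zero f).le.trans zero_le_one
      neg_mem' := fun {x} hx => (f.map_neg x).le.trans hx }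
  have hA (x : K) : x ∈ A ∨ x⁻¹ ∈ A := by
    rcases le_total (f x) 1 with h | h
    · exact .inl h
    · refine .inr ?_
      change f x⁻¹ ≤ 1
      rw [map_inv₀]
      exact inv_le_one_of_one_le₀ h
  obtain ⟨q, hq⟩ := exists_eq_locRing R A hA
  have hpow {u s : K} (hu : f u = 1) (hs : f s ≤ 1) (hs0 : s ≠ 0) :
      ∃ M ≠ 0, ∃ y, f y ≤ 1 ∧ u ^ M = 1 + s * y := by
    have hu0 : u ≠ 0 := by
      rintro rfl
      rw [map_zero] at hu
      exact zero_ne_one hu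
    obtain ⟨M, hM, y, hy, h⟩ := exists_pow_sub_one_mem (q := q) (u := u) hu0
      (hq ▸ (show u ∈ A from hu.le)) (hq ▸ (show f u⁻¹ ≤ 1 by rw [map_inv₀, hu, inv_one]))
      (hq ▸ (show s ∈ A from hs)) hs0
    exact ⟨M, hM, y, by rw [← hq] at hy; exact hy, h⟩
  obtain ⟨x₀, hx₀⟩ := hf
  have hx0 : x₀ ≠ 0 := by
    rintro rfl
    rw [map_zero] at hx₀
    linarith
  have hy₀ : f x₀⁻¹ < 1 := by
    rw [map_inv₀]
    exact inv_lt_one_of_one_lt₀ hx₀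
  -- Such a row would put all 1 + s y with f(y) ≤ 1 into B, for some s ≠ 0. Every element of value
  -- one has a power of this form, so B would contain {f ≤ 1}, hence be equal to it and closed under
  -- addition.
  have key (b : Bool → K) (hb : b ∈ B.rows Bool) (h1 : f (b true) = 1) (h2 : b false ≠ 0) :
      False := by
    have hb1 : b true ≠ 0 := by
      intro h
      rw [h, map_zero] at h1
      exact zero_ne_one h1
    -- Chosen so that diag(1, x₀⁻¹y) between b and its transpose gives (b true)²(1 + s y).
    let s : K := x₀⁻¹ * (b false / b true) ^ 2
    have hs0 : s ≠ 0 := mul_ne_zero (inv_ne_zero hx0) (pow_ne_zero _ (div_ne_zero h2 hb1))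
    have hs : f s ≤ 1 := by
      rw [map_mul, map_pow, map_div₀, h1, div_one]
      exact mul_le_one₀ hy₀.le (pow_nonneg (f.nonneg _) _)
        (pow_le_one₀ (f.nonneg _) (hle _ (coord_mem_scalars hb false)))
    have hmem (y : K) (hy : f y ≤ 1) : b true ^ 2 * (1 + s * y) ∈ B.scalars := by
      have h3 : x₀⁻¹ * y ∈ B.scalars := by
        refine hlt _ ?_
        rw [map_mul]
        exact (mul_le_of_le_one_right (f.nonneg _) hy).trans_lt hy₀
      have h4 := dot_mem_scalars hb (diag_mul_mem_rows
        (d := fun i : Bool => bif i then 1 else x₀⁻¹ * y)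
        (by rintro (_ | _); exacts [h3, one_mem_scalars]) hb)
      rw [Fintype.sum_bool] at h4
      convert h4 using 1
      simp only [s, cond_true, cond_false]
      field_simp
    have hinv : (b true)⁻¹ ∈ B.scalars := by
      -- The cube makes the exponent 2 − 3M of `b true` negative for all M ≥ 1; multiplication by
      -- its power 3(M − 1) then leaves the inverse.
      obtain ⟨M, hM, y, hy, e⟩ := hpow (u := (b true)⁻¹ ^ 3)
        (by rw [map_pow, map_inv₀, h1, inv_one, one_pow]) hs hs0
      obtain ⟨m, rfl⟩ := Nat.exists_eq_succ_of_ne_zero hM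
      have h3 := mul_mem_scalars (hmem y hy)
        (pow_mem_scalars (coord_mem_scalars hb true) (3 * m))
      rw [← e, ← pow_mul, Nat.mul_succ, pow_add, inv_pow _ (3 * m)] at h3
      convert h3 using 1
      field_simp
    have hone (y : K) (hy : f y ≤ 1) : 1 + s * y ∈ B.scalars := by
      have := mul_mem_scalars (pow_mem_scalars hinv 2) (hmem y hy)
      rwa [← mul_assoc, ← mul_pow, inv_mul_cancel₀ hb1, one_pow, one_mul] at this
    have hall (x : K) (hx : f x ≤ 1) : x ∈ B.scalars := by
      rcases hx.lt_or_eq with h | h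
      · exact hlt x h
      · obtain ⟨M, hM, y, hy, e⟩ := hpow h hs hs0
        refine hB.mem_of_pow_mem hM ?_
        rw [e]
        exact hone y hy
    exact hna fun a ha c hc => hall _ ((hmax a c).trans (max_le (hle a ha) (hle c hc)))
  refine key (fun i => bif i then 1 else x₀⁻¹) (hB.mem_rows_iff.2 fun c hc => ?_)
    (map_one f) (inv_ne_zero hx0)
  rw [Fintype.sum_bool]
  simp only [cond_true, cond_false, one_mul]
  -- If c false ≠ 0, `key` gives f(c true) < 1, and the other summand has value less than one
  -- anyway.
  by_cases hc0 : c false = 0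
  · rw [hc0, mul_zero, add_zero]
    exact coord_mem_scalars hc true
  · have h1 : f (c true) < 1 :=
      lt_of_le_of_ne (hle _ (coord_mem_scalars hc true)) fun h => key c hc h hc0
    refine hlt _ ((hmax _ _).trans_lt (max_lt h1 ?_))
    rw [map_mul]
    exact (mul_le_of_le_one_right (f.nonneg _) (hle _ (coord_mem_scalars hc false))).trans_lt hy₀

variable (R) in
-- The scalars form a valuation ring of K, hence some R_q. Both rings have all vectors of scalars as
-- rows, and rows determine them.
theorem eq_localAt (hadd : ∀ a ∈ B.scalars, ∀ b ∈ B.scalars, a + b ∈ B.scalars) :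
    ∃ q : PrimeSpectrum R, B = localAt K q := by
  let A : Subring K :=
    { carrier := B.scalars
      mul_mem' := mul_mem_scalars
      one_mem' := one_mem_scalars
      add_mem' := fun ha hb => hadd _ ha _ hb
      zero_mem' := zero_mem_scalars
      neg_mem' := hB.neg_mem }
  have hA (x : K) : x ∈ A ∨ x⁻¹ ∈ A := by
    rcases eq_or_ne x 0 with rfl | hx
    · exact .inl (zero_mem A)
    · exact hB.mem_or_inv hx
  obtain ⟨q, hq⟩ := exists_eq_locRing R A hA
  have hs : B.scalars = (localAt K q).scalars := by
    ext x
    rw [mem_scalars_localAt, ← hq]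
    rfl
  refine ⟨q, hB.ext_rows (isVal_localAt q) fun X _ => ?_⟩
  ext b
  rw [hB.mem_rows_of_add_mem hadd, (isVal_localAt q).mem_rows_of_add_mem (hs ▸ hadd), hs]

end IsVal

/-! #### Absolute values which are unbounded on the integers -/

section Ostrowski

open NumberField Module

variable {K : Type*} [Field K] [NumberField K]

/-- A crude form of Cauchy's bound for the roots of a monic polynomial. -/
theorem le_of_pow_eq_sum {f : AbsoluteValue K ℝ} {y : K} {d : ℕ} {c : ℕ → K} {D : ℝ} (hD : 0 ≤ D)
    (hc : ∀ i, f (c i) ≤ D) (hd : d ≠ 0) (h : y ^ d = -∑ i ∈ Finset.range d, c i * y ^ i) :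
    f y ≤ max 1 (d * D) := by
  rcases le_total (f y) 1 with h1 | h1
  · exact h1.trans (le_max_left _ _)
  refine le_max_of_le_right ?_
  obtain ⟨m, rfl⟩ := Nat.exists_eq_succ_of_ne_zero hd
  have h2 : f y ^ (m + 1) ≤ (m + 1 : ℕ) * D * f y ^ m := by
    rw [← map_pow, h, f.map_neg]
    refine (f.sum_le _ _).trans ?_
    refine (Finset.sum_le_card_nsmul _ _ (D * f y ^ m) fun i hi => ?_).trans ?_
    · rw [map_mul, map_pow]
      exact mul_le_mul (hc i) (pow_le_pow_right₀ h1 (Nat.lt_succ_iff.1 (Finset.mem_range.1 hi)))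
        (pow_nonneg (f.nonneg _) _) hD
    · rw [Finset.card_range, nsmul_eq_mul, mul_assoc]
  rw [pow_succ, mul_comm] at h2
  exact le_of_mul_le_mul_right h2 (by positivity)

/-- An absolute value of a number field which is unbounded on the integers comes from an infinite
place. -/
theorem exists_infinitePlace_isEquiv {f : AbsoluteValue K ℝ} (hf : ∃ n : ℕ, 1 < f n) :
    ∃ v : InfinitePlace K, f.IsEquiv v.1 := by
  by_contra! hne
  -- Ostrowski's theorem over ℚ: there f is a power of the usual absolute value.
  have hQ : (f.comp (algebraMap ℚ K).injective).IsEquiv Rat.AbsoluteValue.real := by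
    refine Rat.AbsoluteValue.equiv_real_of_unbounded fun h => ?_
    obtain ⟨n, hn⟩ := hf
    have h1 : f (algebraMap ℚ K n) ≤ 1 := h n
    rw [map_natCast] at h1
    exact h1.not_gt hn
  obtain ⟨c, hc, hcQ⟩ := AbsoluteValue.isEquiv_iff_exists_rpow_eq.1 hQ.symm
  have hnt : f.IsNontrivial := by
    obtain ⟨n, hn⟩ := hf
    refine ⟨n, ?_, hn.ne'⟩
    rintro h
    rw [h, map_zero] at hn
    linarith
  let w : Option (InfinitePlace K) → AbsoluteValue K ℝ := fun i => i.elim f fun v => v.1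
  -- Weak approximation: if f were not an infinite place, some a would be large for f and small at
  -- all infinite places.
  obtain ⟨a, ha, hav⟩ := AbsoluteValue.exists_one_lt_lt_one_pi_of_not_isEquiv (v := w)
    (by rintro (_ | v); exacts [hnt, v.isNontrivial])
    (by
      rintro (_ | v) (_ | v') h h'
      · exact h rfl
      · exact hne v' h'
      · exact hne v h'.symm
      · exact h (congrArg some (InfinitePlace.eq_iff_isEquiv.2 h'))) none
  have hav (φ : K →+* ℂ) (n : ℕ) : ‖φ (a ^ n)‖ ≤ 1 := by
    rw [map_pow, norm_pow]
    exact pow_le_one₀ (norm_nonneg _) (hav (some (InfinitePlace.mk φ)) (by simp)).le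
  let D : ℝ := max 1 1 ^ finrank ℚ K * (finrank ℚ K).choose (finrank ℚ K / 2)
  have hD : 0 ≤ D := by positivity
  -- All conjugates of a^n are bounded by one, so the coefficients of its minimal polynomial are
  -- bounded independently of n, for the usual absolute value and hence for f. Thus f(a^n) stays
  -- bounded, against f(a) > 1.
  have hbd (n : ℕ) : f a ^ n ≤ max 1 (finrank ℚ K * D ^ c) := by
    have hint : IsIntegral ℚ (a ^ n) := Algebra.IsIntegral.isIntegral _
    have h1 (i : ℕ) := Embeddings.coeff_bdd_of_norm_le (fun φ => hav φ n) i
    let P := minpoly ℚ (a ^ n)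
    have hP : P.Monic := minpoly.monic hint
    have h2 : (a ^ n) ^ P.natDegree =
        -∑ i ∈ Finset.range P.natDegree, algebraMap ℚ K (P.coeff i) * (a ^ n) ^ i := by
      have h3 := minpoly.aeval ℚ (a ^ n)
      rw [Polynomial.aeval_eq_sum_range, Finset.sum_range_succ, hP.coeff_natDegree, one_smul] at h3
      rw [eq_neg_of_add_eq_zero_right h3]
      simp only [Algebra.smul_def, P]
    have h4 := le_of_pow_eq_sum (f := f) (c := fun i => algebraMap ℚ K (P.coeff i)) (D := D ^ c)
      (by positivity) (fun i => ?_) (minpoly.natDegree_pos hint).ne' h2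
    · rw [← map_pow]
      refine h4.trans (max_le_max le_rfl (mul_le_mul_of_nonneg_right ?_ (by positivity)))
      exact_mod_cast minpoly.natDegree_le (a ^ n)
    · have h5 := congrFun hcQ (P.coeff i)
      refine (h5.symm.le).trans (Real.rpow_le_rpow (AbsoluteValue.nonneg _ _) ?_ hc.le)
      exact h1 i
  obtain ⟨n, hn⟩ := pow_unbounded_of_one_lt (max 1 (finrank ℚ K * D ^ c)) ha
  exact absurd (hbd n) hn.not_ge

end Ostrowski

end FOne

namespace FOne
open TopologicalSpace
open FSpace

/-! #### The archimedean case -/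

section UnitVectors

variable {𝕜 : Type*} [RCLike 𝕜] {X : Type*} [Fintype X]

/-- Pythagoras for the projection onto the line of z. It also yields the case of equality in
Cauchy–Schwarz. -/
theorem sum_sub_sq_of_sum_sq_eq_one {z : X → ℝ} (hz : ∑ x, z x ^ 2 = 1) (a : X → ℝ) :
    ∑ x, (a x - z x * ∑ y, z y * a y) ^ 2 = ∑ x, a x ^ 2 - (∑ x, z x * a x) ^ 2 := by
  set μ := ∑ y, z y * a y with hμ
  have h (x : X) : (a x - z x * μ) ^ 2 = a x ^ 2 - 2 * μ * (z x * a x) + μ ^ 2 * z x ^ 2 := by ring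
  simp only [h, Finset.sum_add_distrib, Finset.sum_sub_distrib, ← Finset.mul_sum, hz, ← hμ]
  ring

theorem norm_sq_eq_re_sq_add_im_sq (x : 𝕜) : ‖x‖ ^ 2 = RCLike.re x ^ 2 + RCLike.im x ^ 2 := by
  rw [RCLike.norm_sq_eq_def]
  ring

theorem sum_norm_sub_sq_of_sum_sq_eq_one {z : X → ℝ} (hz : ∑ x, z x ^ 2 = 1) (a : X → 𝕜) :
    ∑ x, ‖a x - z x * ∑ y, z y * a y‖ ^ 2 = ∑ x, ‖a x‖ ^ 2 - ‖∑ x, z x * a x‖ ^ 2 := by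
  have h1 := sum_sub_sq_of_sum_sq_eq_one hz fun x => RCLike.re (a x)
  have h2 := sum_sub_sq_of_sum_sq_eq_one hz fun x => RCLike.im (a x)
  simp only [norm_sq_eq_re_sq_add_im_sq, map_sub, map_sum, RCLike.re_ofReal_mul,
    RCLike.im_ofReal_mul, Finset.sum_add_distrib, h1, h2]
  ring

theorem norm_sum_mul_sq_le {z : X → ℝ} (hz : ∑ x, z x ^ 2 = 1) (a : X → 𝕜) :
    ‖∑ x, z x * a x‖ ^ 2 ≤ ∑ x, ‖a x‖ ^ 2 := by
  have := sum_norm_sub_sq_of_sum_sq_eq_one hz a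
  have h : 0 ≤ ∑ x, ‖a x - z x * ∑ y, z y * a y‖ ^ 2 := Finset.sum_nonneg fun _ _ => sq_nonneg _
  linarith

end UnitVectors

/-! ### Complex conjugation on a subfield of K -/

section ConjField

open NumberField

variable {K : Type*} [Field K] [NumberField K] {𝕜 : Type*} [RCLike 𝕜]

/-- When the unit circle of `K` contains a non-real number, some prime number is not the square of
an absolute value. -/
theorem exists_prime_ne_norm_sq (σ : K →+* 𝕜) {w : K} (hw : ‖σ w‖ = 1) (hw' : star (σ w) ≠ σ w) :
    ∃ p : ℕ, p.Prime ∧ ∀ β : K, ‖σ β‖ ^ 2 ≠ p := by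
  -- The largest subfield of K on which complex conjugation acts.
  let F₀ : Subfield K := (σ.fieldRange.comap (starRingEnd 𝕜)).comap σ
  let F : IntermediateField ℚ K := F₀.toIntermediateField fun q => by
    change starRingEnd 𝕜 (σ (algebraMap ℚ K q)) ∈ σ.fieldRange
    exact ⟨q, by simp⟩
  have hF {x : K} : x ∈ F ↔ ∃ y, σ y = star (σ x) := Iff.rfl
  choose g hg using fun x : F => hF.1 x.2
  have hgF (x : F) : g x ∈ F := hF.2 ⟨x, by rw [hg, star_star]⟩
  let c : F ≃+* F :=
    { toFun := fun x => ⟨g x, hgF x⟩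
      invFun := fun x => ⟨g x, hgF x⟩
      left_inv := fun x => Subtype.ext (σ.injective (by simp only [hg, star_star]))
      right_inv := fun x => Subtype.ext (σ.injective (by simp only [hg, star_star]))
      map_mul' := fun x y => Subtype.ext (σ.injective (by
        change σ (g (x * y)) = σ (g x * g y)
        rw [hg, map_mul, hg, hg]
        change star (σ (x * y)) = _
        rw [map_mul, star_mul, mul_comm]))
      map_add' := fun x y => Subtype.ext (σ.injective (by
        change σ (g (x + y)) = σ (g x + g y)
        rw [hg, map_add, hg, hg]
        change star (σ (x + y)) = _
        rw [map_add, star_add])) }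
  have hc (x : F) : σ (c x : K) = star (σ x) := hg x
  -- If |β|² = r is rational and non-zero, the conjugate of β is r/β, so β lies in F. For r = 1 this
  -- places w in F and makes the involution non-trivial; for r = p it writes p as y c(y).
  have key {β : K} {r : ℚ} (hr : ‖σ β‖ ^ 2 = r) (hr0 : r ≠ 0) : ∃ x : F, x = β ∧ x * c x = r := by
    have h1 : star (σ β) * σ β = σ r := by
      rw [map_ratCast]
      refine (RCLike.conj_mul (σ β)).trans ?_
      exact_mod_cast congrArg (RCLike.ofReal (K := 𝕜)) hr
    have hβ : σ β ≠ 0 := by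
      intro h
      rw [h, norm_zero] at hr
      refine hr0 ?_
      have : (r : ℝ) = 0 := by rw [← hr]; norm_num
      exact_mod_cast this
    have h2 : star (σ β) = σ (r / β) := by
      rw [map_div₀, eq_div_iff hβ, h1]
    have hmem : β ∈ F := hF.2 ⟨_, h2.symm⟩
    refine ⟨⟨β, hmem⟩, rfl, Subtype.ext (σ.injective ?_)⟩
    change σ (β * (c ⟨β, hmem⟩ : K)) = σ ((r : F) : K)
    rw [map_mul, hc, mul_comm, h1]
    simp
  obtain ⟨x, hx, -⟩ := key (β := w) (r := 1) (by rw [hw]; simp) one_ne_zero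
  obtain ⟨p, hp, h⟩ := exists_prime_ne_mul_involution c (fun x => c.left_inv x) (x := x) (by
    intro h
    refine hw' ?_
    have := hc x
    rw [h, hx] at this
    exact this.symm)
  refine ⟨p, hp, fun β hβ => ?_⟩
  obtain ⟨y, -, hy⟩ := key (β := β) (r := p) (by simpa using hβ) (by exact_mod_cast hp.ne_zero)
  exact h y (by simpa using hy)

end ConjField

/-! ### Valuation sub-𝔽-rings with scalars between the open and the closed unit ball -/

namespace IsVal

variable {K : Type u} [Field K] [NumberField K] {𝕜 : Type} [RCLike 𝕜] {σ : K →+* 𝕜}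
variable {B : Sub (mat K)} (hB : IsVal B) (hlt : ∀ x, ‖σ x‖ < 1 → x ∈ B.scalars)
variable (hle : ∀ x ∈ B.scalars, ‖σ x‖ ≤ 1) {X : Type} [Fintype X]

include hlt hle

/-- For v over K with entries of absolute value less than one, diag(v) between b and its transpose
gives the scalar Σ v_x b_x². If b had length greater than one, v could turn the phases of the b_x²
so that this sum exceeds one. -/
theorem sum_norm_sq_le_one {b : X → K} (hb : b ∈ B.rows X) : ∑ x, ‖σ (b x)‖ ^ 2 ≤ 1 := by
  by_contra! h
  set S := ∑ x, ‖σ (b x)‖ ^ 2 with hS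
  obtain ⟨t, ht, ht1⟩ := exists_between (inv_lt_one_of_one_lt₀ h)
  have ht0 : 0 < t := (inv_pos.2 (by linarith)).trans ht
  -- Here u_x b_x² = t |b_x|² and |u_x| ≤ t < 1, while t S > 1.
  let u : X → 𝕜 := fun x => if σ (b x) = 0 then 0 else t * (star (σ (b x)) / σ (b x))
  have hu (x : X) : ‖u x‖ < 1 := by
    by_cases h0 : σ (b x) = 0
    · simp [u, h0]
    · simp only [u, if_neg h0, norm_mul, norm_div, norm_star, div_self (norm_ne_zero_iff.2 h0),
        RCLike.norm_ofReal, abs_of_pos ht0, mul_one]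
      exact ht1
  have hsum : ∑ x, u x * σ (b x) ^ 2 = ((t * S : ℝ) : 𝕜) := by
    rw [hS, Finset.mul_sum]
    push_cast
    refine Finset.sum_congr rfl fun x _ => ?_
    by_cases h0 : σ (b x) = 0
    · simp [u, h0]
    · rw [← RCLike.conj_mul]
      simp only [u, if_neg h0]
      field_simp
      rfl
  -- Only approximation of u by vectors over K is needed. If σ(K) is real, the phases are trivial
  -- and u_x is 0 or t, a limit of rationals.
  have hcl (x : X) : u x ∈ closure (Set.range σ) := by
    rcases denseRange_or_im_eq_zero σ with hd | hi
    · rw [hd.closure_range]; trivial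
    · by_cases h0 : σ (b x) = 0
      · simp only [u, if_pos h0]
        exact subset_closure ⟨0, map_zero σ⟩
      · have h1 : star (σ (b x)) = σ (b x) := RCLike.conj_eq_iff_im.2 (hi _)
        simp only [u, if_neg h0, h1, div_self h0, mul_one]
        have h2 : t ∈ closure (Set.range ((↑) : ℚ → ℝ)) := by
          rw [Rat.denseRange_cast.closure_range]; trivial
        refine map_mem_closure RCLike.continuous_ofReal h2 ?_
        rintro _ ⟨r, rfl⟩
        exact ⟨r, by simp⟩
  have hcl' : u ∈ closure (Set.univ.pi fun _ : X => Set.range σ) := by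
    rw [closure_pi_set]
    exact fun x _ => hcl x
  let U : Set (X → 𝕜) := {v | (∀ x, ‖v x‖ < 1) ∧ 1 < ‖∑ x, v x * σ (b x) ^ 2‖}
  have hU : IsOpen U := by
    have h1 : IsOpen (⋂ x : X, {v : X → 𝕜 | ‖v x‖ < 1}) :=
      isOpen_iInter_of_finite fun x => isOpen_lt (by fun_prop) continuous_const
    have h2 : IsOpen {v : X → 𝕜 | 1 < ‖∑ x, v x * σ (b x) ^ 2‖} :=
      isOpen_lt continuous_const (by fun_prop)
    convert h1.inter h2 using 1
    ext v
    simp [U]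
  obtain ⟨v, hvU, hv⟩ := mem_closure_iff.1 hcl' U hU ⟨hu, by
    rw [hsum, RCLike.norm_ofReal, abs_of_pos (mul_pos ht0 (by linarith))]
    rwa [inv_lt_iff_one_lt_mul₀ (by linarith)] at ht⟩
  choose d hd using fun x => hv x (Set.mem_univ x)
  have h1 := hle _ (dot_mem_scalars hb (diag_mul_mem_rows
    (fun x => hlt (d x) (by rw [hd]; exact hvU.1 x)) hb))
  rw [map_sum] at h1
  refine h1.not_gt (hvU.2.trans_eq (congrArg _ (Finset.sum_congr rfl fun x _ => ?_)))
  rw [map_mul, map_mul, hd]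
  ring

include hB

/-- By self-duality, μ = Σ z_x b_x must be a scalar for every row b. This holds if |μ| < 1. If |μ| =
1, equality in Cauchy–Schwarz gives b = μ z, so μ² = b·b is a scalar and therefore μ. -/
theorem rat_unit_mem_rows {z : X → ℚ} (hz : ∑ x, z x ^ 2 = 1) : (fun x => (z x : K)) ∈ B.rows X := by
  refine hB.mem_rows_iff.2 fun b hb => ?_
  set μ := ∑ x, (z x : K) * b x with hμ
  have hz' : ∑ x, ((z x : ℝ)) ^ 2 = 1 := by exact_mod_cast hz
  have h1 := sum_norm_sub_sq_of_sum_sq_eq_one hz' fun x => σ (b x)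
  have h2 : ∑ y, ((z y : ℝ) : 𝕜) * σ (b y) = σ μ := by
    rw [hμ, map_sum]
    refine Finset.sum_congr rfl fun x _ => ?_
    rw [map_mul, map_ratCast, RCLike.ofReal_ratCast]
  rw [h2] at h1
  have h3 := sum_norm_sq_le_one hlt hle hb
  have h0 : 0 ≤ ∑ x, ‖σ (b x) - ((z x : ℝ) : 𝕜) * σ μ‖ ^ 2 :=
    Finset.sum_nonneg fun _ _ => sq_nonneg _
  have h4 : ‖σ μ‖ ≤ 1 := by
    rw [← abs_of_nonneg (norm_nonneg (σ μ)), ← sq_le_one_iff_abs_le_one]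
    linarith
  rcases h4.lt_or_eq with h | h
  · exact hlt _ h
  rw [h] at h1
  have h5 : ∑ x, ‖σ (b x) - ((z x : ℝ) : 𝕜) * σ μ‖ ^ 2 = 0 := by linarith
  rw [Finset.sum_eq_zero_iff_of_nonneg fun _ _ => sq_nonneg _] at h5
  have h6 (x : X) : b x = z x * μ := by
    have := h5 x (Finset.mem_univ x)
    rw [sq_eq_zero_iff, norm_eq_zero, sub_eq_zero] at this
    refine σ.injective ?_
    rw [this, map_mul, map_ratCast, RCLike.ofReal_ratCast]
  refine hB.mem_of_pow_mem two_ne_zero ?_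
  have h7 := dot_mem_scalars hb hb
  convert h7 using 1
  simp only [h6]
  have h8 : ∑ x, ((z x : K)) ^ 2 = 1 := by exact_mod_cast congrArg (Rat.cast (K := K)) hz
  rw [← one_mul (μ ^ 2), ← h8, Finset.sum_mul]
  exact Finset.sum_congr rfl fun x _ => by ring

/-- If σ(w) is real, w² = 1. Otherwise take a prime p that is not of the form |β|² and write p = Σ
x_i². A row b of B satisfies |x·b|² ≤ p by Cauchy–Schwarz, and even < p by the choice of p. So the
matrix a = (w/p) x xᵗ pairs rows to scalars of absolute value less than one and lies in B by
tameness, although it multiplies the unit vector x/√p by w. -/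
theorem mem_of_norm_eq_one {w : K} (hw : ‖σ w‖ = 1) : w ∈ B.scalars := by
  by_cases hreal : star (σ w) = σ w
  · refine hB.mem_of_pow_mem two_ne_zero ?_
    have h1 : w ^ 2 = 1 := by
      refine σ.injective ?_
      have h2 := RCLike.conj_mul (σ w)
      rw [hw] at h2
      rw [map_pow, map_one, sq]
      nth_rewrite 1 [← hreal]
      simpa using h2
    rw [h1]
    exact one_mem_scalars
  obtain ⟨p, hp, hne⟩ := exists_prime_ne_norm_sq σ hw hreal
  have hp0 : (0 : ℝ) < p := by exact_mod_cast hp.pos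
  have hpK : (p : K) ≠ 0 := by exact_mod_cast hp.ne_zero
  obtain ⟨x, hx⟩ : ∃ x : Fin 4 → ℕ, ∑ i, x i ^ 2 = p := by
    obtain ⟨a, b, c, d, h⟩ := Nat.sum_four_squares p
    exact ⟨![a, b, c, d], by rw [Fin.sum_univ_four]; exact h⟩
  have hxR : ∑ i, (x i : ℝ) ^ 2 = p := by exact_mod_cast hx
  have hxQ : ∑ i, (x i : ℚ) ^ 2 = p := by exact_mod_cast hx
  have hxK : ∑ i, (x i : K) ^ 2 = p := by exact_mod_cast congrArg (Nat.cast (R := K)) hx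
  have hz : ∑ i, ((x i : ℝ) / √p) ^ 2 = 1 := by
    simp only [div_pow, Real.sq_sqrt hp0.le, ← Finset.sum_div, hxR]
    exact div_self hp0.ne'
  have hβ (b : Fin 4 → K) (hb : b ∈ B.rows (Fin 4)) : ‖σ (∑ i, x i * b i)‖ ^ 2 < p := by
    refine lt_of_le_of_ne ?_ (hne _)
    have h1 := (norm_sum_mul_sq_le hz fun i => σ (b i)).trans (sum_norm_sq_le_one hlt hle hb)
    have h2 : ∑ i, (((x i : ℝ) / √p : ℝ) : 𝕜) * σ (b i) =
        ((√p)⁻¹ : ℝ) * σ (∑ i, x i * b i) := by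
      rw [map_sum, Finset.mul_sum]
      refine Finset.sum_congr rfl fun i _ => ?_
      rw [map_mul, map_natCast]
      push_cast
      ring
    rw [h2, norm_mul, mul_pow, RCLike.norm_ofReal, sq_abs, inv_pow, Real.sq_sqrt hp0.le,
      inv_mul_le_iff₀ hp0, mul_one] at h1
    exact h1
  let a : (mat K).Hom (Fin 4) (Fin 4) := ofM (Matrix.of fun i j => w / p * (x i * x j))
  have ha : a ∈ B.carrier (Fin 4) (Fin 4) := by
    refine hB.mem_iff.2 fun b' hb' b hb => hlt _ ?_
    have e : ∑ i, b' i * ∑ j, toM a i j * b j =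
        w / p * ((∑ i, x i * b' i) * ∑ j, x j * b j) := by
      rw [Finset.sum_mul_sum, Finset.mul_sum]
      refine Finset.sum_congr rfl fun i _ => ?_
      rw [Finset.mul_sum, Finset.mul_sum]
      refine Finset.sum_congr rfl fun j _ => ?_
      change b' i * (w / p * (x i * x j) * b j) = _
      ring
    have h1 := hβ b hb
    have h2 := hβ b' hb'
    rw [e, map_mul, norm_mul, map_div₀, norm_div, hw, norm_map_natCast, map_mul, norm_mul,
      one_div, inv_mul_lt_iff₀ hp0, mul_one]
    nlinarith [sq_nonneg (‖σ (∑ i, x i * b' i)‖ - ‖σ (∑ i, x i * b i)‖)]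
  -- The unit vector x/√p is not rational, but (x ⊗ x)/p is, with sixteen entries. Paired with
  -- itself through four copies of a it gives w.
  have hzr := rat_unit_mem_rows hB hlt hle (z := fun q : Fin 4 × Fin 4 => (x q.1 * x q.2 : ℚ) / p) (by
    rw [Fintype.sum_prod_type]
    simp only [div_pow, mul_pow, ← Finset.sum_div, ← Finset.mul_sum, ← Finset.sum_mul, hxQ]
    have : (p : ℚ) ≠ 0 := by exact_mod_cast hp.ne_zero
    field_simp)
  have hfin := sum_mem_scalars (dsum_mem (Z := Fin 4) fun _ => ha) hzr hzr
  convert hfin using 1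
  have e1 (q : Fin 4 × Fin 4) : ∑ r : Fin 4 × Fin 4,
      toM (FData.dsum (Fin 4) fun _ => a) q r * (((x r.1 * x r.2 : ℚ) / p : ℚ) : K) =
        w / p * (x q.1 * x q.2) := by
    have e2 (r : Fin 4 × Fin 4) : toM (FData.dsum (Fin 4) fun _ => a) q r =
        if q.1 = r.1 then w / p * (x q.2 * x r.2) else 0 := by
      refine (mat_dsum_apply (fun _ : Fin 4 => a) q r).trans ?_
      split_ifs <;> rfl
    rw [Fintype.sum_prod_type, Finset.sum_eq_single q.1]
    · simp only [e2, if_true]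
      calc _ = w / p * (x q.1 * x q.2) / p * ∑ i, (x i : K) ^ 2 := by
            rw [Finset.mul_sum]
            refine Finset.sum_congr rfl fun i _ => ?_
            push_cast
            ring
        _ = _ := by rw [hxK, div_mul_cancel₀ _ hpK]
    · intro i _ hi
      refine Finset.sum_eq_zero fun j _ => ?_
      rw [e2, if_neg hi.symm, zero_mul]
    · simp
  refine Eq.symm ((Finset.sum_congr rfl fun q _ => congrArg _ (e1 q)).trans ?_)
  calc _ = w / p / p * ((∑ i, (x i : K) ^ 2) * ∑ i, (x i : K) ^ 2) := by
        rw [Finset.sum_mul_sum, Fintype.sum_prod_type, Finset.mul_sum]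
        refine Finset.sum_congr rfl fun i _ => ?_
        rw [Finset.mul_sum]
        refine Finset.sum_congr rfl fun j _ => ?_
        push_cast
        ring
    _ = w := by
        rw [hxK]
        field_simp

/-- The scalars agree, and the rows of B have length at most one. Conversely, a vector of length at
most one pairs with these rows into the closed unit ball and is a row of B by self-duality. -/
theorem eq_archimedean : B = archimedean σ := by
  have hs (x : K) : x ∈ B.scalars ↔ ‖σ x‖ ≤ 1 := by
    refine ⟨hle x, fun h => ?_⟩
    rcases h.lt_or_eq with h | h
    · exact hlt x h
    · exact mem_of_norm_eq_one hB hlt hle h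
  refine hB.ext_rows (isVal_archimedean σ) fun X _ => Set.Subset.antisymm (fun b hb => ?_)
    fun b hb => ?_
  · exact mem_rows_archimedean.2 (sum_norm_sq_le_one hlt hle hb)
  · refine hB.mem_rows_iff.2 fun c hc => (hs _).2 ?_
    have h := dot_mem_scalars hb (mem_rows_archimedean.2 (sum_norm_sq_le_one hlt hle hc))
    exact mem_scalars_archimedean.1 h

end IsVal

end FOne

namespace FOne
open TopologicalSpace
open FSpace
open NumberField

/-! #### Classification of the valuation sub-`𝔽`-rings of a number field -/

section Classification

variable {R K : Type u} [CommRing R] [IsDedekindDomain R] [Field K] [NumberField K] [Algebra R K]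
variable [IsFractionRing R K] [IsIntegralClosure R ℤ K] {γ : Type u} {𝕜 : Type} [RCLike 𝕜]
variable {τ : γ → K →+* 𝕜} {e : γ ≃ InfinitePlace K}

variable (R) in
-- Additive closure of the scalars decides between the two cases. Without it, the absolute value
-- attached to B is unbounded on the integers and thus belongs to an infinite place.
theorem IsVal.eq_localAt_or_eq_archimedean (he : ∀ σ x, ‖τ σ x‖ = e σ x) {B : Sub (mat K)}
    (hB : IsVal B) : (∃ q : PrimeSpectrum R, B = localAt K q) ∨ ∃ σ, B = archimedean (τ σ) := by
  by_cases hadd : ∀ a ∈ B.scalars, ∀ b ∈ B.scalars, a + b ∈ B.scalars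
  · exact .inl (hB.eq_localAt R hadd)
  · obtain ⟨f, hf, hlt, hle⟩ := hB.exists_absoluteValue R (by push Not at hadd; exact hadd)
    obtain ⟨v, hv⟩ : ∃ v : InfinitePlace K, f.IsEquiv v.1 := by
      refine exists_infinitePlace_isEquiv ?_
      by_contra! hn
      exact hadd (hB.add_mem_of_natCast_le_one R hf hlt hle hn)
    have hn (x : K) : ‖τ (e.symm v) x‖ = v.1 x := by
      rw [he, e.apply_symm_apply]
      rfl
    refine .inr ⟨e.symm v, hB.eq_archimedean (fun x hx => hlt x ?_) fun x hx => ?_⟩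
    · rw [hv.lt_one_iff, ← hn]
      exact hx
    · rw [hn, ← hv.le_one_iff]
      exact hle x hx

/-- The prime is recovered from its local ring: an element of R lies outside of it exactly if it is
inverted there. -/
theorem localAt_injective : Function.Injective fun q : PrimeSpectrum R => localAt K q := by
  intro q q' h
  have key {p p' : PrimeSpectrum R} (h : localAt K p = localAt K p') : p.asIdeal ≤ p'.asIdeal := by
    intro r hr
    by_contra hr'
    have h1 : (algebraMap R K r)⁻¹ ∈ locRing K p' :=
      inv_mem_locRing p' (algebraMap_mem_locRing p' r) (by rwa [algebraMap_mem_maxSet])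
    rw [← mem_scalars_localAt, ← h, mem_scalars_localAt] at h1
    have h2 := mul_mem_maxSet p h1 ((algebraMap_mem_maxSet p).2 hr)
    rw [inv_mul_cancel₀ (algebraMap_ne_zero hr')] at h2
    exact one_notMem_maxSet p h2
  exact PrimeSpectrum.ext (le_antisymm (key h) (key h.symm))

/-- The number 2 lies in every local ring and in no archimedean one. -/
theorem localAt_ne_archimedean (q : PrimeSpectrum R) (σ : K →+* 𝕜) :
    localAt K q ≠ archimedean σ := by
  intro h
  have h1 : (2 : K) ∈ (localAt K q).scalars := by
    rw [mem_scalars_localAt]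
    exact_mod_cast natCast_mem (locRing K q) 2
  rw [h, mem_scalars_archimedean, map_ofNat] at h1
  norm_num at h1

/-- By inversion the closed unit ball determines the open one, hence the absolute value up to
equivalence; equivalent infinite places are equal. -/
theorem archimedean_injective (he : ∀ σ x, ‖τ σ x‖ = e σ x) :
    Function.Injective fun σ => archimedean (τ σ) := by
  intro σ σ' h
  have hle (x : K) : e σ x ≤ 1 ↔ e σ' x ≤ 1 := by
    rw [← he, ← he, ← mem_scalars_archimedean, ← mem_scalars_archimedean]
    exact iff_of_eq (congrArg (x ∈ Sub.scalars ·) h)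
  refine e.injective (InfinitePlace.eq_iff_isEquiv.2 (AbsoluteValue.isEquiv_iff_lt_one_iff.2 fun x => ?_))
  change e σ x < 1 ↔ e σ' x < 1
  rcases eq_or_ne x 0 with rfl | hx
  · simp
  · have hlt (v : InfinitePlace K) : v x < 1 ↔ ¬ v x⁻¹ ≤ 1 := by
      rw [map_inv₀, inv_le_one₀ (InfinitePlace.pos_iff.2 hx), not_le]
    rw [hlt, hlt, hle]

theorem bijOn_range_stalkVal (he : ∀ σ x, ‖τ σ x‖ = e σ x) :
    Set.BijOn (fun x => Sub.range (stalkVal R τ x)) Set.univ {B : Sub (mat K) | IsVal B} := by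
  refine ⟨fun x _ => ?_, fun x _ y _ h => ?_, fun B hB => ?_⟩
  · obtain ⟨v, rfl⟩ := limPt_surjective (R := R) (τ := τ) x
    rcases v with q | σ
    · exact (congrArg IsVal (range_stalkVal_inl (τ := τ) q)).mpr (isVal_localAt q)
    · exact (congrArg IsVal (range_stalkVal_inr (R := R) (τ := τ) σ)).mpr (isVal_archimedean (τ σ))
  · obtain ⟨v, rfl⟩ := limPt_surjective (R := R) (τ := τ) x
    obtain ⟨w, rfl⟩ := limPt_surjective (R := R) (τ := τ) y
    refine congrArg _ ?_
    rcases v with q | σ <;> rcases w with q' | σ'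
    · exact congrArg _ (localAt_injective ((range_stalkVal_inl (τ := τ) q).symm.trans
        (h.trans (range_stalkVal_inl q'))))
    · exact (localAt_ne_archimedean q (τ σ') ((range_stalkVal_inl (τ := τ) q).symm.trans
        (h.trans (range_stalkVal_inr σ')))).elim
    · exact (localAt_ne_archimedean q' (τ σ) ((range_stalkVal_inl (τ := τ) q').symm.trans
        (h.symm.trans (range_stalkVal_inr σ)))).elim
    · exact congrArg _ (archimedean_injective he ((range_stalkVal_inr (τ := τ) σ).symm.trans
        (h.trans (range_stalkVal_inr σ'))))
  · rcases IsVal.eq_localAt_or_eq_archimedean R he hB with ⟨q, rfl⟩ | ⟨σ, rfl⟩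
    · exact ⟨limPt τ (.inl q), Set.mem_univ _, range_stalkVal_inl q⟩
    · exact ⟨limPt τ (.inr σ), Set.mem_univ _, range_stalkVal_inr σ⟩

end Classification

/-! ### Global sections -/

/-- Injective homomorphisms with the same image have isomorphic sources. -/
theorem FHom.exists_isIso_of_range_eq {A B C : FData.{u}} {f : FHom A C} {g : FHom B C}
    (hf : f.Injective) (hg : g.Injective)
    (h : ∀ (Y X : Type) [Fintype Y] [Fintype X] (c : C.Hom Y X),
      (∃ a, f.app a = c) ↔ ∃ b, g.app b = c) : ∃ φ : FHom A B, φ.IsIso := by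
  have hex {Y X : Type} [Fintype Y] [Fintype X] (a : A.Hom Y X) : ∃ b, g.app b = f.app a :=
    (h Y X _).1 ⟨a, rfl⟩
  let F {Y X : Type} [Fintype Y] [Fintype X] (a : A.Hom Y X) : B.Hom Y X := (hex a).choose
  have hF {Y X : Type} [Fintype Y] [Fintype X] (a : A.Hom Y X) : g.app (F a) = f.app a :=
    (hex a).choose_spec
  refine ⟨{ app := F
            map_comp := fun a b => hg _ _ (by rw [hF, f.map_comp, g.map_comp, hF, hF])
            map_sum := fun a b => hg _ _ (by rw [hF, f.map_sum, g.map_sum, hF, hF])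
            map_tr := fun a => hg _ _ (by rw [hF, f.map_tr, g.map_tr, hF])
            map_emb := fun φ => hg _ _ (by rw [hF, f.map_emb, g.map_emb]) },
    fun Y X _ _ => ⟨fun a b hab => hf _ _ ?_, fun b => ?_⟩⟩
  · rw [← hF, ← hF]
    exact congrArg _ hab
  · obtain ⟨a, ha⟩ := (h Y X _).2 ⟨b, rfl⟩
    exact ⟨a, hg _ _ ((hF a).trans ha)⟩

/-! ### Monomial matrices over K -/

section Monomial

variable {K : Type u} [Field K] {M : Type u} [CommMonoid M] (h : M →* K)

/-- The matrix over `K` of an arrow of `𝔽{M}`, for a homomorphism `M → K`. -/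
noncomputable def monomialVal : FHom (monomial M).ring.toFData (mat K).toFData :=
  (matMap (MonoidAlgebra.lift ℕ K M h : MonoidAlgebra ℕ M →+* K)).comp (monomial M).incl

variable {h} {X Y : Type} [Fintype X] [Fintype Y]

theorem lift_eq_iff (hinj : Function.Injective h) {a b : MonoidAlgebra ℕ M}
    (ha : a = 0 ∨ ∃ m, a = MonoidAlgebra.of ℕ M m) (hb : b = 0 ∨ ∃ m, b = MonoidAlgebra.of ℕ M m)
    (h0 : ∀ m, h m ≠ 0) (hab : MonoidAlgebra.lift ℕ K M h a = MonoidAlgebra.lift ℕ K M h b) :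
    a = b := by
  rcases ha with rfl | ⟨m, rfl⟩ <;> rcases hb with rfl | ⟨n, rfl⟩
  · rfl
  · rw [map_zero, MonoidAlgebra.lift_of] at hab
    exact (h0 n hab.symm).elim
  · rw [map_zero, MonoidAlgebra.lift_of] at hab
    exact (h0 m hab).elim
  · rw [MonoidAlgebra.lift_of, MonoidAlgebra.lift_of] at hab
    rw [hinj hab]

theorem monomialVal_injective (hinj : Function.Injective h) (h0 : ∀ m, h m ≠ 0) :
    (monomialVal h).Injective := by
  intro Y X _ _ a b hab
  refine Subtype.ext (Matrix.ext fun y x => ?_)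
  exact lift_eq_iff hinj (a.2.1 y x) (b.2.1 y x) h0 (congrFun (congrFun hab y) x)

open Classical in
theorem mem_range_monomialVal (h0 : ∀ m, h m ≠ 0) {c : (mat K).Hom Y X} :
    (∃ a, (monomialVal h).app a = c) ↔ (∀ y x, toM c y x = 0 ∨ ∃ m, h m = toM c y x) ∧
      (∀ y x x', toM c y x ≠ 0 → toM c y x' ≠ 0 → x = x') ∧
      ∀ y y' x, toM c y x ≠ 0 → toM c y' x ≠ 0 → y = y' := by
  constructor
  · rintro ⟨a, rfl⟩
    have hne {y : Y} {x : X} (hc : toM ((monomialVal h).app a) y x ≠ 0) :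
        (a.1 : Matrix Y X (MonoidAlgebra ℕ M)) y x ≠ 0 := fun h1 =>
      hc ((congrArg (MonoidAlgebra.lift ℕ K M h) h1).trans (map_zero _))
    refine ⟨fun y x => ?_, fun y x x' h1 h2 => a.2.2.1 y x x' (hne h1) (hne h2),
      fun y y' x h1 h2 => a.2.2.2 y y' x (hne h1) (hne h2)⟩
    rcases a.2.1 y x with h1 | ⟨m, hm⟩
    · exact .inl ((congrArg (MonoidAlgebra.lift ℕ K M h) h1).trans (map_zero _))
    · exact .inr ⟨m, ((congrArg (MonoidAlgebra.lift ℕ K M h) hm).trans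
        (MonoidAlgebra.lift_of ..)).symm⟩
  · rintro ⟨hc, hrow, hcol⟩
    let a : Matrix Y X (MonoidAlgebra ℕ M) := fun y x =>
      if hm : ∃ m, h m = toM c y x then MonoidAlgebra.of ℕ M hm.choose else 0
    have hne {y : Y} {x : X} (ha : a y x ≠ 0) : toM c y x ≠ 0 := by
      by_cases hm : ∃ m, h m = toM c y x
      · rw [← hm.choose_spec]
        exact h0 _
      · exact (ha (dif_neg hm)).elim
    refine ⟨⟨a, fun y x => ?_, fun y x x' h1 h2 => hrow y x x' (hne h1) (hne h2),
      fun y y' x h1 h2 => hcol y y' x (hne h1) (hne h2)⟩, Matrix.ext fun y x => ?_⟩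
    · by_cases hm : ∃ m, h m = toM c y x
      · exact .inr ⟨hm.choose, dif_pos hm⟩
      · exact .inl (dif_neg hm)
    · change MonoidAlgebra.lift ℕ K M h (a y x) = toM c y x
      by_cases hm : ∃ m, h m = toM c y x
      · simp only [a]
        rw [dif_pos hm, MonoidAlgebra.lift_of, hm.choose_spec]
      · simp only [a]
        rw [dif_neg hm, map_zero, (hc y x).resolve_right fun ⟨m, e⟩ => hm ⟨m, e⟩]

open Classical in
/-- Matrices with at most one nonzero entry in every row and column lie in every sub-`𝔽`-ring that
contains their entries. -/
theorem mem_of_monomial {B : Sub (mat K)} {c : (mat K).Hom Y X} (hc : ∀ y x, toM c y x ∈ B.scalars)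
    (hrow : ∀ y x x', toM c y x ≠ 0 → toM c y x' ≠ 0 → x = x')
    (hcol : ∀ y y' x, toM c y x ≠ 0 → toM c y' x ≠ 0 → y = y') : c ∈ B.carrier Y X := by
  -- The positions of the non-zero entries form a partial bijection; the matrix is its composition
  -- with a diagonal matrix.
  let φ : X ≃. Y :=
    { toFun := fun x => if hx : ∃ y, toM c y x ≠ 0 then some hx.choose else none
      invFun := fun y => if hy : ∃ x, toM c y x ≠ 0 then some hy.choose else none
      inv := fun x y => by
        by_cases hx : ∃ y, toM c y x ≠ 0 <;> by_cases hy : ∃ x, toM c y x ≠ 0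
        · simp only [dif_pos hx, dif_pos hy, Option.some.injEq]
          constructor
          · intro h1
            have h2 := hy.choose_spec
            rw [h1] at h2
            exact hcol _ _ x hx.choose_spec h2
          · intro h1
            have h2 := hx.choose_spec
            rw [h1] at h2
            exact hrow y _ _ hy.choose_spec h2
        · simp only [dif_pos hx, dif_neg hy, reduceCtorEq, Option.some.injEq,
            false_iff]
          rintro rfl
          exact hy ⟨x, hx.choose_spec⟩
        · simp only [dif_neg hx, dif_pos hy, reduceCtorEq, Option.some.injEq,
            iff_false]
          rintro rfl
          exact hx ⟨y, hy.choose_spec⟩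
        · simp only [dif_neg hx, dif_neg hy, reduceCtorEq] }
  have hφ (x : X) (y : Y) : φ x = some y ↔ toM c y x ≠ 0 := by
    change (if hx : ∃ y, toM c y x ≠ 0 then some hx.choose else none) = some y ↔ _
    by_cases hx : ∃ y, toM c y x ≠ 0
    · rw [dif_pos hx, Option.some.injEq]
      refine ⟨?_, fun h1 => hcol _ _ x hx.choose_spec h1⟩
      rintro rfl
      exact hx.choose_spec
    · rw [dif_neg hx]
      simp only [reduceCtorEq, false_iff]
      exact fun h1 => hx ⟨y, h1⟩
  -- At a zero column any scalar would do, as φ omits the column.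
  let d : X → K := fun x => (φ x).elim 1 fun y => toM c y x
  have hd (x : X) : d x ∈ B.scalars := by
    change (φ x).elim 1 (fun y => toM c y x) ∈ B.scalars
    cases φ x with
    | none => exact one_mem_scalars
    | some y => exact hc y x
  convert B.comp_mem (B.emb_mem φ) (diag_mem hd) using 1
  refine toM_injective (Matrix.ext fun y x => ?_)
  rw [toM_comp, Matrix.mul_apply]
  refine ((Finset.sum_eq_single x (fun z _ hz => ?_) (by simp)).trans ?_).symm
  · exact (congrArg _ ((mat_diag_apply _ _ _).trans (if_neg hz))).trans (mul_zero _)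
  · refine (congrArg₂ (· * ·) (mat_emb_apply φ y x)
      ((mat_diag_apply (fun x => (ofEntry (d x) : (mat K).Hom Unit Unit)) x x).trans (if_pos rfl))).trans ?_
    change (if φ x = some y then (1 : K) else 0) * d x = toM c y x
    by_cases hx : φ x = some y
    · rw [if_pos hx, one_mul]
      change (φ x).elim 1 (fun y => toM c y x) = _
      rw [hx]
      rfl
    · rw [if_neg hx, zero_mul]
      rw [hφ, not_not] at hx
      exact hx.symm

theorem row_mem {B : Sub (mat K)} {c : (mat K).Hom Y X} (hc : c ∈ B.carrier Y X) (y : Y) :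
    (fun x => toM c y x) ∈ B.rows X := by
  classical
  convert row_mem_rows (B.comp_mem (single_mem_rows B y) hc) using 2 with x
  rw [toM_comp, Matrix.mul_apply]
  refine ((Finset.sum_eq_single y (fun z _ hz => ?_) (by simp)).trans ?_).symm
  · exact (congrArg (· * toM c z x)
      (Pi.single_eq_of_ne (M := fun _ => K) hz 1)).trans (zero_mul _)
  · exact (congrArg (· * toM c y x)
      (Pi.single_eq_same (M := fun _ => K) y 1)).trans (one_mul _)

theorem column_mem {B : Sub (mat K)} {c : (mat K).Hom Y X} (hc : c ∈ B.carrier Y X) (x : X) :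
    (fun y => toM c y x) ∈ B.rows Y := row_mem (B.tr_mem hc) x

end Monomial

/-! ### Matrices which are integral at all places -/

section GlobalSections

variable {R K : Type u} [CommRing R] [IsDedekindDomain R] [Field K] [NumberField K] [Algebra R K]
variable [IsFractionRing R K] [IsIntegralClosure R ℤ K] {γ : Type u} {𝕜 : Type} [RCLike 𝕜]
variable {τ : γ → K →+* 𝕜} {e : γ ≃ InfinitePlace K} {X Y : Type} [Fintype X] [Fintype Y]

theorem mem_range_algebraMap {x : K} (hx : ∀ q : PrimeSpectrum R, x ∈ locRing K q) :
    ∃ r, algebraMap R K r = x := by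
  have h : x ∈ (⊥ : Subalgebra R K) := by
    rw [← PrimeSpectrum.iInf_localization_eq_bot R K, Algebra.mem_iInf]
    exact hx
  exact Algebra.mem_bot.1 h

/-- A scalar at all places is zero or a root of unity. -/
theorem eq_zero_or_pow_eq_one (he : ∀ σ x, ‖τ σ x‖ = e σ x) {x : K}
    (hq : ∀ q : PrimeSpectrum R, x ∈ (localAt K q).scalars)
    (hσ : ∀ σ, x ∈ (archimedean (τ σ)).scalars) : x = 0 ∨ ∃ n, n ≠ 0 ∧ x ^ n = 1 := by
  refine or_iff_not_imp_left.2 fun hx => ?_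
  have hint : IsIntegral ℤ x :=
    (IsIntegralClosure.isIntegral_iff (A := R)).2 (mem_range_algebraMap fun q => mem_scalars_localAt.1 (hq q))
  -- Kronecker's theorem: a non-zero algebraic integer all of whose conjugates have absolute value
  -- at most one is a root of unity.
  obtain ⟨n, hn, h⟩ := Embeddings.pow_eq_one_of_norm_le_one K ℂ hx hint fun φ => by
    have := mem_scalars_archimedean.1 (hσ (e.symm (InfinitePlace.mk φ)))
    rwa [he, e.apply_symm_apply] at this
  exact ⟨n, hn.ne', h⟩

/-- Two entries of absolute value one would already give squared length 2. -/
theorem eq_of_mem_rows_archimedean {σ : K →+* 𝕜} {b : X → K} (hb : b ∈ (archimedean σ).rows X)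
    (h : ∀ x, b x = 0 ∨ ‖σ (b x)‖ = 1) {x x' : X} (hx : b x ≠ 0) (hx' : b x' ≠ 0) : x = x' := by
  classical
  by_contra hne
  have h1 := mem_rows_archimedean.1 hb
  have h2 : ∑ z ∈ {x, x'}, ‖σ (b z)‖ ^ 2 ≤ ∑ z, ‖σ (b z)‖ ^ 2 :=
    Finset.sum_le_sum_of_subset_of_nonneg (Finset.subset_univ _) fun _ _ _ => sq_nonneg _
  rw [Finset.sum_pair hne, (h x).resolve_left hx, (h x').resolve_left hx'] at h2
  norm_num at h2
  linarith

/-- The matrices which are integral at all places are the monomial matrices whose entries are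
roots of unity. -/
theorem mem_all_iff (he : ∀ σ x, ‖τ σ x‖ = e σ x) (c : (mat K).Hom Y X) :
    ((∀ q : PrimeSpectrum R, c ∈ (localAt K q).carrier Y X) ∧
      ∀ σ, c ∈ (archimedean (τ σ)).carrier Y X) ↔
    (∀ y x, toM c y x = 0 ∨ ∃ n, n ≠ 0 ∧ toM c y x ^ n = 1) ∧
      (∀ y x x', toM c y x ≠ 0 → toM c y x' ≠ 0 → x = x') ∧
      ∀ y y' x, toM c y x ≠ 0 → toM c y' x ≠ 0 → y = y' := by
  constructor
  · rintro ⟨hq, hσ⟩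
    have h1 (y : Y) (x : X) : toM c y x = 0 ∨ ∃ n, n ≠ 0 ∧ toM c y x ^ n = 1 :=
      eq_zero_or_pow_eq_one (R := R) he (fun q => coord_mem_scalars (row_mem (hq q) y) x)
        fun σ => coord_mem_scalars (row_mem (hσ σ) y) x
    -- A single archimedean place suffices to see the monomial shape.
    let σ := e.symm (Classical.arbitrary (InfinitePlace K))
    have h2 (y : Y) (x : X) : toM c y x = 0 ∨ ‖τ σ (toM c y x)‖ = 1 := by
      refine (h1 y x).imp_right fun ⟨n, hn, h⟩ => ?_
      refine (pow_eq_one_iff_of_nonneg (norm_nonneg _) hn).1 ?_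
      rw [← norm_pow, ← map_pow, h, map_one, norm_one]
    exact ⟨h1, fun y x x' => eq_of_mem_rows_archimedean (row_mem (hσ σ) y) (h2 y),
      fun y y' x => eq_of_mem_rows_archimedean (column_mem (hσ σ) x) fun y => h2 y x⟩
  · rintro ⟨h1, hrow, hcol⟩
    -- A valuation sub-𝔽-ring is closed under taking roots, so it contains all roots of unity and
    -- the monomial matrices over them.
    have key {B : Sub (mat K)} (hB : IsVal B) : c ∈ B.carrier Y X := by
      refine mem_of_monomial (fun y x => ?_) hrow hcol
      rcases h1 y x with h | ⟨n, hn, h⟩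
      · rw [h]; exact zero_mem_scalars
      · refine hB.mem_of_pow_mem hn ?_
        rw [h]
        exact one_mem_scalars
    exact ⟨fun q => key (isVal_localAt q), fun σ => key (isVal_archimedean (τ σ))⟩

/-- Both sides embed into 𝔽(K) with the same image. -/
theorem exists_isIso_monomial (he : ∀ σ x, ‖τ σ x‖ = e σ x) {M : Type u} [CommMonoid M]
    {h : M →* K} (hinj : Function.Injective h) (hroot : ∀ x : K, (∃ n, n ≠ 0 ∧ x ^ n = 1) ↔ ∃ m, h m = x) :
    ∃ φ : FHom ((archSys R K τ).lim.sec ⊤).toFData (monomial M).ring.toFData, φ.IsIso := by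
  have h0 (m : M) : h m ≠ 0 := by
    intro h1
    obtain ⟨n, hn, h2⟩ := (hroot (h m)).2 ⟨m, rfl⟩
    rw [h1, zero_pow hn] at h2
    exact zero_ne_one h2
  let x : (archSys R K τ).lim.pt := limPt τ (.inl (⊥ : PrimeSpectrum R))
  let f := (stalkVal R τ x).comp ((archSys R K τ).lim.germ ⊤ x trivial)
  refine FHom.exists_isIso_of_range_eq (f := f) (g := monomialVal h) ?_
    (monomialVal_injective hinj h0) fun Y X _ _ c => ?_
  · exact fun Y X _ _ => (archLimModel R τ).val_inj ⊤ ((archLimModel R τ).gen_mem _ x trivial) Y X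
  · have h1 := Set.ext_iff.1 (range_stalkVal_germ (R := R) (τ := τ) (Y := Y) (X := X) ⊤ x trivial) c
    refine Iff.trans h1 (Iff.trans ?_ (mem_range_monomialVal h0).symm)
    simp only [← hroot]
    refine Iff.trans ?_ (mem_all_iff (R := R) he c)
    exact ⟨fun h2 => ⟨fun q => h2.1 q trivial, fun σ => h2.2 σ trivial⟩,
      fun h2 => ⟨fun q _ => h2.1 q, fun σ _ => h2.2 σ⟩⟩

end GlobalSections

end FOne

namespace FOne
open TopologicalSpace
open FSpace
open NumberField

/-! ### The main theorem -/

section Main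

variable {R K : Type u} [CommRing R] [IsDedekindDomain R] [Field K] [NumberField K] [Algebra R K]
variable [IsFractionRing R K] [IsIntegralClosure R ℤ K] {γ : Type u} {𝕜 : Type} [RCLike 𝕜]
variable {τ : γ → K →+* 𝕜} {e : γ ≃ InfinitePlace K}

/-- The common form of both halves of the theorem, with 𝕜 = ℝ for ℚ and 𝕜 = ℂ for a number field.
The monoid M stands for the roots of unity, presented as the units of ℤ or as a torsion group. -/
theorem compactSpec_structure (he : ∀ σ x, ‖τ σ x‖ = e σ x) {M : Type u} [CommMonoid M]
    {h : M →* K} (hinj : Function.Injective h)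
    (hroot : ∀ x : K, (∃ n, n ≠ 0 ∧ x ^ n = 1) ↔ ∃ m, h m = x) :
    ∃ (π : PrimeSpectrum R → (compactSpec R K fun σ => archimedean (τ σ)).pt)
      (η : γ → (compactSpec R K fun σ => archimedean (τ σ)).pt)
      (ι : ∀ x, FHom ((compactSpec R K fun σ => archimedean (τ σ)).stalk x).toFData (mat K).toFData),
      (∀ p, IsFinitePrime p (π p)) ∧ (∀ σ, IsInfinitePrime σ (η σ)) ∧
      Function.Bijective (Sum.elim π η) ∧
      topologicalKrullDim (compactSpec R K fun σ => archimedean (τ σ)).pt = 1 ∧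
      (∀ σ, IsClosed {η σ}) ∧ (∀ p, p ≠ ⊥ → IsClosed {π p}) ∧
      (∀ U : Set (compactSpec R K fun σ => archimedean (τ σ)).pt,
        IsOpen U ↔ U = ∅ ∨ (π ⊥ ∈ U ∧ Uᶜ.Finite)) ∧
      (∀ x, (ι x).Injective) ∧
      (∀ (U : Opens (compactSpec R K fun σ => archimedean (τ σ)).pt) (x y) (hx : x ∈ U) (hy : y ∈ U)
        (Y X : Type) [Fintype Y] [Fintype X]
        (s : ((compactSpec R K fun σ => archimedean (τ σ)).sec U).Hom Y X),
        (ι x).app (((compactSpec R K fun σ => archimedean (τ σ)).germ U x hx).app s) =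
          (ι y).app (((compactSpec R K fun σ => archimedean (τ σ)).germ U y hy).app s)) ∧
      (∀ p, Sub.range (ι (π p)) = localAt K p) ∧
      (∀ σ, Sub.range (ι (η σ)) = archimedean (τ σ)) ∧
      (∀ (U : Opens (compactSpec R K fun σ => archimedean (τ σ)).pt) (x) (hx : x ∈ U),
        ((ι x).comp ((compactSpec R K fun σ => archimedean (τ σ)).germ U x hx)).Injective ∧
        ∀ (Y X : Type) [Fintype Y] [Fintype X],
          (Sub.range ((ι x).comp
            ((compactSpec R K fun σ => archimedean (τ σ)).germ U x hx))).carrier Y X =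
            {a | (∀ p, π p ∈ U → a ∈ (localAt K p).carrier Y X) ∧
              ∀ σ, η σ ∈ U → a ∈ (archimedean (τ σ)).carrier Y X}) ∧
      (∃ φ : FHom ((compactSpec R K fun σ => archimedean (τ σ)).sec ⊤).toFData
        (monomial M).ring.toFData, φ.IsIso) ∧
      Set.BijOn (fun x => Sub.range (ι x)) Set.univ {B : Sub (mat K) | IsVal B} := by
  have : Finite γ := .of_equiv _ e.symm
  have hopen := isOpen_limPt_iff (R := R) (K := K) (τ := τ)
  have hclosed {v : PrimeSpectrum R ⊕ γ} (hv : v ≠ .inl ⊥) : IsClosed {limPt τ v} :=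
    isClosed_of_cofinite hopen (Set.finite_singleton _) fun h => hv (limPt_injective h).symm
  let σ := e.symm (Classical.arbitrary (InfinitePlace K))
  refine ⟨fun q => limPt τ (.inl q), fun σ => limPt τ (.inr σ), stalkVal R τ, isFinitePrime_limPt,
    isInfinitePrime_limPt, ?_, ?_, fun σ => hclosed Sum.inr_ne_inl,
    fun p hp => hclosed (Sum.inl_injective.ne hp), hopen, (archLimModel R τ).stalkVal_injective,
    fun U x y hx hy Y X _ _ s => rfl, range_stalkVal_inl, range_stalkVal_inr,
    fun U x hx => ⟨fun Y X _ _ => (archLimModel R τ).val_inj U ((archLimModel R τ).gen_mem _ _ hx) Y X,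
      fun Y X _ _ => range_stalkVal_germ U x hx⟩,
    exists_isIso_monomial he hinj hroot, bijOn_range_stalkVal he⟩
  · exact (congrArg Function.Bijective (Sum.elim_comp_inl_inr (limPt (R := R) τ))).mpr
      ⟨limPt_injective, limPt_surjective⟩
  · exact topologicalKrullDim_of_cofinite hopen
      (limPt_injective.ne (Sum.inr_ne_inl : (Sum.inr σ : PrimeSpectrum R ⊕ γ) ≠ .inl ⊥))

end Main

end FOne

open FOne NumberField TopologicalSpace in
theorem mainTheorem3 :
    (∃ (π : PrimeSpectrum ℤ → SpecZ.pt) (η : SpecZ.pt)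
      (ι : ∀ x : SpecZ.pt, FHom (SpecZ.stalk x).toFData (mat ℚ).toFData),
      (∀ p, IsFinitePrime p (π p)) ∧ IsInfinitePrime () η ∧
      Function.Bijective (Sum.elim π fun _ : Unit => η) ∧
      topologicalKrullDim SpecZ.pt = 1 ∧
      IsClosed {η} ∧ (∀ p, p ≠ ⊥ → IsClosed {π p}) ∧
      (∀ U : Set SpecZ.pt, IsOpen U ↔ U = ∅ ∨ (π ⊥ ∈ U ∧ Uᶜ.Finite)) ∧
      (∀ x, (ι x).Injective) ∧
      (∀ (U : Opens SpecZ.pt) (x y : SpecZ.pt) (hx : x ∈ U) (hy : y ∈ U) (Y X : Type) [Fintype Y]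
        [Fintype X] (s : (SpecZ.sec U).Hom Y X),
        (ι x).app ((SpecZ.germ U x hx).app s) = (ι y).app ((SpecZ.germ U y hy).app s)) ∧
      (∀ p, Sub.range (ι (π p)) = localAt ℚ p) ∧
      Sub.range (ι η) = archimedean (algebraMap ℚ ℝ) ∧
      (∀ (U : Opens SpecZ.pt) (x : SpecZ.pt) (hx : x ∈ U),
        ((ι x).comp (SpecZ.germ U x hx)).Injective ∧
        ∀ (Y X : Type) [Fintype Y] [Fintype X],
          (Sub.range ((ι x).comp (SpecZ.germ U x hx))).carrier Y X =
            {a | (∀ p, π p ∈ U → a ∈ (localAt ℚ p).carrier Y X) ∧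
              (η ∈ U → a ∈ (archimedean (algebraMap ℚ ℝ)).carrier Y X)}) ∧
      (∃ φ : FHom (SpecZ.sec ⊤).toFData (monomial ℤˣ).ring.toFData, φ.IsIso) ∧
      Set.BijOn (fun x => Sub.range (ι x)) Set.univ {B : Sub (mat ℚ) | IsVal B}) ∧
    ∀ (K : Type u) [Field K] [NumberField K],
      ∃ (π : PrimeSpectrum (𝓞 K) → (SpecOK K).pt) (η : InfinitePlace K → (SpecOK K).pt)
        (ι : ∀ x : (SpecOK K).pt, FHom ((SpecOK K).stalk x).toFData (mat K).toFData),
        (∀ p, IsFinitePrime p (π p)) ∧ (∀ σ, IsInfinitePrime σ (η σ)) ∧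
        Function.Bijective (Sum.elim π η) ∧
        topologicalKrullDim (SpecOK K).pt = 1 ∧
        (∀ σ, IsClosed {η σ}) ∧ (∀ p, p ≠ ⊥ → IsClosed {π p}) ∧
        (∀ U : Set (SpecOK K).pt, IsOpen U ↔ U = ∅ ∨ (π ⊥ ∈ U ∧ Uᶜ.Finite)) ∧
        (∀ x, (ι x).Injective) ∧
        (∀ (U : Opens (SpecOK K).pt) (x y : (SpecOK K).pt) (hx : x ∈ U) (hy : y ∈ U) (Y X : Type)
          [Fintype Y] [Fintype X] (s : ((SpecOK K).sec U).Hom Y X),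
          (ι x).app (((SpecOK K).germ U x hx).app s) =
            (ι y).app (((SpecOK K).germ U y hy).app s)) ∧
        (∀ p, Sub.range (ι (π p)) = localAt K p) ∧
        (∀ σ, Sub.range (ι (η σ)) = archimedean σ.embedding) ∧
        (∀ (U : Opens (SpecOK K).pt) (x : (SpecOK K).pt) (hx : x ∈ U),
          ((ι x).comp ((SpecOK K).germ U x hx)).Injective ∧
          ∀ (Y X : Type) [Fintype Y] [Fintype X],
            (Sub.range ((ι x).comp ((SpecOK K).germ U x hx))).carrier Y X =
              {a | (∀ p, π p ∈ U → a ∈ (localAt K p).carrier Y X) ∧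
                ∀ σ, η σ ∈ U → a ∈ (archimedean σ.embedding).carrier Y X}) ∧
        (∃ φ : FHom ((SpecOK K).sec ⊤).toFData (monomial (CommGroup.torsion Kˣ)).ring.toFData,
          φ.IsIso) ∧
        Set.BijOn (fun x => Sub.range (ι x)) Set.univ {B : Sub (mat K) | IsVal B} := by
  refine ⟨?_, fun K _ _ => ?_⟩
  · let e : Unit ≃ InfinitePlace ℚ := Equiv.ofUnique Unit (InfinitePlace ℚ)
    obtain ⟨π, η, ι, h1, h2, h3, h4, h5, h6, h7, h8, h9, h10, h11, h12, h13, h14⟩ :=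
      compactSpec_structure (R := ℤ) (K := ℚ) (τ := fun _ : Unit => algebraMap ℚ ℝ) (e := e)
        (M := ℤˣ) (h := (Int.castRingHom ℚ : ℤ →* ℚ).comp (Units.coeHom ℤ))
        (fun σ x => by
          rw [Rat.infinitePlace_apply]
          exact (Rat.norm_cast_real x).trans (Rat.cast_abs x).symm)
        (fun a b hab => Units.ext (Int.cast_injective hab))
        fun x => by
          constructor
          · rintro ⟨n, hn, hx⟩
            have h1 : |x| = 1 :=
              (pow_eq_one_iff_of_nonneg (abs_nonneg x) hn).1 (by rw [← abs_pow, hx, abs_one])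
            rcases eq_or_eq_neg_of_abs_eq h1 with rfl | rfl
            · exact ⟨1, by simp⟩
            · exact ⟨-1, by simp⟩
          · rintro ⟨m, rfl⟩
            refine ⟨2, two_ne_zero, ?_⟩
            rw [← map_pow, Int.units_sq, map_one]
    refine ⟨π, η (), ι, h1, h2 (), h3, h4, h5 (), h6, h7, h8, h9, h10, h11 (), fun U x hx => ?_,
      h13, h14⟩
    refine ⟨(h12 U x hx).1, fun Y X _ _ => ((h12 U x hx).2 Y X).trans ?_⟩
    exact Set.ext fun a => and_congr_right' ⟨fun h => h (), fun h _ => h⟩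
  · refine compactSpec_structure (R := 𝓞 K) (K := K) (τ := fun σ : InfinitePlace K => σ.embedding)
      (e := Equiv.refl _) (M := CommGroup.torsion Kˣ)
      (h := (Units.coeHom K).comp (CommGroup.torsion Kˣ).subtype)
      (fun σ x => InfinitePlace.norm_embedding_eq σ x)
      (fun a b hab => Subtype.ext (Units.ext hab)) fun x => ?_
    constructor
    · rintro ⟨n, hn, hx⟩
      let u : Kˣ := Units.ofPowEqOne x n hx hn
      exact ⟨⟨u, isOfFinOrder_iff_pow_eq_one.2 ⟨n, Nat.pos_of_ne_zero hn, Units.ext hx⟩⟩, rfl⟩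
    · rintro ⟨⟨u, hu⟩, rfl⟩
      obtain ⟨n, hn, h1⟩ := isOfFinOrder_iff_pow_eq_one.1 hu
      exact ⟨n, hn.ne', congrArg Units.val h1⟩
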